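/- Let $b,\mathfrak g,\kappa,\mu>0$ and $s\in\mathbb N=\{0,1,2,\dots\}$. Put $\Omega=\mathbb R^2\times(0,b)$, $\Sigma=\mathbb R^2\times\{b\}\simeq\mathbb R^2$, $\Sigma_0=\mathbb R^2\times\{0\}$, $\nabla_\|=(\partial_1,\partial_2)$, $\nabla_\|^\perp=(-\partial_2,\partial_1)$, $\mathbb Du=\nabla u+(\nabla u)^{\mathrm t}$, $\langle\xi\rangle=(1+|\xi|^2)^{1/2}$, and $$\mathbb X_s=H^{1+s}(\Omega;\mathbb C)\times H^{2+s}(\Omega;\mathbb C^3)\times H^{3/2+s}(\Sigma;\mathbb C^2),\qquad \mathbb Y_s=H^{s}(\Omega;\mathbb C^3)\times H^{1/2+s}(\Sigma;\mathbb C^3)\times H^{5/2+s}(\Sigma;\mathbb C^2).$$ For every $(f,k,H)\in\mathbb Y_s$ there is exactly one $(p,u,\chi)=:\Psi(f,k,H)\in\mathbb X_s$ that solves $$\begin{cases}\mathfrak g(\chi,0)+\nabla p-\mu\nabla\cdot\mathbb Du=f,\quad \nabla\cdot u=0&\text{in }\Omega,\\ -(pI-\mu\mathbb Du)e_3-\kappa(\nabla_\|\cdot\chi)e_3=k,\quad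 \nabla_\|^\perp\cdot\chi=0,\quad u\cdot e_3=\nabla_\|\cdot H&\text{on }\Sigma,\\ u=0&\text{on }\Sigma_0.\end{cases}$$ Let $\mathcal L$ be the space of bounded linear operators $$H^s((0,b);\mathbb C^3)\times\mathbb C^3\times\mathbb C^2\to H^{1+s}((0,b);\mathbb C)\times H^{2+s}((0,b);\mathbb C^3)\times\mathbb C^2 .$$ Let $\mathfrak A(s)$ be the set of strongly measurable maps $m=(m_{ij})_{1\le i,j\le3}:\mathbb R^2\to\mathcal L$ (that is, $\xi\mapsto m(\xi)v$ is Bochner measurable for each fixed $v$) for which there is a constant $C$ such that for almost every $\xi\in\mathbb R^2$, with $(r_1,r_2)=(1+s,2+s)$, $i\in\{1,2\}$, and all $\phi\in H^s((0,b);\mathbb C^3)$, $$\|m_{i1}(\xi)\phi\|_{H^{r_i}}+\langle\xi\rangle^{r_i}\|m_{i1}(\xi)\phi\|_{L^2}\le C\big(\|\phi\|_{H^s}+\langle\xi\rangle^s\|\phi\|_{L^2}\big),$$ $$\|m_{i2}(\xi)\|_{H^{r_i}}+\langle\xi\rangle^{r_i}\|m_{i2}(\xi)\|_{L^2}\le C\langle\xi\rangle^{1/2+s},\qquad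 \|m_{i3}(\xi)\|_{H^{r_i}}+\langle\xi\rangle^{r_i}\|m_{i3}(\xi)\|_{L^2}\le C\langle\xi\rangle^{5/2+s},$$ $$\langle\xi\rangle^{3/2+s}|m_{31}(\xi)\phi|\le C\big(\|\phi\|_{H^s}+\langle\xi\rangle^s\|\phi\|_{L^2}\big),\quad \langle\xi\rangle^{3/2+s}|m_{32}(\xi)|\le C\langle\xi\rangle^{1/2+s},\quad \langle\xi\rangle^{3/2+s}|m_{33}(\xi)|\le C\langle\xi\rangle^{5/2+s},$$ where in the second line and in the last two bounds the norms are operator norms. Let $[\![m]\!]_s$ be the infimum of the constants $C$ for which all these bounds hold for almost every $\xi$. Then there is $\mathbf m\in\mathfrak A(s)$ with $\Psi=\mathbf m(D)$, that is, $\mathscr F[\Psi(f,k,H)]=\mathbf m\,\mathscr F[(f,k,H)]$ almost everywhere for all $(f,k,H)\in\mathbb Y_s$, where $\mathscr F$ is the Fourier transform in the tangential variables (with kernel $e^{-2\pi\mathrm i x\cdot\xi}$). Every such $\mathbf m$ agrees almost everywhere with a map, again denoted by $\mathbf m$, whose restriction $\mathbf m:\mathbb R^2\setminus\{0\}\to\mathcal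 L$ is real-analytic (for the operator norm on $\mathcal L$), and for every $\alpha\in\mathbb N^2$ there is a constant $C_\alpha<\infty$ such that $|\cdot|^{|\alpha|}\partial^\alpha\mathbf m\in\mathfrak A(s)$ and $$[\![\,|\cdot|^{|\alpha|}\partial^\alpha\mathbf m\,]\!]_s\le C_\alpha .$$ -/

import Mathlib

open MeasureTheory Set
open scoped ContDiff ENNReal SchwartzMap FourierTransform LineDeriv

namespace CurlLayer

noncomputable section

/-! ### Function spaces over the layer `Ω = ℝ² × (0, b)` and its top `Σ = ℝ² × {b} ≃ ℝ²` -/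

/-- The horizontal plane `ℝ²` with its Euclidean norm. -/
abbrev Plane : Type := EuclideanSpace ℝ (Fin 2)

/-- The Hermitian space `ℂⁿ`. -/
abbrev Cn (n : ℕ) : Type := EuclideanSpace ℂ (Fin n)

/-- `L²((0, b); V)`. -/
abbrev L2I (b : ℝ) (V : Type) [NormedAddCommGroup V] : Type :=
  Lp V 2 ((volume : Measure ℝ).restrict (Ioo 0 b))

/-- `L²(Σ; V) = L²(ℝ²; V)`. -/
abbrev L2Top (V : Type) [NormedAddCommGroup V] : Type :=
  Lp V 2 (volume : Measure Plane)

/-- `L²(Ω; V) = L²(ℝ²; L²((0, b); V))`: for `u : L2Layer b V`, the value of `u` at the point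
`(x, y) ∈ Ω` is `u x y`. -/
abbrev L2Layer (b : ℝ) (V : Type) [NormedAddCommGroup V] : Type :=
  Lp (L2I b V) 2 (volume : Measure Plane)

/-! ### Sobolev spaces on the interval `(0, b)` -/

section Interval

variable {V : Type} [NormedAddCommGroup V] [InnerProductSpace ℂ V]

/-- `w` is the weak derivative of `v` on `(0, b)`. -/
def IsWeakDerivI (b : ℝ) (v w : L2I b V) : Prop :=
  ∀ φ : ℝ → ℝ, ContDiff ℝ ∞ φ → HasCompactSupport φ → tsupport φ ⊆ Ioo 0 b →
    ∫ y in Ioo 0 b, deriv φ y • v y = - ∫ y in Ioo 0 b, φ y • w y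

theorem integrable_test_smul {b : ℝ} (φ : ℝ → ℝ) (hφ : Continuous φ) (hc : HasCompactSupport φ)
    (v : L2I b V) : Integrable (fun y => φ y • v y) (volume.restrict (Ioo 0 b)) := by
  obtain ⟨C, hC⟩ := hφ.bounded_above_of_compact_support hc
  have hv : Integrable (fun y => v y) (volume.restrict (Ioo 0 b)) :=
    (Lp.memLp v).integrable one_le_two
  exact hv.bdd_smul (𝕜 := ℝ) C hφ.aestronglyMeasurable (Filter.Eventually.of_forall hC)

theorem isWeakDerivI_zero (b : ℝ) : IsWeakDerivI b (0 : L2I b V) 0 := by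
  intro φ _ _ _
  have h1 : ∀ ψ : ℝ → ℝ, ∫ y in Ioo 0 b, ψ y • (0 : L2I b V) y = 0 := by
    intro ψ
    rw [← integral_zero ℝ V (μ := volume.restrict (Ioo 0 b))]
    apply integral_congr_ae
    filter_upwards [Lp.coeFn_zero V 2 (volume.restrict (Ioo (0 : ℝ) b))] with y hy
    rw [hy, Pi.zero_apply, smul_zero]
  rw [h1, h1, neg_zero]

theorem IsWeakDerivI.add {b : ℝ} {v w v' w' : L2I b V} (h : IsWeakDerivI b v w)
    (h' : IsWeakDerivI b v' w') : IsWeakDerivI b (v + v') (w + w') := by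
  intro φ hφ hc hs
  have key : ∀ ψ : ℝ → ℝ, Continuous ψ → HasCompactSupport ψ → ∀ a a' : L2I b V,
      ∫ y in Ioo 0 b, ψ y • (a + a' : L2I b V) y =
        (∫ y in Ioo 0 b, ψ y • a y) + ∫ y in Ioo 0 b, ψ y • a' y := by
    intro ψ hψ hψc a a'
    rw [← integral_add (integrable_test_smul ψ hψ hψc a) (integrable_test_smul ψ hψ hψc a')]
    apply integral_congr_ae
    filter_upwards [Lp.coeFn_add a a'] with y hy
    rw [hy, Pi.add_apply, smul_add]
  rw [key _ (hφ.continuous_deriv (by simp)) hc.deriv, key _ hφ.continuous hc,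
    h φ hφ hc hs, h' φ hφ hc hs, neg_add]

theorem IsWeakDerivI.smul {b : ℝ} {v w : L2I b V} (c : ℂ) (h : IsWeakDerivI b v w) :
    IsWeakDerivI b (c • v) (c • w) := by
  intro φ hφ hc hs
  have key : ∀ ψ : ℝ → ℝ, ∀ a : L2I b V,
      ∫ y in Ioo 0 b, ψ y • (c • a : L2I b V) y = c • ∫ y in Ioo 0 b, ψ y • a y := by
    intro ψ a
    rw [← integral_smul]
    apply integral_congr_ae
    filter_upwards [Lp.coeFn_smul c a] with y hy
    simp only [hy, Pi.smul_apply]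
    exact smul_comm _ _ _
  rw [key, key, h φ hφ hc hs, smul_neg]

variable (V) in
/-- The Sobolev space `Hᵏ((0, b); V)`. A function `v` is stored with its weak derivatives, as the
tuple `(v, v', …, v⁽ᵏ⁾)` of elements of `L²((0, b); V)`; the norm is
`(∑_{j ≤ k} ‖v⁽ʲ⁾‖²)^{1/2}`. -/
def sobolevI (b : ℝ) (k : ℕ) : Submodule ℂ (PiLp 2 fun _ : Fin (k + 1) => L2I b V) where
  carrier := {w | ∀ j : Fin k, IsWeakDerivI b (w j.castSucc) (w j.succ)}
  zero_mem' := fun _ => isWeakDerivI_zero b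
  add_mem' := fun h h' j => (h j).add (h' j)
  smul_mem' := fun c _ h j => (h j).smul c

/-- The Hilbert space `Hᵏ((0, b); V)`. -/
def HI (b : ℝ) (k : ℕ) (V : Type) [NormedAddCommGroup V] [InnerProductSpace ℂ V] : Type :=
  sobolevI V b k

instance instNormedAddCommGroupHI (b : ℝ) (k : ℕ) : NormedAddCommGroup (HI b k V) :=
  inferInstanceAs (NormedAddCommGroup (sobolevI V b k))

instance instInnerProductSpaceHI (b : ℝ) (k : ℕ) : InnerProductSpace ℂ (HI b k V) :=
  inferInstanceAs (InnerProductSpace ℂ (sobolevI V b k))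

instance instNormedSpaceHI (b : ℝ) (k : ℕ) : NormedSpace ℂ (HI b k V) :=
  InnerProductSpace.toNormedSpace

/-- The inclusion `Hᵏ((0, b); V) → L²((0, b); V)`. -/
def toL2 (b : ℝ) (k : ℕ) : HI b k V →L[ℂ] L2I b V :=
  (PiLp.proj 2 (𝕜 := ℂ) (fun _ : Fin (k + 1) => L2I b V) 0).comp (sobolevI V b k).subtypeL

end Interval

/-! ### Sobolev spaces and traces on the layer -/

section Layer

variable {V : Type} [NormedAddCommGroup V] [InnerProductSpace ℂ V] [CompleteSpace V]

/-- The coordinate directions `e₁, e₂, e₃` of `ℝ² × ℝ`, indexed by `0, 1, 2`. -/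
def dir : Fin 3 → Plane × ℝ :=
  ![(EuclideanSpace.single 0 1, 0), (EuclideanSpace.single 1 1, 0), (0, 1)]

/-- The integral `∫_Ω φ u`. -/
def layerIntegral (b : ℝ) (φ : Plane × ℝ → ℝ) (u : L2Layer b V) : V :=
  ∫ x : Plane, ∫ y in Ioo 0 b, φ (x, y) • u x y

/-- `w` is the weak partial derivative `∂ⱼ u` on `Ω`. -/
def IsWeakDeriv (b : ℝ) (j : Fin 3) (u w : L2Layer b V) : Prop :=
  ∀ φ : Plane × ℝ → ℝ, ContDiff ℝ ∞ φ → HasCompactSupport φ →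
    tsupport φ ⊆ univ ×ˢ Ioo 0 b →
    layerIntegral b (fun z => fderiv ℝ φ z (dir j)) u = - layerIntegral b φ w

/-- Membership in the Sobolev space `Hᵏ(Ω; V)`: all weak derivatives up to order `k` exist and
are square integrable. -/
def MemHLayer (b : ℝ) : ℕ → L2Layer b V → Prop
  | 0, _ => True
  | k + 1, u => ∀ j : Fin 3, ∃ w, IsWeakDeriv b j u w ∧ MemHLayer b k w

/-- `g` is the trace on `Σ = ℝ² × {b}` of `u ∈ L²(Ω; V)` with `∂₃ u ∈ L²(Ω; V)`, through
Green's formula `∫_Ω (∂₃φ u + φ ∂₃u) = ∫_Σ φ g`. -/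
def HasTraceTop (b : ℝ) (u : L2Layer b V) (g : L2Top V) : Prop :=
  ∃ w, IsWeakDeriv b 2 u w ∧
    ∀ φ : Plane × ℝ → ℝ, ContDiff ℝ ∞ φ → HasCompactSupport φ →
      tsupport φ ⊆ univ ×ˢ Ioi 0 →
      layerIntegral b (fun z => fderiv ℝ φ z (dir 2)) u + layerIntegral b φ w =
        ∫ x : Plane, φ (x, b) • g x

/-- `g` is the trace on `Σ₀ = ℝ² × {0}` of `u ∈ L²(Ω; V)` with `∂₃ u ∈ L²(Ω; V)`. -/
def HasTraceBottom (b : ℝ) (u : L2Layer b V) (g : L2Top V) : Prop :=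
  ∃ w, IsWeakDeriv b 2 u w ∧
    ∀ φ : Plane × ℝ → ℝ, ContDiff ℝ ∞ φ → HasCompactSupport φ →
      tsupport φ ⊆ univ ×ˢ Iio b →
      layerIntegral b (fun z => fderiv ℝ φ z (dir 2)) u + layerIntegral b φ w =
        - ∫ x : Plane, φ (x, 0) • g x

/-- Membership in the Sobolev space `H^σ(Σ; V)` of real order `σ` (Bessel potential space). -/
def MemHTop (σ : ℝ) (g : L2Top V) : Prop :=
  TemperedDistribution.MemSobolev σ 2 (g : 𝓢'(Plane, V))

end Layer

/-- The `i`-th component of a `ℂⁿ`-valued function on `Σ`. -/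
def component {n : ℕ} (i : Fin n) (χ : L2Top (Cn n)) : L2Top ℂ :=
  (EuclideanSpace.proj i : Cn n →L[ℂ] ℂ).compLp χ

/-- The tempered distribution `∂ⱼ χᵢ` on `Σ`. -/
def derivComponent (j i : Fin 2) (χ : L2Top (Cn 2)) : 𝓢'(Plane, ℂ) :=
  ∂_{(EuclideanSpace.single j 1 : Plane)} ((component i χ : L2Top ℂ) : 𝓢'(Plane, ℂ))

/-- `d = ∇_∥ · χ = ∂₁ χ₁ + ∂₂ χ₂`. -/
def IsDivTop (χ : L2Top (Cn 2)) (d : L2Top ℂ) : Prop :=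
  derivComponent 0 0 χ + derivComponent 1 1 χ = (d : 𝓢'(Plane, ℂ))

/-- `c = ∇_∥^⊥ · χ = -∂₂ χ₁ + ∂₁ χ₂`. -/
def IsCurlTop (χ : L2Top (Cn 2)) (c : L2Top ℂ) : Prop :=
  - derivComponent 1 0 χ + derivComponent 0 1 χ = (c : 𝓢'(Plane, ℂ))

/-! ### The linearized system in curl form -/

/-- The vector `(θ, 0) ∈ ℂ³` for `θ ∈ ℂ²`. -/
def horizontal (θ : Cn 2) : Fin 3 → ℂ := ![θ 0, θ 1, 0]

/-- The vector `e₃`. -/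
def e3 : Fin 3 → ℂ := ![0, 0, 1]

/-- `(p, u, χ)` is a strong solution of
`γ (χ, 0) + ∇p - μ ∇·𝔻u = f` and `∇·u = g` in `Ω`,
`-(p I - μ 𝔻u) e₃ - κ (∇_∥·χ) e₃ = k`, `∇_∥^⊥·χ = c` and `u·e₃ = h` on `Σ`,
`u = 0` on `Σ₀`,
where `𝔻u = ∇u + (∇u)ᵗ`. The differential equations hold almost everywhere for the weak
derivatives `Dp i = ∂ᵢ p`, `Du i = ∂ᵢ u`, `DDu j i = ∂ⱼ ∂ᵢ u`, and the boundary conditions hold for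
the traces `pTop`, `uTop`, `DuTop i` of `p`, `u`, `∂ᵢ u` on `Σ`. -/
def IsCurlSolution (b γ κ μ : ℝ) (g : L2Layer b ℂ) (f : L2Layer b (Cn 3)) (k : L2Top (Cn 3))
    (h c : L2Top ℂ) (p : L2Layer b ℂ) (u : L2Layer b (Cn 3)) (χ : L2Top (Cn 2)) : Prop :=
  ∃ (Dp : Fin 3 → L2Layer b ℂ) (Du : Fin 3 → L2Layer b (Cn 3))
    (DDu : Fin 3 → Fin 3 → L2Layer b (Cn 3))
    (pTop : L2Top ℂ) (uTop : L2Top (Cn 3)) (DuTop : Fin 3 → L2Top (Cn 3)) (d : L2Top ℂ),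
    (∀ i, IsWeakDeriv b i p (Dp i)) ∧
    (∀ i, IsWeakDeriv b i u (Du i)) ∧
    (∀ j i, IsWeakDeriv b j (Du i) (DDu j i)) ∧
    HasTraceTop b p pTop ∧
    HasTraceTop b u uTop ∧
    (∀ i, HasTraceTop b (Du i) (DuTop i)) ∧
    IsDivTop χ d ∧
    (∀ᵐ x : Plane, ∀ᵐ y ∂(volume.restrict (Ioo 0 b)), ∀ i : Fin 3,
      (γ : ℂ) * horizontal (χ x) i + Dp i x y
        - (μ : ℂ) * ∑ j : Fin 3, (DDu j j x y i + DDu j i x y j) = f x y i) ∧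
    (∀ᵐ x : Plane, ∀ᵐ y ∂(volume.restrict (Ioo 0 b)), ∑ i : Fin 3, Du i x y i = g x y) ∧
    (∀ᵐ x : Plane, ∀ i : Fin 3,
      -(pTop x * e3 i - (μ : ℂ) * (DuTop 2 x i + DuTop i x 2)) - (κ : ℂ) * d x * e3 i = k x i) ∧
    IsCurlTop χ c ∧
    (∀ᵐ x : Plane, uTop x 2 = h x) ∧
    HasTraceBottom b u 0

/-- `(p, u, χ) ∈ 𝕏_s = H^{1+s}(Ω; ℂ) × H^{2+s}(Ω; ℂ³) × H^{3/2+s}(Σ; ℂ²)`. -/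
def MemX (b : ℝ) (s : ℕ) (p : L2Layer b ℂ) (u : L2Layer b (Cn 3)) (χ : L2Top (Cn 2)) : Prop :=
  MemHLayer b (s + 1) p ∧ MemHLayer b (s + 2) u ∧ MemHTop (3 / 2 + s) χ

/-- `(f, k, H) ∈ 𝕐_s = H^s(Ω; ℂ³) × H^{1/2+s}(Σ; ℂ³) × H^{5/2+s}(Σ; ℂ²)`. -/
def MemY (b : ℝ) (s : ℕ) (f : L2Layer b (Cn 3)) (k : L2Top (Cn 3)) (H : L2Top (Cn 2)) : Prop :=
  MemHLayer b s f ∧ MemHTop (1 / 2 + s) k ∧ MemHTop (5 / 2 + s) H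

/-- The graph of the solution operator `Ψ : 𝕐_s → 𝕏_s`: `(p, u, χ) ∈ 𝕏_s` solves the system with
data `g = 0`, `f`, `k`, `h = ∇_∥ · H`, `c = 0`. -/
def IsPsi (b γ κ μ : ℝ) (s : ℕ) (f : L2Layer b (Cn 3)) (k : L2Top (Cn 3)) (H : L2Top (Cn 2))
    (p : L2Layer b ℂ) (u : L2Layer b (Cn 3)) (χ : L2Top (Cn 2)) : Prop :=
  MemX b s p u χ ∧ ∃ h : L2Top ℂ, IsDivTop H h ∧ IsCurlSolution b γ κ μ 0 f k h 0 p u χ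

/-! ### Operator-valued symbols -/

/-- The fiber space `H^s((0, b); ℂ³) × ℂ³ × ℂ²` of the data. -/
abbrev FiberY (b : ℝ) (s : ℕ) : Type := HI b s (Cn 3) × Cn 3 × Cn 2

/-- The fiber space `H^{1+s}((0, b); ℂ) × H^{2+s}((0, b); ℂ³) × ℂ²` of the solutions. -/
abbrev FiberX (b : ℝ) (s : ℕ) : Type := HI b (s + 1) ℂ × HI b (s + 2) (Cn 3) × Cn 2

/-- Bounded operators between the fiber spaces. -/
abbrev FiberOp (b : ℝ) (s : ℕ) : Type := FiberY b s →L[ℂ] FiberX b s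

instance instNormedAddCommGroupFiberOp (b : ℝ) (s : ℕ) : NormedAddCommGroup (FiberOp b s) :=
  ContinuousLinearMap.toNormedAddCommGroup

instance instNormedSpaceFiberOp (b : ℝ) (s : ℕ) : NormedSpace ℂ (FiberOp b s) :=
  ContinuousLinearMap.toNormedSpace

instance instRealNormedSpaceFiberOp (b : ℝ) (s : ℕ) : NormedSpace ℝ (FiberOp b s) :=
  NormedSpace.complexToReal

section Blocks

variable {b : ℝ} {s : ℕ}

/-- The first column of an operator, `H^s((0, b); ℂ³) → FiberX`. -/
def col1 (A : FiberOp b s) : HI b s (Cn 3) →L[ℂ] FiberX b s :=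
  A.comp (ContinuousLinearMap.inl ℂ _ _)

/-- The second column of an operator, `ℂ³ → FiberX`. -/
def col2 (A : FiberOp b s) : Cn 3 →L[ℂ] FiberX b s :=
  A.comp ((ContinuousLinearMap.inr ℂ _ _).comp (ContinuousLinearMap.inl ℂ _ _))

/-- The third column of an operator, `ℂ² → FiberX`. -/
def col3 (A : FiberOp b s) : Cn 2 →L[ℂ] FiberX b s :=
  A.comp ((ContinuousLinearMap.inr ℂ _ _).comp (ContinuousLinearMap.inr ℂ _ _))

variable {W : Type} [NormedAddCommGroup W] [NormedSpace ℂ W]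

/-- The first row of a column, `W → H^{1+s}((0, b); ℂ)`. -/
def row1 (B : W →L[ℂ] FiberX b s) : W →L[ℂ] HI b (s + 1) ℂ :=
  (ContinuousLinearMap.fst ℂ _ _).comp B

/-- The second row of a column, `W → H^{2+s}((0, b); ℂ³)`. -/
def row2 (B : W →L[ℂ] FiberX b s) : W →L[ℂ] HI b (s + 2) (Cn 3) :=
  (ContinuousLinearMap.fst ℂ _ _).comp ((ContinuousLinearMap.snd ℂ _ _).comp B)

/-- The third row of a column, `W → ℂ²`. -/
def row3 (B : W →L[ℂ] FiberX b s) : W →L[ℂ] Cn 2 :=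
  (ContinuousLinearMap.snd ℂ _ _).comp ((ContinuousLinearMap.snd ℂ _ _).comp B)

end Blocks

/-- The bracket `⟨ξ⟩ = (1 + |ξ|²)^{1/2}`. -/
def bracket (ξ : Plane) : ℝ := Real.sqrt (1 + ‖ξ‖ ^ 2)

/-- The bounds that the nine blocks of an admissible symbol, with value `A` at the frequency `ξ`,
obey with the constant `C`. -/
structure SymbolBounds (b : ℝ) (s : ℕ) (C : ℝ) (ξ : Plane) (A : FiberOp b s) : Prop where
  bound11 : ∀ φ : HI b s (Cn 3),
    ‖row1 (col1 A) φ‖ + bracket ξ ^ (1 + s) * ‖toL2 b (s + 1) (row1 (col1 A) φ)‖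
      ≤ C * (‖φ‖ + bracket ξ ^ s * ‖toL2 b s φ‖)
  bound12 : ‖row1 (col2 A)‖ + bracket ξ ^ (1 + s) * ‖(toL2 b (s + 1)).comp (row1 (col2 A))‖
    ≤ C * bracket ξ ^ (1 / 2 + s : ℝ)
  bound13 : ‖row1 (col3 A)‖ + bracket ξ ^ (1 + s) * ‖(toL2 b (s + 1)).comp (row1 (col3 A))‖
    ≤ C * bracket ξ ^ (5 / 2 + s : ℝ)
  bound21 : ∀ φ : HI b s (Cn 3),
    ‖row2 (col1 A) φ‖ + bracket ξ ^ (2 + s) * ‖toL2 b (s + 2) (row2 (col1 A) φ)‖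
      ≤ C * (‖φ‖ + bracket ξ ^ s * ‖toL2 b s φ‖)
  bound22 : ‖row2 (col2 A)‖ + bracket ξ ^ (2 + s) * ‖(toL2 b (s + 2)).comp (row2 (col2 A))‖
    ≤ C * bracket ξ ^ (1 / 2 + s : ℝ)
  bound23 : ‖row2 (col3 A)‖ + bracket ξ ^ (2 + s) * ‖(toL2 b (s + 2)).comp (row2 (col3 A))‖
    ≤ C * bracket ξ ^ (5 / 2 + s : ℝ)
  bound31 : ∀ φ : HI b s (Cn 3),
    bracket ξ ^ (3 / 2 + s : ℝ) * ‖row3 (col1 A) φ‖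
      ≤ C * (‖φ‖ + bracket ξ ^ s * ‖toL2 b s φ‖)
  bound32 : bracket ξ ^ (3 / 2 + s : ℝ) * ‖row3 (col2 A)‖ ≤ C * bracket ξ ^ (1 / 2 + s : ℝ)
  bound33 : bracket ξ ^ (3 / 2 + s : ℝ) * ‖row3 (col3 A)‖ ≤ C * bracket ξ ^ (5 / 2 + s : ℝ)

/-- Membership in the admissible class `𝔄(s)`: the symbol is strongly measurable, and the bounds on
its blocks hold for almost every frequency with one constant. -/
def Admissible (b : ℝ) (s : ℕ) (m : Plane → FiberOp b s) : Prop :=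
  (∀ Y : FiberY b s, AEStronglyMeasurable (fun ξ => m ξ Y) volume) ∧
    ∃ C : ℝ, ∀ᵐ ξ : Plane, SymbolBounds b s C ξ (m ξ)

/-- The norm `⟦m⟧_s` of an admissible symbol: the infimum of the constants for which the bounds on
its blocks hold for almost every frequency. -/
def symbolNorm (b : ℝ) (s : ℕ) (m : Plane → FiberOp b s) : ℝ :=
  sInf {C : ℝ | ∀ᵐ ξ : Plane, SymbolBounds b s C ξ (m ξ)}

/-- `m(D)(f, k, H) = (p, u, χ)`, that is `m 𝓕(f, k, H) = 𝓕(p, u, χ)` almost everywhere, where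
`𝓕` is the (unitary) Fourier transform in the tangential variables. -/
def IsMultiplierImage {b : ℝ} {s : ℕ} (m : Plane → FiberOp b s)
    (f : L2Layer b (Cn 3)) (k : L2Top (Cn 3)) (H : L2Top (Cn 2))
    (p : L2Layer b ℂ) (u : L2Layer b (Cn 3)) (χ : L2Top (Cn 2)) : Prop :=
  ∀ᵐ ξ : Plane, ∃ (φ : HI b s (Cn 3)) (q : HI b (s + 1) ℂ) (v : HI b (s + 2) (Cn 3)),
    toL2 b s φ = (𝓕 f : L2Layer b (Cn 3)) ξ ∧
    toL2 b (s + 1) q = (𝓕 p : L2Layer b ℂ) ξ ∧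
    toL2 b (s + 2) v = (𝓕 u : L2Layer b (Cn 3)) ξ ∧
    m ξ (φ, (𝓕 k : L2Top (Cn 3)) ξ, (𝓕 H : L2Top (Cn 2)) ξ) =
      (q, v, (𝓕 χ : L2Top (Cn 2)) ξ)

/-- `m` is a symbol of the solution operator: `m ∈ 𝔄(s)` and `Ψ = m(D)` on `𝕐_s`. -/
def IsSymbolOfPsi (b γ κ μ : ℝ) (s : ℕ) (m : Plane → FiberOp b s) : Prop :=
  Admissible b s m ∧
    ∀ (f : L2Layer b (Cn 3)) (k : L2Top (Cn 3)) (H : L2Top (Cn 2)), MemY b s f k H →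
      ∀ (p : L2Layer b ℂ) (u : L2Layer b (Cn 3)) (χ : L2Top (Cn 2)),
        IsPsi b γ κ μ s f k H p u χ → IsMultiplierImage m f k H p u χ

/-- The partial derivative `∂ᵢ m`. -/
def partialSymbol {b : ℝ} {s : ℕ} (i : Fin 2) (m : Plane → FiberOp b s) : Plane → FiberOp b s :=
  fun ξ => fderiv ℝ m ξ (EuclideanSpace.single i 1)

/-- The partial derivative `∂^α m = ∂₁^{α₁} ∂₂^{α₂} m`. -/
def iteratedPartial {b : ℝ} {s : ℕ} (α : Fin 2 → ℕ) (m : Plane → FiberOp b s) :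
    Plane → FiberOp b s :=
  (partialSymbol 0)^[α 0] ((partialSymbol 1)^[α 1] m)

end

end CurlLayer

open CurlLayer

set_option linter.unusedSectionVars false

/-! The tangential Fourier transform turns the system on the layer into a boundary value problem for
ordinary differential equations on (0, b), one for each frequency ξ, with ∂ⱼ replaced by dⱼ = 2πiξⱼ.
Its operator L(ξ), `fiberOp`, acts on velocities that vanish at the bottom and is a polynomial of
degree two in d. The solution operator is then multiplication by `psiSymbol`, which is L(ξ)⁻¹
applied to the data (f, 0, k, d·H, 0), and the theorem becomes a statement on the size of L(ξ)⁻¹ and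
of its derivatives in ξ.

Everything rests on one estimate, `fiberOp_apriori`: the weighted norm `normX` of x is at most C
times the weighted norm `normY` of L(ξ)x, with one C for all ξ ≠ 0. In these norms L is a symbol of
order zero (`isSymbol_fiberOp`), because every factor dⱼ is paid for by a power of the weight Z =
⟨ξ⟩. Since ∂L⁻¹ = -L⁻¹(∂L)L⁻¹, induction on the number of derivatives bounds |ξ|^{|α|}∂^α L⁻¹
(`IsSymbol.inverse`), and L⁻¹ is analytic where L is invertible. The derivative ∂L produces a
divergence g and a curl c, so both must be admitted as data although they vanish in the theorem. The
delicate region is ξ → 0. There `normY` contains |c|/λ and |h - ∫g|/λ with λ = 2π|ξ|. These terms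
are harmless: the no-slip condition makes h - ∫g vanish for the part of L without d, the remaining
parts of L carry a factor d, and so does h = d·H.

For the estimate, split χ = dη + d^⊥ψ, where ψ is controlled by c. The gradient part of γχ joins the
pressure, P = p + γη, and so does the divergence, Q = P - μ div v. This leaves a Stokes problem with
data of size D (`FiberConfig.exists_stokes`). Let N be the weighted H¹ norm of v. The normal
momentum equation bounds Q', the tangential ones give λ²Q as a second derivative plus a remainder,
and pairing with Q yields λ‖Q‖ ≲ D + N (`StokesConfig.dominated_q_zero`). The energy identity then
yields N² ≲ (N + D)D (`StokesConfig.dominated_energy`), hence N ≲ D. At low frequency only λQ and Q'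
are controlled, not Q; the term |h - ∫g|/λ is what the energy identity needs there. The normal
stress condition determines η through the factor γ + κλ², which dominates a multiple of Z², and p
follows from P and η with the uncontrolled part cancelling (`FiberConfig.theta_smul_p`). Higher
derivatives are read off from the equations.

The estimate gives injectivity of L(ξ). Surjectivity is a dimension count: the initial value problem
has five free parameters and there are five scalar boundary data (`fiberOp_surjective`).

To return to the layer, weak derivatives, Sobolev norms and traces are characterised on the Fourier
side. A triple in 𝕏_s then solves the system exactly when its fibers solve the fiber problem for
almost every ξ (`isPsi_iff`). Two symbols of the solution operator agree almost everywhere because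
they agree on a countable dense set of fiber data, multiplied by cutoffs in ξ
(`IsSymbolOfPsi.ae_eq`). -/

namespace CurlLayer

noncomputable section

/-! ### The Sobolev spaces `Hᵏ((0, b); V)` as spaces of tuples -/

section Tuples

variable {V : Type} [NormedAddCommGroup V] [InnerProductSpace ℂ V]
variable {W : Type*} [NormedAddCommGroup W] [NormedSpace ℂ W]

/-- The `j`-th derivative `Hᵏ((0, b); V) → L²((0, b); V)` for `j ≤ k`, and `0` for `j > k`. -/
def der (b : ℝ) (k j : ℕ) : HI b k V →L[ℂ] L2I b V :=
  if h : j < k + 1 then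
    (PiLp.proj 2 (𝕜 := ℂ) (fun _ : Fin (k + 1) => L2I b V) ⟨j, h⟩).comp (sobolevI V b k).subtypeL
  else 0

theorem der_apply {b : ℝ} {k j : ℕ} (h : j < k + 1) (w : HI b k V) :
    der b k j w = (show sobolevI V b k from w).1 ⟨j, h⟩ := by
  rw [der, dif_pos h]; rfl

theorem toL2_eq_der (b : ℝ) (k : ℕ) : (toL2 b k : HI b k V →L[ℂ] L2I b V) = der b k 0 := by
  rw [der, dif_pos (Nat.succ_pos k)]; rfl

theorem isWeakDerivI_der {b : ℝ} {k j : ℕ} (h : j < k) (w : HI b k V) :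
    IsWeakDerivI b (der b k j w) (der b k (j + 1) w) := by
  rw [der_apply (by omega), der_apply (by omega)]
  exact (show sobolevI V b k from w).2 ⟨j, h⟩

theorem HI.ext_der {b : ℝ} {k : ℕ} {v w : HI b k V} (h : ∀ j ≤ k, der b k j v = der b k j w) :
    v = w := by
  apply Subtype.ext
  apply PiLp.ext
  intro j
  have := h j (by omega)
  rwa [der_apply j.2, der_apply j.2] at this

theorem HI.norm_sq_eq {b : ℝ} {k : ℕ} (w : HI b k V) :
    ‖w‖ ^ 2 = ∑ j ∈ Finset.range (k + 1), ‖der b k j w‖ ^ 2 := by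
  have h1 : ‖w‖ = ‖(show sobolevI V b k from w).1‖ := rfl
  rw [h1, PiLp.norm_sq_eq_of_L2, Finset.sum_range]
  refine Finset.sum_congr rfl fun j _ => ?_
  rw [der_apply j.2]

theorem HI.norm_der_le {b : ℝ} {k : ℕ} (j : ℕ) (w : HI b k V) : ‖der b k j w‖ ≤ ‖w‖ := by
  by_cases h : j < k + 1
  · refine le_of_sq_le_sq ?_ (norm_nonneg _)
    rw [HI.norm_sq_eq w]
    exact Finset.single_le_sum (f := fun i => ‖der b k i w‖ ^ 2) (fun i _ => sq_nonneg _)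
      (Finset.mem_range.2 h)
  · rw [der, dif_neg h]; simp

theorem HI.norm_le_sum {b : ℝ} {k : ℕ} (w : HI b k V) :
    ‖w‖ ≤ ∑ j ∈ Finset.range (k + 1), ‖der b k j w‖ := by
  refine le_of_sq_le_sq ?_ (Finset.sum_nonneg fun _ _ => norm_nonneg _)
  rw [HI.norm_sq_eq w]
  exact Finset.sum_sq_le_sq_sum_of_nonneg fun _ _ => norm_nonneg _

/-- The element of `Hᵏ((0, b); V)` with prescribed derivatives. -/
def HI.mk {b : ℝ} {k : ℕ} (w : ℕ → L2I b V) (h : ∀ j < k, IsWeakDerivI b (w j) (w (j + 1))) :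
    HI b k V :=
  (⟨WithLp.toLp 2 fun j : Fin (k + 1) => w j, fun j => h j j.2⟩ : sobolevI V b k)

@[simp]
theorem HI.der_mk {b : ℝ} {k : ℕ} (w : ℕ → L2I b V)
    (h : ∀ j < k, IsWeakDerivI b (w j) (w (j + 1))) {j : ℕ} (hj : j ≤ k) :
    der b k j (HI.mk w h) = w j := by
  rw [der_apply (by omega)]; rfl

/-- The operator into `Hᵏ((0, b); V)` with prescribed derivatives. -/
def HI.lift {b : ℝ} {k : ℕ} (T : ℕ → W →L[ℂ] L2I b V)
    (h : ∀ j < k, ∀ x, IsWeakDerivI b (T j x) (T (j + 1) x)) : W →L[ℂ] HI b k V :=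
  (((PiLp.continuousLinearEquiv 2 ℂ (fun _ : Fin (k + 1) => L2I b V)).symm.toContinuousLinearMap.comp
    (ContinuousLinearMap.pi fun j : Fin (k + 1) => T j)).codRestrict (sobolevI V b k)
      (fun x j => h j j.2 x))

@[simp]
theorem HI.der_lift {b : ℝ} {k : ℕ} (T : ℕ → W →L[ℂ] L2I b V)
    (h : ∀ j < k, ∀ x, IsWeakDerivI b (T j x) (T (j + 1) x)) {j : ℕ} (hj : j ≤ k) (x : W) :
    der b k j (HI.lift T h x) = T j x := by
  rw [der_apply (by omega)]; rfl

/-- The derivative `H^{k+1}((0, b); V) → Hᵏ((0, b); V)`. -/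
def HI.deriv (b : ℝ) (k : ℕ) : HI b (k + 1) V →L[ℂ] HI b k V :=
  HI.lift (fun j => der b (k + 1) (j + 1)) fun _ h _ => isWeakDerivI_der (by omega) _

/-- The inclusion `H^{k+1}((0, b); V) → Hᵏ((0, b); V)`. -/
def HI.incl (b : ℝ) (k : ℕ) : HI b (k + 1) V →L[ℂ] HI b k V :=
  HI.lift (fun j => der b (k + 1) j) fun _ h _ => isWeakDerivI_der (by omega) _

@[simp]
theorem HI.der_deriv {b : ℝ} {k j : ℕ} (hj : j ≤ k) (w : HI b (k + 1) V) :
    der b k j (HI.deriv b k w) = der b (k + 1) (j + 1) w := by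
  rw [HI.deriv, HI.der_lift _ _ hj]

@[simp]
theorem HI.der_incl {b : ℝ} {k j : ℕ} (hj : j ≤ k) (w : HI b (k + 1) V) :
    der b k j (HI.incl b k w) = der b (k + 1) j w := by
  rw [HI.incl, HI.der_lift _ _ hj]

/-! ### Test functionals and uniqueness of weak derivatives -/

/-- The functional `v ↦ ∫ ψ v` on `L²((0, b); V)`. -/
def testI (b : ℝ) (ψ : C(ℝ, ℝ)) : L2I b V →L[ℂ] V :=
  LinearMap.mkContinuousOfExistsBound
    { toFun := fun v => ∫ y in Ioo 0 b, ψ y • v y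
      map_add' := by
        intro u v
        have hint : ∀ w : L2I b V, Integrable (fun y => ψ y • w y) (volume.restrict (Ioo 0 b)) := by
          intro w
          have hw : Integrable (fun y => w y) (volume.restrict (Ioo 0 b)) :=
            (Lp.memLp w).integrable one_le_two
          obtain ⟨C, hC⟩ := (isCompact_Icc (a := (0 : ℝ)) (b := b)).exists_bound_of_continuousOn
            ψ.continuous.continuousOn
          exact hw.bdd_smul (𝕜 := ℝ) C ψ.continuous.aestronglyMeasurable
            ((ae_restrict_iff' measurableSet_Ioo).2 (.of_forall fun y hy =>
              hC y (Ioo_subset_Icc_self hy)))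
        rw [← integral_add (hint u) (hint v)]
        apply integral_congr_ae
        filter_upwards [Lp.coeFn_add u v] with y hy
        rw [hy, Pi.add_apply, smul_add]
      map_smul' := by
        intro c v
        rw [RingHom.id_apply, ← integral_smul]
        apply integral_congr_ae
        filter_upwards [Lp.coeFn_smul c v] with y hy
        simp only [hy, Pi.smul_apply]
        exact smul_comm _ _ _ }
    (by
      obtain ⟨C, hC⟩ := (isCompact_Icc (a := (0 : ℝ)) (b := b)).exists_bound_of_continuousOn
        ψ.continuous.continuousOn
      refine ⟨|C| * (volume.restrict (Ioo 0 b)).real univ ^ (1 / 2 : ℝ), fun v => ?_⟩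
      have hv : Integrable (fun y => v y) (volume.restrict (Ioo 0 b)) :=
        (Lp.memLp v).integrable one_le_two
      calc ‖∫ y in Ioo 0 b, ψ y • v y‖ ≤ ∫ y in Ioo 0 b, |C| * ‖v y‖ := by
            refine norm_integral_le_of_norm_le (hv.norm.const_mul _) ?_
            refine (ae_restrict_iff' measurableSet_Ioo).2 (.of_forall fun y hy => ?_)
            rw [norm_smul]
            gcongr
            exact (hC y (Ioo_subset_Icc_self hy)).trans (le_abs_self C)
        _ = |C| * ∫ y in Ioo 0 b, ‖v y‖ := integral_const_mul _ _
        _ ≤ |C| * ((volume.restrict (Ioo 0 b)).real univ ^ (1 / 2 : ℝ) * ‖v‖) := by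
            gcongr
            have h1 := eLpNorm_le_eLpNorm_mul_rpow_measure_univ
              (μ := volume.restrict (Ioo 0 b)) (f := v) one_le_two (Lp.aestronglyMeasurable v)
            have h2 : ∫ y in Ioo 0 b, ‖v y‖ = (eLpNorm v 1 (volume.restrict (Ioo 0 b))).toReal := by
              rw [eLpNorm_one_eq_lintegral_enorm, integral_norm_eq_lintegral_enorm
                (Lp.aestronglyMeasurable v)]
            rw [h2, Lp.norm_def, mul_comm, Measure.real, ENNReal.toReal_rpow, ← ENNReal.toReal_mul]
            refine ENNReal.toReal_mono ?_ (h1.trans (le_of_eq ?_))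
            · exact ENNReal.mul_ne_top (Lp.eLpNorm_ne_top v)
                (ENNReal.rpow_ne_top_of_nonneg (by norm_num) (measure_ne_top _ _))
            · norm_num
        _ = _ := by ring)

theorem testI_apply (b : ℝ) (ψ : C(ℝ, ℝ)) (v : L2I b V) :
    testI b ψ v = ∫ y in Ioo 0 b, ψ y • v y := rfl

theorem L2I.eq_zero_of_test {b : ℝ} [CompleteSpace V] {v : L2I b V}
    (h : ∀ φ : ℝ → ℝ, ContDiff ℝ ∞ φ → HasCompactSupport φ → tsupport φ ⊆ Ioo 0 b →
      ∫ y in Ioo 0 b, φ y • v y = 0) : v = 0 := by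
  rw [Lp.eq_zero_iff_ae_eq_zero]
  have hv : IntegrableOn (fun y => v y) (Ioo 0 b) volume := (Lp.memLp v).integrable one_le_two
  have := isOpen_Ioo.ae_eq_zero_of_integral_contDiff_smul_eq_zero (μ := volume)
    (U := Ioo 0 b) (f := fun y => v y) hv.locallyIntegrableOn (by
      intro g hg hgc hgs
      rw [← h g hg hgc hgs, setIntegral_eq_integral_of_forall_compl_eq_zero]
      intro x hx
      rw [image_eq_zero_of_notMem_tsupport fun h => hx (hgs h), zero_smul])
  exact (ae_restrict_iff' measurableSet_Ioo).2 this

theorem IsWeakDerivI.unique [CompleteSpace V] {b : ℝ} {v w w' : L2I b V} (h : IsWeakDerivI b v w)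
    (h' : IsWeakDerivI b v w') : w = w' := by
  rw [← sub_eq_zero]
  apply L2I.eq_zero_of_test
  intro φ hφ hc hs
  have h1 : ∫ y in Ioo 0 b, φ y • w y = ∫ y in Ioo 0 b, φ y • w' y :=
    neg_injective ((h φ hφ hc hs).symm.trans (h' φ hφ hc hs))
  have h2 := (testI b ⟨φ, hφ.continuous⟩).map_sub w w'
  simp only [testI_apply, ContinuousMap.coe_mk] at h2
  rw [h2, h1, sub_self]

/-- Uniqueness of weak derivatives propagates equality from each order to the next, so the stored
tuple is determined by its first entry. Later, fiber functions given only through their L² class are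
identified this way. -/
theorem HI.toL2_injective [CompleteSpace V] (b : ℝ) (k : ℕ) :
    Function.Injective (toL2 b k : HI b k V → L2I b V) := by
  intro v w h
  rw [toL2_eq_der] at h
  refine HI.ext_der fun j => ?_
  induction j with
  | zero => exact fun _ => h
  | succ j ih =>
    intro hj
    have h1 := isWeakDerivI_der (by omega : j < k) v
    rw [ih (by omega)] at h1
    exact h1.unique (isWeakDerivI_der (by omega) w)

/-- The weak derivative relation as a closed subspace. -/
theorem isWeakDerivI_iff_testI {b : ℝ} {v w : L2I b V} :
    IsWeakDerivI b v w ↔ ∀ φ : ℝ → ℝ, ∀ h : ContDiff ℝ ∞ φ, HasCompactSupport φ →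
      tsupport φ ⊆ Ioo 0 b → testI b ⟨_root_.deriv φ, h.continuous_deriv (by simp)⟩ v =
        - testI b ⟨φ, h.continuous⟩ w :=
  Iff.rfl

/-- The space is an intersection of equalizers of continuous test functionals. The completeness that
follows is needed to invert the fiber operator continuously and analytically. -/
theorem isClosed_sobolevI [CompleteSpace V] (b : ℝ) (k : ℕ) :
    IsClosed (sobolevI V b k : Set (PiLp 2 fun _ : Fin (k + 1) => L2I b V)) := by
  have : (sobolevI V b k : Set (PiLp 2 fun _ : Fin (k + 1) => L2I b V)) =
      ⋂ j : Fin k, ⋂ φ : ℝ → ℝ, ⋂ h : ContDiff ℝ ∞ φ, ⋂ _ : HasCompactSupport φ,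
        ⋂ _ : tsupport φ ⊆ Ioo 0 b,
        {w | testI b ⟨_root_.deriv φ, h.continuous_deriv (by simp)⟩ (w j.castSucc) =
          - testI b ⟨φ, h.continuous⟩ (w j.succ)} := by
    ext w
    simp only [mem_iInter]
    exact Iff.rfl
  rw [this]
  refine isClosed_iInter fun j => isClosed_iInter fun φ => isClosed_iInter fun h =>
    isClosed_iInter fun _ => isClosed_iInter fun _ => isClosed_eq ?_ ?_
  · exact (testI b _).continuous.comp (PiLp.continuous_apply 2 (fun _ : Fin (k + 1) => L2I b V) _)
  · exact ((testI b _).continuous.comp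
      (PiLp.continuous_apply 2 (fun _ : Fin (k + 1) => L2I b V) _)).neg

instance HI.instCompleteSpace [CompleteSpace V] (b : ℝ) (k : ℕ) : CompleteSpace (HI b k V) :=
  (isClosed_sobolevI (V := V) b k).isComplete.completeSpace_coe

end Tuples

end

end CurlLayer

namespace CurlLayer

noncomputable section

/-! ### Integration by parts for primitives of integrable functions -/

section Primitive

variable {E F G : Type*} [NormedAddCommGroup E] [NormedSpace ℝ E] [CompleteSpace E]
  [NormedAddCommGroup F] [NormedSpace ℝ F] [CompleteSpace F]
  [NormedAddCommGroup G] [NormedSpace ℝ G] [CompleteSpace G]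

theorem integrable_bilin_prod (B : E →L[ℝ] F →L[ℝ] G) {μ : Measure ℝ} [SFinite μ] {w : ℝ → E}
    {z : ℝ → F} (hw : Integrable w μ) (hz : Integrable z μ) :
    Integrable (fun p : ℝ × ℝ => B (w p.1) (z p.2)) (μ.prod μ) := by
  refine ((hw.norm.mul_prod hz.norm).const_mul ‖B‖).mono'
    (B.aestronglyMeasurable_comp₂ hw.1.comp_fst hz.1.comp_snd) (.of_forall fun p => ?_)
  rw [← mul_assoc]
  exact B.le_opNorm₂ _ _

/-- Fubini on the square: one term integrates B (w y) (z t) over the triangle t ≤ y, the other over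
the opposite triangle, and the diagonal is null. No regularity beyond integrability enters. -/
theorem integral_bilin_primitive_aux (B : E →L[ℝ] F →L[ℝ] G) {μ : Measure ℝ} [SFinite μ]
    [NullSingletonClass μ] {w : ℝ → E} {z : ℝ → F} (hw : Integrable w μ) (hz : Integrable z μ) :
    ∫ y, (B (w y) (∫ t, (Iic y).indicator z t ∂μ) + B (∫ t, (Iic y).indicator w t ∂μ) (z y)) ∂μ =
      B (∫ y, w y ∂μ) (∫ y, z y ∂μ) := by
  have hf := integrable_bilin_prod B hw hz
  set S : Set (ℝ × ℝ) := {p | p.2 ≤ p.1} with hS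
  have hSm : MeasurableSet S := measurableSet_le measurable_snd measurable_fst
  set T : Set (ℝ × ℝ) := {p | p.1 ≤ p.2} with hT
  have hTm : MeasurableSet T := measurableSet_le measurable_fst measurable_snd
  have h1 : ∀ y, B (w y) (∫ t, (Iic y).indicator z t ∂μ) =
      ∫ t, S.indicator (fun p : ℝ × ℝ => B (w p.1) (z p.2)) (y, t) ∂μ := by
    intro y
    rw [← (B (w y)).integral_comp_comm (hz.indicator measurableSet_Iic)]
    refine integral_congr_ae (.of_forall fun t => ?_)
    by_cases h : t ≤ y
    · simp [indicator, hS, h]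
    · simp [indicator, hS, h]
  have h2 : ∀ y, B (∫ t, (Iic y).indicator w t ∂μ) (z y) =
      ∫ t, T.indicator (fun p : ℝ × ℝ => B (w p.1) (z p.2)) (t, y) ∂μ := by
    intro y
    rw [← ContinuousLinearMap.flip_apply B, ← (B.flip (z y)).integral_comp_comm
      (hw.indicator measurableSet_Iic)]
    refine integral_congr_ae (.of_forall fun t => ?_)
    by_cases h : t ≤ y
    · simp [indicator, hT, h]
    · simp [indicator, hT, h]
  simp_rw [h1, h2]
  rw [integral_add (hf.indicator hSm).integral_prod_left (hf.indicator hTm).integral_prod_right,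
    ← integral_prod _ (hf.indicator hSm), ← integral_prod_symm _ (hf.indicator hTm),
    ← integral_add (hf.indicator hSm) (hf.indicator hTm)]
  have h3 : (fun p : ℝ × ℝ => S.indicator (fun p : ℝ × ℝ => B (w p.1) (z p.2)) p +
      T.indicator (fun p : ℝ × ℝ => B (w p.1) (z p.2)) p) =ᵐ[μ.prod μ]
      fun p => B (w p.1) (z p.2) := by
    have hd : MeasurableSet {p : ℝ × ℝ | p.1 ≠ p.2} :=
      (measurableSet_eq_fun measurable_fst measurable_snd).compl
    have : ∀ᵐ p ∂μ.prod μ, p.1 ≠ p.2 := by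
      refine (Measure.ae_prod_iff_ae_ae (p := fun p : ℝ × ℝ => p.1 ≠ p.2) hd).2
        (.of_forall fun x => ?_)
      have : ∀ᵐ y ∂μ, y ≠ x := by simp [ae_iff]
      filter_upwards [this] with y hy using hy.symm
    filter_upwards [this] with p hp
    rcases lt_or_gt_of_ne hp with h | h
    · simp [indicator, hS, hT, h.le, not_le.2 h]
    · simp [indicator, hS, hT, h.le, not_le.2 h]
  rw [integral_congr_ae h3, integral_prod _ hf]
  have h4 : ∀ y, ∫ t, B (w y) (z t) ∂μ = B (w y) (∫ t, z t ∂μ) := fun y =>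
    (B (w y)).integral_comp_comm hz
  simp_rw [h4]
  exact (B.flip (∫ t, z t ∂μ)).integral_comp_comm hw

theorem integral_Iic_indicator {b y : ℝ} (hy : y ∈ Ioo 0 b) (z : ℝ → F) :
    ∫ t in Ioo 0 b, (Iic y).indicator z t = ∫ t in (0 : ℝ)..y, z t := by
  rw [integral_indicator measurableSet_Iic, Measure.restrict_restrict measurableSet_Iic,
    intervalIntegral.integral_of_le hy.1.le]
  congr 2
  ext t
  constructor
  · rintro ⟨h1, h2⟩; exact ⟨h2.1, h1⟩
  · rintro ⟨h1, h2⟩; exact ⟨h2, h1, h2.trans_lt hy.2⟩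

theorem integral_Ioo_eq_intervalIntegral {b : ℝ} (hb : 0 ≤ b) (z : ℝ → F) :
    ∫ t in Ioo 0 b, z t = ∫ t in (0 : ℝ)..b, z t := by
  rw [intervalIntegral.integral_of_le hb, integral_Ioc_eq_integral_Ioo]

theorem norm_primitive_le {b y : ℝ} (hy : y ∈ Ioo 0 b) {z : ℝ → F} (hz : IntegrableOn z (Ioo 0 b)) :
    ‖∫ t in (0 : ℝ)..y, z t‖ ≤ ∫ t in Ioo 0 b, ‖z t‖ := by
  rw [← integral_Iic_indicator hy]
  refine norm_integral_le_of_norm_le hz.norm (.of_forall fun t => ?_)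
  exact norm_indicator_le_norm_self _ _

theorem continuousOn_primitive_Icc {b : ℝ} (hb : 0 ≤ b) {z : ℝ → F}
    (hz : IntegrableOn z (Ioo 0 b)) :
    ContinuousOn (fun y => ∫ t in (0 : ℝ)..y, z t) (Icc 0 b) := by
  have := intervalIntegral.continuousOn_primitive_interval (μ := volume) (f := z) (a := 0) (b := b)
    (by rwa [uIcc_of_le hb, integrableOn_Icc_iff_integrableOn_Ioo])
  rwa [uIcc_of_le hb] at this

/-- Integration by parts for a bilinear pairing of two primitives. -/
theorem integral_bilin_primitive (B : E →L[ℝ] F →L[ℝ] G) {b : ℝ} (hb : 0 ≤ b) {w : ℝ → E}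
    {z : ℝ → F} (hw : IntegrableOn w (Ioo 0 b)) (hz : IntegrableOn z (Ioo 0 b)) (c : E) (d : F) :
    ∫ y in Ioo 0 b, (B (w y) (d + ∫ t in (0 : ℝ)..y, z t) +
        B (c + ∫ t in (0 : ℝ)..y, w t) (z y)) =
      B (c + ∫ t in (0 : ℝ)..b, w t) (d + ∫ t in (0 : ℝ)..b, z t) - B c d := by
  have h0 := integral_bilin_primitive_aux B hw hz
  have i1 : IntegrableOn (fun y => B (w y) (∫ t in (0 : ℝ)..y, z t)) (Ioo 0 b) := by
    refine ((hw.norm.const_mul (‖B‖ * ∫ t in Ioo 0 b, ‖z t‖))).mono'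
      (B.aestronglyMeasurable_comp₂ hw.1 ?_) ?_
    · exact ((continuousOn_primitive_Icc hb hz).mono Ioo_subset_Icc_self).aestronglyMeasurable
        measurableSet_Ioo
    · refine (ae_restrict_iff' measurableSet_Ioo).2 (.of_forall fun y hy => ?_)
      calc _ ≤ ‖B‖ * ‖w y‖ * ‖∫ t in (0 : ℝ)..y, z t‖ := B.le_opNorm₂ _ _
        _ ≤ ‖B‖ * ‖w y‖ * ∫ t in Ioo 0 b, ‖z t‖ := by gcongr; exact norm_primitive_le hy hz
        _ = _ := by ring
  have i2 : IntegrableOn (fun y => B (∫ t in (0 : ℝ)..y, w t) (z y)) (Ioo 0 b) := by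
    refine ((hz.norm.const_mul (‖B‖ * ∫ t in Ioo 0 b, ‖w t‖))).mono'
      (B.aestronglyMeasurable_comp₂ ?_ hz.1) ?_
    · exact ((continuousOn_primitive_Icc hb hw).mono Ioo_subset_Icc_self).aestronglyMeasurable
        measurableSet_Ioo
    · refine (ae_restrict_iff' measurableSet_Ioo).2 (.of_forall fun y hy => ?_)
      calc _ ≤ ‖B‖ * ‖∫ t in (0 : ℝ)..y, w t‖ * ‖z y‖ := B.le_opNorm₂ _ _
        _ ≤ ‖B‖ * (∫ t in Ioo 0 b, ‖w t‖) * ‖z y‖ := by gcongr; exact norm_primitive_le hy hw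
  have h1 : ∫ y in Ioo 0 b, (B (w y) (∫ t in (0 : ℝ)..y, z t) +
      B (∫ t in (0 : ℝ)..y, w t) (z y)) = B (∫ t in (0 : ℝ)..b, w t) (∫ t in (0 : ℝ)..b, z t) := by
    rw [← integral_Ioo_eq_intervalIntegral hb, ← integral_Ioo_eq_intervalIntegral hb, ← h0]
    refine setIntegral_congr_fun measurableSet_Ioo fun y hy => ?_
    simp only [integral_Iic_indicator hy]
  have i3 : IntegrableOn (fun y => B (w y) d) (Ioo 0 b) := (B.flip d).integrable_comp hw
  have i4 : IntegrableOn (fun y => B c (z y)) (Ioo 0 b) := (B c).integrable_comp hz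
  have i5 : IntegrableOn (fun y => B (w y) (∫ t in (0 : ℝ)..y, z t) +
      B (∫ t in (0 : ℝ)..y, w t) (z y)) (Ioo 0 b) := i1.add i2
  have i6 : IntegrableOn (fun y => B (w y) d + B c (z y)) (Ioo 0 b) := i3.add i4
  calc _ = ∫ y in Ioo 0 b, ((B (w y) (∫ t in (0 : ℝ)..y, z t) +
        B (∫ t in (0 : ℝ)..y, w t) (z y)) + (B (w y) d + B c (z y))) := by
        congr 1; ext y; simp only [map_add, _root_.add_apply]; abel
    _ = B (∫ t in (0 : ℝ)..b, w t) (∫ t in (0 : ℝ)..b, z t) +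
        (B (∫ t in (0 : ℝ)..b, w t) d + B c (∫ t in (0 : ℝ)..b, z t)) := by
        rw [integral_add i5 i6, h1, integral_add i3 i4,
          (B c).integral_comp_comm hz, show ∫ y in Ioo 0 b, B (w y) d = B (∫ y in Ioo 0 b, w y) d
            from (B.flip d).integral_comp_comm hw, integral_Ioo_eq_intervalIntegral hb,
          integral_Ioo_eq_intervalIntegral hb]
    _ = _ := by simp only [map_add, _root_.add_apply]; abel

end Primitive

/-! ### Structure of weakly differentiable functions -/

section Structure

variable {V : Type} [NormedAddCommGroup V] [InnerProductSpace ℂ V] [CompleteSpace V]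

theorem L2I.integrableOn {b : ℝ} (v : L2I b V) : IntegrableOn (fun y => v y) (Ioo 0 b) :=
  (Lp.memLp v).integrable one_le_two

theorem memLp_of_continuousOn {b : ℝ} {f : ℝ → V} (hf : ContinuousOn f (Icc 0 b)) :
    MemLp f 2 (volume.restrict (Ioo 0 b)) := by
  obtain ⟨C, hC⟩ := isCompact_Icc.exists_bound_of_continuousOn hf
  exact MemLp.of_bound ((hf.mono Ioo_subset_Icc_self).aestronglyMeasurable measurableSet_Ioo) C
    ((ae_restrict_iff' measurableSet_Ioo).2 (.of_forall fun y hy => hC y (Ioo_subset_Icc_self hy)))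

/-- The scalar factor is the primitive of its own derivative, so the bilinear formula applies with
scalar multiplication as the pairing. This is Green's formula before traces are named. -/
theorem integral_deriv_smul_primitive {b : ℝ} (hb : 0 ≤ b) {ψ : ℝ → ℝ} (hψ : ContDiff ℝ 1 ψ)
    {w : ℝ → V} (hw : IntegrableOn w (Ioo 0 b)) (c : V) :
    ∫ y in Ioo 0 b, (deriv ψ y • (c + ∫ t in (0 : ℝ)..y, w t) + ψ y • w y) =
      ψ b • (c + ∫ t in (0 : ℝ)..b, w t) - ψ 0 • c := by
  have hd : Continuous (deriv ψ) := hψ.continuous_deriv le_rfl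
  have key := integral_bilin_primitive (ContinuousLinearMap.lsmul ℝ ℝ (E := V)) hb
    (w := deriv ψ) (z := w)
    (hd.integrableOn_Icc.mono_set Ioo_subset_Icc_self) hw (ψ 0) c
  have h : ∀ y, ψ 0 + ∫ t in (0 : ℝ)..y, deriv ψ t = ψ y := by
    intro y
    rw [intervalIntegral.integral_deriv_eq_sub (fun x _ => hψ.differentiable one_ne_zero x)
      (hd.intervalIntegrable _ _)]
    ring
  simpa only [h, ContinuousLinearMap.lsmul_apply] using key

theorem isWeakDerivI_of_primitive {b : ℝ} (hb : 0 < b) {v w : L2I b V} {c : V}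
    (h : v =ᵐ[volume.restrict (Ioo 0 b)] fun y => c + ∫ t in (0 : ℝ)..y, w t) :
    IsWeakDerivI b v w := by
  intro φ hφ hc hs
  have key := integral_deriv_smul_primitive hb.le (hφ.of_le (by simp)) (L2I.integrableOn w) c
  have e0 : φ 0 = 0 := image_eq_zero_of_notMem_tsupport fun h => lt_irrefl _ (hs h).1
  have e1 : φ b = 0 := image_eq_zero_of_notMem_tsupport fun h => lt_irrefl _ (hs h).2
  rw [e0, e1, zero_smul, zero_smul, sub_zero] at key
  have h1 : ∫ y in Ioo 0 b, (deriv φ y • v y + φ y • w y) = 0 := by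
    rw [← key]
    refine integral_congr_ae ?_
    filter_upwards [h] with y hy
    rw [hy]
  rw [integral_add (integrable_test_smul _ (hφ.continuous_deriv (by simp)) hc.deriv v)
    (integrable_test_smul _ hφ.continuous hc w)] at h1
  exact eq_neg_of_add_eq_zero_left h1

/-- The primitive from 0 vanishes to the left of the support trivially and to the right of it
because the total integral is zero. -/
theorem exists_test_antideriv {b : ℝ} {g : ℝ → ℝ} (hg : ContDiff ℝ ∞ g)
    (hc : HasCompactSupport g) (hs : tsupport g ⊆ Ioo 0 b) (h0 : ∫ y in Ioo 0 b, g y = 0) :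
    ∃ Φ : ℝ → ℝ, ContDiff ℝ ∞ Φ ∧ HasCompactSupport Φ ∧ tsupport Φ ⊆ Ioo 0 b ∧ deriv Φ = g := by
  rcases (tsupport g).eq_empty_or_nonempty with he | hne
  · refine ⟨0, contDiff_const, HasCompactSupport.zero, by simp [tsupport], ?_⟩
    rw [tsupport_eq_empty_iff.1 he]
    ext; simp
  obtain ⟨a, ha, hal⟩ := hc.exists_isLeast hne
  obtain ⟨d, hd, hdl⟩ := hc.exists_isGreatest hne
  have ha' := hs ha
  have hd' := hs hd
  have hD : ∀ y, HasDerivAt (fun y => ∫ t in (0 : ℝ)..y, g t) (g y) y := fun y =>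
    intervalIntegral.integral_hasDerivAt_right (hg.continuous.intervalIntegrable _ _)
      (hg.continuous.stronglyMeasurableAtFilter _ _) hg.continuous.continuousAt
  have hder : deriv (fun y => ∫ t in (0 : ℝ)..y, g t) = g := funext fun y => (hD y).deriv
  have hsupp : ∀ y, y ∉ Icc a d → ∫ t in (0 : ℝ)..y, g t = 0 := by
    intro y hy
    have hz : ∀ t, t ∉ Icc a d → g t = 0 := fun t ht =>
      image_eq_zero_of_notMem_tsupport fun h => ht ⟨hal h, hdl h⟩
    by_cases hya : y < a
    · refine intervalIntegral.integral_zero_ae (.of_forall fun t ht => hz t fun h => ?_)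
      have := ht.2
      have := max_lt ha'.1 hya
      linarith [h.1]
    · have hyd : d < y := by
        by_contra h; exact hy ⟨not_lt.1 hya, not_lt.1 h⟩
      rw [integral_Ioo_eq_intervalIntegral (by linarith [ha'.1, ha'.2])] at h0
      rw [← intervalIntegral.integral_add_adjacent_intervals
        (hg.continuous.intervalIntegrable 0 b) (hg.continuous.intervalIntegrable b y), h0, zero_add]
      refine intervalIntegral.integral_zero_ae (.of_forall fun t ht => hz t fun h => ?_)
      have := ht.1
      have := lt_min hd'.2 hyd
      linarith [h.2]
  have hts : tsupport (fun y => ∫ t in (0 : ℝ)..y, g t) ⊆ Icc a d :=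
    closure_minimal (fun y hy => by by_contra h; exact hy (hsupp y h)) isClosed_Icc
  refine ⟨_, contDiff_infty_iff_deriv.2 ⟨fun y => (hD y).differentiableAt, by rwa [hder]⟩,
    HasCompactSupport.of_support_subset_isCompact isCompact_Icc ((subset_tsupport _).trans hts),
    hts.trans (Icc_subset_Ioo ha'.1 hd'.2), hder⟩

theorem exists_bump_Ioo {b : ℝ} (hb : 0 < b) : ∃ ψ : ℝ → ℝ, ContDiff ℝ ∞ ψ ∧
    HasCompactSupport ψ ∧ tsupport ψ ⊆ Ioo 0 b ∧ ∫ y in Ioo 0 b, ψ y = 1 := by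
  let f : ContDiffBump (b / 2) := ⟨b / 8, b / 4, by positivity, by linarith⟩
  have hts : tsupport (f.normed volume) ⊆ Ioo 0 b := by
    rw [f.tsupport_normed_eq]
    intro y hy
    rw [Metric.mem_closedBall, Real.dist_eq, abs_le] at hy
    change -(b / 4) ≤ _ ∧ _ ≤ b / 4 at hy
    constructor <;> linarith [hy.1, hy.2]
  refine ⟨f.normed volume, f.contDiff_normed, f.hasCompactSupport_normed, hts, ?_⟩
  rw [setIntegral_eq_integral_of_forall_compl_eq_zero, f.integral_normed]
  exact fun x hx => image_eq_zero_of_notMem_tsupport fun h => hx (hts h)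

/-- A weakly differentiable function is a primitive of its weak derivative. -/
theorem IsWeakDerivI.exists_primitive {b : ℝ} (hb : 0 < b) {v w : L2I b V}
    (h : IsWeakDerivI b v w) :
    ∃ c, v =ᵐ[volume.restrict (Ioo 0 b)] fun y => c + ∫ t in (0 : ℝ)..y, w t := by
  have hm : MemLp (fun y => ∫ t in (0 : ℝ)..y, w t) 2 (volume.restrict (Ioo 0 b)) :=
    memLp_of_continuousOn (continuousOn_primitive_Icc hb.le (L2I.integrableOn w))
  have hp : IsWeakDerivI b (hm.toLp) w := isWeakDerivI_of_primitive hb (c := 0) (by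
    filter_upwards [hm.coeFn_toLp] with y hy
    rw [hy, zero_add])
  -- Subtracting the primitive of w leaves a function with zero weak derivative; it remains to show
  -- that it is constant.
  set u : L2I b V := v - hm.toLp with hu
  have hu0 : IsWeakDerivI b u 0 := by
    have := h.add (hp.smul (-1))
    rwa [neg_one_smul, neg_one_smul, ← sub_eq_add_neg, ← sub_eq_add_neg, sub_self] at this
  obtain ⟨ψ, hψ, hψc, hψs, hψ1⟩ := exists_bump_Ioo hb
  set c : V := ∫ y in Ioo 0 b, ψ y • u y with hcdef
  have hint : ∀ {φ : ℝ → ℝ}, Continuous φ → HasCompactSupport φ →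
      IntegrableOn φ (Ioo 0 b) := fun h1 h2 => (h1.integrable_of_hasCompactSupport h2).integrableOn
  have hcm : MemLp (fun _ : ℝ => c) 2 (volume.restrict (Ioo 0 b)) := memLp_const c
  have key : u - hcm.toLp = 0 := by
    apply L2I.eq_zero_of_test
    intro φ hφ hφc hφs
    -- Du Bois-Reymond: φ minus A times the unit bump ψ has zero mean, hence an admissible
    -- antiderivative, so u pairs with φ as the constant c does.
    set A := ∫ y in Ioo 0 b, φ y with hA
    have hgs : tsupport (fun y => φ y - A * ψ y) ⊆ tsupport φ ∪ tsupport ψ := by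
      refine closure_minimal (fun y hy => ?_) ((isClosed_tsupport _).union (isClosed_tsupport _))
      by_contra hn
      rw [mem_union, not_or] at hn
      apply hy
      simp only [image_eq_zero_of_notMem_tsupport hn.1, image_eq_zero_of_notMem_tsupport hn.2,
        mul_zero, sub_zero]
    obtain ⟨Φ, h1, h2, h3, h4⟩ := exists_test_antideriv (b := b) (g := fun y => φ y - A * ψ y)
      (hφ.sub (contDiff_const.mul hψ))
      (HasCompactSupport.of_support_subset_isCompact (hφc.isCompact.union hψc.isCompact)
        ((subset_tsupport _).trans hgs))
      (hgs.trans (union_subset hφs hψs)) (by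
        rw [integral_sub (hint hφ.continuous hφc) ((hint hψ.continuous hψc).const_mul _),
          integral_const_mul, hψ1, mul_one, sub_self])
    have h5 := hu0 Φ h1 h2 h3
    have h6 : ∫ y in Ioo 0 b, Φ y • (0 : L2I b V) y = 0 := by
      rw [← integral_zero ℝ V (μ := volume.restrict (Ioo 0 b))]
      apply integral_congr_ae
      filter_upwards [Lp.coeFn_zero V 2 (volume.restrict (Ioo (0 : ℝ) b))] with y hy
      rw [hy, Pi.zero_apply, smul_zero]
    rw [h6, neg_zero, h4] at h5
    have e1 := integrable_test_smul φ hφ.continuous hφc u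
    have e2 := integrable_test_smul ψ hψ.continuous hψc u
    have h7 : ∫ y in Ioo 0 b, (φ y - A * ψ y) • u y = (∫ y in Ioo 0 b, φ y • u y) - A • c := by
      have e3 : Integrable (fun y => A • ψ y • u y) (volume.restrict (Ioo 0 b)) := e2.smul A
      rw [hcdef, ← integral_smul A, ← integral_sub e1 e3]
      congr 1; ext y
      rw [sub_smul, mul_smul]
    rw [h7, sub_eq_zero] at h5
    calc ∫ y in Ioo 0 b, φ y • (u - hcm.toLp : L2I b V) y
        = ∫ y in Ioo 0 b, (φ y • u y - φ y • c) := by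
          apply integral_congr_ae
          filter_upwards [Lp.coeFn_sub u hcm.toLp, hcm.coeFn_toLp] with y hy hy'
          rw [hy, Pi.sub_apply, hy', smul_sub]
      _ = (∫ y in Ioo 0 b, φ y • u y) - A • c := by
          rw [integral_sub e1 ((hint hφ.continuous hφc).smul_const c), integral_smul_const]
      _ = 0 := by rw [h5, sub_self]
  refine ⟨c, ?_⟩
  have hv : v = hcm.toLp + hm.toLp := by
    rw [← sub_eq_zero.1 key, hu, sub_add_cancel]
  rw [hv]
  filter_upwards [Lp.coeFn_add hcm.toLp hm.toLp, hcm.coeFn_toLp, hm.coeFn_toLp] with y h1 h2 h3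
  rw [h1, Pi.add_apply, h2, h3]

end Structure

end

end CurlLayer

namespace CurlLayer

noncomputable section

/-! ### Constants, linear maps on values, traces -/

section Traces

variable {V W : Type} [NormedAddCommGroup V] [InnerProductSpace ℂ V] [CompleteSpace V]
  [NormedAddCommGroup W] [InnerProductSpace ℂ W] [CompleteSpace W]

/-- The constant functions in `L²((0, b); V)`. -/
def constI (b : ℝ) (V : Type) [NormedAddCommGroup V] [InnerProductSpace ℂ V] : V →L[ℂ] L2I b V :=
  Lp.constL 2 (volume.restrict (Ioo 0 b)) ℂ

theorem coeFn_constI (b : ℝ) (c : V) :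
    constI b V c =ᵐ[volume.restrict (Ioo 0 b)] fun _ => c :=
  Lp.coeFn_const 2 _ c

theorem isWeakDerivI_const (b : ℝ) (c : V) : IsWeakDerivI b (constI b V c) 0 := by
  rcases le_or_gt b 0 with hb | hb
  · intro φ _ _ _
    simp [Ioo_eq_empty (not_lt.2 hb)]
  · refine isWeakDerivI_of_primitive hb (c := c) ?_
    have h0 : ∀ᵐ y, y ∈ Ioo 0 b → (0 : L2I b V) y = 0 :=
      (ae_restrict_iff' measurableSet_Ioo).1 (Lp.coeFn_zero V 2 (volume.restrict (Ioo (0 : ℝ) b)))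
    filter_upwards [coeFn_constI b c, ae_restrict_mem measurableSet_Ioo] with y hy hy'
    rw [hy, intervalIntegral.integral_zero_ae, add_zero]
    filter_upwards [h0] with t ht ht'
    rw [uIoc_of_le hy'.1.le] at ht'
    exact ht ⟨ht'.1, ht'.2.trans_lt hy'.2⟩

/-- The constant functions in `Hᵏ((0, b); V)`. -/
def HI.const (b : ℝ) (k : ℕ) (V : Type) [NormedAddCommGroup V] [InnerProductSpace ℂ V]
    [CompleteSpace V] : V →L[ℂ] HI b k V :=
  HI.lift (fun j => if j = 0 then constI b V else 0) fun j _ c => by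
    cases j with
    | zero => simpa using isWeakDerivI_const b c
    | succ j => simpa using isWeakDerivI_zero b

theorem HI.der_const_zero (b : ℝ) (k : ℕ) (c : V) :
    der b k 0 (HI.const b k V c) = constI b V c := by
  rw [HI.const, HI.der_lift _ _ (Nat.zero_le _), if_pos rfl]

theorem HI.der_const_succ (b : ℝ) (k j : ℕ) (c : V) :
    der b k (j + 1) (HI.const b k V c) = 0 := by
  by_cases h : j + 1 ≤ k
  · rw [HI.const, HI.der_lift _ _ h, if_neg (Nat.succ_ne_zero j)]; rfl
  · rw [der, dif_neg (by omega)]; rfl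

/-- Composition with a linear map on values, as an operator on `L²((0, b))`. -/
def mapI (b : ℝ) (A : V →L[ℂ] W) : L2I b V →L[ℂ] L2I b W := A.compLpL 2 _

theorem coeFn_mapI {b : ℝ} (A : V →L[ℂ] W) (v : L2I b V) :
    mapI b A v =ᵐ[volume.restrict (Ioo 0 b)] fun y => A (v y) := A.coeFn_compLp v

theorem testI_mapI {b : ℝ} (ψ : C(ℝ, ℝ)) (A : V →L[ℂ] W) (v : L2I b V) :
    testI b ψ (mapI b A v) = A (testI b ψ v) := by
  have hint : Integrable (fun y => ψ y • v y) (volume.restrict (Ioo 0 b)) := by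
    obtain ⟨C, hC⟩ := (isCompact_Icc (a := (0 : ℝ)) (b := b)).exists_bound_of_continuousOn
      ψ.continuous.continuousOn
    exact (L2I.integrableOn v).bdd_smul (𝕜 := ℝ) C ψ.continuous.aestronglyMeasurable
      ((ae_restrict_iff' measurableSet_Ioo).2 (.of_forall fun y hy =>
        hC y (Ioo_subset_Icc_self hy)))
  rw [testI_apply, testI_apply, ← A.integral_comp_comm hint]
  apply integral_congr_ae
  filter_upwards [coeFn_mapI A v] with y hy
  rw [hy, A.map_smul_of_tower]

theorem IsWeakDerivI.map {b : ℝ} {v w : L2I b V} (h : IsWeakDerivI b v w) (A : V →L[ℂ] W) :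
    IsWeakDerivI b (mapI b A v) (mapI b A w) := by
  rw [isWeakDerivI_iff_testI] at h ⊢
  intro φ hφ hc hs
  rw [testI_mapI, testI_mapI, h φ hφ hc hs, map_neg]

/-- Composition with a linear map on values, as an operator on `Hᵏ((0, b))`. -/
def HI.map (b : ℝ) (k : ℕ) (A : V →L[ℂ] W) : HI b k V →L[ℂ] HI b k W :=
  HI.lift (fun j => (mapI b A).comp (der b k j)) fun _ h w => by
    rw [ContinuousLinearMap.comp_apply, ContinuousLinearMap.comp_apply]
    exact (isWeakDerivI_der h w).map A

@[simp]
theorem HI.der_map {b : ℝ} {k : ℕ} (j : ℕ) (A : V →L[ℂ] W) (w : HI b k V) :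
    der b k j (HI.map b k A w) = mapI b A (der b k j w) := by
  by_cases hj : j ≤ k
  · rw [HI.map, HI.der_lift _ _ hj]; rfl
  · rw [der, dif_neg (by omega), der, dif_neg (by omega)]; simp

/-- The mean value functional turned into the trace at `0`. -/
def trBot (b : ℝ) (k : ℕ) : HI b (k + 1) V →L[ℂ] V :=
  (b⁻¹ : ℝ) • ((testI b 1).comp (der b (k + 1) 0) +
    (testI b ⟨fun y => y - b, by fun_prop⟩).comp (der b (k + 1) 1))

/-- The trace at `b`. -/
def trTop (b : ℝ) (k : ℕ) : HI b (k + 1) V →L[ℂ] V :=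
  trBot b k + (testI b 1).comp (der b (k + 1) 1)

theorem trBot_apply (b : ℝ) (k : ℕ) (w : HI b (k + 1) V) :
    trBot b k w = (b⁻¹ : ℝ) • (testI b 1 (der b (k + 1) 0 w) +
      testI b ⟨fun y => y - b, by fun_prop⟩ (der b (k + 1) 1 w)) := rfl

theorem trTop_apply (b : ℝ) (k : ℕ) (w : HI b (k + 1) V) :
    trTop b k w = trBot b k w + testI b 1 (der b (k + 1) 1 w) := rfl

theorem testI_one {b : ℝ} (hb : 0 ≤ b) (v : L2I b V) :
    testI b 1 v = ∫ t in (0 : ℝ)..b, v t := by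
  rw [testI_apply, ← integral_Ioo_eq_intervalIntegral hb]
  simp

theorem integrable_continuousMap_smul {b : ℝ} (ψ : C(ℝ, ℝ)) (v : L2I b V) :
    Integrable (fun y => ψ y • v y) (volume.restrict (Ioo 0 b)) := by
  obtain ⟨C, hC⟩ := (isCompact_Icc (a := (0 : ℝ)) (b := b)).exists_bound_of_continuousOn
    ψ.continuous.continuousOn
  exact (L2I.integrableOn v).bdd_smul (𝕜 := ℝ) C ψ.continuous.aestronglyMeasurable
    ((ae_restrict_iff' measurableSet_Ioo).2 (.of_forall fun y hy => hC y (Ioo_subset_Icc_self hy)))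

/-- Green's formula with the weight y - b, which vanishes at b and equals -b at 0, shows that the
averaged functional `trBot` returns the constant of the primitive. Defining the trace by this
average makes it bounded and linear at once. -/
theorem coeFn_der_zero {b : ℝ} (hb : 0 < b) {k : ℕ} (w : HI b (k + 1) V) :
    der b (k + 1) 0 w =ᵐ[volume.restrict (Ioo 0 b)]
      fun y => trBot b k w + ∫ t in (0 : ℝ)..y, der b (k + 1) 1 w t := by
  obtain ⟨c, hc⟩ := (isWeakDerivI_der (Nat.succ_pos k) w).exists_primitive hb
  have key := integral_deriv_smul_primitive hb.le (ψ := fun y => y - b) (by fun_prop)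
    (L2I.integrableOn (der b (k + 1) 1 w)) c
  have h1 : trBot b k w = c := by
    have h2 : (testI b 1 (der b (k + 1) 0 w) +
        testI b ⟨fun y => y - b, by fun_prop⟩ (der b (k + 1) 1 w)) = b • c := by
      rw [testI_apply, testI_apply, ← integral_add (integrable_continuousMap_smul _ _)
        (integrable_continuousMap_smul _ _)]
      simp only [sub_self, zero_smul, zero_sub, neg_smul, sub_neg_eq_add, zero_add] at key
      rw [← key]
      apply integral_congr_ae
      filter_upwards [hc] with y hy
      have : deriv (fun y : ℝ => y - b) y = 1 := by simp
      rw [this, hy]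
      simp
    rw [trBot_apply, h2, smul_smul, inv_mul_cancel₀ hb.ne', one_smul]
  rw [h1]
  exact hc

theorem trTop_eq {b : ℝ} (hb : 0 < b) {k : ℕ} (w : HI b (k + 1) V) :
    trTop b k w = trBot b k w + ∫ t in (0 : ℝ)..b, der b (k + 1) 1 w t := by
  rw [← testI_one hb.le]; rfl

theorem trBot_eq_of_primitive {b : ℝ} (hb : 0 < b) {k : ℕ} {w : HI b (k + 1) V} {c : V}
    (h : der b (k + 1) 0 w =ᵐ[volume.restrict (Ioo 0 b)]
      fun y => c + ∫ t in (0 : ℝ)..y, der b (k + 1) 1 w t) : trBot b k w = c := by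
  have hne : volume.restrict (Ioo 0 b) ≠ 0 := by
    rw [Ne, Measure.restrict_eq_zero, Real.volume_Ioo, ENNReal.ofReal_eq_zero]
    linarith
  have : (ae (volume.restrict (Ioo 0 b))).NeBot := ae_neBot.2 hne
  obtain ⟨y, h1, h2⟩ := (h.and (coeFn_der_zero hb w)).exists
  exact (add_right_cancel (h1.symm.trans h2)).symm

/-- Green's formula on `(0, b)`. -/
theorem green_smul {b : ℝ} (hb : 0 < b) {k : ℕ} (w : HI b (k + 1) V) {ψ : ℝ → ℝ}
    (hψ : ContDiff ℝ 1 ψ) :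
    (∫ y in Ioo 0 b, deriv ψ y • der b (k + 1) 0 w y) +
      ∫ y in Ioo 0 b, ψ y • der b (k + 1) 1 w y = ψ b • trTop b k w - ψ 0 • trBot b k w := by
  have i1 : Integrable (fun y => deriv ψ y • der b (k + 1) 0 w y) (volume.restrict (Ioo 0 b)) :=
    integrable_continuousMap_smul ⟨deriv ψ, hψ.continuous_deriv le_rfl⟩ _
  have i2 : Integrable (fun y => ψ y • der b (k + 1) 1 w y) (volume.restrict (Ioo 0 b)) :=
    integrable_continuousMap_smul ⟨ψ, hψ.continuous⟩ _
  rw [trTop_eq hb, ← integral_deriv_smul_primitive hb.le hψ (L2I.integrableOn _),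
    ← integral_add i1 i2]
  apply integral_congr_ae
  filter_upwards [coeFn_der_zero hb w] with y hy
  rw [hy]

theorem trBot_map {b : ℝ} {k : ℕ} (A : V →L[ℂ] W) (w : HI b (k + 1) V) :
    trBot b k (HI.map b (k + 1) A w) = A (trBot b k w) := by
  rw [trBot_apply, trBot_apply, HI.der_map, HI.der_map, A.map_smul_of_tower, map_add,
    testI_mapI, testI_mapI]

theorem trTop_map {b : ℝ} {k : ℕ} (A : V →L[ℂ] W) (w : HI b (k + 1) V) :
    trTop b k (HI.map b (k + 1) A w) = A (trTop b k w) := by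
  rw [trTop_apply, trTop_apply, trBot_map, HI.der_map, map_add, testI_mapI]

theorem trBot_incl {b : ℝ} {k : ℕ} (w : HI b (k + 2) V) :
    trBot b k (HI.incl b (k + 1) w) = trBot b (k + 1) w := by
  rw [trBot_apply, HI.der_incl (by omega), HI.der_incl (by omega)]; rfl

theorem trTop_incl {b : ℝ} {k : ℕ} (w : HI b (k + 2) V) :
    trTop b k (HI.incl b (k + 1) w) = trTop b (k + 1) w := by
  rw [trTop_apply, HI.der_incl (by omega), trBot_incl]; rfl

theorem trBot_const {b : ℝ} (hb : 0 < b) {k : ℕ} (c : V) :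
    trBot b k (HI.const b (k + 1) V c) = c := by
  apply trBot_eq_of_primitive hb
  rw [HI.der_const_zero, HI.der_const_succ]
  have h0 : ∀ᵐ y, y ∈ Ioo 0 b → (0 : L2I b V) y = 0 :=
    (ae_restrict_iff' measurableSet_Ioo).1 (Lp.coeFn_zero V 2 (volume.restrict (Ioo (0 : ℝ) b)))
  filter_upwards [coeFn_constI b c, ae_restrict_mem measurableSet_Ioo] with y hy hy'
  rw [hy, intervalIntegral.integral_zero_ae, add_zero]
  filter_upwards [h0] with t ht ht'
  rw [uIoc_of_le hy'.1.le] at ht'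
  exact ht ⟨ht'.1, ht'.2.trans_lt hy'.2⟩

theorem trTop_const {b : ℝ} (hb : 0 < b) {k : ℕ} (c : V) :
    trTop b k (HI.const b (k + 1) V c) = c := by
  rw [trTop_apply, trBot_const hb, HI.der_const_succ, map_zero, add_zero]

end Traces

/-! ### Quadratic inequalities for scalar functions -/

section Scalar

theorem L2I.norm_sq_eq {b : ℝ} (v : L2I b ℂ) : ‖v‖ ^ 2 = ∫ y in Ioo 0 b, ‖v y‖ ^ 2 := by
  have h := inner_self_eq_norm_sq_to_K (𝕜 := ℂ) v
  rw [L2.inner_def] at h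
  have h2 : ∫ y in Ioo 0 b, inner ℂ (v y) (v y) = ((∫ y in Ioo 0 b, ‖v y‖ ^ 2 : ℝ) : ℂ) := by
    rw [← integral_complex_ofReal]
    congr 1; ext y
    rw [inner_self_eq_norm_sq_to_K]
    push_cast; rfl
  rw [h2] at h
  apply Complex.ofReal_injective
  rw [h, Complex.ofReal_pow]; rfl

theorem L2I.integrable_norm_sq {b : ℝ} (v : L2I b ℂ) :
    IntegrableOn (fun y => ‖v y‖ ^ 2) (Ioo 0 b) :=
  (Lp.memLp v).norm.integrable_sq

/-- The real bilinear pairing `(x, y) ↦ conj x * y` on `ℂ`. -/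
def conjMul : ℂ →L[ℝ] ℂ →L[ℝ] ℂ :=
  (ContinuousLinearMap.mul ℝ ℂ).comp (Complex.conjCLE : ℂ →L[ℝ] ℂ)

theorem conjMul_apply (x y : ℂ) : conjMul x y = starRingEnd ℂ x * y := rfl

/-- Integration by parts for conj x · y with both traces kept. The interpolation inequality, the
pressure pairing and the energy identity all come from it. -/
theorem inner_der_add {b : ℝ} (hb : 0 < b) {k l : ℕ} (x : HI b (k + 1) ℂ) (y : HI b (l + 1) ℂ) :
    inner ℂ (der b (k + 1) 1 x) (der b (l + 1) 0 y) +
      inner ℂ (der b (k + 1) 0 x) (der b (l + 1) 1 y) =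
    starRingEnd ℂ (trTop b k x) * trTop b l y - starRingEnd ℂ (trBot b k x) * trBot b l y := by
  have key := integral_bilin_primitive conjMul hb.le (L2I.integrableOn (der b (k + 1) 1 x))
    (L2I.integrableOn (der b (l + 1) 1 y)) (trBot b k x) (trBot b l y)
  rw [← trTop_eq hb, ← trTop_eq hb] at key
  rw [L2.inner_def, L2.inner_def, ← integral_add (L2.integrable_inner _ _)
    (L2.integrable_inner _ _), ← conjMul_apply, ← conjMul_apply, ← key]
  apply integral_congr_ae
  filter_upwards [coeFn_der_zero hb x, coeFn_der_zero hb y] with t h1 h2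
  rw [h1, h2, RCLike.inner_apply', RCLike.inner_apply', conjMul_apply, conjMul_apply]

/-- The integrand is the derivative of (y - a)|x|². The factor (y - a)x is itself a primitive, of x
+ (y - a)x' with initial value -a x(0), so the bilinear formula applies. The values a = 0 and a = b
isolate the top and the bottom trace. -/
theorem integral_weighted_norm_sq {b : ℝ} (hb : 0 < b) {k : ℕ} (x : HI b (k + 1) ℂ) (a : ℝ) :
    ∫ y in Ioo 0 b, (starRingEnd ℂ (der b (k + 1) 1 x y) * ((y - a) • der b (k + 1) 0 x y) +
      starRingEnd ℂ (der b (k + 1) 0 x y) *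
        (der b (k + 1) 0 x y + (y - a) • der b (k + 1) 1 x y)) =
    ((b - a) * ‖trTop b k x‖ ^ 2 + a * ‖trBot b k x‖ ^ 2 : ℝ) := by
  set v := der b (k + 1) 0 x with hv
  set w := der b (k + 1) 1 x with hw
  set c := trBot b k x with hc
  have hvc := coeFn_der_zero hb x
  rw [← hv, ← hw, ← hc] at hvc
  have hvc' : ∀ᵐ y, y ∈ Ioo 0 b → v y = c + ∫ t in (0 : ℝ)..y, w t :=
    (ae_restrict_iff' measurableSet_Ioo).1 hvc
  set z : ℝ → ℂ := fun y => v y + (y - a) • w y with hz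
  have hzi : IntegrableOn z (Ioo 0 b) :=
    (L2I.integrableOn v).add (integrable_continuousMap_smul ⟨fun y => y - a, by fun_prop⟩ w)
  have hprim : ∀ y, 0 ≤ y → y ≤ b → (-a) • c + ∫ t in (0 : ℝ)..y, z t =
      (y - a) • (c + ∫ t in (0 : ℝ)..y, w t) := by
    intro y hy0 hyb
    have h := integral_deriv_smul_primitive hy0 (ψ := fun y => y - a) (by fun_prop)
      ((L2I.integrableOn w).mono_set (Ioo_subset_Ioo_right hyb)) c
    have h' : ∫ t in (0 : ℝ)..y, z t = ∫ t in Ioo 0 y, (deriv (fun y => y - a) t •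
        (c + ∫ s in (0 : ℝ)..t, w s) + (t - a) • w t) := by
      rw [← integral_Ioo_eq_intervalIntegral hy0]
      refine setIntegral_congr_ae measurableSet_Ioo ?_
      filter_upwards [hvc'] with t ht hty
      have : deriv (fun y : ℝ => y - a) t = 1 := by simp
      rw [this, one_smul, ← ht ⟨hty.1, hty.2.trans_le hyb⟩]
    rw [h', h, zero_sub]
    abel
  have key := integral_bilin_primitive conjMul hb.le (L2I.integrableOn w) hzi c ((-a) • c)
  rw [hprim b hb.le le_rfl, ← trTop_eq hb x] at key
  have e : ∀ u : ℂ, starRingEnd ℂ u * u = ((‖u‖ ^ 2 : ℝ) : ℂ) := by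
    intro u; rw [Complex.conj_mul']; push_cast; rfl
  have h3 : conjMul (trTop b k x) ((b - a) • trTop b k x) - conjMul c ((-a) • c) =
      ((b - a) * ‖trTop b k x‖ ^ 2 + a * ‖c‖ ^ 2 : ℝ) := by
    rw [conjMul_apply, conjMul_apply, mul_smul_comm, mul_smul_comm, e, e]
    simp only [Complex.real_smul]
    push_cast
    ring
  rw [← h3, ← key]
  apply integral_congr_ae
  filter_upwards [hvc, ae_restrict_mem measurableSet_Ioo] with y h1 h2
  rw [hprim y h2.1.le h2.2.le, ← h1, conjMul_apply, conjMul_apply]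

/-- Young's inequality on the cross term, with |y - a| ≤ b. The parameter t stays free: t
proportional to Z balances a derivative against a power of the frequency, and a large t makes the
coefficient of the derivative small. -/
theorem trace_sq_aux {b : ℝ} (hb : 0 < b) {k : ℕ} (x : HI b (k + 1) ℂ) {a : ℝ} (h0 : 0 ≤ a)
    (h1 : a ≤ b) {t : ℝ} (ht : 0 < t) :
    (b - a) * ‖trTop b k x‖ ^ 2 + a * ‖trBot b k x‖ ^ 2 ≤
      (1 + b * t) * ‖der b (k + 1) 0 x‖ ^ 2 + b * t⁻¹ * ‖der b (k + 1) 1 x‖ ^ 2 := by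
  have key := congrArg norm (integral_weighted_norm_sq hb x a)
  have hnn : 0 ≤ (b - a) * ‖trTop b k x‖ ^ 2 + a * ‖trBot b k x‖ ^ 2 := by
    have : 0 ≤ b - a := by linarith
    positivity
  rw [Complex.norm_real, Real.norm_of_nonneg hnn] at key
  rw [← key, L2I.norm_sq_eq, L2I.norm_sq_eq, ← integral_const_mul, ← integral_const_mul,
    ← integral_add ((L2I.integrable_norm_sq _).const_mul _)
      ((L2I.integrable_norm_sq _).const_mul _)]
  refine norm_integral_le_of_norm_le (((L2I.integrable_norm_sq _).const_mul _).add
      ((L2I.integrable_norm_sq _).const_mul _))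
    ((ae_restrict_iff' measurableSet_Ioo).2 (.of_forall fun y hy => ?_))
  set p := ‖der b (k + 1) 0 x y‖
  set q := ‖der b (k + 1) 1 x y‖
  have hy' : |y - a| ≤ b := abs_le.2 ⟨by linarith [hy.1], by linarith [hy.2]⟩
  calc _ ≤ q * (|y - a| * p) + p * (p + |y - a| * q) := by
        refine (norm_add_le _ _).trans (add_le_add ?_ ?_)
        · rw [norm_mul, RCLike.norm_conj, norm_smul, Real.norm_eq_abs]
        · rw [norm_mul, RCLike.norm_conj]
          refine mul_le_mul_of_nonneg_left ((norm_add_le _ _).trans ?_) (norm_nonneg _)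
          rw [norm_smul, Real.norm_eq_abs]
    _ ≤ q * (b * p) + p * (p + b * q) := by gcongr
    _ = p ^ 2 + b * (2 * p * q) := by ring
    _ ≤ p ^ 2 + b * (t * p ^ 2 + t⁻¹ * q ^ 2) := by
        gcongr
        have h2 : t * t⁻¹ = 1 := mul_inv_cancel₀ ht.ne'
        have h3 : 0 < t⁻¹ := inv_pos.2 ht
        nlinarith [sq_nonneg (t * p - q), mul_nonneg h3.le (sq_nonneg (t * p - q))]
    _ = _ := by ring

/-- The multiplicative trace inequality at `b`. -/
theorem norm_trTop_sq_le {b : ℝ} (hb : 0 < b) {k : ℕ} (x : HI b (k + 1) ℂ) {t : ℝ} (ht : 0 < t) :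
    ‖trTop b k x‖ ^ 2 ≤
      (b⁻¹ + t) * ‖der b (k + 1) 0 x‖ ^ 2 + t⁻¹ * ‖der b (k + 1) 1 x‖ ^ 2 := by
  have h := trace_sq_aux hb x le_rfl hb.le ht
  rw [sub_zero, zero_mul, add_zero] at h
  refine le_of_mul_le_mul_left (h.trans (le_of_eq ?_)) hb
  field_simp

/-- The multiplicative trace inequality at `0`. -/
theorem norm_trBot_sq_le {b : ℝ} (hb : 0 < b) {k : ℕ} (x : HI b (k + 1) ℂ) {t : ℝ} (ht : 0 < t) :
    ‖trBot b k x‖ ^ 2 ≤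
      (b⁻¹ + t) * ‖der b (k + 1) 0 x‖ ^ 2 + t⁻¹ * ‖der b (k + 1) 1 x‖ ^ 2 := by
  have h := trace_sq_aux hb x hb.le le_rfl ht
  rw [sub_self, zero_mul, zero_add] at h
  refine le_of_mul_le_mul_left (h.trans (le_of_eq ?_)) hb
  field_simp

theorem integral_norm_le_sqrt {b : ℝ} (hb : 0 < b) (w : L2I b ℂ) :
    ∫ y in Ioo 0 b, ‖w y‖ ≤ Real.sqrt b * ‖w‖ := by
  have h1 := eLpNorm_le_eLpNorm_mul_rpow_measure_univ
    (μ := volume.restrict (Ioo 0 b)) (f := w) one_le_two (Lp.aestronglyMeasurable w)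
  have h2 : ∫ y in Ioo 0 b, ‖w y‖ = (eLpNorm w 1 (volume.restrict (Ioo 0 b))).toReal := by
    rw [eLpNorm_one_eq_lintegral_enorm, integral_norm_eq_lintegral_enorm
      (Lp.aestronglyMeasurable w)]
  rw [h2, Lp.norm_def, mul_comm]
  have h3 : Real.sqrt b = ((volume.restrict (Ioo 0 b) univ) ^ (1 / 2 : ℝ)).toReal := by
    rw [← ENNReal.toReal_rpow, Measure.restrict_apply_univ, Real.volume_Ioo, sub_zero,
      ENNReal.toReal_ofReal hb.le, Real.sqrt_eq_rpow]
  rw [h3, ← ENNReal.toReal_mul]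
  refine ENNReal.toReal_mono ?_ (h1.trans (le_of_eq ?_))
  · exact ENNReal.mul_ne_top (Lp.eLpNorm_ne_top w)
      (ENNReal.rpow_ne_top_of_nonneg (by norm_num) (measure_ne_top _ _))
  · norm_num

theorem L2I.norm_le_of_bound {b : ℝ} (hb : 0 < b) {v : L2I b ℂ} {C : ℝ} (hC : 0 ≤ C)
    (h : ∀ᵐ y ∂volume.restrict (Ioo 0 b), ‖v y‖ ≤ C) : ‖v‖ ≤ Real.sqrt b * C := by
  refine le_of_sq_le_sq ?_ (by positivity)
  rw [L2I.norm_sq_eq, mul_pow, Real.sq_sqrt hb.le]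
  calc _ ≤ ∫ y in Ioo 0 b, C ^ 2 := by
        refine integral_mono_ae (L2I.integrable_norm_sq v) (integrable_const _) ?_
        filter_upwards [h] with y hy
        gcongr
    _ = _ := by simp [hb.le]

/-- Poincaré's inequality for functions vanishing at `0`. -/
theorem norm_der_zero_le_of_trBot {b : ℝ} (hb : 0 < b) {k : ℕ} {x : HI b (k + 1) ℂ}
    (h : trBot b k x = 0) : ‖der b (k + 1) 0 x‖ ≤ b * ‖der b (k + 1) 1 x‖ := by
  have h1 := L2I.norm_le_of_bound hb (v := der b (k + 1) 0 x)
    (C := Real.sqrt b * ‖der b (k + 1) 1 x‖) (by positivity) (by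
      filter_upwards [coeFn_der_zero hb x, ae_restrict_mem measurableSet_Ioo] with y hy hy'
      rw [hy, h, zero_add]
      exact (norm_primitive_le hy' (L2I.integrableOn _)).trans (integral_norm_le_sqrt hb _))
  rwa [← mul_assoc, Real.mul_self_sqrt hb.le] at h1

/-- Poincaré's inequality for functions vanishing at `b`. -/
theorem norm_der_zero_le_of_trTop {b : ℝ} (hb : 0 < b) {k : ℕ} {x : HI b (k + 1) ℂ}
    (h : trTop b k x = 0) : ‖der b (k + 1) 0 x‖ ≤ 2 * b * ‖der b (k + 1) 1 x‖ := by
  have hB : ‖trBot b k x‖ ≤ Real.sqrt b * ‖der b (k + 1) 1 x‖ := by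
    have h2 := trTop_eq hb x
    rw [h] at h2
    rw [eq_neg_of_add_eq_zero_left h2.symm, norm_neg, ← integral_Ioo_eq_intervalIntegral hb.le]
    exact (norm_integral_le_integral_norm _).trans (integral_norm_le_sqrt hb _)
  have h1 := L2I.norm_le_of_bound hb (v := der b (k + 1) 0 x)
    (C := 2 * (Real.sqrt b * ‖der b (k + 1) 1 x‖)) (by positivity) (by
      filter_upwards [coeFn_der_zero hb x, ae_restrict_mem measurableSet_Ioo] with y hy hy'
      rw [hy, two_mul]
      exact (norm_add_le _ _).trans (add_le_add hB
        ((norm_primitive_le hy' (L2I.integrableOn _)).trans (integral_norm_le_sqrt hb _))))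
  calc _ ≤ _ := h1
    _ = 2 * (Real.sqrt b * Real.sqrt b) * ‖der b (k + 1) 1 x‖ := by ring
    _ = _ := by rw [Real.mul_self_sqrt hb.le]

end Scalar

end

end CurlLayer

namespace CurlLayer

noncomputable section

/-! ### Interpolation with a large parameter -/

section Interpolation

/-- Young's inequality with weight ρZ splits the product of traces. The choice of ρ gives (β + 1)/ρ
≤ 1/4 and 1/ρ ≤ ε/4, so each boundary product costs only half of w² after doubling. -/
theorem interp_boundary_aux {β ε ρ Z v w z α β' : ℝ} (hβ0 : 0 < β) (hε : 0 < ε)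
    (hρ : ρ = 4 * (β + 1) + 4 / ε) (hZ : 1 ≤ Z)
    (h1 : α ^ 2 ≤ (β + 4 * ρ * Z) * v ^ 2 + (4 * ρ * Z)⁻¹ * w ^ 2)
    (h2 : β' ^ 2 ≤ (β + Z) * w ^ 2 + Z⁻¹ * z ^ 2) :
    2 * (α * β') ≤ ρ * (β + 4 * ρ) * (Z ^ 2 * v ^ 2) + 1 / 2 * w ^ 2
      + ε / 4 * (Z⁻¹ ^ 2 * z ^ 2) := by
  have hZ0 : 0 < Z := by linarith
  have hρ0 : 0 < ρ := by rw [hρ]; positivity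
  have hβZ : β ≤ β * Z := le_mul_of_one_le_right hβ0.le hZ
  have g1 : 2 * (α * β') ≤ ρ * Z * α ^ 2 + (ρ * Z)⁻¹ * β' ^ 2 := by
    have hp : 0 < ρ * Z := by positivity
    have h3 : ρ * Z * α ^ 2 + (ρ * Z)⁻¹ * β' ^ 2 - 2 * (α * β') =
        (ρ * Z)⁻¹ * (ρ * Z * α - β') ^ 2 := by
      field_simp; ring
    have h4 : 0 ≤ (ρ * Z)⁻¹ * (ρ * Z * α - β') ^ 2 := by positivity
    linarith
  have g2 : ρ * Z * α ^ 2 ≤ ρ * (β + 4 * ρ) * (Z ^ 2 * v ^ 2) + 1 / 4 * w ^ 2 := by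
    calc ρ * Z * α ^ 2 ≤ ρ * Z * ((β + 4 * ρ * Z) * v ^ 2 + (4 * ρ * Z)⁻¹ * w ^ 2) := by gcongr
      _ ≤ ρ * Z * ((β * Z + 4 * ρ * Z) * v ^ 2 + (4 * ρ * Z)⁻¹ * w ^ 2) := by gcongr
      _ = _ := by field_simp
  have g3 : (ρ * Z)⁻¹ * β' ^ 2 ≤ 1 / 4 * w ^ 2 + ε / 4 * (Z⁻¹ ^ 2 * z ^ 2) := by
    have r1 : (β + 1) / ρ ≤ 1 / 4 := by
      rw [div_le_div_iff₀ hρ0 (by norm_num)]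
      have : 0 < 4 / ε := by positivity
      linarith
    have r2 : 1 / ρ ≤ ε / 4 := by
      rw [div_le_div_iff₀ hρ0 (by norm_num)]
      have h5 : ε * (4 / ε) = 4 := by field_simp
      have h6 : ε * ρ = ε * (4 * (β + 1)) + 4 := by rw [hρ, mul_add, h5]
      have h7 : 0 < ε * (4 * (β + 1)) := by positivity
      linarith
    calc (ρ * Z)⁻¹ * β' ^ 2 ≤ (ρ * Z)⁻¹ * ((β + Z) * w ^ 2 + Z⁻¹ * z ^ 2) := by gcongr
      _ ≤ (ρ * Z)⁻¹ * ((β * Z + Z) * w ^ 2 + Z⁻¹ * z ^ 2) := by gcongr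
      _ = ((β + 1) / ρ) * w ^ 2 + (1 / ρ) * (Z⁻¹ ^ 2 * z ^ 2) := by field_simp
      _ ≤ _ := by gcongr
  linarith

theorem two_mul_le_weighted {ε Z v z : ℝ} (hε : 0 < ε) (hZ : 0 < Z) :
    2 * (v * z) ≤ 2 / ε * (Z ^ 2 * v ^ 2) + ε / 2 * (Z⁻¹ ^ 2 * z ^ 2) := by
  have h6 : 2 / ε * (Z ^ 2 * v ^ 2) + ε / 2 * (Z⁻¹ ^ 2 * z ^ 2) - 2 * (v * z) =
      (2 * ε)⁻¹ * (2 * (Z * v) - ε * (Z⁻¹ * z)) ^ 2 := by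
    field_simp; ring
  have h7 : 0 ≤ (2 * ε)⁻¹ * (2 * (Z * v) - ε * (Z⁻¹ * z)) ^ 2 := by positivity
  linarith

/-- Integration by parts bounds ‖x'‖² by ‖x‖‖x''‖ and two products of traces of x and x'. The trace
inequalities with parameters of order Z let both products be absorbed, uniformly in Z ≥ 1. -/
theorem interp_one {b : ℝ} (hb : 0 < b) {ε : ℝ} (hε : 0 < ε) :
    ∃ C : ℝ, 0 ≤ C ∧ ∀ (Z : ℝ), 1 ≤ Z → ∀ (k : ℕ) (x : HI b (k + 2) ℂ),
      ‖der b (k + 2) 1 x‖ ^ 2 ≤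
        ε * (Z⁻¹ ^ 2 * ‖der b (k + 2) 2 x‖ ^ 2) + C * (Z ^ 2 * ‖der b (k + 2) 0 x‖ ^ 2) := by
  set β : ℝ := b⁻¹ with hβ
  have hβ0 : 0 < β := inv_pos.2 hb
  set ρ : ℝ := 4 * (β + 1) + 4 / ε with hρ
  have hρ0 : 0 < ρ := by positivity
  refine ⟨2 / ε + 2 * ρ * (β + 4 * ρ), by positivity, fun Z hZ k x => ?_⟩
  have hZ0 : 0 < Z := by linarith
  set v := ‖der b (k + 2) 0 x‖ with hv
  set w := ‖der b (k + 2) 1 x‖ with hw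
  set z := ‖der b (k + 2) 2 x‖ with hz
  have e0 : der b (k + 1) 0 (HI.deriv b (k + 1) x) = der b (k + 2) 1 x := HI.der_deriv (by omega) x
  have e1 : der b (k + 1) 1 (HI.deriv b (k + 1) x) = der b (k + 2) 2 x := HI.der_deriv (by omega) x
  have key := inner_der_add hb x (HI.deriv b (k + 1) x)
  rw [e0, e1] at key
  have t1 := norm_trTop_sq_le hb x (t := 4 * ρ * Z) (by positivity)
  have t2 := norm_trBot_sq_le hb x (t := 4 * ρ * Z) (by positivity)
  have t3 := norm_trTop_sq_le hb (HI.deriv b (k + 1) x) (t := Z) hZ0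
  have t4 := norm_trBot_sq_le hb (HI.deriv b (k + 1) x) (t := Z) hZ0
  rw [e0, e1] at t3 t4
  set α₁ := ‖trTop b (k + 1) x‖
  set α₂ := ‖trBot b (k + 1) x‖
  set β₁ := ‖trTop b k (HI.deriv b (k + 1) x)‖
  set β₂ := ‖trBot b k (HI.deriv b (k + 1) x)‖
  have h1 : w ^ 2 ≤ v * z + α₁ * β₁ + α₂ * β₂ := by
    have h2 := congrArg norm (eq_sub_of_add_eq key)
    rw [inner_self_eq_norm_sq_to_K] at h2
    have h3 : ‖((‖der b (k + 2) 1 x‖ : ℂ)) ^ 2‖ = w ^ 2 := by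
      rw [norm_pow, Complex.norm_real, norm_norm]
    change ‖((‖der b (k + 2) 1 x‖ : ℂ)) ^ 2‖ = _ at h2
    rw [h3] at h2
    rw [h2]
    refine (norm_sub_le _ _).trans ?_
    have h4 := norm_inner_le_norm (𝕜 := ℂ) (der b (k + 2) 0 x) (der b (k + 2) 2 x)
    have h5 : ‖starRingEnd ℂ (trTop b (k + 1) x) * trTop b k (HI.deriv b (k + 1) x) -
        starRingEnd ℂ (trBot b (k + 1) x) * trBot b k (HI.deriv b (k + 1) x)‖ ≤
        α₁ * β₁ + α₂ * β₂ := by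
      refine (norm_sub_le _ _).trans (le_of_eq ?_)
      rw [norm_mul, norm_mul, RCLike.norm_conj, RCLike.norm_conj]
    calc _ ≤ (α₁ * β₁ + α₂ * β₂) + v * z := add_le_add h5 h4
      _ = _ := by ring
  have b1 := interp_boundary_aux hβ0 hε hρ hZ t1 t3
  have b2 := interp_boundary_aux hβ0 hε hρ hZ t2 t4
  have b3 := two_mul_le_weighted (v := v) (z := z) hε hZ0
  linarith

theorem interp_step {b : ℝ} (hb : 0 < b) (j : ℕ) : ∀ δ : ℝ, 0 < δ →
    ∃ C : ℝ, 0 ≤ C ∧ ∀ (Z : ℝ), 1 ≤ Z → ∀ (n : ℕ), j + 1 ≤ n → ∀ x : HI b n ℂ,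
      (Z⁻¹ ^ j * ‖der b n j x‖) ^ 2 ≤
        δ * (Z⁻¹ ^ (j + 1) * ‖der b n (j + 1) x‖) ^ 2 + C * ‖der b n 0 x‖ ^ 2 := by
  induction j with
  | zero =>
    intro δ hδ
    refine ⟨1, zero_le_one, fun Z _ n _ x => ?_⟩
    simp only [pow_zero, one_mul]
    have : 0 ≤ δ * (Z⁻¹ ^ (0 + 1) * ‖der b n (0 + 1) x‖) ^ 2 := by positivity
    linarith
  | succ j ih =>
    intro δ hδ
    obtain ⟨C₁, hC₁, h₁⟩ := interp_one hb (half_pos hδ)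
    -- With this δ in the induction hypothesis, C₁δ ≤ 1/2, so the term of order j + 1 that comes
    -- back is absorbed on the left.
    obtain ⟨C₂, hC₂, h₂⟩ := ih (1 / (2 * (C₁ + 1))) (by positivity)
    refine ⟨2 * (C₁ * C₂), by positivity, fun Z hZ n hn x => ?_⟩
    have hZ0 : 0 < Z := by linarith
    have hw : ∀ i < 2, IsWeakDerivI b (der b n (j + i) x) (der b n (j + (i + 1)) x) :=
      fun i hi => isWeakDerivI_der (by omega) x
    have a1 := h₁ Z hZ 0 (HI.mk (fun i => der b n (j + i) x) hw)
    rw [HI.der_mk _ _ (by omega), HI.der_mk _ _ (by omega), HI.der_mk _ _ (by omega)] at a1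
    have a2 := h₂ Z hZ n (by omega) x
    simp only [add_zero] at a1
    set u := ‖der b n j x‖
    set v := ‖der b n (j + 1) x‖
    set w := ‖der b n (j + 2) x‖
    have a3 : (Z⁻¹ ^ (j + 1) * v) ^ 2 ≤
        δ / 2 * (Z⁻¹ ^ (j + 2) * w) ^ 2 + C₁ * (Z⁻¹ ^ j * u) ^ 2 := by
      calc (Z⁻¹ ^ (j + 1) * v) ^ 2 = (Z⁻¹ ^ (j + 1)) ^ 2 * v ^ 2 := by ring
        _ ≤ (Z⁻¹ ^ (j + 1)) ^ 2 * (δ / 2 * (Z⁻¹ ^ 2 * w ^ 2) + C₁ * (Z ^ 2 * u ^ 2)) := by gcongr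
        _ = _ := by rw [pow_succ Z⁻¹ j, pow_succ _ (j + 1), pow_succ _ j]; field_simp
    have a4 : C₁ * (1 / (2 * (C₁ + 1))) ≤ 1 / 2 := by
      rw [mul_one_div, div_le_div_iff₀ (by positivity) (by norm_num)]
      linarith
    set A := (Z⁻¹ ^ (j + 1) * v) ^ 2
    have hA : 0 ≤ A := sq_nonneg _
    have a5 : A ≤ δ / 2 * (Z⁻¹ ^ (j + 2) * w) ^ 2 + (1 / 2 * A + C₁ * C₂ * ‖der b n 0 x‖ ^ 2) := by
      calc A ≤ _ := a3
        _ ≤ δ / 2 * (Z⁻¹ ^ (j + 2) * w) ^ 2 +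
            C₁ * (1 / (2 * (C₁ + 1)) * A + C₂ * ‖der b n 0 x‖ ^ 2) := by gcongr
        _ = δ / 2 * (Z⁻¹ ^ (j + 2) * w) ^ 2 +
            (C₁ * (1 / (2 * (C₁ + 1))) * A + C₁ * C₂ * ‖der b n 0 x‖ ^ 2) := by ring
        _ ≤ _ := by gcongr
    linarith

/-- Interpolation: intermediate derivatives, weighted with powers of a parameter `Z ≥ 1`, are
controlled by the extreme ones. -/
theorem interp_der {b : ℝ} (hb : 0 < b) (n : ℕ) {j : ℕ} (hj : j ≤ n) :
    ∃ C : ℝ, 0 ≤ C ∧ ∀ (Z : ℝ), 1 ≤ Z → ∀ x : HI b n ℂ,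
      Z ^ (n - j) * ‖der b n j x‖ ≤ C * (‖der b n n x‖ + Z ^ n * ‖der b n 0 x‖) := by
  -- Descend from the top order, where the claim is trivial. Each step uses `interp_step` with δ =
  -- 1, so the coefficient of the top derivative stays 1. Dividing all weights by Z^n puts the
  -- orders on one scale.
  suffices h : ∀ i ≤ n, ∃ C : ℝ, 0 ≤ C ∧ ∀ (Z : ℝ), 1 ≤ Z → ∀ x : HI b n ℂ,
      (Z⁻¹ ^ (n - i) * ‖der b n (n - i) x‖) ^ 2 ≤
        (Z⁻¹ ^ n * ‖der b n n x‖) ^ 2 + C * ‖der b n 0 x‖ ^ 2 by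
    obtain ⟨C, hC, h⟩ := h (n - j) (by omega)
    rw [show n - (n - j) = j by omega] at h
    refine ⟨1 + Real.sqrt C, by positivity, fun Z hZ x => ?_⟩
    have hZ0 : 0 < Z := by linarith
    have h1 := h Z hZ x
    have h2 : (Z⁻¹ ^ j * ‖der b n j x‖) ≤
        Z⁻¹ ^ n * ‖der b n n x‖ + Real.sqrt C * ‖der b n 0 x‖ := by
      refine le_of_sq_le_sq (h1.trans ?_) (by positivity)
      have h3 : Real.sqrt C ^ 2 = C := Real.sq_sqrt hC
      have : 0 ≤ 2 * ((Z⁻¹ ^ n * ‖der b n n x‖) * (Real.sqrt C * ‖der b n 0 x‖)) := by positivity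
      nlinarith
    have h4 : Z ^ (n - j) = Z ^ n * Z⁻¹ ^ j := by
      rw [inv_pow, pow_sub₀ _ hZ0.ne' hj]
    calc Z ^ (n - j) * ‖der b n j x‖ = Z ^ n * (Z⁻¹ ^ j * ‖der b n j x‖) := by rw [h4]; ring
      _ ≤ Z ^ n * (Z⁻¹ ^ n * ‖der b n n x‖ + Real.sqrt C * ‖der b n 0 x‖) := by gcongr
      _ = ‖der b n n x‖ + Real.sqrt C * (Z ^ n * ‖der b n 0 x‖) := by
          rw [inv_pow]; field_simp
      _ ≤ _ := by
          have : 0 ≤ Real.sqrt C * ‖der b n n x‖ := by positivity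
          have : 0 ≤ Z ^ n * ‖der b n 0 x‖ := by positivity
          linarith
  intro i
  induction i with
  | zero => exact fun _ => ⟨0, le_rfl, fun Z _ x => by simp⟩
  | succ i ih =>
    intro hi
    obtain ⟨C, hC, h⟩ := ih (by omega)
    obtain ⟨C', hC', h'⟩ := interp_step hb (n - (i + 1)) 1 one_pos
    refine ⟨C + C', by positivity, fun Z hZ x => ?_⟩
    have h1 := h' Z hZ n (by omega) x
    rw [show n - (i + 1) + 1 = n - i by omega, one_mul] at h1
    linarith [h Z hZ x]

end Interpolation

end

end CurlLayer

namespace CurlLayer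

noncomputable section

/-! ### Domination up to a constant -/

section Dominated

variable {α : Type*} {f f' f₁ f₂ g g' h : α → ℝ}

/-- `f ≤ C g` for some constant `C ≥ 0`. -/
def Dominated (f g : α → ℝ) : Prop := ∃ C : ℝ, 0 ≤ C ∧ ∀ x, f x ≤ C * g x

theorem Dominated.of_le (hfg : ∀ x, f x ≤ g x) : Dominated f g :=
  ⟨1, zero_le_one, fun x => by simpa using hfg x⟩

theorem Dominated.trans (h₁ : Dominated f g) (h₂ : Dominated g h) : Dominated f h := by
  obtain ⟨C, hC, h₁⟩ := h₁
  obtain ⟨C', hC', h₂⟩ := h₂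
  refine ⟨C * C', by positivity, fun x => (h₁ x).trans ?_⟩
  rw [mul_assoc]
  exact mul_le_mul_of_nonneg_left (h₂ x) hC

theorem Dominated.of_le_of (hfg : ∀ x, f x ≤ g x) (h₂ : Dominated g h) : Dominated f h :=
  (Dominated.of_le hfg).trans h₂

theorem Dominated.add (h₁ : Dominated f g) (h₂ : Dominated f' g) :
    Dominated (fun x => f x + f' x) g := by
  obtain ⟨C, hC, h₁⟩ := h₁
  obtain ⟨C', hC', h₂⟩ := h₂
  refine ⟨C + C', by positivity, fun x => ?_⟩
  rw [add_mul]
  exact add_le_add (h₁ x) (h₂ x)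

theorem Dominated.const_mul {c : ℝ} (hc : 0 ≤ c) (h₁ : Dominated f g) :
    Dominated (fun x => c * f x) g := by
  obtain ⟨C, hC, h₁⟩ := h₁
  refine ⟨c * C, by positivity, fun x => ?_⟩
  rw [mul_assoc]
  exact mul_le_mul_of_nonneg_left (h₁ x) hc

theorem Dominated.mul (h₁ : Dominated f g) (h₂ : Dominated f' g') (hf' : ∀ x, 0 ≤ f' x)
    (hg : ∀ x, 0 ≤ g x) : Dominated (fun x => f x * f' x) (fun x => g x * g' x) := by
  obtain ⟨C, hC, h₁⟩ := h₁
  obtain ⟨C', hC', h₂⟩ := h₂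
  refine ⟨C * C', by positivity, fun x => ?_⟩
  calc f x * f' x ≤ (C * g x) * f' x := mul_le_mul_of_nonneg_right (h₁ x) (hf' x)
    _ ≤ (C * g x) * (C' * g' x) :=
        mul_le_mul_of_nonneg_left (h₂ x) (mul_nonneg hC (hg x))
    _ = _ := by ring

theorem Dominated.sum {ι : Type*} (s : Finset ι) {F : ι → α → ℝ}
    (hF : ∀ i ∈ s, Dominated (F i) g) (_hg : ∀ x, 0 ≤ g x) :
    Dominated (fun x => ∑ i ∈ s, F i x) g := by
  classical
  induction s using Finset.induction_on with
  | empty => exact ⟨0, le_rfl, fun x => by simp⟩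
  | insert i s hi ih =>
    simp only [Finset.sum_insert hi]
    exact (hF i (Finset.mem_insert_self _ _)).add
      (ih fun j hj => hF j (Finset.mem_insert_of_mem hj))

/-- A quadratic inequality `f² ≲ (f + g) g` implies `f ≲ g`. -/
theorem Dominated.of_sq_le_mul (hf : ∀ x, 0 ≤ f x) (hg : ∀ x, 0 ≤ g x)
    (h₁ : Dominated (fun x => f x ^ 2) (fun x => (f x + g x) * g x)) : Dominated f g := by
  obtain ⟨C, hC, h₁⟩ := h₁
  -- If f > (C + 1)g, then f² > Cfg + fg ≥ Cfg + (C + 1)g², which contradicts f² ≤ C(f + g)g.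
  refine ⟨C + 1, by positivity, fun x => ?_⟩
  by_contra hn
  push Not at hn
  have h2 := h₁ x
  have h3 := hf x
  have h4 := hg x
  have h5 : 0 < f x := lt_of_le_of_lt (by positivity) hn
  have h6 : (C + 1) * g x * f x < f x * f x := mul_lt_mul_of_pos_right hn h5
  have h7 : (C + 1) * g x * g x ≤ f x * g x := mul_le_mul_of_nonneg_right hn.le h4
  nlinarith

end Dominated

/-! ### The Stokes estimate on a fiber -/

section Stokes

/-- A fiber Stokes problem with data bounded by `D`. -/
structure StokesConfig (b μ : ℝ) (s : ℕ) where
  /-- the large parameter -/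
  Z : ℝ
  /-- the modulus of the frequency -/
  lam : ℝ
  /-- the size of the data -/
  D : ℝ
  /-- the symbols of the tangential derivatives -/
  d : Fin 2 → ℂ
  /-- the pressure -/
  Q : HI b (s + 1) ℂ
  /-- the velocity -/
  v : Fin 3 → HI b (s + 2) ℂ
  /-- the force -/
  F : Fin 3 → L2I b ℂ
  /-- the divergence -/
  g₀ : L2I b ℂ
  /-- the normal derivative of the divergence -/
  g₁ : L2I b ℂ
  one_le_Z : 1 ≤ Z
  lam_pos : 0 < lam
  lam_le : lam ≤ 7 * Z
  Z_le : Z ≤ 1 + lam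
  conj_d : ∀ j, starRingEnd ℂ (d j) = -d j
  d_sq : d 0 * d 0 + d 1 * d 1 = -(lam : ℂ) ^ 2
  norm_d_le : ∀ j, ‖d j‖ ≤ lam
  eq_tan : ∀ j : Fin 2, F j.castSucc = d j • der b (s + 1) 0 Q -
    (μ : ℂ) • (der b (s + 2) 2 (v j.castSucc) - ((lam : ℂ) ^ 2) • der b (s + 2) 0 (v j.castSucc))
  eq_nor : F 2 = der b (s + 1) 1 Q -
    (μ : ℂ) • (der b (s + 2) 2 (v 2) - ((lam : ℂ) ^ 2) • der b (s + 2) 0 (v 2))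
  eq_div : g₀ = d 0 • der b (s + 2) 0 (v 0) + d 1 • der b (s + 2) 0 (v 1) + der b (s + 2) 1 (v 2)
  eq_div' : g₁ = d 0 • der b (s + 2) 1 (v 0) + d 1 • der b (s + 2) 1 (v 1) + der b (s + 2) 2 (v 2)
  bot : ∀ i, trBot b (s + 1) (v i) = 0
  D_nonneg : 0 ≤ D
  F_le : ∀ i, ‖F i‖ ≤ D
  g₁_le : ‖g₁‖ ≤ D
  g₀_le : Z * ‖g₀‖ ≤ D
  k_le : ∀ j : Fin 2, Real.sqrt Z * ‖trTop b s (HI.deriv b (s + 1) (v j.castSucc))‖ ≤ D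
  h_le : Z * Real.sqrt Z * ‖trTop b (s + 1) (v 2)‖ ≤ D
  flux_le : ‖trTop b (s + 1) (v 2) - testI b 1 g₀‖ ≤ lam * D

namespace StokesConfig

variable {b μ : ℝ} {s : ℕ} (x : StokesConfig b μ s)

/-- The `L²` norm of the `j`-th derivative of the `i`-th velocity component. -/
def a (j : ℕ) (i : Fin 3) : ℝ := ‖der b (s + 2) j (x.v i)‖

/-- The weighted `H¹` norm of the velocity. -/
def N : ℝ := x.Z * ∑ i, (x.a 1 i + x.lam * x.a 0 i)

/-- The data plus the weighted `H¹` norm of the velocity. -/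
def m : ℝ := x.D + x.N

/-- The `L²` norm of the pressure and of its derivative. -/
def q (j : ℕ) : ℝ := ‖der b (s + 1) j x.Q‖

theorem Z_pos : 0 < x.Z := by linarith [x.one_le_Z]

theorem a_nonneg (j : ℕ) (i : Fin 3) : 0 ≤ x.a j i := norm_nonneg _

theorem q_nonneg (j : ℕ) : 0 ≤ x.q j := norm_nonneg _

theorem term_nonneg (i : Fin 3) : 0 ≤ x.a 1 i + x.lam * x.a 0 i :=
  add_nonneg (x.a_nonneg 1 i) (mul_nonneg x.lam_pos.le (x.a_nonneg 0 i))

theorem N_nonneg : 0 ≤ x.N :=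
  mul_nonneg x.Z_pos.le (Finset.sum_nonneg fun i _ => x.term_nonneg i)

theorem m_nonneg : 0 ≤ x.m := add_nonneg x.D_nonneg x.N_nonneg

theorem D_le_m : x.D ≤ x.m := le_add_of_nonneg_right x.N_nonneg

theorem N_le_m : x.N ≤ x.m := le_add_of_nonneg_left x.D_nonneg

theorem term_le (i : Fin 3) : x.Z * (x.a 1 i + x.lam * x.a 0 i) ≤ x.N :=
  mul_le_mul_of_nonneg_left
    (Finset.single_le_sum (f := fun i => x.a 1 i + x.lam * x.a 0 i)
      (fun i _ => x.term_nonneg i) (Finset.mem_univ i)) x.Z_pos.le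

theorem Z_mul_a_one_le (i : Fin 3) : x.Z * x.a 1 i ≤ x.N := by
  have h1 := x.term_le i
  have h2 := mul_nonneg x.Z_pos.le (mul_nonneg x.lam_pos.le (x.a_nonneg 0 i))
  linarith [mul_add x.Z (x.a 1 i) (x.lam * x.a 0 i)]

theorem Z_mul_lam_mul_a_zero_le (i : Fin 3) : x.Z * (x.lam * x.a 0 i) ≤ x.N := by
  have h1 := x.term_le i
  have h2 := mul_nonneg x.Z_pos.le (x.a_nonneg 1 i)
  linarith [mul_add x.Z (x.a 1 i) (x.lam * x.a 0 i)]

theorem lam_sq_mul_a_zero_le (i : Fin 3) : x.lam ^ 2 * x.a 0 i ≤ 7 * x.N := by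
  calc x.lam ^ 2 * x.a 0 i = x.lam * (x.lam * x.a 0 i) := by ring
    _ ≤ (7 * x.Z) * (x.lam * x.a 0 i) :=
        mul_le_mul_of_nonneg_right x.lam_le (mul_nonneg x.lam_pos.le (x.a_nonneg 0 i))
    _ = 7 * (x.Z * (x.lam * x.a 0 i)) := by ring
    _ ≤ _ := by linarith [x.Z_mul_lam_mul_a_zero_le i]

theorem lam_mul_a_one_le (i : Fin 3) : x.lam * x.a 1 i ≤ 7 * x.N := by
  calc x.lam * x.a 1 i ≤ (7 * x.Z) * x.a 1 i :=
        mul_le_mul_of_nonneg_right x.lam_le (x.a_nonneg 1 i)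
    _ = 7 * (x.Z * x.a 1 i) := by ring
    _ ≤ _ := by linarith [x.Z_mul_a_one_le i]

/-- Since Z ≤ 1 + λ, one factor Z splits: the part λ is in N, and the part 1 is paid by Poincaré's
inequality, available because the velocity vanishes at the bottom. -/
theorem Z_sq_mul_a_zero_le (hb : 0 < b) (i : Fin 3) : x.Z ^ 2 * x.a 0 i ≤ (1 + b) * x.N := by
  have h1 : x.a 0 i ≤ b * x.a 1 i := norm_der_zero_le_of_trBot hb (x.bot i)
  calc x.Z ^ 2 * x.a 0 i = x.Z * (x.Z * x.a 0 i) := by ring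
    _ ≤ x.Z * ((1 + x.lam) * x.a 0 i) := by
        have := x.Z_pos.le; have := x.a_nonneg 0 i; have := x.Z_le; gcongr
    _ ≤ x.Z * (b * x.a 1 i + x.lam * x.a 0 i) := by
        have := x.Z_pos.le; rw [add_mul, one_mul]; gcongr
    _ = b * (x.Z * x.a 1 i) + x.Z * (x.lam * x.a 0 i) := by ring
    _ ≤ b * x.N + x.N := by
        have := x.Z_mul_a_one_le i; have := x.Z_mul_lam_mul_a_zero_le i; gcongr
    _ = _ := by ring

/-- The differentiated divergence equation expresses v₃'' through g₁ and d·v', which costs only λ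
times a first derivative. The momentum equations are not needed. -/
theorem a_two_nor_le : x.a 2 2 ≤ x.D + 14 * x.N := by
  have h : der b (s + 2) 2 (x.v 2) = x.g₁ - x.d 0 • der b (s + 2) 1 (x.v 0) -
      x.d 1 • der b (s + 2) 1 (x.v 1) := by rw [x.eq_div']; abel
  have h0 : ‖x.d 0 • der b (s + 2) 1 (x.v 0)‖ ≤ 7 * x.N := by
    rw [norm_smul]
    exact (mul_le_mul_of_nonneg_right (x.norm_d_le 0) (norm_nonneg _)).trans (x.lam_mul_a_one_le 0)
  have h1 : ‖x.d 1 • der b (s + 2) 1 (x.v 1)‖ ≤ 7 * x.N := by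
    rw [norm_smul]
    exact (mul_le_mul_of_nonneg_right (x.norm_d_le 1) (norm_nonneg _)).trans (x.lam_mul_a_one_le 1)
  rw [a, h]
  linarith [norm_sub_le (x.g₁ - x.d 0 • der b (s + 2) 1 (x.v 0)) (x.d 1 • der b (s + 2) 1 (x.v 1)),
    norm_sub_le x.g₁ (x.d 0 • der b (s + 2) 1 (x.v 0)), x.g₁_le]

theorem norm_lam_sq_smul_le (i : Fin 3) :
    ‖((x.lam : ℂ) ^ 2) • der b (s + 2) 0 (x.v i)‖ ≤ 7 * x.N := by
  rw [norm_smul, norm_pow, Complex.norm_real, Real.norm_of_nonneg x.lam_pos.le]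
  exact x.lam_sq_mul_a_zero_le i

/-- With v₃'' already bounded, the normal momentum equation gives Q' directly. This bound holds at
all frequencies, unlike any bound on Q itself. -/
theorem q_one_le (hμ : 0 < μ) : x.q 1 ≤ (1 + 22 * μ) * x.m := by
  have h : der b (s + 1) 1 x.Q = x.F 2 + (μ : ℂ) •
      (der b (s + 2) 2 (x.v 2) - ((x.lam : ℂ) ^ 2) • der b (s + 2) 0 (x.v 2)) := by
    rw [x.eq_nor]; abel
  have h1 : ‖der b (s + 2) 2 (x.v 2) - ((x.lam : ℂ) ^ 2) • der b (s + 2) 0 (x.v 2)‖ ≤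
      22 * x.m := by
    refine (norm_sub_le _ _).trans ?_
    have := x.a_two_nor_le
    have := x.norm_lam_sq_smul_le 2
    rw [a] at *
    linarith [x.D_le_m, x.N_le_m, x.m_nonneg, show x.m = x.D + x.N from rfl, x.N_nonneg,
      x.D_nonneg]
  rw [q, h]
  refine (norm_add_le _ _).trans ?_
  rw [norm_smul, Complex.norm_real, Real.norm_of_nonneg hμ.le, add_mul, one_mul]
  refine add_le_add ((x.F_le 2).trans x.D_le_m) ?_
  calc _ ≤ μ * (22 * x.m) := mul_le_mul_of_nonneg_left h1 hμ.le
    _ = _ := by ring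

/-- The tangential divergence, up to the sign. -/
def W : HI b (s + 2) ℂ := -(x.d 0 • x.v 0 + x.d 1 • x.v 1)

theorem der_W (j : ℕ) : der b (s + 2) j x.W =
    -(x.d 0 • der b (s + 2) j (x.v 0) + x.d 1 • der b (s + 2) j (x.v 1)) := by
  rw [W, map_neg, map_add, map_smul, map_smul]

/-- The remainder in the equation for the pressure. -/
def G : L2I b ℂ := -∑ j : Fin 2, x.d j • (x.F j.castSucc -
  (μ : ℂ) • ((x.lam : ℂ) ^ 2) • der b (s + 2) 0 (x.v j.castSucc))

/-- Multiply the tangential equations by -dⱼ and add: d·d = -λ² turns the pressure gradient into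
λ²Q. -/
theorem lam_sq_smul_Q :
    ((x.lam : ℂ) ^ 2) • der b (s + 1) 0 x.Q = (μ : ℂ) • der b (s + 2) 2 x.W + x.G := by
  rw [der_W, G, Fin.sum_univ_two, x.eq_tan 0, x.eq_tan 1]
  have h : (x.lam : ℂ) ^ 2 = -(x.d 0 * x.d 0 + x.d 1 * x.d 1) := by rw [x.d_sq, neg_neg]
  simp only [Fin.castSucc_zero, Fin.castSucc_one]
  rw [show ((x.lam : ℂ) ^ 2) • der b (s + 1) 0 x.Q =
    (-(x.d 0 * x.d 0 + x.d 1 * x.d 1)) • der b (s + 1) 0 x.Q by rw [h]]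
  module

theorem norm_G_le (hμ : 0 < μ) : ‖x.G‖ ≤ x.lam * ((2 + 14 * μ) * x.m) := by
  have h : ∀ j : Fin 2, ‖x.d j • (x.F j.castSucc -
      (μ : ℂ) • ((x.lam : ℂ) ^ 2) • der b (s + 2) 0 (x.v j.castSucc))‖ ≤
      x.lam * ((1 + 7 * μ) * x.m) := by
    intro j
    rw [norm_smul]
    refine mul_le_mul (x.norm_d_le j) ?_ (norm_nonneg _) x.lam_pos.le
    refine (norm_sub_le _ _).trans ?_
    rw [norm_smul, Complex.norm_real, Real.norm_of_nonneg hμ.le, add_mul, one_mul]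
    refine add_le_add ((x.F_le _).trans x.D_le_m) ?_
    calc _ ≤ μ * (7 * x.N) := mul_le_mul_of_nonneg_left (x.norm_lam_sq_smul_le _) hμ.le
      _ ≤ μ * (7 * x.m) := by have := x.N_le_m; gcongr
      _ = _ := by ring
  rw [G, norm_neg, Fin.sum_univ_two]
  calc _ ≤ _ := norm_add_le _ _
    _ ≤ x.lam * ((1 + 7 * μ) * x.m) + x.lam * ((1 + 7 * μ) * x.m) := add_le_add (h 0) (h 1)
    _ = _ := by ring

theorem norm_der_one_W_le : x.Z * ‖der b (s + 2) 1 x.W‖ ≤ x.lam * (2 * x.m) := by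
  have h : ∀ j : Fin 2, ‖x.d j • der b (s + 2) 1 (x.v j.castSucc)‖ ≤ x.lam * x.a 1 j.castSucc := by
    intro j
    rw [norm_smul]
    exact mul_le_mul_of_nonneg_right (x.norm_d_le j) (norm_nonneg _)
  have h0 : ‖der b (s + 2) 1 x.W‖ ≤ x.lam * x.a 1 0 + x.lam * x.a 1 1 := by
    rw [der_W, norm_neg]
    exact (norm_add_le _ _).trans (add_le_add (h 0) (h 1))
  calc x.Z * ‖der b (s + 2) 1 x.W‖ ≤ x.Z * (x.lam * x.a 1 0 + x.lam * x.a 1 1) :=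
        mul_le_mul_of_nonneg_left h0 x.Z_pos.le
    _ = x.lam * (x.Z * x.a 1 0 + x.Z * x.a 1 1) := by ring
    _ ≤ x.lam * (2 * x.m) := by
        refine mul_le_mul_of_nonneg_left ?_ x.lam_pos.le
        linarith [x.Z_mul_a_one_le 0, x.Z_mul_a_one_le 1, x.N_le_m]

/-- The same identity read backwards. The term λ·λ‖Q‖ on the right is the quantity to be estimated,
so this bound may only be used with a small coefficient. -/
theorem norm_der_two_W_le (hμ : 0 < μ) :
    μ * ‖der b (s + 2) 2 x.W‖ ≤ x.lam * (x.lam * x.q 0 + (2 + 14 * μ) * x.m) := by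
  have h : (μ : ℂ) • der b (s + 2) 2 x.W = ((x.lam : ℂ) ^ 2) • der b (s + 1) 0 x.Q - x.G := by
    rw [lam_sq_smul_Q]; abel
  have h1 := congrArg norm h
  rw [norm_smul, Complex.norm_real, Real.norm_of_nonneg hμ.le] at h1
  rw [h1]
  refine (norm_sub_le _ _).trans ?_
  rw [norm_smul, norm_pow, Complex.norm_real, Real.norm_of_nonneg x.lam_pos.le]
  calc _ ≤ x.lam ^ 2 * x.q 0 + x.lam * ((2 + 14 * μ) * x.m) := by
        have := x.norm_G_le hμ; rw [q]; gcongr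
    _ = _ := by ring

/-- Pair the formula for λ²Q with Q and integrate W'' by parts. In the interior only Q' and W'
remain, which are controlled; the rest is traces. -/
theorem pairing_le (hb : 0 < b) (hμ : 0 < μ) : (x.lam * x.q 0) ^ 2 ≤ x.q 0 * ‖x.G‖ +
    μ * (x.q 1 * ‖der b (s + 2) 1 x.W‖ +
      ‖trTop b s x.Q‖ * ‖trTop b s (HI.deriv b (s + 1) x.W)‖ +
      ‖trBot b s x.Q‖ * ‖trBot b s (HI.deriv b (s + 1) x.W)‖) := by
  have key := inner_der_add hb x.Q (HI.deriv b (s + 1) x.W)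
  rw [HI.der_deriv (by omega), HI.der_deriv (by omega)] at key
  simp only [zero_add, Nat.reduceAdd] at key
  have h1 : inner ℂ (der b (s + 1) 0 x.Q) (((x.lam : ℂ) ^ 2) • der b (s + 1) 0 x.Q) =
      (μ : ℂ) * inner ℂ (der b (s + 1) 0 x.Q) (der b (s + 2) 2 x.W) +
        inner ℂ (der b (s + 1) 0 x.Q) x.G := by
    rw [lam_sq_smul_Q, inner_add_right, inner_smul_right]
  rw [inner_smul_right, inner_self_eq_norm_sq_to_K, eq_sub_of_add_eq' key] at h1
  have h2 : ‖(x.lam : ℂ) ^ 2 * ((‖der b (s + 1) 0 x.Q‖ : ℂ)) ^ 2‖ = (x.lam * x.q 0) ^ 2 := by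
    rw [norm_mul, norm_pow, norm_pow, Complex.norm_real, Complex.norm_real, norm_norm,
      Real.norm_of_nonneg x.lam_pos.le, q, mul_pow]
  rw [← h2]
  refine (le_of_eq (congrArg norm h1)).trans ?_
  refine (norm_add_le _ _).trans ?_
  rw [add_comm, norm_mul, Complex.norm_real, Real.norm_of_nonneg hμ.le]
  refine add_le_add (norm_inner_le_norm _ _) (mul_le_mul_of_nonneg_left ?_ hμ.le)
  refine (norm_sub_le _ _).trans ?_
  refine (add_le_add (norm_sub_le _ _) (norm_inner_le_norm _ _)).trans (le_of_eq ?_)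
  rw [norm_mul, norm_mul, RCLike.norm_conj, RCLike.norm_conj, q]
  ring

end StokesConfig

end Stokes

end

end CurlLayer

namespace CurlLayer

noncomputable section

/-! ### Scalar inequalities that absorb the boundary terms of the pressure pairing. -/

section Absorb

theorem mul_le_weighted_sq {ε μ Q W : ℝ} (hε : 0 < ε) :
    μ * (Q * W) ≤ ε * Q ^ 2 + μ ^ 2 / (4 * ε) * W ^ 2 := by
  have h : ε * Q ^ 2 + μ ^ 2 / (4 * ε) * W ^ 2 - μ * (Q * W) =
      (4 * ε)⁻¹ * (2 * ε * Q - μ * W) ^ 2 := by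
    field_simp; ring
  have : 0 ≤ (4 * ε)⁻¹ * (2 * ε * Q - μ * W) ^ 2 := by positivity
  linarith

/-- With the weight λ/√Z the trace inequality at t = Z produces exactly λq₀ and (λ/Z)q₁; the factor
49 is 7², from λ ≤ 7Z. -/
theorem boundary_pressure_le {β c₁ Z lam q₀ q₁ m Qb : ℝ} (hβ : 0 < β)
    (hZ : 1 ≤ Z) (hlam : 0 < lam) (hlamZ : lam ≤ 7 * Z) (hq₁0 : 0 ≤ q₁)
    (hq₁ : q₁ ≤ c₁ * m) (hQ : Qb ^ 2 ≤ (β + Z) * q₀ ^ 2 + Z⁻¹ * q₁ ^ 2) :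
    (lam / Real.sqrt Z * Qb) ^ 2 ≤ ((β + 1) + 49 * c₁ ^ 2) * ((lam * q₀) ^ 2 + m ^ 2) := by
  have hZ0 : 0 < Z := by linarith
  have h1 : lam / Z ≤ 7 := by rw [div_le_iff₀ hZ0]; linarith
  have hβZ : β ≤ β * Z := le_mul_of_one_le_right hβ.le hZ
  calc (lam / Real.sqrt Z * Qb) ^ 2 = lam ^ 2 / Z * Qb ^ 2 := by
        rw [mul_pow, div_pow, Real.sq_sqrt hZ0.le]
    _ ≤ lam ^ 2 / Z * ((β + Z) * q₀ ^ 2 + Z⁻¹ * q₁ ^ 2) := by gcongr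
    _ ≤ lam ^ 2 / Z * ((β * Z + Z) * q₀ ^ 2 + Z⁻¹ * q₁ ^ 2) := by gcongr
    _ = (β + 1) * (lam * q₀) ^ 2 + (lam / Z) ^ 2 * q₁ ^ 2 := by field_simp
    _ ≤ (β + 1) * (lam * q₀) ^ 2 + 7 ^ 2 * (c₁ * m) ^ 2 := by gcongr
    _ = (β + 1) * (lam * q₀) ^ 2 + 49 * c₁ ^ 2 * m ^ 2 := by ring
    _ ≤ _ := by
        have h2 : 0 ≤ (β + 1) * m ^ 2 := by positivity
        have h3 : 0 ≤ 49 * c₁ ^ 2 * (lam * q₀) ^ 2 := by positivity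
        nlinarith

/-- The reciprocal weight √Z/λ is used for the traces of W'. Taking the trace parameter as ρZ makes
the coefficient of (λq₀)² of order 1/ρ, hence as small as desired. -/
theorem boundary_velocity_le {β c₂ μ ρ Z lam q₀ m W₀ W₁ W₂ : ℝ} (hβ : 0 < β) (hμ : 0 < μ)
    (hρ : 0 < ρ) (hZ : 1 ≤ Z) (hlam : 0 < lam) (hW₁0 : 0 ≤ W₁)
    (hW₂0 : 0 ≤ W₂) (hW₁ : Z * W₁ ≤ lam * (2 * m))
    (hW₂ : μ * W₂ ≤ lam * (lam * q₀ + c₂ * m))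
    (hW : W₀ ^ 2 ≤ (β + ρ * Z) * W₁ ^ 2 + (ρ * Z)⁻¹ * W₂ ^ 2) :
    (Real.sqrt Z / lam * W₀) ^ 2 ≤ 4 * (β + ρ) * m ^ 2 +
      2 / (ρ * μ ^ 2) * ((lam * q₀) ^ 2 + c₂ ^ 2 * m ^ 2) := by
  have hZ0 : 0 < Z := by linarith
  have hβZ : β ≤ β * Z := le_mul_of_one_le_right hβ.le hZ
  have e1 : Z * W₁ / lam ≤ 2 * m := by rw [div_le_iff₀ hlam]; linarith
  have e2 : W₂ / lam ≤ (lam * q₀ + c₂ * m) / μ := by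
    rw [div_le_div_iff₀ hlam hμ]; linarith
  calc (Real.sqrt Z / lam * W₀) ^ 2 = Z / lam ^ 2 * W₀ ^ 2 := by
        rw [mul_pow, div_pow, Real.sq_sqrt hZ0.le]
    _ ≤ Z / lam ^ 2 * ((β + ρ * Z) * W₁ ^ 2 + (ρ * Z)⁻¹ * W₂ ^ 2) := by gcongr
    _ ≤ Z / lam ^ 2 * ((β * Z + ρ * Z) * W₁ ^ 2 + (ρ * Z)⁻¹ * W₂ ^ 2) := by gcongr
    _ = (β + ρ) * (Z * W₁ / lam) ^ 2 + ρ⁻¹ * (W₂ / lam) ^ 2 := by field_simp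
    _ ≤ (β + ρ) * (2 * m) ^ 2 + ρ⁻¹ * ((lam * q₀ + c₂ * m) / μ) ^ 2 := by
        have : 0 ≤ Z * W₁ / lam := by positivity
        have : 0 ≤ W₂ / lam := by positivity
        gcongr
    _ = 4 * (β + ρ) * m ^ 2 + 1 / (ρ * μ ^ 2) * (lam * q₀ + c₂ * m) ^ 2 := by
        field_simp; ring
    _ ≤ 4 * (β + ρ) * m ^ 2 + 1 / (ρ * μ ^ 2) * (2 * ((lam * q₀) ^ 2 + c₂ ^ 2 * m ^ 2)) := by
        have : (lam * q₀ + c₂ * m) ^ 2 ≤ 2 * ((lam * q₀) ^ 2 + c₂ ^ 2 * m ^ 2) := by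
          nlinarith [sq_nonneg (lam * q₀ - c₂ * m)]
        gcongr
    _ = _ := by ring

/-- The right-hand bounds return X four times with the factor 1/8, that is one half of X in all. -/
theorem le_of_half_absorbed {X M A B C D E t₁ t₂ t₃ t₄ : ℝ} (h : X ≤ t₁ + (t₂ + t₃ + t₄))
    (h₁ : t₁ ≤ 1 / 8 * X + A) (h₂ : t₂ ≤ B) (h₃ : t₃ ≤ 1 / 8 * (X + M) + C)
    (h₄ : t₄ ≤ 1 / 8 * (X + M) + (D + 1 / 8 * (X + E))) :
    X ≤ 2 * (A + B + 2 * (1 / 8) * M + C + D + 1 / 8 * E) := by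
  linarith

theorem weighted_sq_identity {C₁ ρ μ : ℝ} (hC₁ : 0 < C₁) (hμ : 0 < μ)
    (hρ : ρ = 32 * C₁) (β c x m : ℝ) : 2 * μ ^ 2 * C₁ * (4 * (β + ρ) * m ^ 2 +
      2 / (ρ * μ ^ 2) * (x ^ 2 + c ^ 2 * m ^ 2)) =
      2 * μ ^ 2 * C₁ * (4 * (β + ρ)) * m ^ 2 + 1 / 8 * (x ^ 2 + c ^ 2 * m ^ 2) := by
  have h : 2 * μ ^ 2 * C₁ * (2 / (ρ * μ ^ 2)) = 1 / 8 := by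
    rw [hρ]; field_simp; norm_num
  rw [mul_add, ← mul_assoc _ (2 / _), h]; ring

theorem mul_le_weighted_sq_of_le {lam c q₀ m G : ℝ} (hq₀ : 0 ≤ q₀) (hG : G ≤ lam * (c * m)) :
    q₀ * G ≤ 1 / 8 * (lam * q₀) ^ 2 + 2 * c ^ 2 * m ^ 2 := by
  calc q₀ * G ≤ q₀ * (lam * (c * m)) := mul_le_mul_of_nonneg_left hG hq₀
    _ = (lam * q₀) * (c * m) := by ring
    _ ≤ _ := by nlinarith [sq_nonneg (lam * q₀ - 4 * (c * m))]

theorem pressure_absorb {β μ c₁ c₂ : ℝ} (hβ : 0 < β) (hμ : 0 < μ) (hc₁ : 0 ≤ c₁) (_hc₂ : 0 ≤ c₂) :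
    ∃ C : ℝ, 0 ≤ C ∧ ∀ {Z lam q₀ q₁ m G W₁ W₂ Qb Q₀ Wb W₀ : ℝ}, 1 ≤ Z → 0 < lam → lam ≤ 7 * Z →
      0 ≤ q₀ → 0 ≤ q₁ → 0 ≤ m → 0 ≤ W₁ → 0 ≤ W₂ → 0 ≤ Wb →
      q₁ ≤ c₁ * m → G ≤ lam * (c₂ * m) → Z * W₁ ≤ lam * (2 * m) →
      μ * W₂ ≤ lam * (lam * q₀ + c₂ * m) →
      Qb ^ 2 ≤ (β + Z) * q₀ ^ 2 + Z⁻¹ * q₁ ^ 2 → Q₀ ^ 2 ≤ (β + Z) * q₀ ^ 2 + Z⁻¹ * q₁ ^ 2 →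
      Real.sqrt Z * Wb ≤ lam * (2 * m) →
      (∀ t : ℝ, 0 < t → W₀ ^ 2 ≤ (β + t) * W₁ ^ 2 + t⁻¹ * W₂ ^ 2) →
      (lam * q₀) ^ 2 ≤ q₀ * G + μ * (q₁ * W₁ + Qb * Wb + Q₀ * W₀) → lam * q₀ ≤ C * m := by
  set C₁ : ℝ := (β + 1) + 49 * c₁ ^ 2 with hC₁
  have hC₁0 : 0 < C₁ := by positivity
  -- This ρ makes 2μ²C₁ · 2/(ρμ²) equal to 1/8, the share of (λq₀)² allotted to the bottom trace of
  -- W'.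
  set ρ : ℝ := 32 * C₁ with hρ
  have hρ0 : 0 < ρ := by positivity
  -- K collects the coefficients of m² that are left once half of (λq₀)² has been absorbed; hence
  -- the constant √(2K).
  set K : ℝ := 2 * c₂ ^ 2 + 14 * μ * c₁ + 2 * (1 / 8) + 2 * μ ^ 2 * C₁ * 4 +
    2 * μ ^ 2 * C₁ * (4 * (β + ρ)) + 1 / 8 * c₂ ^ 2 with hK
  have hK0 : 0 ≤ K := by positivity
  refine ⟨Real.sqrt (2 * K), Real.sqrt_nonneg _, ?_⟩
  intro Z lam q₀ q₁ m G W₁ W₂ Qb Q₀ Wb W₀ hZ hlam hlamZ hq₀ hq₁0 hm hW₁0 hW₂0 hWb0 hq₁ hG hW₁ hW₂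
    hQb hQ₀ hWb hW₀ hmain
  have hZ0 : 0 < Z := by linarith
  have hsZ : 0 < Real.sqrt Z := Real.sqrt_pos.2 hZ0
  have hn : ∀ x m : ℝ, 2 * μ ^ 2 * C₁ * (4 * (β + ρ) * m ^ 2 +
      2 / (ρ * μ ^ 2) * (x ^ 2 + c₂ ^ 2 * m ^ 2)) =
      2 * μ ^ 2 * C₁ * (4 * (β + ρ)) * m ^ 2 + 1 / 8 * (x ^ 2 + c₂ ^ 2 * m ^ 2) :=
    fun x m => weighted_sq_identity hC₁0 hμ hρ β c₂ x m
  clear_value K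
  clear_value ρ
  clear_value C₁
  refine le_of_sq_le_sq ?_ (by positivity)
  rw [mul_pow (Real.sqrt _), Real.sq_sqrt (by positivity)]
  set x := lam * q₀ with hx
  have b1 := boundary_pressure_le hβ hZ hlam hlamZ hq₁0 hq₁ hQb
  have b2 := boundary_pressure_le hβ hZ hlam hlamZ hq₁0 hq₁ hQ₀
  have b3 := boundary_velocity_le (c₂ := c₂) (q₀ := q₀) hβ hμ hρ0 hZ hlam hW₁0 hW₂0 hW₁ hW₂
    (hW₀ (ρ * Z) (by positivity))
  rw [← hC₁, ← hx] at b1 b2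
  rw [← hx] at b3
  clear_value x
  have b4 : (Real.sqrt Z / lam * Wb) ^ 2 ≤ 4 * m ^ 2 := by
    have : Real.sqrt Z / lam * Wb ≤ 2 * m := by
      rw [div_mul_eq_mul_div, div_le_iff₀ hlam]; linarith
    calc _ ≤ (2 * m) ^ 2 := pow_le_pow_left₀ (by positivity) this 2
      _ = _ := by ring
  have e : ∀ A B : ℝ, (lam / Real.sqrt Z * A) * (Real.sqrt Z / lam * B) = A * B := by
    intro A B; field_simp
  -- The weighted trace of Q is bounded by C₁((λq₀)² + m²), so Young's inequality with this ε
  -- returns one eighth.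
  have hε : (0 : ℝ) < 1 / (8 * C₁) := by positivity
  have m1 := mul_le_weighted_sq (μ := μ) (Q := lam / Real.sqrt Z * Qb)
    (W := Real.sqrt Z / lam * Wb) hε
  have m2 := mul_le_weighted_sq (μ := μ) (Q := lam / Real.sqrt Z * Q₀)
    (W := Real.sqrt Z / lam * W₀) hε
  rw [e] at m1 m2
  have e1 : μ ^ 2 / (4 * (1 / (8 * C₁))) = 2 * μ ^ 2 * C₁ := by field_simp; ring
  rw [e1] at m1 m2
  have e2 : ∀ A : ℝ, A ≤ C₁ * (x ^ 2 + m ^ 2) → 1 / (8 * C₁) * A ≤ 1 / 8 * (x ^ 2 + m ^ 2) := by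
    intro A hA
    calc _ ≤ 1 / (8 * C₁) * (C₁ * (x ^ 2 + m ^ 2)) := by gcongr
      _ = _ := by field_simp
  have n1 : μ * (Qb * Wb) ≤ 1 / 8 * (x ^ 2 + m ^ 2) + 2 * μ ^ 2 * C₁ * (4 * m ^ 2) :=
    m1.trans (add_le_add (e2 _ b1) (by gcongr))
  have n2 : μ * (Q₀ * W₀) ≤ 1 / 8 * (x ^ 2 + m ^ 2) + (2 * μ ^ 2 * C₁ * (4 * (β + ρ)) * m ^ 2 +
      1 / 8 * (x ^ 2 + c₂ ^ 2 * m ^ 2)) := by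
    refine m2.trans (add_le_add (e2 _ b2) ?_)
    calc _ ≤ 2 * μ ^ 2 * C₁ * (4 * (β + ρ) * m ^ 2 +
          2 / (ρ * μ ^ 2) * (x ^ 2 + c₂ ^ 2 * m ^ 2)) := by gcongr
      _ = _ := hn x m
  have n3 : μ * (q₁ * W₁) ≤ 14 * μ * c₁ * m ^ 2 := by
    have h1 : W₁ ≤ 14 * m := by
      have h2 : Z * W₁ ≤ Z * (14 * m) := by
        calc Z * W₁ ≤ lam * (2 * m) := hW₁
          _ ≤ 7 * Z * (2 * m) := by gcongr
          _ = _ := by ring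
      exact le_of_mul_le_mul_left h2 hZ0
    calc _ ≤ μ * ((c₁ * m) * (14 * m)) := by gcongr
      _ = _ := by ring
  have n4 := mul_le_weighted_sq_of_le hq₀ hG
  rw [← hx] at n4
  refine (le_of_half_absorbed (hmain.trans_eq ?_) n4 n3 n1 n2).trans_eq ?_
  · rw [mul_add, mul_add]
  · rw [hK]; ring

end Absorb

/-! ### The pressure bound, the energy identity and the closing of the Stokes estimate. -/

namespace StokesConfig

variable {b μ : ℝ} {s : ℕ} (x : StokesConfig b μ s)

/-- At the top the derivatives of the tangential velocity are data, so this trace needs no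
absorption. -/
theorem sqrt_Z_mul_norm_trTop_W_le :
    Real.sqrt x.Z * ‖trTop b s (HI.deriv b (s + 1) x.W)‖ ≤ x.lam * (2 * x.m) := by
  have h0 : trTop b s (HI.deriv b (s + 1) x.W) =
      -(x.d 0 * trTop b s (HI.deriv b (s + 1) (x.v 0)) +
        x.d 1 * trTop b s (HI.deriv b (s + 1) (x.v 1))) := by
    rw [W]; simp only [map_neg, map_add, map_smul, smul_eq_mul]
  have h : ∀ j : Fin 2, Real.sqrt x.Z *
      ‖x.d j * trTop b s (HI.deriv b (s + 1) (x.v j.castSucc))‖ ≤ x.lam * x.m := by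
    intro j
    rw [norm_mul]
    calc _ = ‖x.d j‖ *
          (Real.sqrt x.Z * ‖trTop b s (HI.deriv b (s + 1) (x.v j.castSucc))‖) := by ring
      _ ≤ _ := mul_le_mul (x.norm_d_le j) ((x.k_le j).trans x.D_le_m) (by positivity) x.lam_pos.le
  rw [h0, norm_neg]
  calc _ ≤ Real.sqrt x.Z * (‖x.d 0 * trTop b s (HI.deriv b (s + 1) (x.v 0))‖ +
        ‖x.d 1 * trTop b s (HI.deriv b (s + 1) (x.v 1))‖) := by
        gcongr; exact norm_add_le _ _
    _ ≤ x.lam * x.m + x.lam * x.m := by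
        rw [mul_add]; exact add_le_add (h 0) (h 1)
    _ = _ := by ring

/-- W'(b) is given by the data, but no boundary condition prescribes W'(0). Its trace is therefore
estimated by W'' with a small coefficient, and W'' by λ²Q, which is absorbed. -/
theorem dominated_q_zero (hb : 0 < b) (hμ : 0 < μ) :
    Dominated (fun x : StokesConfig b μ s => x.lam * x.q 0) (fun x => x.m) := by
  obtain ⟨C, hC, h⟩ := pressure_absorb (β := b⁻¹) (μ := μ) (c₁ := 1 + 22 * μ) (c₂ := 2 + 14 * μ)
    (inv_pos.2 hb) hμ (by positivity) (by positivity)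
  refine ⟨C, hC, fun x => h x.one_le_Z x.lam_pos x.lam_le (x.q_nonneg 0) (x.q_nonneg 1) x.m_nonneg
    (norm_nonneg _) (norm_nonneg _) (norm_nonneg _) (x.q_one_le hμ) (x.norm_G_le hμ)
    x.norm_der_one_W_le (x.norm_der_two_W_le hμ) (norm_trTop_sq_le hb x.Q x.Z_pos)
    (norm_trBot_sq_le hb x.Q x.Z_pos) x.sqrt_Z_mul_norm_trTop_W_le ?_ (x.pairing_le hb hμ)⟩
  intro t ht
  have := norm_trBot_sq_le hb (HI.deriv b (s + 1) x.W) ht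
  rwa [HI.der_deriv (by omega), HI.der_deriv (by omega)] at this

theorem dominated_q_one (hμ : 0 < μ) :
    Dominated (fun x : StokesConfig b μ s => x.q 1) (fun x => x.m) :=
  ⟨1 + 22 * μ, by positivity, fun x => x.q_one_le hμ⟩

/-- Once λQ is controlled, the tangential momentum equations can be solved for the second
derivatives. The normal component was obtained from the divergence. -/
theorem dominated_a_two (hb : 0 < b) (hμ : 0 < μ) (i : Fin 3) :
    Dominated (fun x : StokesConfig b μ s => x.a 2 i) (fun x => x.m) := by
  have htan : ∀ j : Fin 2, Dominated (fun x : StokesConfig b μ s => x.a 2 j.castSucc)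
      (fun x => x.m) := by
    intro j
    have h : ∀ x : StokesConfig b μ s, x.a 2 j.castSucc ≤
        μ⁻¹ * (x.lam * x.q 0 + x.m) + 7 * x.m := by
      intro x
      have h1 : der b (s + 2) 2 (x.v j.castSucc) =
          (μ : ℂ)⁻¹ • (x.d j • der b (s + 1) 0 x.Q - x.F j.castSucc) +
          ((x.lam : ℂ) ^ 2) • der b (s + 2) 0 (x.v j.castSucc) := by
        have hμ' : (μ : ℂ) ≠ 0 := Complex.ofReal_ne_zero.2 hμ.ne'
        rw [x.eq_tan, sub_sub_cancel, smul_smul, inv_mul_cancel₀ hμ', one_smul, sub_add_cancel]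
      rw [a, h1]
      refine (norm_add_le _ _).trans (add_le_add ?_ ((x.norm_lam_sq_smul_le _).trans ?_))
      · rw [norm_smul, norm_inv, Complex.norm_real, Real.norm_of_nonneg hμ.le]
        refine mul_le_mul_of_nonneg_left ((norm_sub_le _ _).trans (add_le_add ?_ ?_))
          (inv_nonneg.2 hμ.le)
        · rw [norm_smul]
          exact mul_le_mul_of_nonneg_right (x.norm_d_le j) (norm_nonneg _)
        · exact (x.F_le _).trans x.D_le_m
      · linarith [x.N_le_m]
    refine Dominated.of_le_of h (Dominated.add (Dominated.const_mul (inv_nonneg.2 hμ.le)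
      (Dominated.add (dominated_q_zero hb hμ) (Dominated.of_le fun _ => le_rfl)))
      (Dominated.const_mul (by norm_num) (Dominated.of_le fun _ => le_rfl)))
  fin_cases i
  · exact htan 0
  · exact htan 1
  · refine ⟨14, by norm_num, fun x => x.a_two_nor_le.trans ?_⟩
    have : x.m = x.D + x.N := rfl
    linarith [x.D_nonneg]

/-- The boundary term that couples the pressure to the normal flux. -/
def flux : ℂ := starRingEnd ℂ (trTop b (s + 1) (x.v 2)) * trTop b s x.Q -
  inner ℂ x.g₀ (der b (s + 1) 0 x.Q)

/-- The squared energy. -/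
def E : ℝ := ∑ i, (x.a 1 i ^ 2 + x.lam ^ 2 * x.a 0 i ^ 2)

theorem inner_v_der_two (hb : 0 < b) (i : Fin 3) :
    inner ℂ (der b (s + 2) 0 (x.v i)) (der b (s + 2) 2 (x.v i)) =
      starRingEnd ℂ (trTop b (s + 1) (x.v i)) * trTop b s (HI.deriv b (s + 1) (x.v i)) -
        ((x.a 1 i ^ 2 : ℝ) : ℂ) := by
  have key := inner_der_add hb (x.v i) (HI.deriv b (s + 1) (x.v i))
  rw [HI.der_deriv (by omega), HI.der_deriv (by omega), x.bot, map_zero, zero_mul, sub_zero] at key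
  rw [← key, inner_self_eq_norm_sq_to_K, a]
  push_cast
  simp

theorem inner_v_smul (i : Fin 3) : inner ℂ (der b (s + 2) 0 (x.v i))
    (((x.lam : ℂ) ^ 2) • der b (s + 2) 0 (x.v i)) = ((x.lam ^ 2 * x.a 0 i ^ 2 : ℝ) : ℂ) := by
  rw [inner_smul_right, inner_self_eq_norm_sq_to_K, a]
  push_cast
  simp

/-- Test the momentum equations with the velocity. Since dⱼ is purely imaginary, the pressure terms
combine through the divergence equation into `flux`, and the no-slip condition removes all traces at
the bottom. -/
theorem energy_identity (hb : 0 < b) :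
    ((μ * x.E : ℝ) : ℂ) = (∑ i, inner ℂ (der b (s + 2) 0 (x.v i)) (x.F i)) - x.flux +
      (μ : ℂ) * ∑ i, starRingEnd ℂ (trTop b (s + 1) (x.v i)) *
        trTop b s (HI.deriv b (s + 1) (x.v i)) := by
  have hQ := inner_der_add hb (x.v 2) x.Q
  rw [x.bot, map_zero, zero_mul, sub_zero] at hQ
  have hg : inner ℂ x.g₀ (der b (s + 1) 0 x.Q) =
      -(x.d 0 * inner ℂ (der b (s + 2) 0 (x.v 0)) (der b (s + 1) 0 x.Q)) -
      x.d 1 * inner ℂ (der b (s + 2) 0 (x.v 1)) (der b (s + 1) 0 x.Q) +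
      inner ℂ (der b (s + 2) 1 (x.v 2)) (der b (s + 1) 0 x.Q) := by
    rw [x.eq_div, inner_add_left, inner_add_left, inner_smul_left, inner_smul_left, x.conj_d,
      x.conj_d]
    ring
  have e0 := x.eq_tan 0
  have e1 := x.eq_tan 1
  simp only [Fin.castSucc_zero, Fin.castSucc_one] at e0 e1
  rw [E, flux, Fin.sum_univ_three, Fin.sum_univ_three, Fin.sum_univ_three, hg, e0, e1, x.eq_nor,
    inner_sub_right, inner_sub_right, inner_sub_right, inner_smul_right, inner_smul_right,
    inner_smul_right, inner_smul_right, inner_smul_right, inner_sub_right, inner_sub_right,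
    inner_sub_right, inner_v_smul, inner_v_smul, inner_v_smul, x.inner_v_der_two hb,
    x.inner_v_der_two hb, x.inner_v_der_two hb, ← hQ]
  push_cast
  ring

theorem _root_.CurlLayer.sqrt_mul_norm_trTop_le {k : ℕ} (hb : 0 < b) {Z : ℝ} (hZ : 1 ≤ Z)
    (y : HI b (k + 1) ℂ) : Real.sqrt Z * ‖trTop b k y‖ ≤
      (b⁻¹ + 1) * (Z * ‖der b (k + 1) 0 y‖ + ‖der b (k + 1) 1 y‖) := by
  have hZ0 : 0 < Z := by linarith
  have hβ : 0 < b⁻¹ := inv_pos.2 hb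
  have hβZ : b⁻¹ ≤ b⁻¹ * Z := le_mul_of_one_le_right hβ.le hZ
  refine le_of_sq_le_sq ?_ (by positivity)
  have h := norm_trTop_sq_le hb y hZ0
  set p := ‖der b (k + 1) 0 y‖ with hp
  set q := ‖der b (k + 1) 1 y‖ with hq
  have hp0 : 0 ≤ p := norm_nonneg _
  have hq0 : 0 ≤ q := norm_nonneg _
  calc (Real.sqrt Z * ‖trTop b k y‖) ^ 2 = Z * ‖trTop b k y‖ ^ 2 := by
        rw [mul_pow, Real.sq_sqrt hZ0.le]
    _ ≤ Z * ((b⁻¹ + Z) * p ^ 2 + Z⁻¹ * q ^ 2) := by gcongr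
    _ ≤ Z * ((b⁻¹ * Z + Z) * p ^ 2 + Z⁻¹ * q ^ 2) := by gcongr
    _ = (b⁻¹ + 1) * (Z * p) ^ 2 + q ^ 2 := by field_simp
    _ ≤ (b⁻¹ + 1) ^ 2 * (Z * p) ^ 2 + (b⁻¹ + 1) ^ 2 * q ^ 2 := by
        have h1 : b⁻¹ + 1 ≤ (b⁻¹ + 1) ^ 2 := by nlinarith
        have h2 : 1 ≤ (b⁻¹ + 1) ^ 2 := by nlinarith
        exact add_le_add (mul_le_mul_of_nonneg_right h1 (sq_nonneg _))
          (le_mul_of_one_le_left (sq_nonneg _) h2)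
    _ ≤ _ := by
        have h3 : 0 ≤ (b⁻¹ + 1) ^ 2 * (2 * (Z * p) * q) := by positivity
        nlinarith

theorem Z_mul_q_zero_add_q_one_le (h : 1 ≤ x.lam) :
    x.Z * x.q 0 + x.q 1 ≤ 2 * (x.lam * x.q 0 + x.q 1) := by
  have h1 : x.Z * x.q 0 ≤ 2 * x.lam * x.q 0 :=
    mul_le_mul_of_nonneg_right (by linarith [x.Z_le]) (x.q_nonneg 0)
  linarith [x.q_nonneg 1]

/-- Subtracting from Q its top value Q(b) groups the flux into (v₃(b) - ∫g₀) and Q(b), plus g₀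
against Q - Q(b). The first factor is at most λD by `flux_le`, and Q - Q(b) is controlled by Q'
through Poincaré's inequality, so no bound on Q without a factor λ is required. -/
theorem flux_eq : x.flux =
    starRingEnd ℂ (trTop b (s + 1) (x.v 2) - testI b 1 x.g₀) * trTop b s x.Q -
      inner ℂ x.g₀ (der b (s + 1) 0 (x.Q - HI.const b (s + 1) ℂ (trTop b s x.Q))) := by
  have h : inner ℂ x.g₀ (constI b ℂ (trTop b s x.Q)) =
      starRingEnd ℂ (testI b 1 x.g₀) * trTop b s x.Q := by
    rw [L2.inner_def, testI_apply, ← integral_conj, ← integral_mul_const]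
    apply integral_congr_ae
    filter_upwards [coeFn_constI b (trTop b s x.Q)] with y hy
    rw [hy, RCLike.inner_apply']
    simp
  rw [map_sub (der b (s + 1) 0), HI.der_const_zero, inner_sub_right, h, flux, map_sub]
  ring

theorem Z_sq_mul_norm_flux_le (hb : 0 < b) : x.Z ^ 2 * ‖x.flux‖ ≤
    (8 * (b⁻¹ + 1) + 8 * b + 2) * (x.lam * x.q 0 + x.q 1) * x.D := by
  have hβ : 0 < b⁻¹ := inv_pos.2 hb
  have hD := x.D_nonneg
  have hZ := x.Z_pos
  have hlam := x.lam_pos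
  have hq0 := x.q_nonneg 0
  have hq1 := x.q_nonneg 1
  have hlq := mul_nonneg hlam.le hq0
  set P := x.lam * x.q 0 + x.q 1 with hP
  have hP0 : 0 ≤ P := by positivity
  have htr := sqrt_mul_norm_trTop_le hb x.one_le_Z x.Q
  change _ ≤ (b⁻¹ + 1) * (x.Z * x.q 0 + x.q 1) at htr
  -- For λ ≥ 1 one has Z ≤ 2λ, so ZQ is controlled and Cauchy–Schwarz suffices. For λ ≤ 1 the
  -- weights Z are bounded by 2 and the rewritten flux is used.
  rcases le_total 1 x.lam with h | h
  · have hZP := x.Z_mul_q_zero_add_q_one_le h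
    have h1 : ‖x.flux‖ ≤ ‖trTop b (s + 1) (x.v 2)‖ * ‖trTop b s x.Q‖ + ‖x.g₀‖ * x.q 0 := by
      refine (norm_sub_le _ _).trans (add_le_add ?_ (norm_inner_le_norm _ _))
      rw [norm_mul, RCLike.norm_conj]
    calc x.Z ^ 2 * ‖x.flux‖ ≤ x.Z ^ 2 *
          (‖trTop b (s + 1) (x.v 2)‖ * ‖trTop b s x.Q‖ + ‖x.g₀‖ * x.q 0) := by gcongr
      _ = x.Z * (Real.sqrt x.Z * Real.sqrt x.Z) * ‖trTop b (s + 1) (x.v 2)‖ * ‖trTop b s x.Q‖ +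
          (x.Z * ‖x.g₀‖) * (x.Z * x.q 0) := by rw [Real.mul_self_sqrt hZ.le]; ring
      _ = (x.Z * Real.sqrt x.Z * ‖trTop b (s + 1) (x.v 2)‖) * (Real.sqrt x.Z * ‖trTop b s x.Q‖) +
          (x.Z * ‖x.g₀‖) * (x.Z * x.q 0) := by ring
      _ ≤ x.D * ((b⁻¹ + 1) * (2 * P)) + x.D * (2 * P) := by
          refine add_le_add (mul_le_mul x.h_le (htr.trans ?_) (by positivity) hD)
            (mul_le_mul x.g₀_le ?_ (by positivity) hD)
          · gcongr
          · linarith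
      _ ≤ _ := by
          have : 0 ≤ b * P * x.D := by positivity
          have : 0 ≤ b⁻¹ * P * x.D := by positivity
          nlinarith [mul_nonneg hP0 hD]
  · have hZ2 : x.Z ≤ 2 := by linarith [x.Z_le]
    have h1 : x.lam * ‖trTop b s x.Q‖ ≤ (b⁻¹ + 1) * (2 * P) := by
      have h2 : ‖trTop b s x.Q‖ ≤ Real.sqrt x.Z * ‖trTop b s x.Q‖ :=
        le_mul_of_one_le_left (norm_nonneg _) (Real.one_le_sqrt.2 x.one_le_Z)
      calc _ ≤ x.lam * ((b⁻¹ + 1) * (x.Z * x.q 0 + x.q 1)) :=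
            mul_le_mul_of_nonneg_left (h2.trans htr) hlam.le
        _ = (b⁻¹ + 1) * (x.Z * (x.lam * x.q 0) + x.lam * x.q 1) := by ring
        _ ≤ (b⁻¹ + 1) * (2 * (x.lam * x.q 0) + 1 * x.q 1) := by gcongr
        _ ≤ _ := by gcongr; linarith
    have h3 : ‖der b (s + 1) 0 (x.Q - HI.const b (s + 1) ℂ (trTop b s x.Q))‖ ≤
        2 * b * x.q 1 := by
      have := norm_der_zero_le_of_trTop hb (k := s)
        (x := x.Q - HI.const b (s + 1) ℂ (trTop b s x.Q)) (by rw [map_sub, trTop_const hb, sub_self])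
      rwa [map_sub (der b (s + 1) 1), HI.der_const_succ, sub_zero] at this
    have h4 : ‖x.g₀‖ ≤ x.D :=
      (le_mul_of_one_le_left (norm_nonneg _) x.one_le_Z).trans x.g₀_le
    have h5 : ‖x.flux‖ ≤ x.D * ((b⁻¹ + 1) * (2 * P)) + x.D * (2 * b * P) := by
      rw [flux_eq]
      refine (norm_sub_le _ _).trans (add_le_add ?_ ((norm_inner_le_norm _ _).trans
        (mul_le_mul h4 (h3.trans ?_) (norm_nonneg _) hD)))
      · rw [norm_mul, RCLike.norm_conj]
        calc _ ≤ x.lam * x.D * ‖trTop b s x.Q‖ :=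
              mul_le_mul_of_nonneg_right x.flux_le (norm_nonneg _)
          _ = x.D * (x.lam * ‖trTop b s x.Q‖) := by ring
          _ ≤ _ := mul_le_mul_of_nonneg_left h1 hD
      · gcongr; linarith
    calc x.Z ^ 2 * ‖x.flux‖ ≤ 2 ^ 2 * (x.D * ((b⁻¹ + 1) * (2 * P)) + x.D * (2 * b * P)) := by
          gcongr
      _ ≤ _ := by nlinarith [mul_nonneg hP0 hD]

/-- In every term of the energy identity one factor is data of size D and its partner is bounded by
m = D + N. This includes the boundary products: the tangential stress prescribes v₁'(b) and v₂'(b),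
and the kinematic condition prescribes v₃(b). -/
theorem dominated_energy (hb : 0 < b) (hμ : 0 < μ) :
    Dominated (fun x : StokesConfig b μ s => x.Z ^ 2 * x.E) (fun x => (x.N + x.D) * x.D) := by
  have hm : (fun x : StokesConfig b μ s => (x.N + x.D) * x.D) = fun x => x.m * x.D := by
    ext x; rw [m, add_comm]
  rw [hm]
  have hself : Dominated (fun x : StokesConfig b μ s => x.m) (fun x => x.m) :=
    Dominated.of_le fun _ => le_rfl
  have hN : Dominated (fun x : StokesConfig b μ s => x.N) (fun x => x.m) :=
    Dominated.of_le fun x => x.N_le_m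
  have hD : Dominated (fun x : StokesConfig b μ s => x.D) (fun x => x.D) :=
    Dominated.of_le fun _ => le_rfl
  have h1 : ∀ i, Dominated (fun x : StokesConfig b μ s => x.Z ^ 2 * x.a 0 i) (fun x => x.m) :=
    fun i => Dominated.trans ⟨1 + b, by positivity, fun x => x.Z_sq_mul_a_zero_le hb i⟩ hN
  have h1' : ∀ i, Dominated (fun x : StokesConfig b μ s => x.Z * x.a 1 i) (fun x => x.m) :=
    fun i => Dominated.of_le_of (fun x => x.Z_mul_a_one_le i) hN
  have h2 : ∀ i, Dominated (fun x : StokesConfig b μ s =>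
      x.Z * Real.sqrt x.Z * ‖trTop b (s + 1) (x.v i)‖) (fun x => x.m) := by
    intro i
    refine Dominated.of_le_of (g := fun x => (b⁻¹ + 1) * (x.Z ^ 2 * x.a 0 i + x.Z * x.a 1 i))
      (fun x => ?_) (Dominated.const_mul (by positivity) ((h1 i).add (h1' i)))
    calc _ = x.Z * (Real.sqrt x.Z * ‖trTop b (s + 1) (x.v i)‖) := by ring
      _ ≤ x.Z * ((b⁻¹ + 1) * (x.Z * x.a 0 i + x.a 1 i)) :=
          mul_le_mul_of_nonneg_left (sqrt_mul_norm_trTop_le hb x.one_le_Z _) x.Z_pos.le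
      _ = _ := by ring
  have h3 : Dominated (fun x : StokesConfig b μ s =>
      Real.sqrt x.Z * ‖trTop b s (HI.deriv b (s + 1) (x.v 2))‖) (fun x => x.m) := by
    refine Dominated.of_le_of (g := fun x => (b⁻¹ + 1) * (x.Z * x.a 1 2 + x.a 2 2))
      (fun x => ?_) (Dominated.const_mul (by positivity) ((h1' 2).add (dominated_a_two hb hμ 2)))
    have := sqrt_mul_norm_trTop_le hb x.one_le_Z (HI.deriv b (s + 1) (x.v 2))
    rwa [HI.der_deriv (by omega), HI.der_deriv (by omega)] at this
  have h4 : ∀ i, Dominated (fun x : StokesConfig b μ s => x.Z ^ 2 * (‖trTop b (s + 1) (x.v i)‖ *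
      ‖trTop b s (HI.deriv b (s + 1) (x.v i))‖)) (fun x => x.m * x.D) := by
    -- Z² splits as Z^{3/2} · Z^{1/2}, the natural weights of a trace of v and of a trace of v'.
    have e : ∀ (x : StokesConfig b μ s) (A B : ℝ),
        x.Z ^ 2 * (A * B) = (x.Z * Real.sqrt x.Z * A) * (Real.sqrt x.Z * B) := by
      intro x A B
      calc _ = x.Z * x.Z * (A * B) := by ring
        _ = x.Z * (Real.sqrt x.Z * Real.sqrt x.Z) * (A * B) := by
            rw [Real.mul_self_sqrt x.Z_pos.le]
        _ = _ := by ring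
    have htan : ∀ j : Fin 2, Dominated (fun x : StokesConfig b μ s =>
        x.Z ^ 2 * (‖trTop b (s + 1) (x.v j.castSucc)‖ *
          ‖trTop b s (HI.deriv b (s + 1) (x.v j.castSucc))‖)) (fun x => x.m * x.D) := by
      intro j
      simp only [e]
      exact (h2 j.castSucc).mul (Dominated.of_le fun x => x.k_le j) (fun x => by positivity)
        (fun x => x.m_nonneg)
    intro i
    fin_cases i
    · exact htan 0
    · exact htan 1
    · simp only [e]
      have := Dominated.mul (Dominated.of_le fun x : StokesConfig b μ s => x.h_le) h3
        (fun x => by positivity) (fun x => x.D_nonneg)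
      exact this.trans (Dominated.of_le fun x => (mul_comm _ _).le)
  have h5 : Dominated (fun x : StokesConfig b μ s => x.Z ^ 2 * ‖x.flux‖) (fun x => x.m * x.D) := by
    have hPm : Dominated (fun x : StokesConfig b μ s =>
        (8 * (b⁻¹ + 1) + 8 * b + 2) * (x.lam * x.q 0 + x.q 1)) (fun x => x.m) :=
      Dominated.const_mul (by positivity) ((dominated_q_zero hb hμ).add (dominated_q_one hμ))
    exact Dominated.of_le_of (fun x => x.Z_sq_mul_norm_flux_le hb)
      (hPm.mul hD (fun x => x.D_nonneg) fun x => x.m_nonneg)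
  have h6 : ∀ i, Dominated (fun x : StokesConfig b μ s => x.Z ^ 2 * x.a 0 i * x.D)
      (fun x => x.m * x.D) := fun i => (h1 i).mul hD (fun x => x.D_nonneg) fun x => x.m_nonneg
  have hmD : ∀ x : StokesConfig b μ s, 0 ≤ x.m * x.D := fun x => mul_nonneg x.m_nonneg x.D_nonneg
  refine Dominated.of_le_of (g := fun x => μ⁻¹ * ((∑ i, x.Z ^ 2 * x.a 0 i * x.D) +
    x.Z ^ 2 * ‖x.flux‖ + μ * ∑ i, x.Z ^ 2 * (‖trTop b (s + 1) (x.v i)‖ *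
      ‖trTop b s (HI.deriv b (s + 1) (x.v i))‖))) (fun x => ?_)
    (Dominated.const_mul (by positivity) (((Dominated.sum _ (fun i _ => h6 i) hmD).add h5).add
      (Dominated.const_mul hμ.le (Dominated.sum _ (fun i _ => h4 i) hmD))))
  have hE0 : 0 ≤ x.E := Finset.sum_nonneg fun i _ =>
    add_nonneg (sq_nonneg _) (mul_nonneg (sq_nonneg _) (sq_nonneg _))
  have key := congrArg norm (x.energy_identity (μ := μ) hb)
  rw [Complex.norm_real, Real.norm_of_nonneg (mul_nonneg hμ.le hE0)] at key
  have key2 : μ * x.E ≤ (∑ i, x.a 0 i * x.D) + ‖x.flux‖ + μ * ∑ i, (‖trTop b (s + 1) (x.v i)‖ *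
      ‖trTop b s (HI.deriv b (s + 1) (x.v i))‖) := by
    rw [key]
    refine (norm_add_le _ _).trans (add_le_add ((norm_sub_le _ _).trans (add_le_add ?_ le_rfl)) ?_)
    · refine (norm_sum_le _ _).trans (Finset.sum_le_sum fun i _ => ?_)
      exact (norm_inner_le_norm _ _).trans (mul_le_mul_of_nonneg_left (x.F_le i) (norm_nonneg _))
    · rw [norm_mul, Complex.norm_real, Real.norm_of_nonneg hμ.le]
      refine mul_le_mul_of_nonneg_left ((norm_sum_le _ _).trans (Finset.sum_le_sum fun i _ => ?_))
        hμ.le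
      rw [norm_mul, RCLike.norm_conj]
  calc x.Z ^ 2 * x.E = μ⁻¹ * (x.Z ^ 2 * (μ * x.E)) := by field_simp
    _ ≤ μ⁻¹ * (x.Z ^ 2 * ((∑ i, x.a 0 i * x.D) + ‖x.flux‖ + μ * ∑ i,
        (‖trTop b (s + 1) (x.v i)‖ * ‖trTop b s (HI.deriv b (s + 1) (x.v i))‖))) := by
        gcongr
    _ = _ := by
        have e₁ : ∑ i, x.Z ^ 2 * x.a 0 i * x.D = x.Z ^ 2 * ∑ i, x.a 0 i * x.D := by
          rw [Finset.mul_sum]; simp only [mul_assoc]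
        rw [e₁, ← Finset.mul_sum]
        ring

/-- N² is at most 6Z²E, where 6 = 3 · 2 comes from three components with two squares each. With Z²E
≲ (N + D)D the quadratic inequality closes. -/
theorem dominated_N (hb : 0 < b) (hμ : 0 < μ) :
    Dominated (fun x : StokesConfig b μ s => x.N) (fun x => x.D) := by
  refine Dominated.of_sq_le_mul (fun x => x.N_nonneg) (fun x => x.D_nonneg) ?_
  refine Dominated.of_le_of (g := fun x => 6 * (x.Z ^ 2 * x.E)) (fun x => ?_)
    (Dominated.const_mul (by norm_num) (dominated_energy hb hμ))
  have h1 : (∑ i, (x.a 1 i + x.lam * x.a 0 i)) ^ 2 ≤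
      3 * ∑ i, (x.a 1 i + x.lam * x.a 0 i) ^ 2 := by
    have := sq_sum_le_card_mul_sum_sq (s := Finset.univ)
      (f := fun i => x.a 1 i + x.lam * x.a 0 i)
    simpa using this
  have h2 : ∑ i, (x.a 1 i + x.lam * x.a 0 i) ^ 2 ≤ 2 * x.E := by
    rw [E, Finset.mul_sum]
    refine Finset.sum_le_sum fun i _ => ?_
    nlinarith [sq_nonneg (x.a 1 i - x.lam * x.a 0 i)]
  calc x.N ^ 2 = x.Z ^ 2 * (∑ i, (x.a 1 i + x.lam * x.a 0 i)) ^ 2 := by rw [N, mul_pow]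
    _ ≤ x.Z ^ 2 * (3 * (2 * x.E)) := by
        gcongr
        exact h1.trans (by linarith)
    _ = _ := by ring

theorem dominated_m (hb : 0 < b) (hμ : 0 < μ) :
    Dominated (fun x : StokesConfig b μ s => x.m) (fun x => x.D) :=
  (Dominated.of_le fun _ => le_rfl).add (dominated_N hb hμ)

end StokesConfig

end

end CurlLayer

namespace CurlLayer

noncomputable section

/-! ### The system on a fiber -/

section FiberSystem

/-- The unknowns `(p, v, χ)` on a fiber, in components. -/
abbrev Unknowns (b : ℝ) (s : ℕ) : Type :=
  HI b (s + 1) ℂ × (Fin 3 → HI b (s + 2) ℂ) × (Fin 2 → ℂ)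

/-- The data `(f, g, k, h, c)` on a fiber, in components. -/
abbrev FiberData (b : ℝ) (s : ℕ) : Type :=
  (Fin 3 → HI b s ℂ) × HI b (s + 1) ℂ × (Fin 3 → ℂ) × ℂ × ℂ

variable {b : ℝ} {s : ℕ}

/-- The pressure. -/
def prP : Unknowns b s →L[ℂ] HI b (s + 1) ℂ := ContinuousLinearMap.fst ℂ _ _

/-- The `i`-th component of the velocity. -/
def prV (i : Fin 3) : Unknowns b s →L[ℂ] HI b (s + 2) ℂ :=
  (ContinuousLinearMap.proj i).comp
    ((ContinuousLinearMap.fst ℂ _ _).comp (ContinuousLinearMap.snd ℂ _ _))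

/-- The `j`-th component of `χ`. -/
def prX (j : Fin 2) : Unknowns b s →L[ℂ] ℂ :=
  (ContinuousLinearMap.proj j).comp
    ((ContinuousLinearMap.snd ℂ _ _).comp (ContinuousLinearMap.snd ℂ _ _))

@[simp] theorem prP_apply (x : Unknowns b s) : prP x = x.1 := rfl
@[simp] theorem prV_apply (i : Fin 3) (x : Unknowns b s) : prV i x = x.2.1 i := rfl
@[simp] theorem prX_apply (j : Fin 2) (x : Unknowns b s) : prX j x = x.2.2 j := rfl

/-- Assemble an operator into the space of the data from its components. -/
def assemble {E : Type*} [NormedAddCommGroup E] [NormedSpace ℂ E]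
    (f : Fin 3 → E →L[ℂ] HI b s ℂ) (g : E →L[ℂ] HI b (s + 1) ℂ) (k : Fin 3 → E →L[ℂ] ℂ)
    (h c : E →L[ℂ] ℂ) : E →L[ℂ] FiberData b s :=
  (ContinuousLinearMap.pi f).prod (g.prod ((ContinuousLinearMap.pi k).prod (h.prod c)))

@[simp] theorem assemble_apply {E : Type*} [NormedAddCommGroup E] [NormedSpace ℂ E]
    (f : Fin 3 → E →L[ℂ] HI b s ℂ) (g : E →L[ℂ] HI b (s + 1) ℂ) (k : Fin 3 → E →L[ℂ] ℂ)
    (h c : E →L[ℂ] ℂ) (x : E) :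
    assemble f g k h c x = (fun i => f i x, g x, fun i => k i x, h x, c x) := rfl

/-- The part of the system without tangential derivatives. -/
def sysZero (b γ μ : ℝ) (s : ℕ) : Unknowns b s →L[ℂ] FiberData b s :=
  assemble
    ![(γ : ℂ) • (HI.const b s ℂ).comp (prX 0) -
        (μ : ℂ) • ((HI.deriv b s).comp (HI.deriv b (s + 1))).comp (prV 0),
      (γ : ℂ) • (HI.const b s ℂ).comp (prX 1) -
        (μ : ℂ) • ((HI.deriv b s).comp (HI.deriv b (s + 1))).comp (prV 1),
      (HI.deriv b s).comp prP -
        (2 * μ : ℂ) • ((HI.deriv b s).comp (HI.deriv b (s + 1))).comp (prV 2)]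
    ((HI.deriv b (s + 1)).comp (prV 2))
    ![(μ : ℂ) • (trTop b s).comp ((HI.deriv b (s + 1)).comp (prV 0)),
      (μ : ℂ) • (trTop b s).comp ((HI.deriv b (s + 1)).comp (prV 1)),
      (2 * μ : ℂ) • (trTop b s).comp ((HI.deriv b (s + 1)).comp (prV 2)) - (trTop b s).comp prP]
    ((trTop b (s + 1)).comp (prV 2)) 0

/-- The coefficient of the symbol of `∂ⱼ`. -/
def sysOne (b κ μ : ℝ) (s : ℕ) (j : Fin 2) : Unknowns b s →L[ℂ] FiberData b s :=
  assemble
    (Pi.single j.castSucc ((HI.incl b s).comp prP -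
        (μ : ℂ) • ((HI.incl b s).comp (HI.deriv b (s + 1))).comp (prV 2)) +
      Pi.single 2 (-(μ : ℂ) • ((HI.deriv b s).comp (HI.incl b (s + 1))).comp (prV j.castSucc)))
    ((HI.incl b (s + 1)).comp (prV j.castSucc))
    (Pi.single j.castSucc ((μ : ℂ) • (trTop b (s + 1)).comp (prV 2)) +
      Pi.single 2 (-(κ : ℂ) • prX j))
    0 (if j = 0 then prX 1 else -prX 0)

/-- The coefficient of the symbol of `∂ⱼ∂ₖ`. -/
def sysTwo (b μ : ℝ) (s : ℕ) (j k : Fin 2) : Unknowns b s →L[ℂ] FiberData b s :=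
  assemble
    (-(μ : ℂ) • ((fun i => if j = k then
        ((HI.incl b s).comp (HI.incl b (s + 1))).comp (prV i) else 0) +
      Pi.single j.castSucc (((HI.incl b s).comp (HI.incl b (s + 1))).comp (prV k.castSucc))))
    0 0 0 0

/-- The system on a fiber, where `d` stands for the symbols of the tangential derivatives. -/
def fiberSys (b γ κ μ : ℝ) (s : ℕ) (d : Fin 2 → ℂ) : Unknowns b s →L[ℂ] FiberData b s :=
  sysZero b γ μ s + ∑ j, d j • sysOne b κ μ s j + ∑ j, ∑ k, (d j * d k) • sysTwo b μ s j k

/-- The divergence of the velocity. -/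
def fiberDiv (d : Fin 2 → ℂ) (x : Unknowns b s) : HI b (s + 1) ℂ :=
  d 0 • HI.incl b (s + 1) (x.2.1 0) + d 1 • HI.incl b (s + 1) (x.2.1 1) +
    HI.deriv b (s + 1) (x.2.1 2)

variable {γ κ μ : ℝ} (d : Fin 2 → ℂ) (x : Unknowns b s)

/-- Since ∇·𝔻u = Δu + ∇ div u, the divergence enters the momentum equations as a gradient. In this
form it can be moved into the pressure. -/
theorem fiberSys_tan (j : Fin 2) : (fiberSys b γ κ μ s d x).1 j.castSucc =
    (γ : ℂ) • HI.const b s ℂ (x.2.2 j) + d j • HI.incl b s x.1 -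
      (μ : ℂ) • (HI.deriv b s (HI.deriv b (s + 1) (x.2.1 j.castSucc)) +
        (d 0 * d 0 + d 1 * d 1) • HI.incl b s (HI.incl b (s + 1) (x.2.1 j.castSucc)) +
        d j • HI.incl b s (fiberDiv d x)) := by
  fin_cases j <;>
  · simp [fiberSys, sysZero, sysOne, sysTwo, Fin.sum_univ_two, fiberDiv]
    module

theorem fiberSys_nor : (fiberSys b γ κ μ s d x).1 2 =
    HI.deriv b s x.1 - (μ : ℂ) • (HI.deriv b s (HI.deriv b (s + 1) (x.2.1 2)) +
        (d 0 * d 0 + d 1 * d 1) • HI.incl b s (HI.incl b (s + 1) (x.2.1 2)) +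
        HI.deriv b s (fiberDiv d x)) := by
  simp [fiberSys, sysZero, sysOne, sysTwo, Fin.sum_univ_two, fiberDiv]
  module

theorem fiberSys_div : (fiberSys b γ κ μ s d x).2.1 = fiberDiv d x := by
  simp [fiberSys, sysZero, sysOne, sysTwo, Fin.sum_univ_two, fiberDiv]
  module

theorem fiberSys_stress_tan (j : Fin 2) : (fiberSys b γ κ μ s d x).2.2.1 j.castSucc =
    μ * (trTop b s (HI.deriv b (s + 1) (x.2.1 j.castSucc)) +
      d j * trTop b (s + 1) (x.2.1 2)) := by
  fin_cases j <;>
  · simp [fiberSys, sysZero, sysOne, sysTwo, Fin.sum_univ_two]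
    ring

theorem fiberSys_stress_nor : (fiberSys b γ κ μ s d x).2.2.1 2 =
    -trTop b s x.1 + 2 * μ * trTop b s (HI.deriv b (s + 1) (x.2.1 2)) -
      κ * (d 0 * x.2.2 0 + d 1 * x.2.2 1) := by
  simp [fiberSys, sysZero, sysOne, sysTwo, Fin.sum_univ_two]
  ring

theorem fiberSys_kin : (fiberSys b γ κ μ s d x).2.2.2.1 = trTop b (s + 1) (x.2.1 2) := by
  simp [fiberSys, sysZero, sysOne, sysTwo, Fin.sum_univ_two]

theorem fiberSys_curl : (fiberSys b γ κ μ s d x).2.2.2.2 = d 0 * x.2.2 1 - d 1 * x.2.2 0 := by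
  simp [fiberSys, sysZero, sysOne, sysTwo, Fin.sum_univ_two]
  ring

end FiberSystem

end
end CurlLayer

namespace CurlLayer

noncomputable section

/-! ### Frequencies -/

section Frequency

/-- The symbol `2πi ξⱼ` of `∂ⱼ`. -/
def dsym (ξ : Plane) (j : Fin 2) : ℂ := ((2 * Real.pi * ξ j : ℝ) : ℂ) * Complex.I

/-- The modulus `2π|ξ|`. -/
def modulus (ξ : Plane) : ℝ := 2 * Real.pi * ‖ξ‖

theorem modulus_nonneg (ξ : Plane) : 0 ≤ modulus ξ := by unfold modulus; positivity

theorem modulus_pos {ξ : Plane} (h : ξ ≠ 0) : 0 < modulus ξ := by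
  have := norm_pos_iff.2 h
  have := Real.pi_pos
  unfold modulus; positivity

theorem one_le_bracket (ξ : Plane) : 1 ≤ bracket ξ := by
  rw [bracket, Real.one_le_sqrt]; nlinarith [norm_nonneg ξ]

theorem bracket_pos (ξ : Plane) : 0 < bracket ξ := by linarith [one_le_bracket ξ]

theorem bracket_sq (ξ : Plane) : bracket ξ ^ 2 = 1 + ‖ξ‖ ^ 2 := Real.sq_sqrt (by positivity)

theorem norm_le_bracket (ξ : Plane) : ‖ξ‖ ≤ bracket ξ :=
  le_of_sq_le_sq (by rw [bracket_sq]; linarith) (bracket_pos ξ).le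

/-- The number 7 that recurs below is an upper bound of 2π. -/
theorem modulus_le (ξ : Plane) : modulus ξ ≤ 7 * bracket ξ := by
  have h1 := norm_le_bracket ξ
  have h2 := Real.pi_lt_d2
  have h3 := Real.pi_pos
  unfold modulus
  calc 2 * Real.pi * ‖ξ‖ ≤ 7 * ‖ξ‖ := by gcongr; linarith
    _ ≤ _ := by linarith

theorem norm_le_modulus (ξ : Plane) : ‖ξ‖ ≤ modulus ξ := by
  have := Real.pi_gt_three
  unfold modulus
  exact le_mul_of_one_le_left (norm_nonneg _) (by linarith)

theorem bracket_le (ξ : Plane) : bracket ξ ≤ 1 + modulus ξ := by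
  have h1 := norm_le_modulus ξ
  have h2 := norm_nonneg ξ
  refine le_of_sq_le_sq ?_ (by linarith)
  rw [bracket_sq]; nlinarith

theorem conj_dsym (ξ : Plane) (j : Fin 2) : starRingEnd ℂ (dsym ξ j) = -dsym ξ j := by
  rw [dsym, map_mul, Complex.conj_ofReal, Complex.conj_I, mul_neg]

theorem dsym_sq (ξ : Plane) :
    dsym ξ 0 * dsym ξ 0 + dsym ξ 1 * dsym ξ 1 = -(modulus ξ : ℂ) ^ 2 := by
  have h : modulus ξ ^ 2 = (2 * Real.pi * ξ 0) ^ 2 + (2 * Real.pi * ξ 1) ^ 2 := by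
    rw [modulus, mul_pow, EuclideanSpace.norm_sq_eq, Fin.sum_univ_two]
    simp only [Real.norm_eq_abs, sq_abs]; ring
  rw [← Complex.ofReal_pow, h, dsym, dsym]
  have hI := Complex.I_mul_I
  push_cast
  linear_combination ((2 * Real.pi * ξ 0 : ℂ) ^ 2 + (2 * Real.pi * ξ 1 : ℂ) ^ 2) * hI

theorem norm_dsym_le (ξ : Plane) (j : Fin 2) : ‖dsym ξ j‖ ≤ modulus ξ := by
  rw [dsym, norm_mul, Complex.norm_I, mul_one, Complex.norm_real, norm_mul,
    Real.norm_of_nonneg (by positivity), modulus]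
  exact mul_le_mul_of_nonneg_left (PiLp.norm_apply_le ξ j) (by positivity)

end Frequency

/-! ### Weighted norms on the fibers -/

section Weighted

variable {V : Type} [NormedAddCommGroup V] [InnerProductSpace ℂ V]

/-- The weighted `Hᵏ` norm `∑_{j ≤ k} Z^{k-j} ‖w⁽ʲ⁾‖`. -/
def wnorm {b : ℝ} {k : ℕ} (Z : ℝ) (w : HI b k V) : ℝ :=
  ∑ j ∈ Finset.range (k + 1), Z ^ (k - j) * ‖der b k j w‖

variable {b : ℝ} {k s : ℕ} {Z : ℝ}

theorem wnorm_nonneg (hZ : 0 ≤ Z) (w : HI b k V) : 0 ≤ wnorm Z w :=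
  Finset.sum_nonneg fun _ _ => by positivity

theorem le_wnorm (hZ : 0 ≤ Z) (w : HI b k V) {j : ℕ} (hj : j ≤ k) :
    Z ^ (k - j) * ‖der b k j w‖ ≤ wnorm Z w :=
  Finset.single_le_sum (f := fun j => Z ^ (k - j) * ‖der b k j w‖)
    (fun _ _ => by positivity) (Finset.mem_range.2 (by omega))

theorem wnorm_add_le (hZ : 0 ≤ Z) (w w' : HI b k V) : wnorm Z (w + w') ≤ wnorm Z w + wnorm Z w' := by
  rw [wnorm, wnorm, wnorm, ← Finset.sum_add_distrib]
  refine Finset.sum_le_sum fun j _ => ?_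
  rw [← mul_add, map_add]
  exact mul_le_mul_of_nonneg_left (norm_add_le _ _) (by positivity)

theorem wnorm_smul (c : ℂ) (w : HI b k V) : wnorm Z (c • w) = ‖c‖ * wnorm Z w := by
  rw [wnorm, wnorm, Finset.mul_sum]
  refine Finset.sum_congr rfl fun j _ => ?_
  rw [map_smul, norm_smul]; ring

theorem wnorm_incl_le (hZ : 0 ≤ Z) (w : HI b (k + 1) V) :
    Z * wnorm Z (HI.incl b k w) ≤ wnorm Z w := by
  rw [wnorm, wnorm, Finset.mul_sum, Finset.sum_range_succ _ (k + 1)]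
  refine le_add_of_le_of_nonneg (Finset.sum_le_sum fun j hj => ?_) (by positivity)
  have hj' : j ≤ k := by have := Finset.mem_range.1 hj; omega
  rw [HI.der_incl hj', show k + 1 - j = (k - j) + 1 by omega, pow_succ]
  exact le_of_eq (by ring)

theorem wnorm_deriv_le (hZ : 0 ≤ Z) (w : HI b (k + 1) V) :
    wnorm Z (HI.deriv b k w) ≤ wnorm Z w := by
  rw [wnorm, wnorm, Finset.sum_range_succ' _ (k + 1)]
  refine le_add_of_le_of_nonneg (Finset.sum_le_sum fun j hj => ?_) (by positivity)
  have hj' : j ≤ k := by have := Finset.mem_range.1 hj; omega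
  rw [HI.der_deriv hj', show k + 1 - (j + 1) = k - j by omega]

/-- The weighted norm of the unknowns. -/
def normX (Z : ℝ) (x : Unknowns b s) : ℝ :=
  wnorm Z x.1 + ∑ i, wnorm Z (x.2.1 i) + Real.sqrt Z * Z ^ (s + 1) * ∑ j, ‖x.2.2 j‖

/-- The weighted norm of the data. -/
def normY (Z lam : ℝ) (y : FiberData b s) : ℝ :=
  ∑ i, wnorm Z (y.1 i) + wnorm Z y.2.1 + Real.sqrt Z * Z ^ s * ∑ i, ‖y.2.2.1 i‖ +
    Real.sqrt Z * Z ^ (s + 1) * (‖y.2.2.2.1‖ + ‖y.2.2.2.2‖ / lam) +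
    Z ^ s * (‖y.2.2.2.1 - testI b 1 (der b (s + 1) 0 y.2.1)‖ / lam)

theorem normY_terms {lam : ℝ} (hZ : 0 ≤ Z) (hlam : 0 ≤ lam) (y : FiberData b s) :
    (∀ i, wnorm Z (y.1 i) ≤ normY Z lam y) ∧ wnorm Z y.2.1 ≤ normY Z lam y ∧
      (∀ i, Real.sqrt Z * Z ^ s * ‖y.2.2.1 i‖ ≤ normY Z lam y) ∧
      Real.sqrt Z * Z ^ (s + 1) * ‖y.2.2.2.1‖ ≤ normY Z lam y ∧
      Real.sqrt Z * Z ^ (s + 1) * (‖y.2.2.2.2‖ / lam) ≤ normY Z lam y ∧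
      Z ^ s * (‖y.2.2.2.1 - testI b 1 (der b (s + 1) 0 y.2.1)‖ / lam) ≤ normY Z lam y ∧
      0 ≤ normY Z lam y := by
  have h1 : ∀ i, 0 ≤ wnorm Z (y.1 i) := fun i => wnorm_nonneg hZ _
  have h1' := Finset.sum_nonneg fun i (_ : i ∈ Finset.univ) => h1 i
  have h2 := wnorm_nonneg hZ y.2.1
  have h3 : 0 ≤ Real.sqrt Z * Z ^ s * ∑ i, ‖y.2.2.1 i‖ := by positivity
  have h4 : 0 ≤ Real.sqrt Z * Z ^ (s + 1) * ‖y.2.2.2.1‖ := by positivity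
  have h5 : 0 ≤ Real.sqrt Z * Z ^ (s + 1) * (‖y.2.2.2.2‖ / lam) := by positivity
  have h6 : 0 ≤ Z ^ s * (‖y.2.2.2.1 - testI b 1 (der b (s + 1) 0 y.2.1)‖ / lam) := by positivity
  have h7 : ∀ i, Real.sqrt Z * Z ^ s * ‖y.2.2.1 i‖ ≤
      Real.sqrt Z * Z ^ s * ∑ i, ‖y.2.2.1 i‖ := fun i =>
    mul_le_mul_of_nonneg_left (Finset.single_le_sum (f := fun i => ‖y.2.2.1 i‖)
      (fun _ _ => norm_nonneg _) (Finset.mem_univ i)) (by positivity)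
  have h8 : ∀ i, wnorm Z (y.1 i) ≤ ∑ i, wnorm Z (y.1 i) := fun i =>
    Finset.single_le_sum (f := fun i => wnorm Z (y.1 i)) (fun i _ => h1 i) (Finset.mem_univ i)
  rw [normY, mul_add]
  exact ⟨fun i => by linarith [h8 i], by linarith, fun i => by linarith [h7 i], by linarith,
    by linarith, by linarith, by linarith⟩

end Weighted

theorem norm_constI_le {b : ℝ} (hb : 0 < b) (c : ℂ) : ‖constI b ℂ c‖ ≤ Real.sqrt b * ‖c‖ :=
  L2I.norm_le_of_bound hb (norm_nonneg _) (by
    filter_upwards [coeFn_constI b c] with y hy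
    rw [hy])

/-! ### The a priori estimate -/

/-- A nonzero frequency with a triple of unknowns whose velocity vanishes on the bottom. -/
structure FiberConfig (b : ℝ) (s : ℕ) where
  /-- the frequency -/
  freq : Plane
  freq_ne : freq ≠ 0
  /-- the unknowns -/
  x : Unknowns b s
  bot : ∀ i, trBot b (s + 1) (x.2.1 i) = 0

namespace FiberConfig

variable {b : ℝ} {s : ℕ} (γ κ μ : ℝ) (c : FiberConfig b s)

/-- The bracket of the frequency. -/
def Z : ℝ := bracket c.freq

/-- The modulus of the frequency. -/
def lam : ℝ := modulus c.freq

/-- The symbol of `∂ⱼ`. -/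
def d (j : Fin 2) : ℂ := dsym c.freq j

/-- The data. -/
def y : FiberData b s := fiberSys b γ κ μ s c.d c.x

/-- The norm of the data. -/
def Y : ℝ := normY c.Z c.lam (c.y γ κ μ)

/-- The potential of `χ`. -/
def η : ℂ := -(c.d 0 * c.x.2.2 0 + c.d 1 * c.x.2.2 1) / (c.lam : ℂ) ^ 2

/-- The stream function of `χ`. -/
def ψ : ℂ := -(c.y γ κ μ).2.2.2.2 / (c.lam : ℂ) ^ 2

/-- The pressure plus `γ` times the potential. -/
def P : HI b (s + 1) ℂ := c.x.1 + (γ : ℂ) • HI.const b (s + 1) ℂ c.η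

/-- The Stokes pressure. -/
def Q : HI b (s + 1) ℂ := c.P γ - (μ : ℂ) • fiberDiv c.d c.x

theorem one_le_Z : 1 ≤ c.Z := one_le_bracket _
theorem Z_pos : 0 < c.Z := bracket_pos _
theorem lam_pos : 0 < c.lam := modulus_pos c.freq_ne
theorem lam_le : c.lam ≤ 7 * c.Z := modulus_le _
theorem Z_le : c.Z ≤ 1 + c.lam := bracket_le _
theorem d_sq : c.d 0 * c.d 0 + c.d 1 * c.d 1 = -(c.lam : ℂ) ^ 2 := dsym_sq _
theorem norm_d_le (j : Fin 2) : ‖c.d j‖ ≤ c.lam := norm_dsym_le _ _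
theorem lam_ne : (c.lam : ℂ) ≠ 0 := Complex.ofReal_ne_zero.2 c.lam_pos.ne'

theorem one_le_sqrt_Z : 1 ≤ Real.sqrt c.Z := Real.one_le_sqrt.2 c.one_le_Z

theorem Y_nonneg : 0 ≤ c.Y γ κ μ :=
  (normY_terms c.Z_pos.le c.lam_pos.le (c.y γ κ μ)).2.2.2.2.2.2

theorem F_le (i : Fin 3) {j : ℕ} (hj : j ≤ s) :
    c.Z ^ (s - j) * ‖der b s j ((c.y γ κ μ).1 i)‖ ≤ c.Y γ κ μ :=
  (le_wnorm c.Z_pos.le _ hj).trans ((normY_terms c.Z_pos.le c.lam_pos.le (c.y γ κ μ)).1 i)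

theorem g_le {j : ℕ} (hj : j ≤ s + 1) :
    c.Z ^ (s + 1 - j) * ‖der b (s + 1) j (fiberDiv c.d c.x)‖ ≤ c.Y γ κ μ := by
  have := (le_wnorm c.Z_pos.le _ hj).trans
    ((normY_terms c.Z_pos.le c.lam_pos.le (c.y γ κ μ)).2.1)
  rwa [y, fiberSys_div] at this

theorem k_le (i : Fin 3) :
    c.Z ^ s * (Real.sqrt c.Z * ‖(c.y γ κ μ).2.2.1 i‖) ≤ c.Y γ κ μ :=
  (le_of_eq (by ring)).trans ((normY_terms c.Z_pos.le c.lam_pos.le (c.y γ κ μ)).2.2.1 i)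

theorem h_le :
    c.Z ^ s * (c.Z * Real.sqrt c.Z * ‖trTop b (s + 1) (c.x.2.1 2)‖) ≤ c.Y γ κ μ := by
  have := (normY_terms c.Z_pos.le c.lam_pos.le (c.y γ κ μ)).2.2.2.1
  rw [y, fiberSys_kin] at this
  exact (le_of_eq (by rw [pow_succ]; ring)).trans this

theorem lam_mul_norm_ψ : c.lam * ‖c.ψ γ κ μ‖ = ‖(c.y γ κ μ).2.2.2.2‖ / c.lam := by
  have := c.lam_pos
  rw [ψ, norm_div, norm_neg, norm_pow, Complex.norm_real, Real.norm_of_nonneg this.le]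
  field_simp

theorem ψ_le : Real.sqrt c.Z * c.Z ^ (s + 1) * (c.lam * ‖c.ψ γ κ μ‖) ≤ c.Y γ κ μ := by
  rw [lam_mul_norm_ψ]
  exact (normY_terms c.Z_pos.le c.lam_pos.le (c.y γ κ μ)).2.2.2.2.1

theorem flux_le : c.Z ^ s * (‖trTop b (s + 1) (c.x.2.1 2) -
    testI b 1 (der b (s + 1) 0 (fiberDiv c.d c.x))‖ / c.lam) ≤ c.Y γ κ μ := by
  have := (normY_terms c.Z_pos.le c.lam_pos.le (c.y γ κ μ)).2.2.2.2.2.1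
  rwa [y, fiberSys_kin, fiberSys_div] at this

/-- The Helmholtz decomposition χ = dη + d^⊥ψ at a nonzero frequency, by Cramer's rule with
determinant d·d = -λ². The potential η is unknown, while ψ comes from the curl datum alone. -/
theorem χ_zero : c.x.2.2 0 = c.d 0 * c.η - c.d 1 * c.ψ γ κ μ := by
  have h := c.lam_ne
  rw [η, ψ, y, fiberSys_curl]
  field_simp
  linear_combination c.x.2.2 0 * c.d_sq

theorem χ_one : c.x.2.2 1 = c.d 1 * c.η + c.d 0 * c.ψ γ κ μ := by
  have h := c.lam_ne
  rw [η, ψ, y, fiberSys_curl]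
  field_simp
  linear_combination c.x.2.2 1 * c.d_sq

/-- The solenoidal part of `χ`. -/
def rot (j : Fin 2) : ℂ := if j = 0 then -(c.d 1 * c.ψ γ κ μ) else c.d 0 * c.ψ γ κ μ

theorem χ_eq (j : Fin 2) : c.x.2.2 j = c.d j * c.η + c.rot γ κ μ j := by
  fin_cases j
  · simpa [rot, sub_eq_add_neg] using c.χ_zero γ κ μ
  · simpa [rot] using c.χ_one γ κ μ

theorem norm_rot_le (j : Fin 2) : ‖c.rot γ κ μ j‖ ≤ c.lam * ‖c.ψ γ κ μ‖ := by
  fin_cases j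
  · simpa [rot] using mul_le_mul_of_nonneg_right (c.norm_d_le 1) (norm_nonneg _)
  · simpa [rot] using mul_le_mul_of_nonneg_right (c.norm_d_le 0) (norm_nonneg _)

theorem der_fiberDiv {j : ℕ} (hj : j ≤ s + 1) : der b (s + 1) j (fiberDiv c.d c.x) =
    c.d 0 • der b (s + 2) j (c.x.2.1 0) + c.d 1 • der b (s + 2) j (c.x.2.1 1) +
      der b (s + 2) (j + 1) (c.x.2.1 2) := by
  rw [fiberDiv, map_add, map_add, map_smul, map_smul, HI.der_incl hj, HI.der_incl hj,
    HI.der_deriv hj]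

theorem der_tan (i : Fin 2) {j : ℕ} (hj : j ≤ s) :
    der b s j ((c.y γ κ μ).1 i.castSucc) = (γ : ℂ) • der b s j (HI.const b s ℂ (c.x.2.2 i)) +
      c.d i • der b (s + 1) j c.x.1 - (μ : ℂ) • (der b (s + 2) (j + 2) (c.x.2.1 i.castSucc) -
        ((c.lam : ℂ) ^ 2) • der b (s + 2) j (c.x.2.1 i.castSucc) +
        c.d i • der b (s + 1) j (fiberDiv c.d c.x)) := by
  rw [y, fiberSys_tan, c.d_sq]
  simp only [map_add, map_sub, map_smul]
  rw [HI.der_incl hj, HI.der_incl hj, HI.der_incl hj, HI.der_incl (by omega), HI.der_deriv hj,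
    HI.der_deriv (by omega), neg_smul, ← sub_eq_add_neg]

theorem der_nor {j : ℕ} (hj : j ≤ s) :
    der b s j ((c.y γ κ μ).1 2) =
      der b (s + 1) (j + 1) c.x.1 - (μ : ℂ) • (der b (s + 2) (j + 2) (c.x.2.1 2) -
        ((c.lam : ℂ) ^ 2) • der b (s + 2) j (c.x.2.1 2) +
        der b (s + 1) (j + 1) (fiberDiv c.d c.x)) := by
  rw [y, fiberSys_nor, c.d_sq]
  simp only [map_add, map_sub, map_smul]
  rw [HI.der_incl hj, HI.der_incl (by omega), HI.der_deriv hj, HI.der_deriv hj, HI.der_deriv hj,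
    HI.der_deriv (by omega), neg_smul, ← sub_eq_add_neg]

theorem der_P_zero : der b (s + 1) 0 (c.P γ) =
    der b (s + 1) 0 c.x.1 + (γ : ℂ) • constI b ℂ c.η := by
  rw [P, map_add, map_smul, HI.der_const_zero]

theorem der_P_succ (j : ℕ) : der b (s + 1) (j + 1) (c.P γ) = der b (s + 1) (j + 1) c.x.1 := by
  rw [P, map_add, map_smul, HI.der_const_succ, smul_zero, add_zero]

variable {γ κ μ}

/-- Passing from p to Q absorbs the gradient part of γχ and the gradient of the divergence. Only the
rotational part of γχ remains, and it is bounded by the curl datum. The Stokes problem sees L² data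
only, so the size of the data is divided by Z^s. -/
theorem exists_stokes (hb : 0 < b) (hγ : 0 < γ) (hμ : 0 < μ) (κ : ℝ) :
    ∃ C : ℝ, 0 ≤ C ∧ ∀ c : FiberConfig b s, ∃ σ : StokesConfig b μ s, σ.Z = c.Z ∧ σ.lam = c.lam ∧
      σ.v = c.x.2.1 ∧ σ.Q = c.Q γ μ ∧ σ.D = C * (c.Y γ κ μ / c.Z ^ s) := by
  -- The summands account for the data themselves, for the rotational part of γχ as a constant force
  -- on (0, b), and for μ⁻¹k and dⱼv₃(b) when the tangential stress is solved for vⱼ'(b).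
  refine ⟨1 + γ * Real.sqrt b + μ⁻¹ + 7, by positivity, fun c => ?_⟩
  have hZ := c.Z_pos
  have hZs : 0 < c.Z ^ s := by positivity
  have hE0 : 0 ≤ c.Y γ κ μ / c.Z ^ s := div_nonneg (c.Y_nonneg γ κ μ) hZs.le
  have of_le : ∀ {t : ℝ}, c.Z ^ s * t ≤ c.Y γ κ μ → t ≤ c.Y γ κ μ / c.Z ^ s := fun h => by
    rw [le_div_iff₀ hZs]; linarith
  have hF : ∀ i, ‖der b s 0 ((c.y γ κ μ).1 i)‖ ≤ c.Y γ κ μ / c.Z ^ s := fun i =>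
    of_le (c.F_le γ κ μ i (Nat.zero_le s))
  have hg0 : c.Z * ‖der b (s + 1) 0 (fiberDiv c.d c.x)‖ ≤ c.Y γ κ μ / c.Z ^ s := by
    refine of_le ((le_of_eq ?_).trans (c.g_le γ κ μ (Nat.zero_le (s + 1))))
    rw [Nat.sub_zero, pow_succ]; ring
  have hg1 : ‖der b (s + 1) 1 (fiberDiv c.d c.x)‖ ≤ c.Y γ κ μ / c.Z ^ s :=
    of_le (c.g_le γ κ μ (j := 1) (by omega))
  have hk := fun i => of_le (c.k_le γ κ μ i)
  have hh := of_le (c.h_le γ κ μ)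
  have hfl := of_le (c.flux_le γ κ μ)
  have hψ : c.lam * ‖c.ψ γ κ μ‖ ≤ c.Y γ κ μ / c.Z ^ s := by
    refine of_le (le_trans ?_ (c.ψ_le γ κ μ))
    have h1 : c.Z ^ s ≤ Real.sqrt c.Z * c.Z ^ (s + 1) := by
      calc c.Z ^ s ≤ c.Z ^ (s + 1) := pow_le_pow_right₀ c.one_le_Z (by omega)
        _ ≤ _ := le_mul_of_one_le_left (by positivity) c.one_le_sqrt_Z
    exact mul_le_mul_of_nonneg_right h1 (mul_nonneg c.lam_pos.le (norm_nonneg _))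
  set E := c.Y γ κ μ / c.Z ^ s with hE
  clear_value E
  have hsb := Real.sqrt_nonneg b
  have hμi : 0 < μ⁻¹ := inv_pos.2 hμ
  have hEC : E ≤ (1 + γ * Real.sqrt b + μ⁻¹ + 7) * E :=
    le_mul_of_one_le_left hE0 (by nlinarith [mul_nonneg hγ.le hsb])
  have hμ' : (μ : ℂ) ≠ 0 := Complex.ofReal_ne_zero.2 hμ.ne'
  -- The rotational part of χ is moved to the force. It has tangential components only, hence the
  -- case distinction on the index, with 0 for the normal one.
  refine ⟨⟨c.Z, c.lam, (1 + γ * Real.sqrt b + μ⁻¹ + 7) * E, c.d, c.Q γ μ, c.x.2.1,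
    fun i => der b s 0 ((c.y γ κ μ).1 i) -
      (γ : ℂ) • constI b ℂ (if h : (i : ℕ) < 2 then c.rot γ κ μ (i.castLT h) else 0),
    der b (s + 1) 0 (fiberDiv c.d c.x), der b (s + 1) 1 (fiberDiv c.d c.x), c.one_le_Z, c.lam_pos,
    c.lam_le, c.Z_le, conj_dsym _, c.d_sq, c.norm_d_le, ?_, ?_, ?_, ?_, c.bot,
    mul_nonneg (by positivity) hE0, ?_, hg1.trans hEC, hg0.trans hEC, ?_, hh.trans hEC, ?_⟩,
    rfl, rfl, rfl, rfl, rfl⟩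
  · intro j
    have hj : ((j.castSucc : Fin 3) : ℕ) < 2 := j.2
    have hj' : (j.castSucc : Fin 3).castLT hj = j := Fin.castLT_castSucc j hj
    simp only [hj, dite_true, hj']
    rw [c.der_tan γ κ μ j (Nat.zero_le s), HI.der_const_zero, Q, map_sub, map_smul, c.der_P_zero,
      c.χ_eq γ κ μ j, map_add, ← smul_eq_mul (c.d j) c.η, map_smul]
    module
  · simp only [show ¬ ((2 : Fin 3) : ℕ) < 2 by decide, dite_false, map_zero, smul_zero, sub_zero]
    rw [c.der_nor γ κ μ (Nat.zero_le s), Q, map_sub, map_smul, c.der_P_succ]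
    module
  · exact c.der_fiberDiv (Nat.zero_le _)
  · exact c.der_fiberDiv (by omega)
  · intro i
    have h1 : ‖(if h : (i : ℕ) < 2 then c.rot γ κ μ (i.castLT h) else 0)‖ ≤ E := by
      split_ifs with h
      · exact (c.norm_rot_le γ κ μ _).trans hψ
      · simpa using hE0
    calc _ ≤ ‖der b s 0 ((c.y γ κ μ).1 i)‖ + ‖(γ : ℂ) • constI b ℂ
          (if h : (i : ℕ) < 2 then c.rot γ κ μ (i.castLT h) else 0)‖ := norm_sub_le _ _
      _ ≤ E + γ * (Real.sqrt b * E) := by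
          refine add_le_add (hF i) ?_
          rw [norm_smul, Complex.norm_real, Real.norm_of_nonneg hγ.le]
          exact mul_le_mul_of_nonneg_left ((norm_constI_le hb _).trans
            (mul_le_mul_of_nonneg_left h1 hsb)) hγ.le
      _ ≤ _ := by nlinarith [mul_nonneg hμi.le hE0]
  · intro j
    have h1 : trTop b s (HI.deriv b (s + 1) (c.x.2.1 j.castSucc)) =
        (μ : ℂ)⁻¹ * (c.y γ κ μ).2.2.1 j.castSucc - c.d j * trTop b (s + 1) (c.x.2.1 2) := by
      rw [y, fiberSys_stress_tan]; field_simp; ring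
    rw [h1]
    calc _ ≤ Real.sqrt c.Z * (μ⁻¹ * ‖(c.y γ κ μ).2.2.1 j.castSucc‖ +
          c.lam * ‖trTop b (s + 1) (c.x.2.1 2)‖) := by
          refine mul_le_mul_of_nonneg_left ((norm_sub_le _ _).trans (add_le_add ?_ ?_))
            (Real.sqrt_nonneg _)
          · rw [norm_mul, norm_inv, Complex.norm_real, Real.norm_of_nonneg hμ.le]
          · rw [norm_mul]; exact mul_le_mul_of_nonneg_right (c.norm_d_le j) (norm_nonneg _)
      _ ≤ Real.sqrt c.Z * (μ⁻¹ * ‖(c.y γ κ μ).2.2.1 j.castSucc‖ +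
          7 * c.Z * ‖trTop b (s + 1) (c.x.2.1 2)‖) := by
          have := c.lam_le; gcongr
      _ = μ⁻¹ * (Real.sqrt c.Z * ‖(c.y γ κ μ).2.2.1 j.castSucc‖) +
          7 * (c.Z * Real.sqrt c.Z * ‖trTop b (s + 1) (c.x.2.1 2)‖) := by ring
      _ ≤ μ⁻¹ * E + 7 * E := by have := hk j.castSucc; gcongr
      _ ≤ _ := by nlinarith [mul_nonneg (mul_nonneg hγ.le hsb) hE0]
  · rw [div_le_iff₀ c.lam_pos] at hfl
    nlinarith [mul_le_mul_of_nonneg_left hEC c.lam_pos.le]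

end FiberConfig
end
end CurlLayer

namespace CurlLayer

noncomputable section

/-! ### Lowest-order estimates on the fibers: from the Stokes problem back to η and p. -/

namespace FiberConfig

variable {b : ℝ} {s : ℕ} {γ κ μ : ℝ}

/-- Transfers a bound by the Stokes data D to a bound by `Y`, the factor Z^s undoing the division in
`exists_stokes`. -/
theorem dominated_of_stokes (hb : 0 < b) (hγ : 0 < γ) (hμ : 0 < μ) {Φ : StokesConfig b μ s → ℝ}
    {φ : FiberConfig b s → ℝ} (hΦ : Dominated Φ fun σ => σ.D)
    (hφ : ∀ (c : FiberConfig b s) (σ : StokesConfig b μ s), σ.Z = c.Z → σ.lam = c.lam →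
      σ.v = c.x.2.1 → σ.Q = c.Q γ μ → φ c = c.Z ^ s * Φ σ) :
    Dominated φ fun c => c.Y γ κ μ := by
  obtain ⟨C, hC, h⟩ := exists_stokes (s := s) hb hγ hμ κ
  obtain ⟨C', hC', h'⟩ := hΦ
  refine ⟨C' * C, by positivity, fun c => ?_⟩
  obtain ⟨σ, h1, h2, h3, h4, h5⟩ := h c
  have hZ : 0 < c.Z ^ s := pow_pos c.Z_pos s
  rw [hφ c σ h1 h2 h3 h4]
  calc _ ≤ c.Z ^ s * (C' * σ.D) := mul_le_mul_of_nonneg_left (h' σ) hZ.le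
    _ = _ := by rw [h5]; field_simp

/-- The basic estimates of the velocity. -/
theorem dominated_velocity_basic (hb : 0 < b) (hγ : 0 < γ) (hμ : 0 < μ) (i : Fin 3) {j : ℕ}
    (hj : j ≤ 2) : Dominated
      (fun c : FiberConfig b s => c.Z ^ (s + 2 - j) * ‖der b (s + 2) j (c.x.2.1 i)‖)
      fun c => c.Y γ κ μ := by
  have hm := StokesConfig.dominated_m (s := s) hb hμ
  have h0 : Dominated (fun σ : StokesConfig b μ s => σ.Z ^ (2 - j) * σ.a j i) fun σ => σ.D := by
    refine Dominated.trans ?_ hm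
    interval_cases j
    · exact ⟨1 + b, by positivity, fun σ => (σ.Z_sq_mul_a_zero_le hb i).trans
        (mul_le_mul_of_nonneg_left σ.N_le_m (by positivity))⟩
    · exact ⟨1, by positivity, fun σ => by
        simpa using (σ.Z_mul_a_one_le i).trans σ.N_le_m⟩
    · simpa using StokesConfig.dominated_a_two hb hμ i
  refine dominated_of_stokes hb hγ hμ h0 fun c σ h1 _ h3 _ => ?_
  rw [StokesConfig.a, h1, h3, ← mul_assoc, ← pow_add, show s + (2 - j) = s + 2 - j by omega]

theorem dominated_Q_zero (hb : 0 < b) (hγ : 0 < γ) (hμ : 0 < μ) :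
    Dominated (fun c : FiberConfig b s => c.Z ^ s * (c.lam * ‖der b (s + 1) 0 (c.Q γ μ)‖))
      fun c => c.Y γ κ μ := by
  refine dominated_of_stokes hb hγ hμ ((StokesConfig.dominated_q_zero hb hμ).trans
    (StokesConfig.dominated_m hb hμ)) fun c σ h1 h2 _ h4 => ?_
  rw [StokesConfig.q, h2, h4]

theorem dominated_Q_one (hb : 0 < b) (hγ : 0 < γ) (hμ : 0 < μ) :
    Dominated (fun c : FiberConfig b s => c.Z ^ s * ‖der b (s + 1) 1 (c.Q γ μ)‖)
      fun c => c.Y γ κ μ := by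
  refine dominated_of_stokes hb hγ hμ ((StokesConfig.dominated_q_one hμ).trans
    (StokesConfig.dominated_m hb hμ)) fun c σ h1 h2 _ h4 => ?_
  rw [StokesConfig.q, h4]

theorem P_eq (c : FiberConfig b s) : c.P γ = c.Q γ μ + (μ : ℂ) • fiberDiv c.d c.x := by
  rw [Q, sub_add_cancel]

theorem dominated_P_zero (hb : 0 < b) (hγ : 0 < γ) (hμ : 0 < μ) :
    Dominated (fun c : FiberConfig b s => c.Z ^ s * (c.lam * ‖der b (s + 1) 0 (c.P γ)‖))
      fun c => c.Y γ κ μ := by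
  have hg : Dominated (fun c : FiberConfig b s =>
      μ * (7 * (c.Z ^ (s + 1) * ‖der b (s + 1) 0 (fiberDiv c.d c.x)‖))) fun c => c.Y γ κ μ :=
    Dominated.const_mul hμ.le (Dominated.const_mul (by norm_num)
      (Dominated.of_le fun c => c.g_le γ κ μ (Nat.zero_le _)))
  refine Dominated.of_le_of (fun c => ?_) (Dominated.add (dominated_Q_zero hb hγ hμ) hg)
  have hZ := c.Z_pos
  have hl := c.lam_pos
  rw [c.P_eq (μ := μ), map_add, map_smul]
  calc _ ≤ c.Z ^ s * (c.lam * (‖der b (s + 1) 0 (c.Q γ μ)‖ +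
        μ * ‖der b (s + 1) 0 (fiberDiv c.d c.x)‖)) := by
        gcongr
        refine (norm_add_le _ _).trans_eq ?_
        rw [norm_smul, Complex.norm_real, Real.norm_of_nonneg hμ.le]
    _ = c.Z ^ s * (c.lam * ‖der b (s + 1) 0 (c.Q γ μ)‖) +
        μ * (c.lam * (c.Z ^ s * ‖der b (s + 1) 0 (fiberDiv c.d c.x)‖)) := by ring
    _ ≤ c.Z ^ s * (c.lam * ‖der b (s + 1) 0 (c.Q γ μ)‖) +
        μ * ((7 * c.Z) * (c.Z ^ s * ‖der b (s + 1) 0 (fiberDiv c.d c.x)‖)) := by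
        have := c.lam_le; gcongr
    _ = _ := by rw [pow_succ]; ring

theorem dominated_P_one (hb : 0 < b) (hγ : 0 < γ) (hμ : 0 < μ) :
    Dominated (fun c : FiberConfig b s => c.Z ^ s * ‖der b (s + 1) 1 (c.P γ)‖)
      fun c => c.Y γ κ μ := by
  have hg : Dominated (fun c : FiberConfig b s =>
      μ * (c.Z ^ s * ‖der b (s + 1) 1 (fiberDiv c.d c.x)‖)) fun c => c.Y γ κ μ :=
    Dominated.const_mul hμ.le (Dominated.of_le fun c => c.g_le γ κ μ (j := 1) (by omega))
  refine Dominated.of_le_of (fun c => ?_) (Dominated.add (dominated_Q_one hb hγ hμ) hg)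
  have hZ := c.Z_pos
  rw [c.P_eq (μ := μ), map_add, map_smul]
  calc _ ≤ c.Z ^ s * (‖der b (s + 1) 1 (c.Q γ μ)‖ +
        μ * ‖der b (s + 1) 1 (fiberDiv c.d c.x)‖) := by
        gcongr
        refine (norm_add_le _ _).trans_eq ?_
        rw [norm_smul, Complex.norm_real, Real.norm_of_nonneg hμ.le]
    _ = _ := by ring

theorem dominated_trTop_deriv (hb : 0 < b) (hγ : 0 < γ) (hμ : 0 < μ) :
    Dominated (fun c : FiberConfig b s =>
      c.Z ^ s * (Real.sqrt c.Z * ‖trTop b s (HI.deriv b (s + 1) (c.x.2.1 2))‖))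
      fun c => c.Y γ κ μ := by
  refine Dominated.of_le_of (fun c => ?_) (Dominated.const_mul (c := b⁻¹ + 1) (by positivity)
    (Dominated.add (dominated_velocity_basic hb hγ hμ 2 (j := 1) (by norm_num))
    (dominated_velocity_basic hb hγ hμ 2 (j := 2) (by norm_num))))
  have := sqrt_mul_norm_trTop_le hb c.one_le_Z (HI.deriv b (s + 1) (c.x.2.1 2))
  rw [HI.der_deriv (by omega), HI.der_deriv (by omega)] at this
  calc _ ≤ c.Z ^ s * _ := mul_le_mul_of_nonneg_left this (pow_pos c.Z_pos s).le
    _ = _ := by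
      rw [show s + 2 - 1 = s + 1 by omega, show s + 2 - 2 = s by omega, pow_succ]; ring

/-- The normal stress condition with p = P - γη and d·χ = -λ²η. Gravity and surface tension add up
to the positive factor γ + κλ² in front of η. -/
theorem stress_eq (hb : 0 < b) (c : FiberConfig b s) :
    ((γ + κ * c.lam ^ 2 : ℝ) : ℂ) * c.η = (c.y γ κ μ).2.2.1 2 + trTop b s (c.P γ) -
      2 * μ * trTop b s (HI.deriv b (s + 1) (c.x.2.1 2)) := by
  have h := c.lam_ne
  have h1 : c.d 0 * c.x.2.2 0 + c.d 1 * c.x.2.2 1 = -(c.lam : ℂ) ^ 2 * c.η := by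
    rw [η]; field_simp
  rw [y, fiberSys_stress_nor, h1, P, map_add, map_smul, trTop_const hb]
  push_cast
  rw [smul_eq_mul]
  ring

theorem norm_stress_le (hb : 0 < b) (hγ : 0 < γ) (hκ : 0 < κ) (hμ : 0 < μ)
    (c : FiberConfig b s) :
    (γ + κ * c.lam ^ 2) * ‖c.η‖ ≤ ‖(c.y γ κ μ).2.2.1 2‖ + ‖trTop b s (c.P γ)‖ +
      2 * μ * ‖trTop b s (HI.deriv b (s + 1) (c.x.2.1 2))‖ := by
  have h := congrArg norm (c.stress_eq (γ := γ) (κ := κ) (μ := μ) hb)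
  rw [norm_mul, Complex.norm_real, Real.norm_of_nonneg (by positivity)] at h
  rw [h]
  refine (norm_sub_le _ _).trans (add_le_add (norm_add_le _ _) (le_of_eq ?_))
  rw [norm_mul, norm_mul, Complex.norm_real, Real.norm_of_nonneg hμ.le, Complex.norm_ofNat]

/-- Gravity γ bounds the factor from below at low frequencies, surface tension κλ² at high ones. -/
theorem Z_sq_le (hγ : 0 < γ) (hκ : 0 < κ) (c : FiberConfig b s) :
    c.Z ^ 2 ≤ 2 * (γ⁻¹ + κ⁻¹) * (γ + κ * c.lam ^ 2) := by
  have h1 : c.Z ^ 2 ≤ 2 * (1 + c.lam ^ 2) := by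
    nlinarith [c.Z_le, c.Z_pos, c.lam_pos, sq_nonneg (1 - c.lam)]
  have h2 : 2 * (γ⁻¹ + κ⁻¹) * (γ + κ * c.lam ^ 2) =
      2 * (1 + c.lam ^ 2) + 2 * (γ * κ⁻¹ + γ⁻¹ * (κ * c.lam ^ 2)) := by field_simp; ring
  rw [h2]
  have : 0 ≤ γ * κ⁻¹ + γ⁻¹ * (κ * c.lam ^ 2) := by positivity
  linarith

/-- An inequality `θ f ≤ Z² g` with `θ = γ + κ λ²` gives `f ≲ g`. -/
theorem dominated_of_theta (hγ : 0 < γ) (hκ : 0 < κ) {f g h : FiberConfig b s → ℝ}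
    (hg : ∀ c, 0 ≤ g c) (h₁ : ∀ c, (γ + κ * c.lam ^ 2) * f c ≤ c.Z ^ 2 * g c)
    (h₂ : Dominated g h) : Dominated f h := by
  refine Dominated.trans ⟨2 * (γ⁻¹ + κ⁻¹), by positivity, fun c => ?_⟩ h₂
  have hθ : 0 < γ + κ * c.lam ^ 2 := by positivity
  refine le_of_mul_le_mul_left ((h₁ c).trans ?_) hθ
  calc _ ≤ 2 * (γ⁻¹ + κ⁻¹) * (γ + κ * c.lam ^ 2) * g c :=
        mul_le_mul_of_nonneg_right (c.Z_sq_le hγ hκ) (hg c)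
    _ = _ := by ring

theorem dominated_stress (hb : 0 < b) (hγ : 0 < γ) (hμ : 0 < μ) :
    Dominated (fun c : FiberConfig b s => c.Z ^ s * (Real.sqrt c.Z * ‖(c.y γ κ μ).2.2.1 2‖) +
      2 * μ * (c.Z ^ s * (Real.sqrt c.Z * ‖trTop b s (HI.deriv b (s + 1) (c.x.2.1 2))‖)))
      fun c => c.Y γ κ μ :=
  Dominated.add (Dominated.of_le fun c => c.k_le γ κ μ 2)
    (Dominated.const_mul (by positivity) (dominated_trTop_deriv hb hγ hμ))

theorem lam_mul_Z_le (c : FiberConfig b s) : c.lam * c.Z ≤ 7 * c.Z ^ 2 := by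
  nlinarith [c.lam_le, c.Z_pos]

/-- Only λη is claimed, so the top trace of P enters with a factor λ, which is what the bound on λP
supplies. The product λZ is at most 7Z² and is paid by γ + κλ². -/
theorem dominated_η (hb : 0 < b) (hγ : 0 < γ) (hκ : 0 < κ) (hμ : 0 < μ) :
    Dominated (fun c : FiberConfig b s => Real.sqrt c.Z * c.Z ^ (s + 1) * (c.lam * ‖c.η‖))
      fun c => c.Y γ κ μ := by
  refine dominated_of_theta hγ hκ (g := fun c =>
    7 * (c.Z ^ s * (Real.sqrt c.Z * ‖(c.y γ κ μ).2.2.1 2‖) +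
      2 * μ * (c.Z ^ s * (Real.sqrt c.Z * ‖trTop b s (HI.deriv b (s + 1) (c.x.2.1 2))‖))) +
    (b⁻¹ + 1) * (c.Z ^ s * (c.lam * ‖der b (s + 1) 0 (c.P γ)‖) +
      7 * (c.Z ^ s * ‖der b (s + 1) 1 (c.P γ)‖))) (fun c => ?_) (fun c => ?_)
    (Dominated.add (Dominated.const_mul (by norm_num) (dominated_stress hb hγ hμ))
      (Dominated.const_mul (by positivity) (Dominated.add (dominated_P_zero hb hγ hμ)
        (Dominated.const_mul (by norm_num) (dominated_P_one hb hγ hμ)))))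
  · have := c.Z_pos; have := c.lam_pos; positivity
  · have hZ := c.Z_pos
    have hl := c.lam_pos
    have h1 := c.norm_stress_le (γ := γ) hb hγ hκ hμ
    have h2 := sqrt_mul_norm_trTop_le hb c.one_le_Z (c.P γ)
    have h3 := c.lam_mul_Z_le
    set k := ‖(c.y γ κ μ).2.2.1 2‖
    set t := ‖trTop b s (HI.deriv b (s + 1) (c.x.2.1 2))‖
    set p := ‖trTop b s (c.P γ)‖
    set p0 := ‖der b (s + 1) 0 (c.P γ)‖
    set p1 := ‖der b (s + 1) 1 (c.P γ)‖
    have hk : 0 ≤ k := norm_nonneg _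
    have ht : 0 ≤ t := norm_nonneg _
    have hp1 : 0 ≤ p1 := norm_nonneg _
    calc _ = Real.sqrt c.Z * c.Z ^ (s + 1) * c.lam * ((γ + κ * c.lam ^ 2) * ‖c.η‖) := by ring
      _ ≤ Real.sqrt c.Z * c.Z ^ (s + 1) * c.lam * (k + p + 2 * μ * t) := by gcongr
      _ = (c.lam * c.Z) * (c.Z ^ s * (Real.sqrt c.Z * k) +
            2 * μ * (c.Z ^ s * (Real.sqrt c.Z * t))) +
          (c.lam * c.Z) * c.Z ^ s * (Real.sqrt c.Z * p) := by rw [pow_succ]; ring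
      _ ≤ (7 * c.Z ^ 2) * (c.Z ^ s * (Real.sqrt c.Z * k) +
            2 * μ * (c.Z ^ s * (Real.sqrt c.Z * t))) +
          (c.lam * c.Z) * c.Z ^ s * ((b⁻¹ + 1) * (c.Z * p0 + p1)) := by gcongr
      _ = (7 * c.Z ^ 2) * (c.Z ^ s * (Real.sqrt c.Z * k) +
            2 * μ * (c.Z ^ s * (Real.sqrt c.Z * t))) +
          (b⁻¹ + 1) * (c.Z ^ 2 * (c.Z ^ s * (c.lam * p0)) + (c.lam * c.Z) * (c.Z ^ s * p1)) := by
          ring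
      _ ≤ (7 * c.Z ^ 2) * (c.Z ^ s * (Real.sqrt c.Z * k) +
            2 * μ * (c.Z ^ s * (Real.sqrt c.Z * t))) +
          (b⁻¹ + 1) * (c.Z ^ 2 * (c.Z ^ s * (c.lam * p0)) + (7 * c.Z ^ 2) * (c.Z ^ s * p1)) := by
          gcongr
      _ = _ := by ring

/-- Eliminate η from p = P - γη. The result contains P only as λ²P and as P - P(b). Both are
controlled as ξ → 0, though P and η separately are not. -/
theorem theta_smul_p (hb : 0 < b) (c : FiberConfig b s) :
    ((γ + κ * c.lam ^ 2 : ℝ) : ℂ) • der b (s + 1) 0 c.x.1 =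
      ((κ * c.lam ^ 2 : ℝ) : ℂ) • der b (s + 1) 0 (c.P γ) +
      (γ : ℂ) • der b (s + 1) 0 (c.P γ - HI.const b (s + 1) ℂ (trTop b s (c.P γ))) -
      (γ : ℂ) • constI b ℂ ((c.y γ κ μ).2.2.1 2 -
        2 * μ * trTop b s (HI.deriv b (s + 1) (c.x.2.1 2))) := by
  have h1 : der b (s + 1) 0 c.x.1 = der b (s + 1) 0 (c.P γ) - (γ : ℂ) • constI b ℂ c.η := by
    rw [der_P_zero, add_sub_cancel_right]
  have h2 : constI b ℂ ((c.y γ κ μ).2.2.1 2 -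
        2 * μ * trTop b s (HI.deriv b (s + 1) (c.x.2.1 2))) =
      ((γ + κ * c.lam ^ 2 : ℝ) : ℂ) • constI b ℂ c.η - constI b ℂ (trTop b s (c.P γ)) := by
    rw [← map_smul, ← map_sub, smul_eq_mul, c.stress_eq (μ := μ) hb]
    congr 1; ring
  rw [h1, h2, map_sub, HI.der_const_zero]
  push_cast
  module

theorem dominated_p_zero (hb : 0 < b) (hγ : 0 < γ) (hκ : 0 < κ) (hμ : 0 < μ) :
    Dominated (fun c : FiberConfig b s => c.Z ^ (s + 1) * ‖der b (s + 1) 0 c.x.1‖)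
      fun c => c.Y γ κ μ := by
  refine dominated_of_theta hγ hκ (g := fun c =>
    κ * (7 * (c.Z ^ s * (c.lam * ‖der b (s + 1) 0 (c.P γ)‖))) +
    (γ * (2 * b) * (c.Z ^ s * ‖der b (s + 1) 1 (c.P γ)‖) +
    γ * Real.sqrt b * (c.Z ^ s * (Real.sqrt c.Z * ‖(c.y γ κ μ).2.2.1 2‖) +
      2 * μ * (c.Z ^ s * (Real.sqrt c.Z * ‖trTop b s (HI.deriv b (s + 1) (c.x.2.1 2))‖)))))
    (fun c => ?_) (fun c => ?_)
    (Dominated.add (Dominated.const_mul hκ.le (Dominated.const_mul (by norm_num)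
        (dominated_P_zero hb hγ hμ)))
      (Dominated.add (Dominated.const_mul (by positivity) (dominated_P_one hb hγ hμ))
      (Dominated.const_mul (by positivity) (dominated_stress hb hγ hμ))))
  · have := c.Z_pos; have := c.lam_pos; positivity
  · have hZ := c.Z_pos
    have hl := c.lam_pos
    have h3 := c.lam_mul_Z_le
    have h0 := congrArg norm (c.theta_smul_p (γ := γ) (κ := κ) (μ := μ) hb)
    rw [norm_smul, Complex.norm_real, Real.norm_of_nonneg (by positivity)] at h0
    have h4 : ‖der b (s + 1) 0 (c.P γ - HI.const b (s + 1) ℂ (trTop b s (c.P γ)))‖ ≤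
        2 * b * ‖der b (s + 1) 1 (c.P γ)‖ := by
      have := norm_der_zero_le_of_trTop hb (k := s)
        (x := c.P γ - HI.const b (s + 1) ℂ (trTop b s (c.P γ)))
        (by rw [map_sub, trTop_const hb, sub_self])
      rwa [map_sub (der b (s + 1) 1), HI.der_const_succ, sub_zero] at this
    have h5 : ‖constI b ℂ ((c.y γ κ μ).2.2.1 2 -
        2 * μ * trTop b s (HI.deriv b (s + 1) (c.x.2.1 2)))‖ ≤
        Real.sqrt b * (‖(c.y γ κ μ).2.2.1 2‖ +
          2 * μ * ‖trTop b s (HI.deriv b (s + 1) (c.x.2.1 2))‖) := by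
      refine (norm_constI_le hb _).trans (mul_le_mul_of_nonneg_left ((norm_sub_le _ _).trans
        (add_le_add le_rfl (le_of_eq ?_))) (Real.sqrt_nonneg _))
      rw [norm_mul, norm_mul, Complex.norm_real, Real.norm_of_nonneg hμ.le, Complex.norm_ofNat]
    have h6 : (γ + κ * c.lam ^ 2) * ‖der b (s + 1) 0 c.x.1‖ ≤
        κ * c.lam ^ 2 * ‖der b (s + 1) 0 (c.P γ)‖ +
        γ * (2 * b * ‖der b (s + 1) 1 (c.P γ)‖) +
        γ * (Real.sqrt b * (‖(c.y γ κ μ).2.2.1 2‖ +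
          2 * μ * ‖trTop b s (HI.deriv b (s + 1) (c.x.2.1 2))‖)) := by
      rw [h0]
      refine (norm_sub_le _ _).trans (add_le_add ((norm_add_le _ _).trans (add_le_add ?_ ?_)) ?_)
      · rw [norm_smul, Complex.norm_real, Real.norm_of_nonneg (by positivity)]
      · rw [norm_smul, Complex.norm_real, Real.norm_of_nonneg hγ.le]; gcongr
      · rw [norm_smul, Complex.norm_real, Real.norm_of_nonneg hγ.le]; gcongr
    have hs1 := c.one_le_sqrt_Z
    have hZZ : c.Z ≤ c.Z ^ 2 := by nlinarith [c.one_le_Z]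
    set k := ‖(c.y γ κ μ).2.2.1 2‖
    set t := ‖trTop b s (HI.deriv b (s + 1) (c.x.2.1 2))‖
    set p0 := ‖der b (s + 1) 0 (c.P γ)‖
    set p1 := ‖der b (s + 1) 1 (c.P γ)‖
    have hk : 0 ≤ k := norm_nonneg _
    have ht : 0 ≤ t := norm_nonneg _
    have hp0 : 0 ≤ p0 := norm_nonneg _
    have hp1 : 0 ≤ p1 := norm_nonneg _
    have hsb := Real.sqrt_nonneg b
    calc _ = c.Z ^ (s + 1) * ((γ + κ * c.lam ^ 2) * ‖der b (s + 1) 0 c.x.1‖) := by ring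
      _ ≤ c.Z ^ (s + 1) * (κ * c.lam ^ 2 * p0 + γ * (2 * b * p1) +
          γ * (Real.sqrt b * (k + 2 * μ * t))) := by gcongr
      _ = (c.lam * c.Z) * (κ * (c.Z ^ s * (c.lam * p0))) +
          c.Z * (γ * (2 * b) * (c.Z ^ s * p1) + γ * Real.sqrt b * (c.Z ^ s * (1 * k) +
            2 * μ * (c.Z ^ s * (1 * t)))) := by rw [pow_succ]; ring
      _ ≤ (7 * c.Z ^ 2) * (κ * (c.Z ^ s * (c.lam * p0))) +
          c.Z ^ 2 * (γ * (2 * b) * (c.Z ^ s * p1) + γ * Real.sqrt b *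
            (c.Z ^ s * (Real.sqrt c.Z * k) + 2 * μ * (c.Z ^ s * (Real.sqrt c.Z * t)))) := by
          gcongr
      _ = _ := by ring

end FiberConfig
end
end CurlLayer

namespace CurlLayer

noncomputable section

/-! ### Higher vertical derivatives and the complete a priori estimate. -/

namespace FiberConfig

variable {b : ℝ} {s : ℕ} {γ κ μ : ℝ}

/-- The term γχ is constant in the vertical variable, so it disappears from the differentiated
equation; bounds of higher derivatives do not involve χ. -/
theorem der_v_tan (hμ : 0 < μ) (c : FiberConfig b s) (i : Fin 2) {l : ℕ} (hl : l + 1 ≤ s) :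
    ‖der b (s + 2) (l + 3) (c.x.2.1 i.castSucc)‖ ≤
      μ⁻¹ * (‖der b s (l + 1) ((c.y γ κ μ).1 i.castSucc)‖ +
        c.lam * ‖der b (s + 1) (l + 1) c.x.1‖) +
      (c.lam ^ 2 * ‖der b (s + 2) (l + 1) (c.x.2.1 i.castSucc)‖ +
        c.lam * ‖der b (s + 1) (l + 1) (fiberDiv c.d c.x)‖) := by
  have hμ' : (μ : ℂ) ≠ 0 := Complex.ofReal_ne_zero.2 hμ.ne'
  have h := c.der_tan γ κ μ i hl
  rw [HI.der_const_succ, smul_zero, zero_add] at h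
  have h1 : der b (s + 2) (l + 3) (c.x.2.1 i.castSucc) =
      -((μ : ℂ)⁻¹ • (der b s (l + 1) ((c.y γ κ μ).1 i.castSucc) -
        c.d i • der b (s + 1) (l + 1) c.x.1)) +
      (((c.lam : ℂ) ^ 2) • der b (s + 2) (l + 1) (c.x.2.1 i.castSucc) -
        c.d i • der b (s + 1) (l + 1) (fiberDiv c.d c.x)) := by
    rw [h, sub_right_comm, sub_self, zero_sub, smul_neg, neg_neg, smul_smul, inv_mul_cancel₀ hμ',
      one_smul]
    module
  rw [h1]
  have hd : ∀ w : L2I b ℂ, ‖c.d i • w‖ ≤ c.lam * ‖w‖ := fun w => by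
    rw [norm_smul]; exact mul_le_mul_of_nonneg_right (c.norm_d_le i) (norm_nonneg _)
  refine (norm_add_le _ _).trans (add_le_add ?_ ((norm_sub_le _ _).trans (add_le_add ?_ (hd _))))
  · rw [norm_neg, norm_smul, norm_inv, Complex.norm_real, Real.norm_of_nonneg hμ.le]
    exact mul_le_mul_of_nonneg_left ((norm_sub_le _ _).trans (add_le_add le_rfl (hd _)))
      (inv_nonneg.2 hμ.le)
  · rw [norm_smul, norm_pow, Complex.norm_real, Real.norm_of_nonneg c.lam_pos.le]

theorem der_v_nor (c : FiberConfig b s) {l : ℕ} (hl : l + 1 ≤ s) :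
    ‖der b (s + 2) (l + 3) (c.x.2.1 2)‖ ≤ ‖der b (s + 1) (l + 2) (fiberDiv c.d c.x)‖ +
      c.lam * ‖der b (s + 2) (l + 2) (c.x.2.1 0)‖ + c.lam * ‖der b (s + 2) (l + 2) (c.x.2.1 1)‖ := by
  have h1 : der b (s + 2) (l + 3) (c.x.2.1 2) = der b (s + 1) (l + 2) (fiberDiv c.d c.x) -
      c.d 0 • der b (s + 2) (l + 2) (c.x.2.1 0) - c.d 1 • der b (s + 2) (l + 2) (c.x.2.1 1) := by
    rw [c.der_fiberDiv (by omega)]; abel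
  have hd : ∀ (i : Fin 2) (w : L2I b ℂ), ‖c.d i • w‖ ≤ c.lam * ‖w‖ := fun i w => by
    rw [norm_smul]; exact mul_le_mul_of_nonneg_right (c.norm_d_le i) (norm_nonneg _)
  rw [h1]
  exact (norm_sub_le _ _).trans (add_le_add ((norm_sub_le _ _).trans
    (add_le_add le_rfl (hd _ _))) (hd _ _))

theorem der_p (hμ : 0 < μ) (c : FiberConfig b s) {l : ℕ} (hl : l + 1 ≤ s) :
    ‖der b (s + 1) (l + 2) c.x.1‖ ≤ ‖der b s (l + 1) ((c.y γ κ μ).1 2)‖ +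
      μ * (‖der b (s + 2) (l + 3) (c.x.2.1 2)‖ +
        c.lam ^ 2 * ‖der b (s + 2) (l + 1) (c.x.2.1 2)‖ +
        ‖der b (s + 1) (l + 2) (fiberDiv c.d c.x)‖) := by
  have h1 : der b (s + 1) (l + 2) c.x.1 = der b s (l + 1) ((c.y γ κ μ).1 2) +
      (μ : ℂ) • (der b (s + 2) (l + 3) (c.x.2.1 2) -
        ((c.lam : ℂ) ^ 2) • der b (s + 2) (l + 1) (c.x.2.1 2) +
        der b (s + 1) (l + 2) (fiberDiv c.d c.x)) := by
    rw [c.der_nor γ κ μ hl, sub_add_cancel]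
  rw [h1]
  refine (norm_add_le _ _).trans (add_le_add le_rfl ?_)
  rw [norm_smul, Complex.norm_real, Real.norm_of_nonneg hμ.le]
  refine mul_le_mul_of_nonneg_left ((norm_add_le _ _).trans
    (add_le_add ((norm_sub_le _ _).trans (add_le_add le_rfl (le_of_eq ?_))) le_rfl)) hμ.le
  rw [norm_smul, norm_pow, Complex.norm_real, Real.norm_of_nonneg c.lam_pos.le]

theorem dominated_lam_mul {f g : FiberConfig b s → ℝ} {m : ℕ} (hf : ∀ c, 0 ≤ f c)
    (h : Dominated (fun c => c.Z ^ (m + 1) * f c) g) :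
    Dominated (fun c => c.Z ^ m * (c.lam * f c)) g := by
  refine Dominated.of_le_of (fun c => ?_) (Dominated.const_mul (c := 7) (by norm_num) h)
  have := c.Z_pos; have := hf c
  calc _ ≤ c.Z ^ m * ((7 * c.Z) * f c) := by have := c.lam_le; gcongr
    _ = _ := by rw [pow_succ]; ring

theorem dominated_lam_sq_mul {f g : FiberConfig b s → ℝ} {m : ℕ} (hf : ∀ c, 0 ≤ f c)
    (h : Dominated (fun c => c.Z ^ (m + 2) * f c) g) :
    Dominated (fun c => c.Z ^ m * (c.lam ^ 2 * f c)) g := by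
  refine Dominated.of_le_of (fun c => le_of_eq ?_)
    (dominated_lam_mul (f := fun c => c.lam * f c) (m := m)
      (fun c => mul_nonneg c.lam_pos.le (hf c)) (dominated_lam_mul (m := m + 1) hf h))
  ring

/-- Bootstrapping in the number of vertical derivatives. At each level the tangential velocity comes
from the momentum equations, then the normal velocity from the divergence, and finally the pressure
from the normal momentum equation. A factor λ always replaces one vertical derivative and is bounded
by 7Z. -/
theorem dominated_higher (hb : 0 < b) (hγ : 0 < γ) (hκ : 0 < κ) (hμ : 0 < μ) (l : ℕ) : l ≤ s →
    (∀ i : Fin 3, ∀ j ≤ l + 2, Dominated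
      (fun c : FiberConfig b s => c.Z ^ (s + 2 - j) * ‖der b (s + 2) j (c.x.2.1 i)‖)
      fun c => c.Y γ κ μ) ∧
    (∀ j ≤ l + 1, Dominated
      (fun c : FiberConfig b s => c.Z ^ (s + 1 - j) * ‖der b (s + 1) j c.x.1‖)
      fun c => c.Y γ κ μ) := by
  induction l with
  | zero =>
    refine fun _ => ⟨fun i j hj => dominated_velocity_basic hb hγ hμ i hj, fun j hj => ?_⟩
    interval_cases j
    · exact dominated_p_zero hb hγ hκ hμ
    · refine Dominated.of_le_of (fun c => le_of_eq ?_) (dominated_P_one hb hγ hμ)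
      rw [c.der_P_succ γ 0, Nat.add_sub_cancel]
  | succ l ih =>
    intro hl
    obtain ⟨hv, hp⟩ := ih (by omega)
    -- Naming the remaining order n turns the truncated differences in the exponents of Z into
    -- honest powers.
    obtain ⟨n, rfl⟩ : ∃ n, s = n + (l + 1) := ⟨s - (l + 1), by omega⟩
    have hF : ∀ i : Fin 3, Dominated (fun c : FiberConfig b (n + (l + 1)) =>
        c.Z ^ n * ‖der b (n + (l + 1)) (l + 1) ((c.y γ κ μ).1 i)‖) fun c => c.Y γ κ μ := fun i =>
      Dominated.of_le fun c => by
        have := c.F_le γ κ μ i (j := l + 1) (by omega)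
        rwa [show n + (l + 1) - (l + 1) = n by omega] at this
    have hg1 : Dominated (fun c : FiberConfig b (n + (l + 1)) =>
        c.Z ^ (n + 1) * ‖der b (n + (l + 1) + 1) (l + 1) (fiberDiv c.d c.x)‖)
        fun c => c.Y γ κ μ := Dominated.of_le fun c => by
        have := c.g_le γ κ μ (j := l + 1) (by omega)
        rwa [show n + (l + 1) + 1 - (l + 1) = n + 1 by omega] at this
    have hg2 : Dominated (fun c : FiberConfig b (n + (l + 1)) =>
        c.Z ^ n * ‖der b (n + (l + 1) + 1) (l + 2) (fiberDiv c.d c.x)‖)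
        fun c => c.Y γ κ μ := Dominated.of_le fun c => by
        have := c.g_le γ κ μ (j := l + 2) (by omega)
        rwa [show n + (l + 1) + 1 - (l + 2) = n by omega] at this
    have hp1 := hp (l + 1) (by omega)
    rw [show n + (l + 1) + 1 - (l + 1) = n + 1 by omega] at hp1
    have hv1 : ∀ i, Dominated (fun c : FiberConfig b (n + (l + 1)) =>
        c.Z ^ (n + 2) * ‖der b (n + (l + 1) + 2) (l + 1) (c.x.2.1 i)‖) fun c => c.Y γ κ μ := by
      intro i
      have := hv i (l + 1) (by omega)
      rwa [show n + (l + 1) + 2 - (l + 1) = n + 2 by omega] at this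
    have hv2 : ∀ i, Dominated (fun c : FiberConfig b (n + (l + 1)) =>
        c.Z ^ (n + 1) * ‖der b (n + (l + 1) + 2) (l + 2) (c.x.2.1 i)‖) fun c => c.Y γ κ μ := by
      intro i
      have := hv i (l + 2) (by omega)
      rwa [show n + (l + 1) + 2 - (l + 2) = n + 1 by omega] at this
    have hv3 : ∀ i, Dominated (fun c : FiberConfig b (n + (l + 1)) =>
        c.Z ^ n * ‖der b (n + (l + 1) + 2) (l + 3) (c.x.2.1 i)‖) fun c => c.Y γ κ μ := by
      have htan : ∀ i : Fin 2, Dominated (fun c : FiberConfig b (n + (l + 1)) =>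
          c.Z ^ n * ‖der b (n + (l + 1) + 2) (l + 3) (c.x.2.1 i.castSucc)‖)
          fun c => c.Y γ κ μ := by
        intro i
        refine Dominated.of_le_of (fun c => ?_) (Dominated.add
          (Dominated.const_mul (inv_nonneg.2 hμ.le) (Dominated.add (hF i.castSucc)
            (dominated_lam_mul (m := n) (fun c => norm_nonneg _) hp1)))
          (Dominated.add (dominated_lam_sq_mul (m := n) (fun c => norm_nonneg _) (hv1 i.castSucc))
            (dominated_lam_mul (m := n) (fun c => norm_nonneg _) hg1)))
        refine (mul_le_mul_of_nonneg_left (c.der_v_tan (γ := γ) (κ := κ) hμ i (by omega))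
          (pow_pos c.Z_pos n).le).trans_eq ?_
        ring
      have hnor : Dominated (fun c : FiberConfig b (n + (l + 1)) =>
          c.Z ^ n * ‖der b (n + (l + 1) + 2) (l + 3) (c.x.2.1 2)‖)
          fun c => c.Y γ κ μ := by
        refine Dominated.of_le_of (fun c => ?_) (Dominated.add (Dominated.add hg2
          (dominated_lam_mul (m := n) (fun c => norm_nonneg _) (hv2 0)))
          (dominated_lam_mul (m := n) (fun c => norm_nonneg _) (hv2 1)))
        refine (mul_le_mul_of_nonneg_left (c.der_v_nor (by omega))
          (pow_pos c.Z_pos n).le).trans_eq ?_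
        ring
      intro i
      fin_cases i
      · exact htan 0
      · exact htan 1
      · exact hnor
    have hp2 : Dominated (fun c : FiberConfig b (n + (l + 1)) =>
        c.Z ^ n * ‖der b (n + (l + 1) + 1) (l + 2) c.x.1‖) fun c => c.Y γ κ μ := by
      refine Dominated.of_le_of (fun c => ?_) (Dominated.add (hF 2) (Dominated.const_mul hμ.le
        (Dominated.add (Dominated.add (hv3 2)
          (dominated_lam_sq_mul (m := n) (fun c => norm_nonneg _) (hv1 2))) hg2)))
      refine (mul_le_mul_of_nonneg_left (c.der_p (γ := γ) (κ := κ) hμ (by omega))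
        (pow_pos c.Z_pos n).le).trans_eq ?_
      ring
    refine ⟨fun i j hj => ?_, fun j hj => ?_⟩
    · rcases Nat.lt_or_ge j (l + 3) with h | h
      · exact hv i j (by omega)
      · obtain rfl : j = l + 3 := by omega
        rw [show n + (l + 1) + 2 - (l + 3) = n by omega]
        exact hv3 i
    · rcases Nat.lt_or_ge j (l + 2) with h | h
      · exact hp j (by omega)
      · obtain rfl : j = l + 2 := by omega
        rw [show n + (l + 1) + 1 - (l + 2) = n by omega]
        exact hp2

theorem dominated_χ (hb : 0 < b) (hγ : 0 < γ) (hκ : 0 < κ) (hμ : 0 < μ) (j : Fin 2) :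
    Dominated (fun c : FiberConfig b s => Real.sqrt c.Z * c.Z ^ (s + 1) * ‖c.x.2.2 j‖)
      fun c => c.Y γ κ μ := by
  refine Dominated.of_le_of (fun c => ?_) (Dominated.add (dominated_η hb hγ hκ hμ)
    (Dominated.of_le fun c => c.ψ_le γ κ μ))
  have := c.Z_pos
  rw [c.χ_eq γ κ μ j, ← mul_add]
  refine mul_le_mul_of_nonneg_left ((norm_add_le _ _).trans (add_le_add ?_ (c.norm_rot_le γ κ μ j)))
    (by positivity)
  rw [norm_mul]
  exact mul_le_mul_of_nonneg_right (c.norm_d_le j) (norm_nonneg _)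

/-- The a priori estimate on the fibers. -/
theorem dominated_normX (hb : 0 < b) (hγ : 0 < γ) (hκ : 0 < κ) (hμ : 0 < μ) :
    Dominated (fun c : FiberConfig b s => normX c.Z c.x) fun c => c.Y γ κ μ := by
  obtain ⟨hv, hp⟩ := dominated_higher (s := s) hb hγ hκ hμ s le_rfl
  have hY : ∀ c : FiberConfig b s, 0 ≤ c.Y γ κ μ := fun c => c.Y_nonneg γ κ μ
  refine Dominated.add (Dominated.add ?_ ?_) ?_
  · exact Dominated.sum _ (fun j hj => hp j (by have := Finset.mem_range.1 hj; omega)) hY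
  · exact Dominated.sum _ (fun i _ => Dominated.sum _
      (fun j hj => hv i j (by have := Finset.mem_range.1 hj; omega)) hY) hY
  · refine Dominated.of_le_of (fun c => le_of_eq (Finset.mul_sum _ _ _))
      (Dominated.sum _ (fun j _ => dominated_χ hb hγ hκ hμ j) hY)

end FiberConfig
end
end CurlLayer

namespace CurlLayer

noncomputable section

/-! ### Linear ordinary differential equations on the interval -/

section ODE

variable {V : Type} [NormedAddCommGroup V] [InnerProductSpace ℂ V] [CompleteSpace V]

/-- Variation of constants, Y(t) = e^{tA}(y₀ + ∫₀ᵗ e^{-τA}R). Since R is only square integrable, the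
equation is verified in integrated form: e^{tA} is the primitive of Ae^{tA}, and the bilinear
integration by parts differentiates the product. -/
theorem exists_ode_solution_L2 {b : ℝ} (hb : 0 < b) (A : V →L[ℂ] V) (R : L2I b V) (y₀ : V) :
    ∃ Y : L2I b V, Y =ᵐ[volume.restrict (Ioo 0 b)]
      fun y => y₀ + ∫ t in (0 : ℝ)..y, (mapI b A Y + R : L2I b V) t := by
  let _ : NormedAlgebra ℚ (V →L[ℂ] V) := NormedAlgebra.restrictScalars ℚ ℝ _
  let E : ℝ → V →L[ℂ] V := fun t => NormedSpace.exp (t • A)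
  have hE : ∀ t, HasDerivAt E (A * E t) t := fun t => hasDerivAt_exp_smul_const' A t
  have hEc : Continuous E := continuous_iff_continuousAt.2 fun t => (hE t).continuousAt
  have hE0 : E 0 = 1 := by simp [E]
  have hEE : ∀ t, E t * E (-t) = 1 := fun t => by
    simp only [E, neg_smul]
    rw [← NormedSpace.exp_add_of_commute (Commute.neg_right (Commute.refl _)), add_neg_cancel,
      NormedSpace.exp_zero]
  let z : ℝ → V := fun t => E (-t) (R t)
  have hz : IntegrableOn z (Ioo 0 b) := by
    obtain ⟨C, hC⟩ := (isCompact_Icc (a := (0 : ℝ)) (b := b)).exists_bound_of_continuousOn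
      (f := fun t => E (-t)) (by fun_prop)
    refine Integrable.mono' ((L2I.integrableOn R).norm.const_mul C) ?_ ?_
    · exact (ContinuousLinearMap.apply ℂ V).flip.aestronglyMeasurable_comp₂
        (by fun_prop : Continuous fun t => E (-t)).aestronglyMeasurable
        (Lp.aestronglyMeasurable R)
    · refine (ae_restrict_iff' measurableSet_Ioo).2 (.of_forall fun t ht => ?_)
      exact ((E (-t)).le_opNorm _).trans
        (mul_le_mul_of_nonneg_right (hC t (Ioo_subset_Icc_self ht)) (norm_nonneg _))
  let Y : ℝ → V := fun t => E t (y₀ + ∫ τ in (0 : ℝ)..t, z τ)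
  have hYc : ContinuousOn Y (Icc 0 b) :=
    hEc.continuousOn.clm_apply (continuousOn_const.add (continuousOn_primitive_Icc hb.le hz))
  have hYm := memLp_of_continuousOn hYc
  have key : ∀ y ∈ Ioo 0 b, Y y = y₀ + ∫ t in (0 : ℝ)..y, (A (Y t) + R t) := by
    intro y hy
    have h1 : ∀ t, (1 : V →L[ℂ] V) + ∫ τ in (0 : ℝ)..t, A * E τ = E t := by
      intro t
      rw [intervalIntegral.integral_eq_sub_of_hasDerivAt (fun τ _ => hE τ)
        ((continuous_const.mul hEc).intervalIntegrable _ _), hE0]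
      abel
    have h2 := integral_bilin_primitive (ContinuousLinearMap.restrictScalarsL ℂ V V ℝ ℝ) hy.1.le
      (w := fun τ => A * E τ) (z := z)
      (((continuous_const.mul hEc).integrableOn_Icc (a := 0) (b := y)).mono_set Ioo_subset_Icc_self)
      (hz.mono_set (Ioo_subset_Ioo_right hy.2.le)) 1 y₀
    simp only [h1] at h2
    rw [integral_Ioo_eq_intervalIntegral hy.1.le] at h2
    have h3 : ∫ t in (0 : ℝ)..y, (A (Y t) + R t) = Y y - y₀ := by
      refine Eq.trans ?_ h2
      refine intervalIntegral.integral_congr fun t _ => ?_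
      change A (E t _) + R t = (A * E t) _ + E t (E (-t) (R t))
      rw [← mul_apply_eq_comp (E t), hEE]
      rfl
    rw [h3]; abel
  refine ⟨hYm.toLp Y, ?_⟩
  filter_upwards [hYm.coeFn_toLp, ae_restrict_mem measurableSet_Ioo] with y hy hyb
  rw [hy, key y hyb]
  congr 1
  rw [← integral_Ioo_eq_intervalIntegral hyb.1.le, ← integral_Ioo_eq_intervalIntegral hyb.1.le]
  have h4 : (mapI b A (hYm.toLp Y) + R : L2I b V) =ᵐ[volume.restrict (Ioo 0 b)]
      fun t => A (Y t) + R t := by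
    filter_upwards [Lp.coeFn_add (mapI b A (hYm.toLp Y)) R, coeFn_mapI A (hYm.toLp Y),
      hYm.coeFn_toLp] with t h1 h2 h3
    rw [h1, Pi.add_apply, h2, h3]
  exact (integral_congr_ae
    (ae_restrict_of_ae_restrict_of_subset (Ioo_subset_Ioo_right hyb.2.le) h4)).symm

theorem exists_ode_solution {b : ℝ} (hb : 0 < b) {s : ℕ} (A : V →L[ℂ] V) (R : HI b s V) (y₀ : V) :
    ∃ Y : HI b (s + 1) V, HI.deriv b s Y = HI.map b s A (HI.incl b s Y) + R ∧
      trBot b s Y = y₀ := by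
  obtain ⟨Y, hY⟩ := exists_ode_solution_L2 hb A (der b s 0 R) y₀
  -- The derivatives of the solution are prescribed by differentiating the equation: W_{j+1} = A W_j
  -- + R^{(j)}.
  let W : ℕ → L2I b V := fun j => Nat.rec Y (fun j w => mapI b A w + der b s j R) j
  have hW : ∀ j ≤ s, IsWeakDerivI b (W j) (W (j + 1)) := by
    intro j
    induction j with
    | zero => exact fun _ => isWeakDerivI_of_primitive hb hY
    | succ j ih =>
      intro hj
      exact ((ih (by omega)).map A).add (isWeakDerivI_der (by omega) R)
  have hW' : ∀ j < s + 1, IsWeakDerivI b (W j) (W (j + 1)) := fun j hj => hW j (by omega)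
  refine ⟨HI.mk W hW', HI.ext_der fun j hj => ?_, trBot_eq_of_primitive hb ?_⟩
  · rw [HI.der_deriv hj, HI.der_mk W hW' (by omega), map_add, HI.der_map, HI.der_incl hj,
      HI.der_mk W hW' (by omega)]
  · rw [HI.der_mk W hW' (by omega), HI.der_mk W hW' (by omega)]
    exact hY

/-- A function with `v ∈ H^{k+1}` and `v' ∈ H^{k+1}` is in `H^{k+2}`. -/
theorem HI.exists_deriv_eq {b : ℝ} {k : ℕ} (v w : HI b (k + 1) V)
    (h : HI.deriv b k v = HI.incl b k w) :
    ∃ u : HI b (k + 2) V, HI.incl b (k + 1) u = v ∧ HI.deriv b (k + 1) u = w := by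
  have hd : ∀ j ≤ k, der b (k + 1) (j + 1) v = der b (k + 1) j w := fun j hj => by
    rw [← HI.der_deriv hj, h, HI.der_incl hj]
  let W : ℕ → L2I b V := fun j => if j = 0 then der b (k + 1) 0 v else der b (k + 1) (j - 1) w
  have hW : ∀ j < k + 2, IsWeakDerivI b (W j) (W (j + 1)) := by
    intro j hj
    cases j with
    | zero =>
      simp only [W, if_true, if_false, zero_add, Nat.sub_self, one_ne_zero]
      rw [← hd 0 (Nat.zero_le _)]
      exact isWeakDerivI_der (by omega) v
    | succ j =>
      simp only [W, Nat.succ_ne_zero, if_false, Nat.add_sub_cancel]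
      exact isWeakDerivI_der (by omega) w
  refine ⟨HI.mk W hW, HI.ext_der fun j hj => ?_, HI.ext_der fun j hj => ?_⟩
  · rw [HI.der_incl hj, HI.der_mk W hW (by omega)]
    cases j with
    | zero => rfl
    | succ j =>
      simp only [W, Nat.succ_ne_zero, if_false, Nat.add_sub_cancel]
      rw [hd j (by omega)]
  · rw [HI.der_deriv hj, HI.der_mk W hW (by omega)]
    simp only [W, Nat.succ_ne_zero, if_false, Nat.add_sub_cancel]

end ODE

/-! ### Components of vector valued functions -/

section Components

variable {b : ℝ} {k : ℕ} {n : ℕ}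

/-- The `i`-th coordinate on `ℂⁿ`. -/
abbrev coord {n : ℕ} (i : Fin n) : Cn n →L[ℂ] ℂ := EuclideanSpace.proj i

/-- The `i`-th coordinate axis of `ℂⁿ`. -/
def axis {n : ℕ} (i : Fin n) : ℂ →L[ℂ] Cn n :=
  ContinuousLinearMap.toSpanSingleton ℂ (EuclideanSpace.single i 1)

theorem coord_axis (i j : Fin n) (z : ℂ) : coord i (axis j z) = if i = j then z else 0 := by
  simp [axis, coord]

theorem sum_axis_coord (z : Cn n) : ∑ i, axis i (coord i z) = z := by
  ext j
  have : (∑ i, axis i (coord i z)).ofLp j = coord j (∑ i, axis i (coord i z)) := rfl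
  rw [this, map_sum]
  simp only [coord_axis]
  simp [coord]

variable {V W U : Type} [NormedAddCommGroup V] [InnerProductSpace ℂ V] [CompleteSpace V]
  [NormedAddCommGroup W] [InnerProductSpace ℂ W] [CompleteSpace W]
  [NormedAddCommGroup U] [InnerProductSpace ℂ U] [CompleteSpace U]

theorem mapI_comp (A : W →L[ℂ] U) (B : V →L[ℂ] W) (w : L2I b V) :
    mapI b A (mapI b B w) = mapI b (A.comp B) w := by
  apply Lp.ext
  filter_upwards [coeFn_mapI A (mapI b B w), coeFn_mapI B w, coeFn_mapI (A.comp B) w]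
    with y h1 h2 h3
  rw [h1, h2, h3]; rfl

theorem mapI_id (w : L2I b V) : mapI b (ContinuousLinearMap.id ℂ V) w = w := by
  apply Lp.ext
  filter_upwards [coeFn_mapI (ContinuousLinearMap.id ℂ V) w] with y h1
  rw [h1]; rfl

theorem mapI_add (A B : V →L[ℂ] W) (w : L2I b V) :
    mapI b (A + B) w = mapI b A w + mapI b B w := by
  rw [mapI, ContinuousLinearMap.add_compLpL]; rfl

theorem mapI_smul (c : ℂ) (A : V →L[ℂ] W) (w : L2I b V) :
    mapI b (c • A) w = c • mapI b A w := by
  rw [mapI, ContinuousLinearMap.smul_compLpL]; rfl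

theorem HI.map_comp (A : W →L[ℂ] U) (B : V →L[ℂ] W) (w : HI b k V) :
    HI.map b k A (HI.map b k B w) = HI.map b k (A.comp B) w :=
  HI.ext_der fun j _ => by simp only [HI.der_map, mapI_comp]

theorem HI.map_id (w : HI b k V) : HI.map b k (ContinuousLinearMap.id ℂ V) w = w :=
  HI.ext_der fun j _ => by simp only [HI.der_map, mapI_id]

theorem HI.map_add_left (A B : V →L[ℂ] W) (w : HI b k V) :
    HI.map b k (A + B) w = HI.map b k A w + HI.map b k B w :=
  HI.ext_der fun j _ => by simp only [HI.der_map, mapI_add, map_add]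

theorem HI.map_smul_left (c : ℂ) (A : V →L[ℂ] W) (w : HI b k V) :
    HI.map b k (c • A) w = c • HI.map b k A w :=
  HI.ext_der fun j _ => by rw [HI.der_map, mapI_smul, map_smul, HI.der_map]

theorem HI.map_zero_left (w : HI b k V) : HI.map b k (0 : V →L[ℂ] W) w = 0 := by
  have := HI.map_smul_left (0 : ℂ) (0 : V →L[ℂ] W) w
  rwa [zero_smul, zero_smul] at this

theorem HI.map_sum_left {ι : Type*} (t : Finset ι) (A : ι → V →L[ℂ] W) (w : HI b k V) :
    HI.map b k (∑ i ∈ t, A i) w = ∑ i ∈ t, HI.map b k (A i) w := by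
  classical
  induction t using Finset.induction_on with
  | empty => simp [HI.map_zero_left]
  | insert i t hi ih => rw [Finset.sum_insert hi, Finset.sum_insert hi, HI.map_add_left, ih]

theorem HI.map_deriv (A : V →L[ℂ] W) (w : HI b (k + 1) V) :
    HI.map b k A (HI.deriv b k w) = HI.deriv b k (HI.map b (k + 1) A w) :=
  HI.ext_der fun j hj => by rw [HI.der_map, HI.der_deriv hj, HI.der_deriv hj, HI.der_map]

theorem HI.map_incl (A : V →L[ℂ] W) (w : HI b (k + 1) V) :
    HI.map b k A (HI.incl b k w) = HI.incl b k (HI.map b (k + 1) A w) :=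
  HI.ext_der fun j hj => by rw [HI.der_map, HI.der_incl hj, HI.der_incl hj, HI.der_map]

/-- The function with given components. -/
def HI.ofComponents (b : ℝ) (k n : ℕ) : (Fin n → HI b k ℂ) →L[ℂ] HI b k (Cn n) :=
  ∑ i, (HI.map b k (axis i)).comp (ContinuousLinearMap.proj i)

theorem HI.ofComponents_apply (w : Fin n → HI b k ℂ) :
    HI.ofComponents b k n w = ∑ i, HI.map b k (axis i) (w i) := by
  simp [HI.ofComponents]

theorem coord_comp_axis (i j : Fin n) :
    (coord i).comp (axis j) = if i = j then ContinuousLinearMap.id ℂ ℂ else 0 := by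
  ext
  simp only [ContinuousLinearMap.comp_apply, coord_axis]
  split_ifs <;> rfl

@[simp] theorem HI.map_coord_ofComponents (i : Fin n) (w : Fin n → HI b k ℂ) :
    HI.map b k (coord i) (HI.ofComponents b k n w) = w i := by
  rw [HI.ofComponents_apply, map_sum, Finset.sum_eq_single i]
  · rw [HI.map_comp, coord_comp_axis, if_pos rfl, HI.map_id]
  · intro j _ hj
    rw [HI.map_comp, coord_comp_axis, if_neg hj.symm, HI.map_zero_left]
  · simp

theorem HI.ofComponents_map_coord (w : HI b k (Cn n)) :
    HI.ofComponents b k n (fun i => HI.map b k (coord i) w) = w := by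
  rw [HI.ofComponents_apply]
  simp only [HI.map_comp]
  rw [← HI.map_sum_left]
  have : ∑ i : Fin n, (axis i).comp (coord i) = ContinuousLinearMap.id ℂ (Cn n) := by
    ext1 z
    simpa [sum_apply] using sum_axis_coord z
  rw [this, HI.map_id]

end Components

end
end CurlLayer

namespace CurlLayer

noncomputable section

/-! ### Unique solvability of the fiber problem at nonzero frequencies. -/

section Solve

variable {b : ℝ} {s : ℕ}

/-- A linear system of ordinary differential equations, in components. -/
theorem exists_ode_solution_components (hb : 0 < b) {n : ℕ} (T : Fin n → Cn n →L[ℂ] ℂ)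
    (r : Fin n → HI b s ℂ) (a : Fin n → ℂ) :
    ∃ Y : HI b (s + 1) (Cn n), ∀ i,
      HI.deriv b s (HI.map b (s + 1) (coord i) Y) = HI.incl b s (HI.map b (s + 1) (T i) Y) + r i ∧
      trBot b s (HI.map b (s + 1) (coord i) Y) = a i := by
  obtain ⟨Y, hY, h0⟩ := exists_ode_solution hb (∑ i, (axis i).comp (T i))
    (HI.ofComponents b s n r) (WithLp.toLp 2 a)
  refine ⟨Y, fun i => ⟨?_, ?_⟩⟩
  · have h : (coord i).comp (∑ j, (axis j).comp (T j)) = T i := by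
      ext1 z
      simp only [ContinuousLinearMap.comp_apply, sum_apply, map_sum, coord_axis]
      simp
    rw [← HI.map_deriv, hY, map_add, HI.map_comp, h, HI.map_coord_ofComponents, HI.map_incl]
  · rw [trBot_map, h0]; rfl

/-- Reduction to a first-order system with six unknowns. The divergence equation gives v₃' and hence
v₃'', so the normal momentum equation becomes first order in p and v₃'(0) is not free. The free
parameters are a ∈ ℂ³ and χ ∈ ℂ². -/
theorem exists_fiber_solution (hb : 0 < b) {γ κ μ : ℝ} (hμ : 0 < μ) (d : Fin 2 → ℂ)
    (F : Fin 3 → HI b s ℂ) (g : HI b (s + 1) ℂ) (χ : Fin 2 → ℂ) (a : Fin 3 → ℂ) :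
    ∃ x : Unknowns b s, (∀ i, trBot b (s + 1) (x.2.1 i) = 0) ∧ (fiberSys b γ κ μ s d x).1 = F ∧
      (fiberSys b γ κ μ s d x).2.1 = g ∧ x.2.2 = χ ∧
      (∀ j : Fin 2, trBot b s (HI.deriv b (s + 1) (x.2.1 j.castSucc)) = a j.castSucc) ∧
      trBot b s x.1 = a 2 := by
  have hμ' : (μ : ℂ) ≠ 0 := Complex.ofReal_ne_zero.2 hμ.ne'
  set D : ℂ := d 0 * d 0 + d 1 * d 1 with hD
  -- Coordinates 0 to 2 are the velocity, 3 and 4 the derivatives of the tangential velocity, 5 the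
  -- pressure. In the last equation g' has the factor 2μ: one μ from v₃'' = g' - d·v' and one from ∇
  -- div u.
  obtain ⟨Y, hY⟩ := exists_ode_solution_components (s := s) hb
    (n := 6) ![coord 3, coord 4, -(d 0 • coord 0 + d 1 • coord 1),
      ((μ : ℂ)⁻¹ * d 0) • coord 5 - D • coord 0, ((μ : ℂ)⁻¹ * d 1) • coord 5 - D • coord 1,
      (μ * D) • coord 2 - (μ : ℂ) • (d 0 • coord 3 + d 1 • coord 4)]
    ![0, 0, HI.incl b s g,
      (μ : ℂ)⁻¹ • ((γ : ℂ) • HI.const b s ℂ (χ 0) - F 0) - d 0 • HI.incl b s g,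
      (μ : ℂ)⁻¹ • ((γ : ℂ) • HI.const b s ℂ (χ 1) - F 1) - d 1 • HI.incl b s g,
      F 2 + (2 * μ : ℂ) • HI.deriv b s g] ![0, 0, 0, a 0, a 1, a 2]
  set y : Fin 6 → HI b (s + 1) ℂ := fun i => HI.map b (s + 1) (coord i) Y with hy
  have neg_left : ∀ A : Cn 6 →L[ℂ] ℂ, HI.map b (s + 1) (-A) Y = -HI.map b (s + 1) A Y := fun A => by
    rw [← neg_one_smul ℂ A, HI.map_smul_left, neg_one_smul]
  have sub_left : ∀ A B : Cn 6 →L[ℂ] ℂ, HI.map b (s + 1) (A - B) Y =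
      HI.map b (s + 1) A Y - HI.map b (s + 1) B Y := fun A B => by
    rw [sub_eq_add_neg, HI.map_add_left, neg_left, ← sub_eq_add_neg]
  have e0 : HI.deriv b s (y 0) = HI.incl b s (y 3) := by simpa using (hY 0).1
  have e1 : HI.deriv b s (y 1) = HI.incl b s (y 4) := by simpa using (hY 1).1
  have e2 : HI.deriv b s (y 2) = HI.incl b s (g - (d 0 • y 0 + d 1 • y 1)) := by
    refine (hY 2).1.trans ?_
    simp only [Matrix.cons_val, neg_left, HI.map_add_left, HI.map_smul_left, map_sub, map_add,
      map_smul, map_neg, hy]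
    module
  have e3 := (hY 3).1
  have e4 := (hY 4).1
  have e5 := (hY 5).1
  simp only [Matrix.cons_val, sub_left, HI.map_add_left, HI.map_smul_left, map_sub, map_add,
      map_smul] at e3 e4 e5
  obtain ⟨v0, hv0, hw0⟩ := HI.exists_deriv_eq _ _ e0
  obtain ⟨v1, hv1, hw1⟩ := HI.exists_deriv_eq _ _ e1
  obtain ⟨v2, hv2, hw2⟩ := HI.exists_deriv_eq _ _ e2
  have hdiv : fiberDiv d ((y 5, ![v0, v1, v2], χ) : Unknowns b s) = g := by
    simp only [fiberDiv, Matrix.cons_val, hv0, hv1, hw2]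
    module
  refine ⟨(y 5, ![v0, v1, v2], χ), ?_, ?_, ?_, rfl, ?_, ?_⟩
  · intro i
    fin_cases i
    · change trBot b (s + 1) v0 = 0
      rw [← trBot_incl, hv0]; exact (hY 0).2
    · change trBot b (s + 1) v1 = 0
      rw [← trBot_incl, hv1]; exact (hY 1).2
    · change trBot b (s + 1) v2 = 0
      rw [← trBot_incl, hv2]; exact (hY 2).2
  · funext i
    fin_cases i
    · refine (fiberSys_tan d _ 0).trans ?_
      rw [hdiv]
      simp only [Fin.castSucc_zero, Matrix.cons_val, hv0, hw0]
      change _ + d 0 • HI.incl b s (y 5) - _ = F 0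
      rw [e3, smul_add, smul_add, smul_add, smul_sub, smul_sub, smul_smul, smul_smul, smul_smul]
      simp only [← mul_assoc, mul_inv_cancel₀ hμ', one_mul, one_smul, hy]
      module
    · refine (fiberSys_tan d _ 1).trans ?_
      rw [hdiv]
      simp only [Fin.castSucc_one, Matrix.cons_val, hv1, hw1]
      change _ + d 1 • HI.incl b s (y 5) - _ = F 1
      rw [e4, smul_add, smul_add, smul_add, smul_sub, smul_sub, smul_smul, smul_smul, smul_smul]
      simp only [← mul_assoc, mul_inv_cancel₀ hμ', one_mul, one_smul, hy]
      module
    · refine (fiberSys_nor d _).trans ?_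
      rw [hdiv]
      simp only [Matrix.cons_val, hv2, hw2, map_sub, map_add, map_smul, e0, e1]
      change HI.deriv b s (y 5) - _ = F 2
      rw [e5]
      simp only [hy]
      module
  · exact (fiberSys_div d _).trans hdiv
  · intro j
    fin_cases j
    · change trBot b s (HI.deriv b (s + 1) v0) = _
      rw [hw0]; exact (hY 3).2
    · change trBot b s (HI.deriv b (s + 1) v1) = _
      rw [hw1]; exact (hY 4).2
  · exact (hY 5).2

/-- The unknowns whose velocity vanishes on the bottom. -/
def noSlip (b : ℝ) (s : ℕ) : Submodule ℂ (Unknowns b s) where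
  carrier := {x | ∀ i, trBot b (s + 1) (x.2.1 i) = 0}
  zero_mem' := fun i => by simp
  add_mem' := fun h h' i => by
    have h1 := h i
    have h2 := h' i
    simp only [Prod.snd_add, Prod.fst_add, Pi.add_apply, map_add, h1, h2, add_zero]
  smul_mem' := fun c x h i => by
    have h1 := h i
    simp only [Prod.smul_snd, Prod.smul_fst, Pi.smul_apply, map_smul, h1, smul_zero]

theorem isClosed_noSlip (b : ℝ) (s : ℕ) : IsClosed (noSlip b s : Set (Unknowns b s)) := by
  have : (noSlip b s : Set (Unknowns b s)) = ⋂ i, {x | trBot b (s + 1) (x.2.1 i) = 0} := by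
    ext x; simp [noSlip]
  rw [this]
  exact isClosed_iInter fun i => isClosed_eq (by fun_prop) continuous_const

instance (b : ℝ) (s : ℕ) : CompleteSpace (noSlip b s) :=
  (isClosed_noSlip b s).completeSpace_coe

/-- The system on a fiber for velocities that vanish on the bottom. -/
def fiberOp (b γ κ μ : ℝ) (s : ℕ) (d : Fin 2 → ℂ) : noSlip b s →L[ℂ] FiberData b s :=
  (fiberSys b γ κ μ s d).comp (noSlip b s).subtypeL

theorem eq_zero_of_wnorm {k : ℕ} {Z : ℝ} (hZ : 0 < Z) {w : HI b k ℂ} (h : wnorm Z w ≤ 0) : w = 0 := by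
  refine HI.ext_der fun j hj => ?_
  have h1 := (le_wnorm hZ.le w hj).trans h
  have h2 : ‖der b k j w‖ ≤ 0 := by
    by_contra hn
    push Not at hn
    have : 0 < Z ^ (k - j) * ‖der b k j w‖ := by positivity
    linarith
  rw [norm_le_zero_iff.1 h2, map_zero]

theorem eq_zero_of_normX {Z : ℝ} (hZ : 0 < Z) {x : Unknowns b s} (h : normX Z x ≤ 0) : x = 0 := by
  have h1 := wnorm_nonneg hZ.le x.1
  have h2 : ∀ i, 0 ≤ wnorm Z (x.2.1 i) := fun i => wnorm_nonneg hZ.le _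
  have h2' := Finset.sum_nonneg fun i (_ : i ∈ Finset.univ) => h2 i
  have h3 : 0 ≤ ∑ j, ‖x.2.2 j‖ := Finset.sum_nonneg fun j _ => norm_nonneg _
  have hc : 0 < Real.sqrt Z * Z ^ (s + 1) := mul_pos (Real.sqrt_pos.2 hZ) (pow_pos hZ _)
  have h4 := mul_nonneg hc.le h3
  rw [normX] at h
  have h5 : ∑ j, ‖x.2.2 j‖ ≤ 0 := by
    by_contra hn
    push Not at hn
    have := mul_pos hc hn
    linarith
  refine Prod.ext (eq_zero_of_wnorm hZ (by linarith)) (Prod.ext (funext fun i => ?_)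
    (funext fun j => ?_))
  · refine eq_zero_of_wnorm hZ ?_
    have := Finset.single_le_sum (f := fun i => wnorm Z (x.2.1 i)) (fun i _ => h2 i)
      (Finset.mem_univ i)
    exact this.trans (by linarith)
  · have := Finset.single_le_sum (f := fun j => ‖x.2.2 j‖) (fun i _ => norm_nonneg _)
      (Finset.mem_univ j)
    exact norm_le_zero_iff.1 (this.trans h5)

/-- The a priori estimate for the fiber operator. -/
theorem fiberOp_apriori (hb : 0 < b) {γ κ μ : ℝ} (hγ : 0 < γ) (hκ : 0 < κ) (hμ : 0 < μ) :
    ∃ C : ℝ, 0 ≤ C ∧ ∀ ξ : Plane, ξ ≠ 0 → ∀ x : noSlip b s, normX (bracket ξ) (x : Unknowns b s) ≤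
      C * normY (bracket ξ) (modulus ξ) (fiberOp b γ κ μ s (dsym ξ) x) := by
  obtain ⟨C, hC, h⟩ := FiberConfig.dominated_normX (s := s) hb hγ hκ hμ
  exact ⟨C, hC, fun ξ hξ x => h ⟨ξ, hξ, x.1, x.2⟩⟩

theorem normY_zero (Z lam : ℝ) : normY Z lam (0 : FiberData b s) = 0 := by
  simp [normY, wnorm]

theorem fiberOp_injective (hb : 0 < b) {γ κ μ : ℝ} (hγ : 0 < γ) (hκ : 0 < κ) (hμ : 0 < μ)
    {ξ : Plane} (hξ : ξ ≠ 0) : Function.Injective (fiberOp b γ κ μ s (dsym ξ)) := by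
  obtain ⟨C, hC, h⟩ := fiberOp_apriori (s := s) hb hγ hκ hμ
  rw [injective_iff_map_eq_zero]
  intro x hx
  have := h ξ hξ x
  rw [hx, normY_zero, mul_zero] at this
  exact Subtype.ext (eq_zero_of_normX (bracket_pos ξ) this)

/-- Among no-slip unknowns with zero force and divergence, the initial values with χ fill ℂ³ × ℂ²,
so the dimension is at least five. The boundary data inject this space into ℂ³ × ℂ × ℂ by the a
priori estimate. Both dimensions are five, so every boundary datum is attained, and a particular
solution takes care of force and divergence. -/
theorem fiberOp_surjective (hb : 0 < b) {γ κ μ : ℝ} (hγ : 0 < γ) (hκ : 0 < κ) (hμ : 0 < μ)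
    {ξ : Plane} (hξ : ξ ≠ 0) : Function.Surjective (fiberOp b γ κ μ s (dsym ξ)) := by
  set L := fiberOp b γ κ μ s (dsym ξ) with hL
  let K : Submodule ℂ (noSlip b s) :=
    LinearMap.ker ((LinearMap.fst ℂ _ _).comp (L : noSlip b s →ₗ[ℂ] FiberData b s)) ⊓
    LinearMap.ker ((LinearMap.fst ℂ _ _).comp ((LinearMap.snd ℂ _ _).comp
      (L : noSlip b s →ₗ[ℂ] FiberData b s)))
  let T : K →ₗ[ℂ] (Fin 3 → ℂ) × ℂ × ℂ := ((LinearMap.snd ℂ _ _).comp ((LinearMap.snd ℂ _ _).comp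
      (L : noSlip b s →ₗ[ℂ] FiberData b s))).comp K.subtype
  have hK : ∀ x : K, (L x).1 = 0 ∧ (L x).2.1 = 0 := fun x => x.2
  have hT : Function.Injective T := by
    rw [injective_iff_map_eq_zero]
    intro x hx
    have h1 : L x = 0 := Prod.ext (hK x).1 (Prod.ext (hK x).2 hx)
    exact Subtype.ext ((injective_iff_map_eq_zero L).1 (fiberOp_injective hb hγ hκ hμ hξ) _ h1)
  let I : K →ₗ[ℂ] (Fin 3 → ℂ) × (Fin 2 → ℂ) :=
    { toFun := fun x => (![trBot b s (HI.deriv b (s + 1) (x.1.1.2.1 0)),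
        trBot b s (HI.deriv b (s + 1) (x.1.1.2.1 1)), trBot b s x.1.1.1], x.1.1.2.2)
      map_add' := fun x x' => by
        refine Prod.ext (funext fun i => ?_) rfl
        fin_cases i <;> simp
      map_smul' := fun c x => by
        refine Prod.ext (funext fun i => ?_) rfl
        fin_cases i <;> simp }
  have hI : Function.Surjective I := by
    rintro ⟨a, χ⟩
    obtain ⟨x, h0, h1, h2, h3, h4, h5⟩ := exists_fiber_solution (γ := γ) (κ := κ) hb hμ (dsym ξ)
      (0 : Fin 3 → HI b s ℂ) 0 χ a
    refine ⟨⟨⟨x, h0⟩, h1, h2⟩, Prod.ext (funext fun i => ?_) h3⟩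
    fin_cases i
    · exact h4 0
    · exact h4 1
    · exact h5
  have : FiniteDimensional ℂ K := FiniteDimensional.of_injective T hT
  have hrank : Module.finrank ℂ K = Module.finrank ℂ ((Fin 3 → ℂ) × ℂ × ℂ) := by
    refine le_antisymm (LinearMap.finrank_le_finrank_of_injective hT) ?_
    have h1 := LinearMap.finrank_le_finrank_of_surjective (f := I) hI
    simp only [Module.finrank_prod, Module.finrank_fintype_fun_eq_card, Fintype.card_fin,
      Module.finrank_self] at h1 ⊢
    omega
  have hTs : Function.Surjective T :=
    LinearMap.range_eq_top.1
      (Submodule.eq_top_of_finrank_eq ((LinearMap.finrank_range_of_inj hT).trans hrank))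
  rintro ⟨F, g, t⟩
  obtain ⟨x, h0, h1, h2, -⟩ := exists_fiber_solution (γ := γ) (κ := κ) hb hμ (dsym ξ) F g 0 0
  obtain ⟨z, hz⟩ := hTs (t - (L ⟨x, h0⟩).2.2)
  refine ⟨⟨x, h0⟩ + z, ?_⟩
  have hz' : (L z).2.2 = t - (L ⟨x, h0⟩).2.2 := hz
  rw [map_add]
  refine Prod.ext ?_ (Prod.ext ?_ ?_)
  · rw [Prod.fst_add, (hK z).1, add_zero]; exact h1
  · rw [Prod.snd_add, Prod.fst_add, (hK z).2, add_zero]; exact h2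
  · rw [Prod.snd_add, Prod.snd_add, hz', add_sub_cancel]

end Solve

end
end CurlLayer

namespace CurlLayer

noncomputable section

/-! ### Classes of operator-valued symbols -/

section Symbols

variable {E F G : Type*} [NormedAddCommGroup E] [NormedSpace ℂ E] [NormedAddCommGroup F]
  [NormedSpace ℂ F] [NormedAddCommGroup G] [NormedSpace ℂ G]

/-- The partial derivative of a map on the plane. -/
def pd (i : Fin 2) (A : Plane → E →L[ℂ] F) : Plane → E →L[ℂ] F :=
  fun ξ => fderiv ℝ A ξ (EuclideanSpace.single i 1)

/-- `A` is a symbol of order zero, up to `n` derivatives, with respect to the weights `NE`, `NF`: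
it is analytic off the origin, and `|ξ|^{|α|} ∂^α A` is bounded for `|α| ≤ n`. -/
def IsSymbol : ℕ → (Plane → E → ℝ) → (Plane → F → ℝ) → (Plane → E →L[ℂ] F) → Prop
  | 0, NE, NF, A => AnalyticOnNhd ℝ A {0}ᶜ ∧
      ∃ C : ℝ, 0 ≤ C ∧ ∀ ξ : Plane, ξ ≠ 0 → ∀ x, NF ξ (A ξ x) ≤ C * NE ξ x
  | n + 1, NE, NF, A => (AnalyticOnNhd ℝ A {0}ᶜ ∧
      ∃ C : ℝ, 0 ≤ C ∧ ∀ ξ : Plane, ξ ≠ 0 → ∀ x, NF ξ (A ξ x) ≤ C * NE ξ x) ∧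
      ∀ i, IsSymbol n NE (fun ξ y => ‖ξ‖ * NF ξ y) (pd i A)

variable {n : ℕ} {NE : Plane → E → ℝ} {NF : Plane → F → ℝ} {NG : Plane → G → ℝ}
  {A A' : Plane → E →L[ℂ] F} {B : Plane → F →L[ℂ] G}

theorem IsSymbol.zero_of (h : IsSymbol n NE NF A) : IsSymbol 0 NE NF A := by
  cases n with
  | zero => exact h
  | succ n => exact h.1

theorem IsSymbol.analytic (h : IsSymbol n NE NF A) : AnalyticOnNhd ℝ A {0}ᶜ := h.zero_of.1

theorem IsSymbol.differentiableAt (h : AnalyticOnNhd ℝ A {0}ᶜ) {ξ : Plane} (hξ : ξ ≠ 0) :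
    DifferentiableAt ℝ A ξ := (h ξ hξ).differentiableAt

theorem IsSymbol.of_succ (h : IsSymbol (n + 1) NE NF A) : IsSymbol n NE NF A := by
  induction n generalizing A NF with
  | zero => exact h.1
  | succ n ih => exact ⟨h.1, fun i => ih (h.2 i)⟩

theorem pd_congr (h : ∀ ξ, ξ ≠ 0 → A ξ = A' ξ) (i : Fin 2) (ξ : Plane) (hξ : ξ ≠ 0) :
    pd i A ξ = pd i A' ξ := by
  have : A =ᶠ[nhds ξ] A' := by
    filter_upwards [isOpen_compl_singleton.mem_nhds hξ] with η hη
    exact h η hη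
  rw [pd, pd, this.fderiv_eq]

theorem IsSymbol.congr (h : IsSymbol n NE NF A) (hA : ∀ ξ, ξ ≠ 0 → A ξ = A' ξ) :
    IsSymbol n NE NF A' := by
  induction n generalizing A A' NF with
  | zero =>
    obtain ⟨h1, C, hC, h2⟩ := h
    exact ⟨h1.congr (isOpen_compl_singleton) fun ξ hξ => hA ξ hξ, C, hC, fun ξ hξ x => by
      rw [← hA ξ hξ]; exact h2 ξ hξ x⟩
  | succ n ih =>
    obtain ⟨⟨h1, C, hC, h2⟩, h3⟩ := h
    exact ⟨⟨h1.congr (isOpen_compl_singleton) fun ξ hξ => hA ξ hξ, C, hC, fun ξ hξ x => by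
      rw [← hA ξ hξ]; exact h2 ξ hξ x⟩, fun i => ih (h3 i) (pd_congr hA i)⟩

theorem pd_add (hA : AnalyticOnNhd ℝ A {0}ᶜ) (hA' : AnalyticOnNhd ℝ A' {0}ᶜ) (i : Fin 2)
    (ξ : Plane) (hξ : ξ ≠ 0) : pd i A ξ + pd i A' ξ = pd i (fun ξ => A ξ + A' ξ) ξ := by
  rw [pd, pd, pd, fderiv_fun_add (IsSymbol.differentiableAt hA hξ)
    (IsSymbol.differentiableAt hA' hξ)]
  rfl

theorem IsSymbol.add (hNF : ∀ ξ y y', NF ξ (y + y') ≤ NF ξ y + NF ξ y')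
    (h : IsSymbol n NE NF A) (h' : IsSymbol n NE NF A') :
    IsSymbol n NE NF (fun ξ => A ξ + A' ξ) := by
  induction n generalizing A A' NF with
  | zero =>
    obtain ⟨h1, C, hC, h2⟩ := h
    obtain ⟨h1', C', hC', h2'⟩ := h'
    refine ⟨h1.add h1', C + C', by positivity, fun ξ hξ x => ?_⟩
    rw [add_mul]
    exact (hNF _ _ _).trans (add_le_add (h2 ξ hξ x) (h2' ξ hξ x))
  | succ n ih =>
    obtain ⟨⟨h1, C, hC, h2⟩, h3⟩ := h
    obtain ⟨⟨h1', C', hC', h2'⟩, h3'⟩ := h'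
    refine ⟨⟨h1.add h1', C + C', by positivity, fun ξ hξ x => ?_⟩, fun i => ?_⟩
    · rw [add_mul]
      exact (hNF _ _ _).trans (add_le_add (h2 ξ hξ x) (h2' ξ hξ x))
    · refine (ih (fun ξ y y' => ?_) (h3 i) (h3' i)).congr (pd_add h1 h1' i)
      rw [← mul_add]
      exact mul_le_mul_of_nonneg_left (hNF _ _ _) (norm_nonneg _)

theorem IsSymbol.scale (h : IsSymbol n NE NF A) :
    IsSymbol n (fun ξ x => ‖ξ‖ * NE ξ x) (fun ξ y => ‖ξ‖ * NF ξ y) A := by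
  induction n generalizing A NF with
  | zero =>
    obtain ⟨h1, C, hC, h2⟩ := h
    refine ⟨h1, C, hC, fun ξ hξ x => ?_⟩
    rw [mul_left_comm]
    exact mul_le_mul_of_nonneg_left (h2 ξ hξ x) (norm_nonneg _)
  | succ n ih =>
    obtain ⟨⟨h1, C, hC, h2⟩, h3⟩ := h
    refine ⟨⟨h1, C, hC, fun ξ hξ x => ?_⟩, fun i => ih (h3 i)⟩
    rw [mul_left_comm]
    exact mul_le_mul_of_nonneg_left (h2 ξ hξ x) (norm_nonneg _)

/-- The composition of operators as a real bilinear map. -/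
def compReal (E F G : Type*) [NormedAddCommGroup E] [NormedSpace ℂ E] [NormedAddCommGroup F]
    [NormedSpace ℂ F] [NormedAddCommGroup G] [NormedSpace ℂ G] :
    (F →L[ℂ] G) →L[ℝ] (E →L[ℂ] F) →L[ℝ] (E →L[ℂ] G) :=
  (ContinuousLinearMap.compL ℂ E F G).bilinearRestrictScalars ℝ

theorem compReal_apply (S : F →L[ℂ] G) (T : E →L[ℂ] F) : compReal E F G S T = S.comp T := rfl

theorem analyticOnNhd_comp (hB : AnalyticOnNhd ℝ B {0}ᶜ) (hA : AnalyticOnNhd ℝ A {0}ᶜ) :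
    AnalyticOnNhd ℝ (fun ξ => (B ξ).comp (A ξ)) {0}ᶜ := fun ξ hξ =>
  ((compReal E F G).analyticAt_bilinear (B ξ, A ξ)).comp₂ (hB ξ hξ) (hA ξ hξ)

theorem pd_comp (hB : AnalyticOnNhd ℝ B {0}ᶜ) (hA : AnalyticOnNhd ℝ A {0}ᶜ) (i : Fin 2)
    (ξ : Plane) (hξ : ξ ≠ 0) :
    (B ξ).comp (pd i A ξ) + (pd i B ξ).comp (A ξ) = pd i (fun ξ => (B ξ).comp (A ξ)) ξ := by
  have h := (compReal E F G).hasFDerivAt_of_bilinear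
    (IsSymbol.differentiableAt hB hξ).hasFDerivAt (IsSymbol.differentiableAt hA hξ).hasFDerivAt
  have h' : HasFDerivAt (fun ξ => (B ξ).comp (A ξ)) _ ξ := h
  rw [pd, pd, pd, h'.fderiv]
  rfl

/-- The Leibniz rule. The extra factor |ξ| goes to whichever operator is differentiated; if that is
A, the weights of B are rescaled on both sides by `scale`. -/
theorem IsSymbol.comp (hNG : ∀ ξ y y', NG ξ (y + y') ≤ NG ξ y + NG ξ y')
    (hB : IsSymbol n NF NG B) (hA : IsSymbol n NE NF A) :
    IsSymbol n NE NG (fun ξ => (B ξ).comp (A ξ)) := by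
  have base : ∀ {A : Plane → E →L[ℂ] F} {B : Plane → F →L[ℂ] G} {NF : Plane → F → ℝ}
      {NG : Plane → G → ℝ}, IsSymbol 0 NF NG B → IsSymbol 0 NE NF A →
      IsSymbol 0 NE NG (fun ξ => (B ξ).comp (A ξ)) := by
    rintro A B NF NG ⟨h1, C, hC, h2⟩ ⟨h1', C', hC', h2'⟩
    refine ⟨analyticOnNhd_comp h1 h1', C * C', by positivity, fun ξ hξ x => ?_⟩
    rw [mul_assoc]
    exact (h2 ξ hξ _).trans (mul_le_mul_of_nonneg_left (h2' ξ hξ x) hC)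
  induction n generalizing A B NF NG with
  | zero => exact base hB hA
  | succ n ih =>
    refine ⟨base hB.zero_of hA.zero_of, fun i => ?_⟩
    have hNG' : ∀ (ξ : Plane) (y y' : G), ‖ξ‖ * NG ξ (y + y') ≤ ‖ξ‖ * NG ξ y + ‖ξ‖ * NG ξ y' := by
      intro ξ y y'
      rw [← mul_add]
      exact mul_le_mul_of_nonneg_left (hNG _ _ _) (norm_nonneg _)
    exact (IsSymbol.add hNG' (ih hNG' hB.of_succ.scale (hA.2 i))
      (ih hNG' (hB.2 i) hA.of_succ)).congr (pd_comp hB.analytic hA.analytic i)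

theorem IsSymbol.neg (hNF : ∀ ξ y, NF ξ (-y) = NF ξ y) (h : IsSymbol n NE NF A) :
    IsSymbol n NE NF (fun ξ => -A ξ) := by
  induction n generalizing A NF with
  | zero =>
    obtain ⟨h1, C, hC, h2⟩ := h
    exact ⟨h1.neg, C, hC, fun ξ hξ x => (hNF _ _).trans_le (h2 ξ hξ x)⟩
  | succ n ih =>
    obtain ⟨⟨h1, C, hC, h2⟩, h3⟩ := h
    refine ⟨⟨h1.neg, C, hC, fun ξ hξ x => (hNF _ _).trans_le (h2 ξ hξ x)⟩, fun i => ?_⟩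
    refine (ih (fun ξ y => by rw [hNF]) (h3 i)).congr fun ξ hξ => ?_
    rw [pd, pd, fderiv_fun_neg]; rfl

theorem IsSymbol.zero (hNF : ∀ ξ, NF ξ 0 = 0) :
    IsSymbol n NE NF (fun _ => (0 : E →L[ℂ] F)) := by
  have base : ∀ NF : Plane → F → ℝ, (∀ ξ, NF ξ 0 = 0) →
      IsSymbol 0 NE NF (fun _ => (0 : E →L[ℂ] F)) := fun NF hNF =>
    ⟨analyticOnNhd_const, 0, le_rfl, fun ξ _ x => by simp [hNF]⟩
  induction n generalizing NF with
  | zero => exact base NF hNF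
  | succ n ih =>
    refine ⟨base NF hNF, fun i => (ih (NF := fun ξ y => ‖ξ‖ * NF ξ y)
      fun ξ => by simp [hNF]).congr fun ξ _ => ?_⟩
    simp [pd]

theorem IsSymbol.const (hNF : ∀ ξ, NF ξ 0 = 0) {T : E →L[ℂ] F}
    {C : ℝ} (hC : 0 ≤ C) (h : ∀ ξ : Plane, ξ ≠ 0 → ∀ x, NF ξ (T x) ≤ C * NE ξ x) :
    IsSymbol n NE NF (fun _ => T) := by
  cases n with
  | zero => exact ⟨analyticOnNhd_const, C, hC, h⟩
  | succ n =>
    refine ⟨⟨analyticOnNhd_const, C, hC, h⟩, fun i =>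
      (IsSymbol.zero fun ξ => by simp [hNF]).congr fun ξ _ => ?_⟩
    simp [pd]

/-- The map `ξ ↦ 2πi ξⱼ` as a real linear map. -/
def dsymL (j : Fin 2) : Plane →L[ℝ] ℂ :=
  ((ContinuousLinearMap.mul ℝ ℂ).flip Complex.I).comp
    (Complex.ofRealCLM.comp ((2 * Real.pi) • (EuclideanSpace.proj j : Plane →L[ℝ] ℝ)))

/-- A family of seminorms, indexed by the frequency. -/
structure IsWeight (N : Plane → E → ℝ) : Prop where
  nonneg : ∀ ξ x, 0 ≤ N ξ x
  add_le : ∀ ξ x y, N ξ (x + y) ≤ N ξ x + N ξ y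
  smul : ∀ ξ (c : ℂ) x, N ξ (c • x) = ‖c‖ * N ξ x

theorem IsWeight.norm_mul (h : IsWeight NE) : IsWeight fun ξ x => ‖ξ‖ * NE ξ x where
  nonneg ξ x := mul_nonneg (norm_nonneg _) (h.nonneg ξ x)
  add_le ξ x y := by
    rw [← mul_add]
    exact mul_le_mul_of_nonneg_left (h.add_le _ _ _) (norm_nonneg _)
  smul ξ c x := by rw [h.smul]; ring

theorem IsWeight.zero (h : IsWeight NE) (ξ : Plane) : NE ξ 0 = 0 := by
  simpa using h.smul ξ 0 0

theorem IsWeight.neg (h : IsWeight NE) (ξ : Plane) (x : E) : NE ξ (-x) = NE ξ x := by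
  simpa using h.smul ξ (-1) x

/-- The map `z ↦ z T` as a real linear map. -/
def smulOp (T : E →L[ℂ] F) : ℂ →L[ℝ] E →L[ℂ] F :=
  (ContinuousLinearMap.toSpanSingleton ℂ T).restrictScalars ℝ

theorem smulOp_apply (T : E →L[ℂ] F) (z : ℂ) : smulOp T z = z • T := rfl

theorem norm_dsym_le' (ξ : Plane) (j : Fin 2) : ‖dsym ξ j‖ ≤ 7 * ‖ξ‖ := by
  refine (norm_dsym_le ξ j).trans ?_
  have := Real.pi_lt_d2
  unfold modulus
  gcongr
  linarith

/-- The factor dⱼ compensates the |ξ| in the hypothesis. After one derivative the coefficient is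
constant and the |ξ| of the symbol condition takes the place of dⱼ; further derivatives vanish. -/
theorem IsSymbol.dsym_smul (hNF : IsWeight NF) {T : E →L[ℂ] F} {C : ℝ} (hC : 0 ≤ C)
    (h : ∀ ξ : Plane, ξ ≠ 0 → ∀ x, ‖ξ‖ * NF ξ (T x) ≤ C * NE ξ x) (j : Fin 2) :
    IsSymbol n NE NF (fun ξ => dsym ξ j • T) := by
  have h0 : IsSymbol 0 NE NF (fun ξ => dsym ξ j • T) := by
    refine ⟨fun ξ _ => ((smulOp T).comp (dsymL j)).analyticAt ξ, 7 * C, by positivity,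
      fun ξ hξ x => ?_⟩
    calc NF ξ (dsym ξ j • T x) = ‖dsym ξ j‖ * NF ξ (T x) := hNF.smul _ _ _
      _ ≤ 7 * ‖ξ‖ * NF ξ (T x) :=
        mul_le_mul_of_nonneg_right (norm_dsym_le' ξ j) (hNF.nonneg _ _)
      _ ≤ 7 * (C * NE ξ x) := by linarith [h ξ hξ x]
      _ = _ := by ring
  cases n with
  | zero => exact h0
  | succ n =>
    refine ⟨h0, fun i => ?_⟩
    refine (IsSymbol.const (T := dsymL j (EuclideanSpace.single i 1) • T) (C := ‖dsymL j
      (EuclideanSpace.single i 1)‖ * C) hNF.norm_mul.zero (by positivity)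
      fun ξ hξ x => ?_).congr fun ξ _ => ?_
    · rw [_root_.smul_apply, hNF.smul, mul_left_comm, mul_assoc]
      exact mul_le_mul_of_nonneg_left (h ξ hξ x) (norm_nonneg _)
    · have hd : HasFDerivAt (fun ξ => dsym ξ j • T) ((smulOp T).comp (dsymL j)) ξ :=
        ((smulOp T).comp (dsymL j)).hasFDerivAt
      rw [pd, hd.fderiv]; rfl

theorem IsSymbol.dsym_mul_dsym_smul (hNF : IsWeight NF) {T : E →L[ℂ] F} {C : ℝ} (hC : 0 ≤ C)
    (h : ∀ ξ : Plane, ξ ≠ 0 → ∀ x, ‖ξ‖ * (‖ξ‖ * NF ξ (T x)) ≤ C * NE ξ x) (j k : Fin 2) :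
    IsSymbol n NE NF (fun ξ => (dsym ξ j * dsym ξ k) • T) := by
  have h0 : IsSymbol 0 NE NF (fun ξ => (dsym ξ j * dsym ξ k) • T) := by
    refine ⟨fun ξ _ => ((smulOp T).analyticAt _).comp
      (((dsymL j).analyticAt ξ).mul ((dsymL k).analyticAt ξ)), 49 * C, by positivity,
      fun ξ hξ x => ?_⟩
    calc NF ξ ((dsym ξ j * dsym ξ k) • T x) = ‖dsym ξ j‖ * ‖dsym ξ k‖ * NF ξ (T x) := by
          rw [hNF.smul, norm_mul]
      _ ≤ (7 * ‖ξ‖) * (7 * ‖ξ‖) * NF ξ (T x) := by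
          refine mul_le_mul_of_nonneg_right ?_ (hNF.nonneg _ _)
          exact mul_le_mul (norm_dsym_le' ξ j) (norm_dsym_le' ξ k) (norm_nonneg _) (by positivity)
      _ ≤ 49 * (C * NE ξ x) := by linarith [h ξ hξ x]
      _ = _ := by ring
  cases n with
  | zero => exact h0
  | succ n =>
    refine ⟨h0, fun i => ?_⟩
    have hs : ∀ (c : ℂ) (l : Fin 2), IsSymbol n NE (fun ξ y => ‖ξ‖ * NF ξ y)
        (fun ξ => dsym ξ l • (c • T)) := fun c l => by
      refine IsSymbol.dsym_smul hNF.norm_mul (C := ‖c‖ * C) (by positivity) (fun ξ hξ x => ?_) l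
      rw [_root_.smul_apply, hNF.smul]
      calc _ = ‖c‖ * (‖ξ‖ * (‖ξ‖ * NF ξ (T x))) := by ring
        _ ≤ ‖c‖ * (C * NE ξ x) := mul_le_mul_of_nonneg_left (h ξ hξ x) (norm_nonneg _)
        _ = _ := by ring
    refine (IsSymbol.add hNF.norm_mul.add_le (hs (dsymL k (EuclideanSpace.single i 1)) j)
      (hs (dsymL j (EuclideanSpace.single i 1)) k)).congr fun ξ _ => ?_
    have hd : HasFDerivAt (fun ξ => (dsym ξ j * dsym ξ k) • T) _ ξ :=
      (smulOp T).hasFDerivAt.comp ξ ((dsymL j).hasFDerivAt.mul (dsymL k).hasFDerivAt)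
    rw [pd, hd.fderiv]
    change _ = smulOp T (dsym ξ j * dsymL k _ + dsym ξ k * dsymL j _)
    rw [smulOp_apply, add_smul, mul_smul, mul_smul]

/-- Composing with a fixed isomorphism moves the inversion to the Banach algebra of endomorphisms
near 1, where inversion is analytic. -/
theorem analyticAt_clm_inverse [CompleteSpace E] {A : Plane → E →L[ℂ] F} {ξ : Plane}
    (hA : AnalyticAt ℝ A ξ) (h : (A ξ).IsInvertible) :
    AnalyticAt ℝ (fun η => (A η).inverse) ξ := by
  obtain ⟨e, he⟩ := h
  have h1 : (fun η => (A η).inverse) = fun η =>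
      compReal F E E (Ring.inverse (compReal E F E (e.symm : F →L[ℂ] E) (A η)))
        (e.symm : F →L[ℂ] E) := by
    funext η
    rw [ContinuousLinearMap.inverse_eq_ringInverse e]; rfl
  rw [h1]
  have h2 : AnalyticAt ℝ (fun η => compReal E F E (e.symm : F →L[ℂ] E) (A η)) ξ :=
    ((compReal E F E (e.symm : F →L[ℂ] E)).analyticAt _).comp hA
  have h3 : compReal E F E (e.symm : F →L[ℂ] E) (A ξ) = ((1 : (E →L[ℂ] E)ˣ) : E →L[ℂ] E) := by
    rw [← he, compReal_apply]; ext; simp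
  have h4 : AnalyticAt ℝ Ring.inverse (compReal E F E (e.symm : F →L[ℂ] E) (A ξ)) := by
    rw [h3]; exact analyticAt_inverse (𝕜 := ℝ) (1 : (E →L[ℂ] E)ˣ)
  exact (((compReal F E E).flip (e.symm : F →L[ℂ] E)).analyticAt _).comp 
    (AnalyticAt.comp (g := Ring.inverse) (f := fun η => compReal E F E (e.symm : F →L[ℂ] E) (A η))
      h4 h2)

theorem pd_inverse {L : Plane → E →L[ℂ] F} (hL : AnalyticOnNhd ℝ L {0}ᶜ)
    (hinv : ∀ ξ : Plane, ξ ≠ 0 → (L ξ).IsInvertible)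
    (hR : AnalyticOnNhd ℝ (fun ξ => (L ξ).inverse) {0}ᶜ) (i : Fin 2) (ξ : Plane) (hξ : ξ ≠ 0) :
    -((L ξ).inverse.comp ((pd i L ξ).comp (L ξ).inverse)) = pd i (fun ξ => (L ξ).inverse) ξ := by
  have h1 := pd_comp hR hL i ξ hξ
  have h2 : pd i (fun ξ => (L ξ).inverse.comp (L ξ)) ξ = 0 := by
    rw [← pd_congr (A := fun _ => ContinuousLinearMap.id ℂ E)
      (fun η hη => (hinv η hη).inverse_comp_self.symm) i ξ hξ]
    simp [pd]
  rw [h2] at h1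
  have h3 := congrArg (fun T => T.comp (L ξ).inverse) h1
  simp only [ContinuousLinearMap.add_comp, ContinuousLinearMap.comp_assoc,
    (hinv ξ hξ).self_comp_inverse, ContinuousLinearMap.comp_id, ContinuousLinearMap.zero_comp] at h3
  exact neg_eq_of_add_eq_zero_right h3

/-- The lower bound on L is the case without derivatives. Each further derivative replaces L⁻¹ by
-L⁻¹(∂L)L⁻¹, a composition of symbols in which only ∂L takes up the factor |ξ|. -/
theorem IsSymbol.inverse [CompleteSpace E] {L : Plane → E →L[ℂ] F} (hNE : IsWeight NE)
    (hNF : IsWeight NF) (hL : ∀ n, IsSymbol n NE NF L) (hinv : ∀ ξ : Plane, ξ ≠ 0 → (L ξ).IsInvertible) {C : ℝ}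
    (hC : 0 ≤ C) (hb : ∀ ξ : Plane, ξ ≠ 0 → ∀ x, NE ξ x ≤ C * NF ξ (L ξ x)) (n : ℕ) :
    IsSymbol n NF NE (fun ξ => (L ξ).inverse) := by
  have hR : AnalyticOnNhd ℝ (fun ξ => (L ξ).inverse) {0}ᶜ := fun ξ hξ =>
    analyticAt_clm_inverse ((hL 0).1 ξ hξ) (hinv ξ hξ)
  have h0 : IsSymbol 0 NF NE (fun ξ => (L ξ).inverse) := by
    refine ⟨hR, C, hC, fun ξ hξ y => ?_⟩
    have h1 := hb ξ hξ ((L ξ).inverse y)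
    rwa [← ContinuousLinearMap.comp_apply (L ξ), (hinv ξ hξ).self_comp_inverse] at h1
  induction n with
  | zero => exact h0
  | succ n ih =>
    refine ⟨h0, fun i => ?_⟩
    exact (IsSymbol.neg hNE.norm_mul.neg (IsSymbol.comp hNE.norm_mul.add_le ih.scale
      (IsSymbol.comp (NF := NE) hNF.norm_mul.add_le ((hL (n + 1)).2 i) ih))).congr
      (pd_inverse (hL 0).1 hinv hR i)

theorem IsSymbol.iterate (h : ∀ n, IsSymbol n NE NF A) (i : Fin 2) (m : ℕ) (n : ℕ) :
    IsSymbol n NE (fun ξ y => ‖ξ‖ ^ m * NF ξ y) ((pd i)^[m] A) := by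
  induction m generalizing n with
  | zero => simpa using h n
  | succ m ih =>
    rw [Function.iterate_succ_apply']
    have := (ih (n + 1)).2 i
    simp only [← mul_assoc, ← pow_succ'] at this
    exact this

end Symbols

end
end CurlLayer

namespace CurlLayer

noncomputable section

/-! ### The symbol of the solution operator -/

section FiberSymbol

variable {b : ℝ} {s : ℕ}

theorem isWeight_normX : IsWeight fun ξ (x : Unknowns b s) => normX (bracket ξ) x where
  nonneg ξ x := by
    have hZ := (bracket_pos ξ).le
    have h1 := wnorm_nonneg hZ x.1
    have h2 := Finset.sum_nonneg fun i (_ : i ∈ Finset.univ) => wnorm_nonneg hZ (x.2.1 i)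
    rw [normX]; positivity
  add_le ξ x x' := by
    have hZ := (bracket_pos ξ).le
    rw [normX, normX, normX]
    have h1 := wnorm_add_le hZ x.1 x'.1
    have h2 : ∑ i, wnorm (bracket ξ) ((x + x').2.1 i) ≤
        ∑ i, wnorm (bracket ξ) (x.2.1 i) + ∑ i, wnorm (bracket ξ) (x'.2.1 i) := by
      rw [← Finset.sum_add_distrib]
      exact Finset.sum_le_sum fun i _ => wnorm_add_le hZ _ _
    have h3 : ∑ j, ‖(x + x').2.2 j‖ ≤ ∑ j, ‖x.2.2 j‖ + ∑ j, ‖x'.2.2 j‖ := by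
      rw [← Finset.sum_add_distrib]
      exact Finset.sum_le_sum fun i _ => norm_add_le _ _
    have h4 := mul_le_mul_of_nonneg_left h3
      (show 0 ≤ Real.sqrt (bracket ξ) * bracket ξ ^ (s + 1) by positivity)
    rw [mul_add] at h4
    change wnorm _ (x.1 + x'.1) + _ + _ ≤ _
    linarith
  smul ξ c x := by
    rw [normX, normX]
    change wnorm _ (c • x.1) + ∑ i, wnorm _ (c • x.2.1 i) + _ * ∑ j, ‖c • x.2.2 j‖ = _
    simp only [wnorm_smul, norm_smul, ← Finset.mul_sum]
    ring

theorem isWeight_normY :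
    IsWeight fun ξ (y : FiberData b s) => normY (bracket ξ) (modulus ξ) y where
  nonneg ξ y := (normY_terms (bracket_pos ξ).le (modulus_nonneg ξ) y).2.2.2.2.2.2
  add_le ξ y y' := by
    have hZ := (bracket_pos ξ).le
    have hl := modulus_nonneg ξ
    rw [normY, normY, normY]
    have h1 : ∑ i, wnorm (bracket ξ) ((y + y').1 i) ≤
        ∑ i, wnorm (bracket ξ) (y.1 i) + ∑ i, wnorm (bracket ξ) (y'.1 i) := by
      rw [← Finset.sum_add_distrib]
      exact Finset.sum_le_sum fun i _ => wnorm_add_le hZ _ _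
    have h2 := wnorm_add_le hZ y.2.1 y'.2.1
    have h3 : ∑ j, ‖(y + y').2.2.1 j‖ ≤ ∑ j, ‖y.2.2.1 j‖ + ∑ j, ‖y'.2.2.1 j‖ := by
      rw [← Finset.sum_add_distrib]
      exact Finset.sum_le_sum fun i _ => norm_add_le _ _
    have h4 := mul_le_mul_of_nonneg_left h3
      (show 0 ≤ Real.sqrt (bracket ξ) * bracket ξ ^ s by positivity)
    have h5 : ‖y.2.2.2.1 + y'.2.2.2.1‖ + ‖y.2.2.2.2 + y'.2.2.2.2‖ / modulus ξ ≤
        (‖y.2.2.2.1‖ + ‖y.2.2.2.2‖ / modulus ξ) + (‖y'.2.2.2.1‖ + ‖y'.2.2.2.2‖ / modulus ξ) := by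
      have := div_le_div_of_nonneg_right (norm_add_le y.2.2.2.2 y'.2.2.2.2) hl
      rw [add_div] at this
      linarith [norm_add_le y.2.2.2.1 y'.2.2.2.1]
    have h6 := mul_le_mul_of_nonneg_left h5
      (show 0 ≤ Real.sqrt (bracket ξ) * bracket ξ ^ (s + 1) by positivity)
    have h7 : ‖(y.2.2.2.1 + y'.2.2.2.1) - testI b 1 (der b (s + 1) 0 (y.2.1 + y'.2.1))‖ /
        modulus ξ ≤ ‖y.2.2.2.1 - testI b 1 (der b (s + 1) 0 y.2.1)‖ / modulus ξ +
        ‖y'.2.2.2.1 - testI b 1 (der b (s + 1) 0 y'.2.1)‖ / modulus ξ := by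
      rw [← add_div, map_add, map_add, add_sub_add_comm]
      exact div_le_div_of_nonneg_right (norm_add_le _ _) hl
    have h8 := mul_le_mul_of_nonneg_left h7 (show 0 ≤ bracket ξ ^ s by positivity)
    rw [mul_add] at h4 h6 h8
    change _ + wnorm _ (y.2.1 + y'.2.1) + _ + Real.sqrt (bracket ξ) * bracket ξ ^ (s + 1) *
      (‖y.2.2.2.1 + y'.2.2.2.1‖ + ‖y.2.2.2.2 + y'.2.2.2.2‖ / modulus ξ) + bracket ξ ^ s *
      (‖(y.2.2.2.1 + y'.2.2.2.1) - testI b 1 (der b (s + 1) 0 (y.2.1 + y'.2.1))‖ / modulus ξ) ≤ _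
    linarith
  smul ξ c y := by
    rw [normY, normY]
    change ∑ i, wnorm _ (c • y.1 i) + wnorm _ (c • y.2.1) + _ * ∑ j, ‖c • y.2.2.1 j‖ +
      _ * (‖c • y.2.2.2.1‖ + ‖c • y.2.2.2.2‖ / _) +
      _ * (‖c • y.2.2.2.1 - testI b 1 (der b (s + 1) 0 (c • y.2.1))‖ / _) = _
    rw [map_smul, map_smul, ← smul_sub]
    simp only [wnorm_smul, norm_smul, ← Finset.mul_sum]
    ring

variable {Z : ℝ}

theorem sqrt_mul_norm_trTop_le_wnorm (hb : 0 < b) (hZ : 1 ≤ Z) {k : ℕ} (w : HI b (k + 1) ℂ) :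
    Real.sqrt Z * Z ^ k * ‖trTop b k w‖ ≤ 2 * (b⁻¹ + 1) * wnorm Z w := by
  have hZ0 : 0 < Z := by linarith
  have hb' := inv_pos.2 hb
  have h1 := le_wnorm hZ0.le w (Nat.zero_le (k + 1))
  have h2 := le_wnorm hZ0.le w (j := 1) (by omega)
  rw [Nat.add_sub_cancel] at h2
  rw [Nat.sub_zero, pow_succ] at h1
  calc _ = Z ^ k * (Real.sqrt Z * ‖trTop b k w‖) := by ring
    _ ≤ Z ^ k * ((b⁻¹ + 1) * (Z * ‖der b (k + 1) 0 w‖ + ‖der b (k + 1) 1 w‖)) :=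
        mul_le_mul_of_nonneg_left (sqrt_mul_norm_trTop_le hb hZ w) (by positivity)
    _ = (b⁻¹ + 1) * (Z ^ k * Z * ‖der b (k + 1) 0 w‖ + Z ^ k * ‖der b (k + 1) 1 w‖) := by ring
    _ ≤ (b⁻¹ + 1) * (wnorm Z w + wnorm Z w) := by gcongr
    _ = _ := by ring

theorem wnorm_const_le (hb : 0 < b) (hZ : 1 ≤ Z) (k : ℕ) (c : ℂ) :
    wnorm Z (HI.const b k ℂ c) ≤ Z ^ k * (Real.sqrt b * ‖c‖) := by
  rw [wnorm, Finset.sum_range_succ', Finset.sum_eq_zero fun j _ => by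
    rw [HI.der_const_succ, norm_zero, mul_zero], zero_add, HI.der_const_zero, Nat.sub_zero]
  exact mul_le_mul_of_nonneg_left (norm_constI_le hb c) (by positivity)

theorem norm_testI_one_le (hb : 0 < b) (w : L2I b ℂ) : ‖testI b 1 w‖ ≤ Real.sqrt b * ‖w‖ := by
  rw [testI_apply]
  refine (norm_integral_le_integral_norm _).trans ?_
  simpa using integral_norm_le_sqrt hb w

theorem normX_terms (hZ : 0 ≤ Z) (x : Unknowns b s) : wnorm Z x.1 ≤ normX Z x ∧
    (∀ i, wnorm Z (x.2.1 i) ≤ normX Z x) ∧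
    (∀ j, Real.sqrt Z * Z ^ (s + 1) * ‖x.2.2 j‖ ≤ normX Z x) ∧ 0 ≤ normX Z x := by
  have h1 := wnorm_nonneg hZ x.1
  have h2 := Finset.sum_nonneg fun i (_ : i ∈ Finset.univ) => wnorm_nonneg hZ (x.2.1 i)
  have h3 : 0 ≤ Real.sqrt Z * Z ^ (s + 1) * ∑ j, ‖x.2.2 j‖ := by positivity
  rw [normX]
  refine ⟨by linarith, fun i => ?_, fun j => ?_, by linarith⟩
  · have := Finset.single_le_sum (f := fun i => wnorm Z (x.2.1 i))
      (fun i _ => wnorm_nonneg hZ _) (Finset.mem_univ i)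
    linarith
  · have := mul_le_mul_of_nonneg_left (Finset.single_le_sum (f := fun j => ‖x.2.2 j‖)
      (fun i _ => norm_nonneg _) (Finset.mem_univ j))
      (show 0 ≤ Real.sqrt Z * Z ^ (s + 1) by positivity)
    linarith

theorem wnorm_sub_le (hZ : 0 ≤ Z) {k : ℕ} (w w' : HI b k ℂ) :
    wnorm Z (w - w') ≤ wnorm Z w + wnorm Z w' := by
  have := wnorm_add_le hZ w ((-1 : ℂ) • w')
  rw [wnorm_smul, norm_neg, norm_one, one_mul] at this
  rwa [sub_eq_add_neg, ← neg_one_smul ℂ w']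

theorem wnorm_zero {V : Type} [NormedAddCommGroup V] [InnerProductSpace ℂ V] (k : ℕ) :
    wnorm Z (0 : HI b k V) = 0 := by simp [wnorm]

theorem wnorm_deriv_deriv_le (hZ : 0 ≤ Z) (w : HI b (s + 2) ℂ) :
    wnorm Z (HI.deriv b s (HI.deriv b (s + 1) w)) ≤ wnorm Z w :=
  (wnorm_deriv_le hZ _).trans (wnorm_deriv_le hZ w)

/-- This part carries no factor ξ to offset 1/λ, so the two singular terms of the data norm must
vanish identically: the curl component is zero, and the flux defect is zero on no-slip velocities.
-/
theorem normY_sysZero_le (hb : 0 < b) {γ μ : ℝ} (hγ : 0 < γ) (hμ : 0 < μ) :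
    ∃ C : ℝ, 0 ≤ C ∧ ∀ ξ : Plane, ξ ≠ 0 → ∀ x : noSlip b s,
      normY (bracket ξ) (modulus ξ) (sysZero b γ μ s x) ≤
        C * normX (bracket ξ) (x : Unknowns b s) := by
  refine ⟨2 * (γ * Real.sqrt b + μ) + (1 + 2 * μ) + 1 + (8 * μ * (b⁻¹ + 1) + 2 * (b⁻¹ + 1)) +
    2 * (b⁻¹ + 1), by have := inv_pos.2 hb; positivity, fun ξ _ x => ?_⟩
  have hZ1 := one_le_bracket ξ
  have hZ := (bracket_pos ξ).le
  set Z := bracket ξ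
  obtain ⟨p1, p2, p3, p4⟩ := normX_terms hZ (x : Unknowns b s)
  have hbot := x.2
  obtain ⟨⟨p, v, χ⟩, hx⟩ := x
  set K := normX Z ((p, v, χ) : Unknowns b s)
  dsimp only at p1 p2 p3 hbot
  have hs : 1 ≤ Real.sqrt Z := Real.one_le_sqrt.2 hZ1
  have hχ : ∀ j, wnorm Z (HI.const b s ℂ (χ j)) ≤ Real.sqrt b * K := by
    intro j
    refine (wnorm_const_le hb hZ1 s _).trans ?_
    have h1 : Z ^ s ≤ Real.sqrt Z * Z ^ (s + 1) := by
      calc Z ^ s ≤ Z ^ (s + 1) := pow_le_pow_right₀ hZ1 (by omega)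
        _ ≤ _ := le_mul_of_one_le_left (by positivity) hs
    calc _ = Real.sqrt b * (Z ^ s * ‖χ j‖) := by ring
      _ ≤ Real.sqrt b * (Real.sqrt Z * Z ^ (s + 1) * ‖χ j‖) := by gcongr
      _ ≤ _ := mul_le_mul_of_nonneg_left (p3 j) (Real.sqrt_nonneg _)
  have hf : ∀ j : Fin 2, wnorm Z ((γ : ℂ) • HI.const b s ℂ (χ j) -
      (μ : ℂ) • HI.deriv b s (HI.deriv b (s + 1) (v j.castSucc))) ≤
      (γ * Real.sqrt b + μ) * K := by
    intro j
    refine (wnorm_sub_le hZ _ _).trans ?_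
    rw [wnorm_smul, wnorm_smul, Complex.norm_real, Complex.norm_real, Real.norm_of_nonneg hγ.le,
      Real.norm_of_nonneg hμ.le, add_mul, mul_assoc]
    exact add_le_add (mul_le_mul_of_nonneg_left (hχ j) hγ.le)
      (mul_le_mul_of_nonneg_left ((wnorm_deriv_deriv_le hZ _).trans (p2 _)) hμ.le)
  have hf2 : wnorm Z (HI.deriv b s p - (2 * μ : ℂ) • HI.deriv b s (HI.deriv b (s + 1) (v 2))) ≤
      (1 + 2 * μ) * K := by
    refine (wnorm_sub_le hZ _ _).trans ?_
    rw [wnorm_smul, norm_mul, Complex.norm_real, Real.norm_of_nonneg hμ.le, Complex.norm_ofNat,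
      add_mul, one_mul]
    exact add_le_add ((wnorm_deriv_le hZ _).trans p1)
      (mul_le_mul_of_nonneg_left ((wnorm_deriv_deriv_le hZ _).trans (p2 _)) (by positivity))
  have hg : wnorm Z (HI.deriv b (s + 1) (v 2)) ≤ K := (wnorm_deriv_le hZ _).trans (p2 _)
  have hb' := inv_pos.2 hb
  have ht : ∀ i, Real.sqrt Z * Z ^ s * ‖trTop b s (HI.deriv b (s + 1) (v i))‖ ≤
      2 * (b⁻¹ + 1) * K := fun i =>
    (sqrt_mul_norm_trTop_le_wnorm hb hZ1 _).trans (mul_le_mul_of_nonneg_left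
      ((wnorm_deriv_le hZ _).trans (p2 _)) (by positivity))
  have htp : Real.sqrt Z * Z ^ s * ‖trTop b s p‖ ≤ 2 * (b⁻¹ + 1) * K :=
    (sqrt_mul_norm_trTop_le_wnorm hb hZ1 _).trans (mul_le_mul_of_nonneg_left p1 (by positivity))
  have hh : Real.sqrt Z * Z ^ (s + 1) * ‖trTop b (s + 1) (v 2)‖ ≤ 2 * (b⁻¹ + 1) * K :=
    (sqrt_mul_norm_trTop_le_wnorm hb hZ1 _).trans
      (mul_le_mul_of_nonneg_left (p2 _) (by positivity))
  have hk2 : ‖(2 * μ : ℂ) * trTop b s (HI.deriv b (s + 1) (v 2)) - trTop b s p‖ ≤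
      2 * μ * ‖trTop b s (HI.deriv b (s + 1) (v 2))‖ + ‖trTop b s p‖ := by
    refine (norm_sub_le _ _).trans_eq ?_
    rw [norm_mul, norm_mul, Complex.norm_real, Real.norm_of_nonneg hμ.le, Complex.norm_ofNat]
  have hk2' := mul_le_mul_of_nonneg_left hk2 (show 0 ≤ Real.sqrt Z * Z ^ s by positivity)
  -- Because v₃(0) = 0, the top trace v₃(b) equals the integral of v₃', which is the divergence in
  -- this part.
  have hflux : trTop b (s + 1) (v 2) - testI b 1 (der b (s + 1) 0 (HI.deriv b (s + 1) (v 2))) =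
      0 := by
    rw [HI.der_deriv (by omega), trTop_apply, hbot 2, zero_add, sub_self]
  have hf0 := hf 0
  have hf1 := hf 1
  rw [normY]
  simp only [sysZero, assemble_apply, Fin.sum_univ_three, Matrix.cons_val, _root_.sub_apply,
    _root_.smul_apply, ContinuousLinearMap.comp_apply, prP_apply, prV_apply, prX_apply,
    smul_eq_mul, _root_.zero_apply, norm_zero, zero_div, add_zero, hflux, mul_zero]
  simp only [Fin.castSucc_zero, Fin.castSucc_one] at hf0 hf1
  rw [norm_mul, norm_mul (μ : ℂ), Complex.norm_real, Real.norm_of_nonneg hμ.le]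
  have h0 := mul_le_mul_of_nonneg_left (ht 0) hμ.le
  have h1 := mul_le_mul_of_nonneg_left (ht 1) hμ.le
  have h2 := mul_le_mul_of_nonneg_left (ht 2) hμ.le
  nlinarith [hf0, hf1, hf2, hg, htp, hh, hk2', h0, h1, h2]

end FiberSymbol

end
end CurlLayer

namespace CurlLayer

noncomputable section

/-! ### The fiber operator and its inverse as symbols of order zero. -/

section FiberSymbol

variable {b : ℝ} {s : ℕ}

theorem norm_mul_wnorm_incl_le (ξ : Plane) {k : ℕ} (w : HI b (k + 1) ℂ) :
    ‖ξ‖ * wnorm (bracket ξ) (HI.incl b k w) ≤ wnorm (bracket ξ) w :=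
  (mul_le_mul_of_nonneg_right (norm_le_bracket ξ) (wnorm_nonneg (bracket_pos ξ).le _)).trans
    (wnorm_incl_le (bracket_pos ξ).le w)

/-- The factor |ξ| on the left cancels 1/λ in the curl and flux terms. Elsewhere it is at most Z and
is recovered from an inclusion or from the weight of a boundary term. -/
theorem normY_sysOne_le (hb : 0 < b) {κ μ : ℝ} (hκ : 0 < κ) (hμ : 0 < μ) (j : Fin 2) :
    ∃ C : ℝ, 0 ≤ C ∧ ∀ ξ : Plane, ξ ≠ 0 → ∀ x : Unknowns b s,
      ‖ξ‖ * normY (bracket ξ) (modulus ξ) (sysOne b κ μ s j x) ≤ C * normX (bracket ξ) x := by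
  have hb' := inv_pos.2 hb
  refine ⟨(1 + 2 * μ) + 1 + (2 * μ * (b⁻¹ + 1) + κ) + 1 + Real.sqrt b, by positivity,
    fun ξ hξ x => ?_⟩
  have hZ1 := one_le_bracket ξ
  have hZ := (bracket_pos ξ).le
  have hξ0 := norm_nonneg ξ
  have hl := modulus_pos hξ
  have hξZ := norm_le_bracket ξ
  have hξl : ∀ t : ℝ, 0 ≤ t → ‖ξ‖ * (t / modulus ξ) ≤ t := fun t ht => by
    rw [← mul_div_assoc, div_le_iff₀ hl, mul_comm t]
    exact mul_le_mul_of_nonneg_right (norm_le_modulus ξ) ht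
  have hincl : ∀ {k : ℕ} (w : HI b (k + 1) ℂ), ‖ξ‖ * wnorm (bracket ξ) (HI.incl b k w) ≤
    wnorm (bracket ξ) w := fun w => norm_mul_wnorm_incl_le ξ w
  set Z := bracket ξ
  obtain ⟨p1, p2, p3, p4⟩ := normX_terms hZ x
  obtain ⟨p, v, χ⟩ := x
  set K := normX Z ((p, v, χ) : Unknowns b s)
  dsimp only at p1 p2 p3
  have hfj : ‖ξ‖ * wnorm Z (HI.incl b s p - (μ : ℂ) • HI.incl b s (HI.deriv b (s + 1) (v 2))) ≤
      (1 + μ) * K := by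
    have h1 := wnorm_sub_le hZ (HI.incl b s p) ((μ : ℂ) • HI.incl b s (HI.deriv b (s + 1) (v 2)))
    rw [wnorm_smul, Complex.norm_real, Real.norm_of_nonneg hμ.le] at h1
    have h2 := (hincl p).trans p1
    have h3 := ((hincl (HI.deriv b (s + 1) (v 2))).trans (wnorm_deriv_le hZ _)).trans (p2 2)
    have h4 := mul_le_mul_of_nonneg_left h1 hξ0
    have h5 := mul_le_mul_of_nonneg_left h3 hμ.le
    linarith
  have hf2 : ‖ξ‖ * wnorm Z (-(μ : ℂ) • HI.deriv b s (HI.incl b (s + 1) (v j.castSucc))) ≤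
      μ * K := by
    rw [wnorm_smul, norm_neg, Complex.norm_real, Real.norm_of_nonneg hμ.le]
    have h1 := mul_le_mul_of_nonneg_left (wnorm_deriv_le hZ (HI.incl b (s + 1) (v j.castSucc))) hξ0
    have h2 := mul_le_mul_of_nonneg_left (h1.trans ((hincl (v j.castSucc)).trans (p2 _))) hμ.le
    linarith
  have hg : ‖ξ‖ * wnorm Z (HI.incl b (s + 1) (v j.castSucc)) ≤ K := (hincl _).trans (p2 _)
  have hsw : ∀ t : ℝ, 0 ≤ t → ‖ξ‖ * (Real.sqrt Z * Z ^ s * t) ≤ Real.sqrt Z * Z ^ (s + 1) * t := by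
    intro t ht
    calc _ ≤ Z * (Real.sqrt Z * Z ^ s * t) := mul_le_mul_of_nonneg_right hξZ (by positivity)
      _ = _ := by rw [pow_succ]; ring
  have hkj : ‖ξ‖ * (Real.sqrt Z * Z ^ s * ‖(μ : ℂ) * trTop b (s + 1) (v 2)‖) ≤
      2 * μ * (b⁻¹ + 1) * K := by
    rw [norm_mul, Complex.norm_real, Real.norm_of_nonneg hμ.le]
    refine (hsw _ (by positivity)).trans ?_
    have := mul_le_mul_of_nonneg_left ((sqrt_mul_norm_trTop_le_wnorm hb hZ1 (v 2)).trans
      (mul_le_mul_of_nonneg_left (p2 2) (by positivity))) hμ.le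
    linarith
  have hk2 : ‖ξ‖ * (Real.sqrt Z * Z ^ s * ‖-((κ : ℂ) * χ j)‖) ≤ κ * K := by
    rw [norm_neg, norm_mul, Complex.norm_real, Real.norm_of_nonneg hκ.le]
    refine (hsw _ (by positivity)).trans ?_
    have := mul_le_mul_of_nonneg_left (p3 j) hκ.le
    linarith
  have hc : ∀ i, ‖ξ‖ * (Real.sqrt Z * Z ^ (s + 1) * (‖χ i‖ / modulus ξ)) ≤ K := by
    intro i
    calc _ = Real.sqrt Z * Z ^ (s + 1) * (‖ξ‖ * (‖χ i‖ / modulus ξ)) := by ring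
      _ ≤ Real.sqrt Z * Z ^ (s + 1) * ‖χ i‖ :=
        mul_le_mul_of_nonneg_left (hξl _ (norm_nonneg _)) (by positivity)
      _ ≤ K := p3 i
  have hflux : ‖ξ‖ * (Z ^ s * (‖testI b 1 (der b (s + 1) 0 (HI.incl b (s + 1) (v j.castSucc)))‖ /
      modulus ξ)) ≤ Real.sqrt b * K := by
    rw [HI.der_incl (by omega)]
    have h1 := (le_wnorm hZ (v j.castSucc) (Nat.zero_le _)).trans (p2 _)
    have h2 : Z ^ s ≤ Z ^ (s + 2 - 0) := pow_le_pow_right₀ hZ1 (by omega)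
    calc _ = Z ^ s * (‖ξ‖ * (‖testI b 1 (der b (s + 2) 0 (v j.castSucc))‖ / modulus ξ)) := by ring
      _ ≤ Z ^ s * (Real.sqrt b * ‖der b (s + 2) 0 (v j.castSucc)‖) :=
        mul_le_mul_of_nonneg_left ((hξl _ (norm_nonneg _)).trans (norm_testI_one_le hb _))
          (by positivity)
      _ ≤ Z ^ (s + 2 - 0) * (Real.sqrt b * ‖der b (s + 2) 0 (v j.castSucc)‖) := by gcongr
      _ = Real.sqrt b * (Z ^ (s + 2 - 0) * ‖der b (s + 2) 0 (v j.castSucc)‖) := by ring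
      _ ≤ _ := mul_le_mul_of_nonneg_left h1 (Real.sqrt_nonneg _)
  have hc0 := hc 0
  have hc1 := hc 1
  rw [normY]
  fin_cases j
  · simp [sysOne, Fin.sum_univ_three, wnorm_zero] at hfj hf2 hg hkj hk2 hflux ⊢
    linarith
  · simp [sysOne, Fin.sum_univ_three, wnorm_zero] at hfj hf2 hg hkj hk2 hflux ⊢
    linarith

theorem normY_sysTwo_le {μ : ℝ} (hμ : 0 < μ) (j k : Fin 2) :
    ∃ C : ℝ, 0 ≤ C ∧ ∀ ξ : Plane, ξ ≠ 0 → ∀ x : Unknowns b s,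
      ‖ξ‖ * (‖ξ‖ * normY (bracket ξ) (modulus ξ) (sysTwo b μ s j k x)) ≤
        C * normX (bracket ξ) x := by
  refine ⟨6 * μ, by positivity, fun ξ hξ x => ?_⟩
  have hZ := (bracket_pos ξ).le
  have hξ0 := norm_nonneg ξ
  have hw : ∀ i, ‖ξ‖ * (‖ξ‖ * wnorm (bracket ξ) (HI.incl b s (HI.incl b (s + 1) (x.2.1 i)))) ≤
      normX (bracket ξ) x := fun i =>
    (mul_le_mul_of_nonneg_left (norm_mul_wnorm_incl_le ξ _) hξ0).trans
      ((norm_mul_wnorm_incl_le ξ _).trans ((normX_terms hZ x).2.1 i))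
  have hK := (normX_terms hZ x).2.2.2
  set K := normX (bracket ξ) x
  have hf : ∀ i, ‖ξ‖ * (‖ξ‖ * wnorm (bracket ξ) ((sysTwo b μ s j k x).1 i)) ≤ μ * (2 * K) := by
    intro i
    have e : (sysTwo b μ s j k x).1 i = (-(μ : ℂ)) • ((if j = k then
        HI.incl b s (HI.incl b (s + 1) (x.2.1 i)) else 0) + if i = j.castSucc then
        HI.incl b s (HI.incl b (s + 1) (x.2.1 k.castSucc)) else 0) := by
      by_cases h2 : i = j.castSucc
      · subst h2; by_cases h1 : j = k <;> simp [sysTwo, h1]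
      · by_cases h1 : j = k
        · subst h1; simp [sysTwo, h2]
        · simp [sysTwo, h1, h2]
    rw [e, wnorm_smul, norm_neg, Complex.norm_real, Real.norm_of_nonneg hμ.le]
    have h3 := wnorm_add_le hZ (if j = k then HI.incl b s (HI.incl b (s + 1) (x.2.1 i)) else 0)
      (if i = j.castSucc then HI.incl b s (HI.incl b (s + 1) (x.2.1 k.castSucc)) else 0)
    have hite : ∀ (q : Prop) [Decidable q] (i : Fin 3), ‖ξ‖ * (‖ξ‖ * wnorm (bracket ξ)
        (if q then HI.incl b s (HI.incl b (s + 1) (x.2.1 i)) else 0)) ≤ K := by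
      intro q _ i
      split_ifs
      · exact hw i
      · rw [wnorm_zero, mul_zero, mul_zero]; exact hK
    have h4 := mul_le_mul_of_nonneg_left (mul_le_mul_of_nonneg_left h3 hξ0) hξ0
    have h5 := hite (j = k) i
    have h6 := hite (i = j.castSucc) k.castSucc
    rw [mul_left_comm ‖ξ‖ μ, mul_left_comm ‖ξ‖ μ]
    refine mul_le_mul_of_nonneg_left (h4.trans ?_) hμ.le
    rw [mul_add, mul_add]
    linarith
  have h0 := hf 0
  have h1 := hf 1
  have h2 := hf 2
  have e : normY (bracket ξ) (modulus ξ) (sysTwo b μ s j k x) =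
      ∑ i, wnorm (bracket ξ) ((sysTwo b μ s j k x).1 i) := by
    rw [normY]
    simp [sysTwo, wnorm_zero]
  rw [e, Fin.sum_univ_three]
  linarith

theorem isSymbol_fiberOp (hb : 0 < b) {γ κ μ : ℝ} (hγ : 0 < γ) (hκ : 0 < κ) (hμ : 0 < μ) (n : ℕ) :
    IsSymbol n (fun ξ (x : noSlip b s) => normX (bracket ξ) (x : Unknowns b s))
      (fun ξ y => normY (bracket ξ) (modulus ξ) y)
      (fun ξ => fiberOp b γ κ μ s (dsym ξ)) := by
  have hW := isWeight_normY (b := b) (s := s)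
  obtain ⟨C₀, hC₀, h₀⟩ := normY_sysZero_le (s := s) hb hγ hμ
  have hT0 : IsSymbol n (fun ξ (x : noSlip b s) => normX (bracket ξ) (x : Unknowns b s))
      (fun ξ y => normY (bracket ξ) (modulus ξ) y)
      (fun _ => (sysZero b γ μ s).comp (noSlip b s).subtypeL) :=
    IsSymbol.const hW.zero hC₀ h₀
  have hT1 : ∀ j, IsSymbol n (fun ξ (x : noSlip b s) => normX (bracket ξ) (x : Unknowns b s))
      (fun ξ y => normY (bracket ξ) (modulus ξ) y)
      (fun ξ => dsym ξ j • (sysOne b κ μ s j).comp (noSlip b s).subtypeL) := fun j => by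
    obtain ⟨C, hC, h⟩ := normY_sysOne_le (s := s) hb hκ hμ j
    exact IsSymbol.dsym_smul (T := (sysOne b κ μ s j).comp (noSlip b s).subtypeL) hW hC
      (fun ξ hξ x => h ξ hξ x.1) j
  have hT2 : ∀ j k, IsSymbol n (fun ξ (x : noSlip b s) => normX (bracket ξ) (x : Unknowns b s))
      (fun ξ y => normY (bracket ξ) (modulus ξ) y)
      (fun ξ => (dsym ξ j * dsym ξ k) • (sysTwo b μ s j k).comp (noSlip b s).subtypeL) :=
    fun j k => by
      obtain ⟨C, hC, h⟩ := normY_sysTwo_le (b := b) (s := s) hμ j k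
      exact IsSymbol.dsym_mul_dsym_smul (T := (sysTwo b μ s j k).comp (noSlip b s).subtypeL) hW hC
        (fun ξ hξ x => h ξ hξ x.1) j k
  refine (IsSymbol.add hW.add_le (IsSymbol.add hW.add_le hT0 (IsSymbol.add hW.add_le (hT1 0)
    (hT1 1))) (IsSymbol.add hW.add_le (IsSymbol.add hW.add_le (hT2 0 0) (hT2 0 1))
    (IsSymbol.add hW.add_le (hT2 1 0) (hT2 1 1)))).congr fun ξ _ => ?_
  rw [fiberOp, fiberSys]
  simp only [Fin.sum_univ_two, ContinuousLinearMap.add_comp, ContinuousLinearMap.smul_comp]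

theorem isInvertible_fiberOp (hb : 0 < b) {γ κ μ : ℝ} (hγ : 0 < γ) (hκ : 0 < κ) (hμ : 0 < μ)
    {ξ : Plane} (hξ : ξ ≠ 0) : (fiberOp b γ κ μ s (dsym ξ)).IsInvertible :=
  ⟨ContinuousLinearEquiv.ofBijective (fiberOp b γ κ μ s (dsym ξ))
    (LinearMap.ker_eq_bot.2 (fiberOp_injective hb hγ hκ hμ hξ))
    (LinearMap.range_eq_top.2 (fiberOp_surjective hb hγ hκ hμ hξ)), by ext1; rfl⟩

theorem isWeight_normX_noSlip :
    IsWeight fun ξ (x : noSlip b s) => normX (bracket ξ) (x : Unknowns b s) where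
  nonneg ξ x := isWeight_normX.nonneg ξ (x : Unknowns b s)
  add_le ξ x y := isWeight_normX.add_le ξ (x : Unknowns b s) (y : Unknowns b s)
  smul ξ c x := isWeight_normX.smul ξ c (x : Unknowns b s)

theorem isSymbol_inverse_fiberOp (hb : 0 < b) {γ κ μ : ℝ} (hγ : 0 < γ) (hκ : 0 < κ) (hμ : 0 < μ)
    (n : ℕ) : IsSymbol n (fun ξ y => normY (bracket ξ) (modulus ξ) y)
      (fun ξ (x : noSlip b s) => normX (bracket ξ) (x : Unknowns b s))
      (fun ξ => (fiberOp b γ κ μ s (dsym ξ)).inverse) := by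
  obtain ⟨C, hC, h⟩ := fiberOp_apriori (s := s) hb hγ hκ hμ
  exact IsSymbol.inverse (E := noSlip b s) (F := FiberData b s)
    (NE := fun ξ (x : noSlip b s) => normX (bracket ξ) (x : Unknowns b s))
    (NF := fun ξ y => normY (bracket ξ) (modulus ξ) y) (L := fun ξ => fiberOp b γ κ μ s (dsym ξ))
    isWeight_normX_noSlip isWeight_normY (fun n => isSymbol_fiberOp hb hγ hκ hμ n)
    (fun ξ hξ => isInvertible_fiberOp hb hγ hκ hμ hξ) hC h n

/-! ### Passage to the spaces of vector valued functions -/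

/-- The data `(f, 0, k, 0, 0)` for `(f, k, H)`. -/
def dataZero (b : ℝ) (s : ℕ) : FiberY b s →L[ℂ] FiberData b s :=
  assemble (fun i => (HI.map b s (coord i)).comp (ContinuousLinearMap.fst ℂ _ _)) 0
    (fun i => (coord i).comp ((ContinuousLinearMap.fst ℂ _ _).comp (ContinuousLinearMap.snd ℂ _ _)))
    0 0

/-- The data `(0, 0, 0, Hⱼ, 0)` for `(f, k, H)`. -/
def dataOne (b : ℝ) (s : ℕ) (j : Fin 2) : FiberY b s →L[ℂ] FiberData b s :=
  assemble 0 0 0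
    ((coord j).comp ((ContinuousLinearMap.snd ℂ _ _).comp (ContinuousLinearMap.snd ℂ _ _))) 0

/-- The data `(f, 0, k, d · H, 0)` for `(f, k, H)`. -/
def dataOp (b : ℝ) (s : ℕ) (d : Fin 2 → ℂ) : FiberY b s →L[ℂ] FiberData b s :=
  dataZero b s + ∑ j, d j • dataOne b s j

theorem dataOp_apply (d : Fin 2 → ℂ) (y : FiberY b s) : dataOp b s d y =
    (fun i => HI.map b s (coord i) y.1, 0, fun i => y.2.1 i, d 0 * y.2.2 0 + d 1 * y.2.2 1, 0) := by
  simp [dataOp, dataZero, dataOne, Fin.sum_univ_two]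
  exact ⟨by funext i; simp, by funext i; simp⟩

/-- The unknowns as vector valued functions. -/
def toFiberX (b : ℝ) (s : ℕ) : Unknowns b s →L[ℂ] FiberX b s :=
  prP.prod (((HI.ofComponents b (s + 2) 3).comp (ContinuousLinearMap.pi prV)).prod
    (((PiLp.continuousLinearEquiv 2 ℂ (fun _ : Fin 2 => ℂ)).symm.toContinuousLinearMap).comp
      (ContinuousLinearMap.pi prX)))

theorem toFiberX_apply (x : Unknowns b s) :
    toFiberX b s x = (x.1, HI.ofComponents b (s + 2) 3 x.2.1, WithLp.toLp 2 x.2.2) := rfl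

/-- The symbol of the solution operator. -/
def psiSymbol (b γ κ μ : ℝ) (s : ℕ) (ξ : Plane) : FiberOp b s :=
  ((toFiberX b s).comp (noSlip b s).subtypeL).comp
    ((fiberOp b γ κ μ s (dsym ξ)).inverse.comp (dataOp b s (dsym ξ)))

/-- The weighted norm on the space of the data. -/
def normFY (Z : ℝ) (y : FiberY b s) : ℝ :=
  wnorm Z y.1 + Real.sqrt Z * Z ^ s * ‖y.2.1‖ + Real.sqrt Z * Z ^ (s + 2) * ‖y.2.2‖

/-- The weighted norm on the space of the solutions. -/
def normFX (Z : ℝ) (x : FiberX b s) : ℝ :=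
  wnorm Z x.1 + wnorm Z x.2.1 + Real.sqrt Z * Z ^ (s + 1) * ‖x.2.2‖

theorem isWeight_normFX : IsWeight fun ξ (x : FiberX b s) => normFX (bracket ξ) x where
  nonneg ξ x := by
    have hZ := (bracket_pos ξ).le
    have h1 := wnorm_nonneg hZ x.1
    have h2 := wnorm_nonneg hZ x.2.1
    rw [normFX]; positivity
  add_le ξ x y := by
    have hZ := (bracket_pos ξ).le
    have h1 := wnorm_add_le hZ x.1 y.1
    have h2 := wnorm_add_le hZ x.2.1 y.2.1
    have h3 := mul_le_mul_of_nonneg_left (norm_add_le x.2.2 y.2.2)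
      (show 0 ≤ Real.sqrt (bracket ξ) * bracket ξ ^ (s + 1) by positivity)
    rw [normFX, normFX, normFX]
    change wnorm _ (x.1 + y.1) + wnorm _ (x.2.1 + y.2.1) + _ * ‖x.2.2 + y.2.2‖ ≤ _
    linarith
  smul ξ c x := by
    rw [normFX, normFX]
    change wnorm _ (c • x.1) + wnorm _ (c • x.2.1) + _ * ‖c • x.2.2‖ = _
    rw [wnorm_smul, wnorm_smul, norm_smul]
    ring

theorem norm_coord_le {n : ℕ} (i : Fin n) : ‖(coord i : Cn n →L[ℂ] ℂ)‖ ≤ 1 :=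
  ContinuousLinearMap.opNorm_le_bound _ zero_le_one fun x => by
    rw [one_mul]; exact PiLp.norm_apply_le x i

theorem norm_axis_le {n : ℕ} (i : Fin n) : ‖(axis i : ℂ →L[ℂ] Cn n)‖ ≤ 1 :=
  ContinuousLinearMap.opNorm_le_bound _ zero_le_one fun x => by
    simp [axis, norm_smul]

theorem wnorm_map_le {V W : Type} [NormedAddCommGroup V] [InnerProductSpace ℂ V] [CompleteSpace V]
    [NormedAddCommGroup W] [InnerProductSpace ℂ W] [CompleteSpace W] {k : ℕ} {Z : ℝ} (hZ : 0 ≤ Z)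
    {A : V →L[ℂ] W} (hA : ‖A‖ ≤ 1) (w : HI b k V) : wnorm Z (HI.map b k A w) ≤ wnorm Z w := by
  refine Finset.sum_le_sum fun j _ => mul_le_mul_of_nonneg_left ?_ (by positivity)
  rw [HI.der_map]
  refine (A.norm_compLp_le _).trans ?_
  exact mul_le_of_le_one_left (norm_nonneg _) hA

theorem normX_toFiberX_le (ξ : Plane) (x : Unknowns b s) :
    normFX (bracket ξ) (toFiberX b s x) ≤ normX (bracket ξ) x := by
  have hZ := (bracket_pos ξ).le
  rw [toFiberX_apply, normFX, normX]
  refine add_le_add (add_le_add le_rfl ?_) (mul_le_mul_of_nonneg_left ?_ (by positivity))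
  · dsimp only
    rw [HI.ofComponents_apply, Fin.sum_univ_three, Fin.sum_univ_three]
    have h := fun i : Fin 3 => wnorm_map_le hZ (norm_axis_le i) (x.2.1 i)
    have h0 := h 0
    have h1 := h 1
    have h2 := h 2
    have h3 := wnorm_add_le hZ (HI.map b (s + 2) (axis (0 : Fin 3)) (x.2.1 0) +
      HI.map b (s + 2) (axis 1) (x.2.1 1)) (HI.map b (s + 2) (axis 2) (x.2.1 2))
    have h4 := wnorm_add_le hZ (HI.map b (s + 2) (axis (0 : Fin 3)) (x.2.1 0))
      (HI.map b (s + 2) (axis 1) (x.2.1 1))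
    linarith
  · have h : WithLp.toLp 2 x.2.2 = ∑ j, axis j (x.2.2 j) :=
      (sum_axis_coord (WithLp.toLp 2 x.2.2)).symm
    dsimp only
    rw [h]
    refine (norm_sum_le _ _).trans (Finset.sum_le_sum fun j _ => ?_)
    exact ((axis j).le_opNorm _).trans (mul_le_of_le_one_left (norm_nonneg _) (norm_axis_le j))

theorem normY_dataZero_le (ξ : Plane) (y : FiberY b s) :
    normY (bracket ξ) (modulus ξ) (dataZero b s y) ≤ 3 * normFY (bracket ξ) y := by
  have hZ := (bracket_pos ξ).le
  have h1 := fun i : Fin 3 => wnorm_map_le hZ (norm_coord_le i) y.1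
  have h2 := fun i : Fin 3 => mul_le_mul_of_nonneg_left (PiLp.norm_apply_le y.2.1 i)
    (show 0 ≤ Real.sqrt (bracket ξ) * bracket ξ ^ s by positivity)
  have h10 := h1 0
  have h11 := h1 1
  have h12 := h1 2
  have h20 := h2 0
  have h21 := h2 1
  have h22 := h2 2
  have h3 : 0 ≤ Real.sqrt (bracket ξ) * bracket ξ ^ (s + 2) * ‖y.2.2‖ := by positivity
  rw [normY, normFY]
  simp [dataZero, Fin.sum_univ_three, wnorm_zero] at h10 h11 h12 h20 h21 h22 ⊢
  linarith

/-- The datum h = d·H carries a factor ξ, which is what the singular flux term of `normY` asks for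
at g = 0. A general normal velocity h would not be admissible near ξ = 0. -/
theorem normY_dataOne_le {ξ : Plane} (hξ : ξ ≠ 0) (j : Fin 2) (y : FiberY b s) :
    ‖ξ‖ * normY (bracket ξ) (modulus ξ) (dataOne b s j y) ≤ 2 * normFY (bracket ξ) y := by
  have hZ1 := one_le_bracket ξ
  have hZ := (bracket_pos ξ).le
  have hl := modulus_pos hξ
  have h1 := wnorm_nonneg hZ y.1
  have h2 : 0 ≤ Real.sqrt (bracket ξ) * bracket ξ ^ s * ‖y.2.1‖ := by positivity
  have hs : 1 ≤ Real.sqrt (bracket ξ) := Real.one_le_sqrt.2 hZ1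
  have h3 := PiLp.norm_apply_le y.2.2 j
  have h4 : ‖ξ‖ * (Real.sqrt (bracket ξ) * bracket ξ ^ (s + 1) * ‖y.2.2 j‖) ≤
      Real.sqrt (bracket ξ) * bracket ξ ^ (s + 2) * ‖y.2.2‖ := by
    calc _ ≤ bracket ξ * (Real.sqrt (bracket ξ) * bracket ξ ^ (s + 1) * ‖y.2.2‖) := by
          have := norm_le_bracket ξ; gcongr
      _ = _ := by ring
  have h5 : ‖ξ‖ * (bracket ξ ^ s * (‖y.2.2 j‖ / modulus ξ)) ≤
      Real.sqrt (bracket ξ) * bracket ξ ^ (s + 2) * ‖y.2.2‖ := by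
    have h6 : ‖ξ‖ * (‖y.2.2 j‖ / modulus ξ) ≤ ‖y.2.2‖ := by
      rw [← mul_div_assoc, div_le_iff₀ hl, mul_comm]
      exact mul_le_mul h3 (norm_le_modulus ξ) (norm_nonneg _) (norm_nonneg _)
    have h7 : bracket ξ ^ s ≤ Real.sqrt (bracket ξ) * bracket ξ ^ (s + 2) :=
      (pow_le_pow_right₀ hZ1 (by omega)).trans (le_mul_of_one_le_left (by positivity) hs)
    calc _ = bracket ξ ^ s * (‖ξ‖ * (‖y.2.2 j‖ / modulus ξ)) := by ring
      _ ≤ _ := mul_le_mul h7 h6 (by positivity) (by positivity)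
  have e : normY (bracket ξ) (modulus ξ) (dataOne b s j y) = Real.sqrt (bracket ξ) *
      bracket ξ ^ (s + 1) * ‖y.2.2 j‖ + bracket ξ ^ s * (‖y.2.2 j‖ / modulus ξ) := by
    rw [normY]
    simp [dataOne, wnorm_zero]
  rw [e, normFY, mul_add]
  linarith

theorem isSymbol_psiSymbol (hb : 0 < b) {γ κ μ : ℝ} (hγ : 0 < γ) (hκ : 0 < κ) (hμ : 0 < μ)
    (n : ℕ) : IsSymbol n (fun ξ y => normFY (bracket ξ) y) (fun ξ x => normFX (bracket ξ) x)
      (psiSymbol b γ κ μ s) := by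
  have hW := isWeight_normY (b := b) (s := s)
  have h0 : IsSymbol n (fun ξ (y : FiberY b s) => normFY (bracket ξ) y)
      (fun ξ y => normY (bracket ξ) (modulus ξ) y) (fun ξ => dataOp b s (dsym ξ)) := by
    have h1 := fun j => IsSymbol.dsym_smul (n := n) hW (C := 2) (by norm_num)
      (fun ξ hξ y => normY_dataOne_le (b := b) (s := s) hξ j y) j
    refine (IsSymbol.add hW.add_le (IsSymbol.const hW.zero (C := 3) (by norm_num)
      fun ξ _ y => normY_dataZero_le ξ y) (IsSymbol.add hW.add_le (h1 0) (h1 1))).congr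
      fun ξ _ => ?_
    rw [dataOp, Fin.sum_univ_two]
  refine IsSymbol.comp isWeight_normFX.add_le (IsSymbol.const isWeight_normFX.zero (C := 1)
    (by norm_num) fun ξ _ x => ?_) (IsSymbol.comp (fun ξ x y => isWeight_normX.add_le ξ _ _)
    (isSymbol_inverse_fiberOp hb hγ hκ hμ n) h0)
  rw [one_mul]
  exact normX_toFiberX_le ξ _

end FiberSymbol

end
end CurlLayer

namespace CurlLayer

noncomputable section

/-! ### The bounds on the blocks of a symbol -/

section Bounds

variable {b : ℝ} {s : ℕ}

theorem wnorm_zero_smul_sum_le {k n : ℕ} {Z : ℝ} (hZ : 0 ≤ Z) (w : HI b k (Cn n)) :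
    wnorm Z w ≤ ∑ i, wnorm Z (HI.map b k (coord i) w) := by
  conv_lhs => rw [← HI.ofComponents_map_coord w, HI.ofComponents_apply]
  have key : ∀ (t : Finset (Fin n)) (F : Fin n → HI b k (Cn n)),
      wnorm Z (∑ i ∈ t, F i) ≤ ∑ i ∈ t, wnorm Z (F i) := by
    intro t F
    induction t using Finset.cons_induction with
    | empty => simp [wnorm_zero]
    | cons i t hi ih =>
      rw [Finset.sum_cons, Finset.sum_cons]
      exact (wnorm_add_le hZ _ _).trans (by linarith)
  exact (key _ _).trans (Finset.sum_le_sum fun i _ => wnorm_map_le hZ (norm_axis_le i) _)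

/-- Interpolation removes the intermediate derivatives from the weighted norm and leaves the
two-term expression of the admissible class, with a constant independent of Z. -/
theorem exists_wnorm_le (hb : 0 < b) (n : ℕ) : ∃ K : ℝ, 1 ≤ K ∧ ∀ Z : ℝ, 1 ≤ Z →
    ∀ w : HI b s (Cn n), wnorm Z w ≤ K * (‖w‖ + Z ^ s * ‖toL2 b s w‖) := by
  choose! C hC h using fun (j : ℕ) (hj : j ≤ s) => interp_der hb s hj
  have hsum : 0 ≤ ∑ j ∈ Finset.range (s + 1), C j :=
    Finset.sum_nonneg fun j hj => hC j (by simpa [Nat.lt_succ_iff] using hj)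
  refine ⟨1 + n * ∑ j ∈ Finset.range (s + 1), C j, by
    have : (0 : ℝ) ≤ n * ∑ j ∈ Finset.range (s + 1), C j := by positivity
    linarith, fun Z hZ w => ?_⟩
  have hZ0 : 0 ≤ Z := by linarith
  have h1 : ∀ i, wnorm Z (HI.map b s (coord i) w) ≤
      (∑ j ∈ Finset.range (s + 1), C j) * (‖w‖ + Z ^ s * ‖toL2 b s w‖) := by
    intro i
    rw [wnorm, Finset.sum_mul]
    refine Finset.sum_le_sum fun j hj => ?_
    have hj' : j ≤ s := by simpa [Nat.lt_succ_iff] using hj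
    refine (h j hj' Z hZ _).trans (mul_le_mul_of_nonneg_left ?_ (hC j hj'))
    have h2 : ∀ l, ‖der b s l (HI.map b s (coord i) w)‖ ≤ ‖der b s l w‖ := by
      intro l
      rw [HI.der_map]
      exact ((coord i).norm_compLp_le _).trans
        (mul_le_of_le_one_left (norm_nonneg _) (norm_coord_le i))
    rw [toL2_eq_der]
    exact add_le_add ((h2 s).trans (HI.norm_der_le s w))
      (mul_le_mul_of_nonneg_left (h2 0) (by positivity))
  refine (wnorm_zero_smul_sum_le hZ0 w).trans ?_
  refine (Finset.sum_le_sum fun i _ => h1 i).trans ?_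
  rw [Finset.sum_const, Finset.card_univ, Fintype.card_fin, nsmul_eq_mul]
  have : 0 ≤ ‖w‖ + Z ^ s * ‖toL2 b s w‖ := by positivity
  nlinarith

theorem norm_le_wnorm {V : Type} [NormedAddCommGroup V] [InnerProductSpace ℂ V] {k : ℕ} {Z : ℝ}
    (hZ : 1 ≤ Z) (w : HI b k V) : ‖w‖ ≤ wnorm Z w :=
  (HI.norm_le_sum w).trans (Finset.sum_le_sum fun _ _ =>
    le_mul_of_one_le_left (norm_nonneg _) (one_le_pow₀ hZ))

theorem norm_add_le_wnorm {V : Type} [NormedAddCommGroup V] [InnerProductSpace ℂ V] {k : ℕ} {Z : ℝ}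
    (hZ : 1 ≤ Z) (w : HI b k V) : ‖w‖ + Z ^ k * ‖toL2 b k w‖ ≤ 2 * wnorm Z w := by
  have h := le_wnorm (by linarith : 0 ≤ Z) w (Nat.zero_le k)
  rw [toL2_eq_der, two_mul]
  exact add_le_add (norm_le_wnorm hZ w) h

theorem mul_opNorm_le {E F : Type} [NormedAddCommGroup E] [NormedSpace ℂ E]
    [NormedAddCommGroup F] [NormedSpace ℂ F] {T : E →L[ℂ] F} {a B : ℝ} (ha : 0 < a) (hB : 0 ≤ B)
    (h : ∀ x, a * ‖T x‖ ≤ B * ‖x‖) : a * ‖T‖ ≤ B := by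
  rw [mul_comm, ← le_div_iff₀ ha]
  refine T.opNorm_le_bound (by positivity) fun x => ?_
  rw [div_mul_eq_mul_div, le_div_iff₀ ha, mul_comm]
  exact h x

theorem bracket_rpow (ξ : Plane) (r : ℝ) (n : ℕ) (hr : r = 1 / 2 + n) :
    bracket ξ ^ r = Real.sqrt (bracket ξ) * bracket ξ ^ n := by
  rw [hr, Real.rpow_add (bracket_pos ξ), Real.rpow_natCast, Real.sqrt_eq_rpow]

theorem normFX_nonneg {Z : ℝ} (hZ : 0 ≤ Z) (x : FiberX b s) :
    0 ≤ wnorm Z x.1 ∧ 0 ≤ wnorm Z x.2.1 ∧ 0 ≤ Real.sqrt Z * Z ^ (s + 1) * ‖x.2.2‖ :=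
  ⟨wnorm_nonneg hZ _, wnorm_nonneg hZ _, by positivity⟩

theorem opNorm_add_le_of_wnorm {E V : Type} [NormedAddCommGroup E] [NormedSpace ℂ E]
    [NormedAddCommGroup V] [InnerProductSpace ℂ V] {k : ℕ} {Z B : ℝ} (hZ : 1 ≤ Z) (hB : 0 ≤ B)
    {T : E →L[ℂ] HI b k V} (h : ∀ x, wnorm Z (T x) ≤ B * ‖x‖) :
    ‖T‖ + Z ^ k * ‖(toL2 b k).comp T‖ ≤ 2 * B := by
  rw [two_mul]
  refine add_le_add ?_ ?_
  · exact T.opNorm_le_bound hB fun x => (norm_le_wnorm hZ _).trans (h x)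
  · refine mul_opNorm_le (by positivity) hB fun x => le_trans ?_ (h x)
    have h := le_wnorm (by linarith : 0 ≤ Z) (T x) (Nat.zero_le k)
    rwa [ContinuousLinearMap.comp_apply, toL2_eq_der]

/-- Data with a single nonzero component test one column, and each summand of `normFX` is one row.
The factors √Z Z^n are the half-integer powers of the bracket. The constant doubles because the
required bounds add two norms, each at most the weighted one. -/
theorem symbolBounds_of_normFX_le {C K : ℝ} (hC : 0 ≤ C) (hK : 1 ≤ K) {ξ : Plane}
    (hw : ∀ w : HI b s (Cn 3), wnorm (bracket ξ) w ≤ K * (‖w‖ + bracket ξ ^ s * ‖toL2 b s w‖))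
    {A : FiberOp b s} (h : ∀ y, normFX (bracket ξ) (A y) ≤ C * normFY (bracket ξ) y) :
    SymbolBounds b s (2 * (C * K)) ξ A := by
  have hZ := one_le_bracket ξ
  have hZ0 := bracket_pos ξ
  have e1 := bracket_rpow ξ (1 / 2 + s) s rfl
  have e2 := bracket_rpow ξ (3 / 2 + s) (s + 1) (by push_cast; ring)
  have e3 := bracket_rpow ξ (5 / 2 + s) (s + 2) (by push_cast; ring)
  have hCK : C ≤ C * K := le_mul_of_one_le_right hC hK
  have h1 : ∀ φ : HI b s (Cn 3), normFX (bracket ξ) (A (φ, 0, 0)) ≤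
      C * K * (‖φ‖ + bracket ξ ^ s * ‖toL2 b s φ‖) := by
    intro φ
    have h2 := h (φ, 0, 0)
    simp only [normFY, norm_zero, mul_zero, add_zero] at h2
    refine h2.trans ?_
    rw [mul_assoc]
    exact mul_le_mul_of_nonneg_left (hw φ) hC
  have h2 : ∀ k : Cn 3, normFX (bracket ξ) (A (0, k, 0)) ≤
      C * K * (Real.sqrt (bracket ξ) * bracket ξ ^ s) * ‖k‖ := by
    intro k
    have h3 := h (0, k, 0)
    simp only [normFY, norm_zero, mul_zero, add_zero, zero_add, wnorm_zero] at h3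
    refine h3.trans ?_
    rw [mul_assoc (C * K)]
    exact mul_le_mul_of_nonneg_right hCK (by positivity)
  have h3 : ∀ k : Cn 2, normFX (bracket ξ) (A (0, 0, k)) ≤
      C * K * (Real.sqrt (bracket ξ) * bracket ξ ^ (s + 2)) * ‖k‖ := by
    intro k
    have h3 := h (0, 0, k)
    simp only [normFY, norm_zero, mul_zero, zero_add, wnorm_zero] at h3
    refine h3.trans ?_
    rw [mul_assoc (C * K)]
    exact mul_le_mul_of_nonneg_right hCK (by positivity)
  have hn := normFX_nonneg (b := b) (s := s) hZ0.le
  have hB1 : 0 ≤ C * K * (Real.sqrt (bracket ξ) * bracket ξ ^ s) := by positivity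
  have hB2 : 0 ≤ C * K * (Real.sqrt (bracket ξ) * bracket ξ ^ (s + 2)) := by positivity
  have p1 : ∀ x : FiberX b s, wnorm (bracket ξ) x.1 ≤ normFX (bracket ξ) x := fun x => by
    obtain ⟨a1, a2, a3⟩ := hn x
    rw [normFX]; linarith
  have p2 : ∀ x : FiberX b s, wnorm (bracket ξ) x.2.1 ≤ normFX (bracket ξ) x := fun x => by
    obtain ⟨a1, a2, a3⟩ := hn x
    rw [normFX]; linarith
  have p3 : ∀ x : FiberX b s, Real.sqrt (bracket ξ) * bracket ξ ^ (s + 1) * ‖x.2.2‖ ≤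
      normFX (bracket ξ) x := fun x => by
    obtain ⟨a1, a2, a3⟩ := hn x
    rw [normFX]; linarith
  have q0 : ∀ φ : HI b s (Cn 3), 0 ≤ C * K * (‖φ‖ + bracket ξ ^ s * ‖toL2 b s φ‖) :=
    fun φ => by positivity
  rw [show 2 * (C * K) = 2 * (C * K) from rfl]
  constructor
  · intro φ
    rw [Nat.add_comm 1 s, mul_assoc 2]
    exact (norm_add_le_wnorm hZ _).trans
      (mul_le_mul_of_nonneg_left ((p1 _).trans (h1 φ)) zero_le_two)
  · rw [e1, Nat.add_comm 1 s, mul_assoc 2]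
    exact opNorm_add_le_of_wnorm hZ hB1 fun k => (p1 _).trans (h2 k)
  · rw [e3, Nat.add_comm 1 s, mul_assoc 2]
    exact opNorm_add_le_of_wnorm hZ hB2 fun k => (p1 _).trans (h3 k)
  · intro φ
    rw [Nat.add_comm 2 s, mul_assoc 2]
    exact (norm_add_le_wnorm hZ _).trans
      (mul_le_mul_of_nonneg_left ((p2 _).trans (h1 φ)) zero_le_two)
  · rw [e1, Nat.add_comm 2 s, mul_assoc 2]
    exact opNorm_add_le_of_wnorm hZ hB1 fun k => (p2 _).trans (h2 k)
  · rw [e3, Nat.add_comm 2 s, mul_assoc 2]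
    exact opNorm_add_le_of_wnorm hZ hB2 fun k => (p2 _).trans (h3 k)
  · intro φ
    rw [e2, mul_assoc 2]
    refine ((p3 _).trans (h1 φ)).trans ?_
    linarith [q0 φ]
  · rw [e1, e2, mul_assoc 2]
    refine (mul_opNorm_le (by positivity) hB1 fun k => (p3 _).trans (h2 k)).trans ?_
    linarith
  · rw [e3, e2, mul_assoc 2]
    refine (mul_opNorm_le (by positivity) hB2 fun k => (p3 _).trans (h3 k)).trans ?_
    linarith

theorem ae_ne_zero : ∀ᵐ ξ : Plane, ξ ≠ 0 := by
  have : Nontrivial Plane := ⟨⟨0, EuclideanSpace.single 0 1, fun h => by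
    have := congrArg (fun x : Plane => x 0) h
    simp at this⟩⟩
  rw [ae_iff]
  simp

theorem aestronglyMeasurable_of_continuousOn {E : Type} [NormedAddCommGroup E] {F : Plane → E}
    (h : ContinuousOn F {0}ᶜ) : AEStronglyMeasurable F volume := by
  have h1 : (volume : Measure Plane).restrict {0}ᶜ = volume :=
    Measure.restrict_eq_self_of_ae_mem ae_ne_zero
  rw [← h1]
  exact h.aestronglyMeasurable isOpen_compl_singleton.measurableSet

/-- The scalar |ξ|^{|α|} in front of the derivative is the weight accumulated in the target norm by
differentiating α 1 times in one direction and α 0 times in the other. Continuity off the origin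
gives measurability, the origin being null. -/
theorem admissible_scaled (hb : 0 < b) {M : Plane → FiberOp b s}
    (hM : ∀ n, IsSymbol n (fun ξ y => normFY (bracket ξ) y) (fun ξ x => normFX (bracket ξ) x) M)
    (α : Fin 2 → ℕ) :
    Admissible b s (fun ξ => ‖ξ‖ ^ (α 0 + α 1) • iteratedPartial α M ξ) := by
  obtain ⟨K, hK, hw⟩ := exists_wnorm_le (s := s) hb 3
  obtain ⟨ha, C, hC, hb⟩ := IsSymbol.iterate (fun n => IsSymbol.iterate hM 1 (α 1) n) 0 (α 0) 0
  have e : iteratedPartial α M = (pd 0)^[α 0] ((pd 1)^[α 1] M) := rfl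
  refine ⟨fun Y => aestronglyMeasurable_of_continuousOn ?_, 2 * (C * K), ?_⟩
  · rw [e]
    have h1 : ContinuousOn (fun ξ : Plane => ((pd 0)^[α 0] ((pd 1)^[α 1] M)) ξ Y) {0}ᶜ :=
      ha.continuousOn.clm_apply continuousOn_const
    exact ((continuous_norm.pow _).continuousOn).smul h1
  · filter_upwards [ae_ne_zero] with ξ hξ
    refine symbolBounds_of_normFX_le hC hK (hw _ (one_le_bracket ξ)) fun y => ?_
    refine le_trans (le_of_eq ?_) (hb ξ hξ y)
    rw [e]
    dsimp only
    rw [← mul_assoc, ← pow_add]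
    have h2 : (‖ξ‖ ^ (α 0 + α 1) • ((pd 0)^[α 0] ((pd 1)^[α 1] M)) ξ) y =
        ((‖ξ‖ ^ (α 0 + α 1) : ℝ) : ℂ) • (((pd 0)^[α 0] ((pd 1)^[α 1] M)) ξ) y := rfl
    rw [h2, isWeight_normFX.smul ξ]
    simp

end Bounds

end
end CurlLayer

namespace CurlLayer

noncomputable section

/-! ### The tangential Fourier transform of square integrable functions -/

section Fourier

variable {H K : Type} [NormedAddCommGroup H] [InnerProductSpace ℂ H] [CompleteSpace H]
  [NormedAddCommGroup K] [InnerProductSpace ℂ K] [CompleteSpace K]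

theorem integrable_smul_L2 {g : Plane → ℂ} (hg : MemLp g 2) (u : L2Top H) :
    Integrable (fun x => g x • u x) := by
  have h : MemLp (fun x => g x • u x) 1 := (Lp.memLp u).smul hg
  exact memLp_one_iff_integrable.1 h

theorem map_integral_smul_L2 (T : H →L[ℂ] K) {g : Plane → ℂ} (hg : MemLp g 2)
    (u : L2Top H) : T (∫ x, g x • u x) = ∫ x, g x • T (u x) := by
  rw [← T.integral_comp_comm (integrable_smul_L2 hg u)]
  simp only [map_smul]

theorem integrable_real_smul_L2 {g : Plane → ℝ} (hg : MemLp g 2) (u : L2Top H) :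
    Integrable (fun x => g x • u x) := by
  refine (integrable_smul_L2 (g := fun x => (g x : ℂ)) hg.ofReal u).congr
    (Filter.Eventually.of_forall fun x => ?_)
  exact Complex.coe_smul (g x) (u x)

theorem toTemperedDistribution_injective {u v : L2Top H}
    (h : (u : 𝓢'(Plane, H)) = (v : 𝓢'(Plane, H))) : u = v := by
  have h1 : u - v ∈ (Lp.toTemperedDistributionCLM H (volume : Measure Plane) 2).ker := by
    rw [LinearMap.mem_ker]
    change Lp.toTemperedDistributionCLM H (volume : Measure Plane) 2 (u - v) = 0
    rw [map_sub, Lp.toTemperedDistributionCLM_apply, Lp.toTemperedDistributionCLM_apply, h, sub_self]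
  rw [Lp.ker_toTemperedDistributionCLM_eq_bot] at h1
  exact sub_eq_zero.1 h1

theorem integral_fourier_smul (u : L2Top H) (g : 𝓢(Plane, ℂ)) :
    ∫ x, g x • (𝓕 u : L2Top H) x = ∫ x, (𝓕 g) x • u x := by
  have h := congrArg (fun T : 𝓢'(Plane, H) => T g) (Lp.fourier_toTemperedDistribution_eq u)
  simpa using h.symm

/-- The Fourier transform commutes with bounded operators between the value spaces. -/
theorem fourier_compLp (T : H →L[ℂ] K) (u : L2Top H) :
    (𝓕 (T.compLp u) : L2Top K) = T.compLp (𝓕 u : L2Top H) := by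
  apply toTemperedDistribution_injective
  ext g
  rw [Lp.toTemperedDistribution_apply, Lp.toTemperedDistribution_apply, integral_fourier_smul]
  have key : ∀ (g : 𝓢(Plane, ℂ)) (v : L2Top H),
      ∫ x, g x • (T.compLp v) x = T (∫ x, g x • v x) := by
    intro g v
    rw [← T.integral_comp_comm (integrable_smul_L2 (g.memLp 2) v)]
    refine integral_congr_ae ?_
    filter_upwards [T.coeFn_compLp v] with x hx
    rw [hx, map_smul]
  rw [key, key, integral_fourier_smul]

theorem fourier_injective {u v : L2Top H} (h : (𝓕 u : L2Top H) = 𝓕 v) : u = v :=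
  (Lp.fourierTransformₗᵢ Plane H).injective h

/-- The coordinate direction of the plane. -/
abbrev planeDir (j : Fin 2) : Plane := EuclideanSpace.single j 1

theorem inner_planeDir (ξ : Plane) (j : Fin 2) : inner ℝ ξ (planeDir j) = ξ j := by
  simp [planeDir, EuclideanSpace.inner_single_right]

theorem continuous_dsym (j : Fin 2) : Continuous fun ξ : Plane => dsym ξ j := by
  unfold dsym
  fun_prop

theorem smulLeftCLM_inner_planeDir (j : Fin 2) (g : 𝓢(Plane, ℂ)) (ξ : Plane) :
    SchwartzMap.smulLeftCLM ℂ (fun ξ : Plane => ((inner ℝ ξ (planeDir j) : ℝ) : ℂ)) g ξ =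
      (ξ j : ℂ) * g ξ := by
  have hg : (fun ξ : Plane => ((inner ℝ ξ (planeDir j) : ℝ) : ℂ)).HasTemperateGrowth := by
    fun_prop
  rw [SchwartzMap.smulLeftCLM_apply hg]
  simp only [inner_planeDir, smul_eq_mul]

theorem fourier_lineDeriv_apply (u : L2Top H) (j : Fin 2) (g : 𝓢(Plane, ℂ)) :
    (𝓕 (∂_{planeDir j} (u : 𝓢'(Plane, H)))) g = ∫ ξ, g ξ • dsym ξ j • (𝓕 u : L2Top H) ξ := by
  rw [TemperedDistribution.fourier_lineDerivOp_eq, Lp.fourier_toTemperedDistribution_eq]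
  change (2 * Real.pi * Complex.I : ℂ) • (TemperedDistribution.smulLeftCLM H
    (fun ξ : Plane => ((inner ℝ ξ (planeDir j) : ℝ) : ℂ)) _) g = _
  rw [TemperedDistribution.smulLeftCLM_apply_apply, Lp.toTemperedDistribution_apply,
    ← integral_smul]
  refine integral_congr_ae (Filter.Eventually.of_forall fun ξ => ?_)
  simp only [smulLeftCLM_inner_planeDir, dsym, smul_smul]
  congr 1
  push_cast
  ring

theorem integrable_dsym_smul (u : L2Top H) (j : Fin 2) (g : 𝓢(Plane, ℂ)) :
    Integrable fun ξ => g ξ • dsym ξ j • u ξ := by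
  have h := (integrable_smul_L2 ((SchwartzMap.smulLeftCLM ℂ
    (fun ξ : Plane => ((inner ℝ ξ (planeDir j) : ℝ) : ℂ)) g).memLp 2) u).smul
    (2 * Real.pi * Complex.I : ℂ)
  refine h.congr (Filter.Eventually.of_forall fun ξ => ?_)
  simp only [Pi.smul_apply, smulLeftCLM_inner_planeDir, dsym, smul_smul]
  congr 1
  push_cast
  ring

theorem locallyIntegrable_dsym_smul (u : L2Top H) (j : Fin 2) :
    LocallyIntegrable fun ξ => dsym ξ j • u ξ := by
  have h : LocallyIntegrable (fun ξ => u ξ) := (Lp.memLp u).locallyIntegrable one_le_two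
  rw [← locallyIntegrableOn_univ] at h ⊢
  exact h.continuousOn_smul isOpen_univ.isLocallyClosed (continuous_dsym j).continuousOn

theorem ae_eq_of_schwartz {F G : Plane → H} (hF : LocallyIntegrable F) (hG : LocallyIntegrable G)
    (h : ∀ g : 𝓢(Plane, ℂ), ∫ ξ, g ξ • F ξ = ∫ ξ, g ξ • G ξ) : F =ᵐ[volume] G := by
  refine ae_eq_of_integral_contDiff_smul_eq hF hG fun g hg hc => ?_
  have hg₁ : HasCompactSupport (Complex.ofRealCLM ∘ g) := hc.comp_left rfl
  have hg₂ : ContDiff ℝ ∞ (Complex.ofRealCLM ∘ g) := by fun_prop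
  simpa using h (hg₁.toSchwartzMap hg₂)

/-- The two sides are compared on the Fourier side as locally integrable functions tested with
Schwartz functions. Sums of two derivatives are treated together because divergence and curl may be
square integrable when the individual terms are not. -/
theorem lineDeriv_add_eq_iff (i j : Fin 2) (u v d : L2Top H) :
    ∂_{planeDir i} (u : 𝓢'(Plane, H)) + ∂_{planeDir j} (v : 𝓢'(Plane, H)) = (d : 𝓢'(Plane, H)) ↔
      ∀ᵐ ξ : Plane, dsym ξ i • (𝓕 u : L2Top H) ξ + dsym ξ j • (𝓕 v : L2Top H) ξ =
        (𝓕 d : L2Top H) ξ := by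
  have h1 : ∀ g : 𝓢(Plane, ℂ), (𝓕 (∂_{planeDir i} (u : 𝓢'(Plane, H)) +
      ∂_{planeDir j} (v : 𝓢'(Plane, H)))) g =
      ∫ ξ, g ξ • (dsym ξ i • (𝓕 u : L2Top H) ξ + dsym ξ j • (𝓕 v : L2Top H) ξ) := by
    intro g
    rw [FourierTransform.fourier_add]
    change (𝓕 (∂_{planeDir i} (u : 𝓢'(Plane, H)))) g +
      (𝓕 (∂_{planeDir j} (v : 𝓢'(Plane, H)))) g = _
    rw [fourier_lineDeriv_apply, fourier_lineDeriv_apply,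
      ← integral_add (integrable_dsym_smul _ _ _) (integrable_dsym_smul _ _ _)]
    simp only [smul_add]
  have h2 : ∀ g : 𝓢(Plane, ℂ), (𝓕 (d : 𝓢'(Plane, H))) g =
      ∫ ξ, g ξ • (𝓕 d : L2Top H) ξ := by
    intro g
    rw [Lp.fourier_toTemperedDistribution_eq, Lp.toTemperedDistribution_apply]
  constructor
  · intro h
    refine ae_eq_of_schwartz ((locallyIntegrable_dsym_smul _ i).add
      (locallyIntegrable_dsym_smul _ j)) ((Lp.memLp _).locallyIntegrable one_le_two) fun g => ?_
    have h3 := h1 g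
    rw [h, h2] at h3
    exact h3.symm
  · intro h
    have h3 : 𝓕 (∂_{planeDir i} (u : 𝓢'(Plane, H)) + ∂_{planeDir j} (v : 𝓢'(Plane, H))) =
        𝓕 (d : 𝓢'(Plane, H)) := by
      ext g
      rw [h1, h2]
      refine integral_congr_ae ?_
      filter_upwards [h] with ξ hξ
      rw [hξ]
    simpa using congrArg (fun T : 𝓢'(Plane, H) => 𝓕⁻ T) h3

theorem lineDeriv_eq_iff (j : Fin 2) (u w : L2Top H) :
    ∂_{planeDir j} (u : 𝓢'(Plane, H)) = (w : 𝓢'(Plane, H)) ↔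
      ∀ᵐ ξ : Plane, dsym ξ j • (𝓕 u : L2Top H) ξ = (𝓕 w : L2Top H) ξ := by
  have h := lineDeriv_add_eq_iff j j u 0 w
  have h0 : ∂_{planeDir j} (((0 : L2Top H) : 𝓢'(Plane, H))) = 0 := by
    ext g
    have : ((0 : L2Top H) : 𝓢'(Plane, H)) = 0 :=
      map_zero (Lp.toTemperedDistributionCLM H (volume : Measure Plane) 2)
    rw [TemperedDistribution.lineDerivOp_apply_apply, this]
    rfl
  rw [h0, add_zero] at h
  rw [h]
  have h2 : (𝓕 (0 : L2Top H) : L2Top H) = 0 := FourierTransform.fourier_zero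
  rw [h2]
  refine Filter.eventually_congr ?_
  filter_upwards [Lp.coeFn_zero H 2 (volume : Measure Plane)] with ξ hξ
  rw [hξ, Pi.zero_apply, smul_zero, add_zero]

end Fourier

end
end CurlLayer

namespace CurlLayer

noncomputable section

/-! ### Weak derivatives in the plane -/

section Weak

variable {H K : Type} [NormedAddCommGroup H] [InnerProductSpace ℂ H] [CompleteSpace H]

theorem exists_cutoff : ∃ χ : ℕ → Plane → ℝ, ∃ C : ℝ, 0 ≤ C ∧
    (∀ n, ContDiff ℝ ∞ (χ n)) ∧ (∀ n, HasCompactSupport (χ n)) ∧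
    (∀ n x, |χ n x| ≤ 1) ∧ (∀ n x e, |fderiv ℝ (χ n) x e| ≤ C * ‖e‖) ∧
    (∀ x, ∀ᶠ n in Filter.atTop, χ n x = 1) ∧
    (∀ x e, Filter.Tendsto (fun n => fderiv ℝ (χ n) x e) Filter.atTop (nhds 0)) := by
  let η : ContDiffBump (0 : Plane) := ⟨1, 2, one_pos, one_lt_two⟩
  have hη : ContDiff ℝ ∞ η := η.contDiff
  obtain ⟨C, hC⟩ := (hη.continuous_fderiv (by simp)).bounded_above_of_compact_support
    (η.hasCompactSupport.fderiv ℝ)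
  have hC0 : 0 ≤ C := (norm_nonneg _).trans (hC 0)
  let r : ℕ → ℝ := fun n => ((n : ℝ) + 1)⁻¹
  have hr : ∀ n, 0 < r n := fun n => by positivity
  have hr1 : ∀ n, r n ≤ 1 := fun n => inv_le_one_of_one_le₀ (by
    have : (0 : ℝ) ≤ n := Nat.cast_nonneg n
    linarith)
  have hr0 : Filter.Tendsto r Filter.atTop (nhds 0) := by
    simpa [r] using tendsto_one_div_add_atTop_nhds_zero_nat (𝕜 := ℝ)
  have hd : ∀ n x e, fderiv ℝ (fun x : Plane => η (r n • x)) x e = r n * fderiv ℝ η (r n • x) e := by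
    intro n x e
    have h1 : HasFDerivAt (fun x : Plane => r n • x) (r n • ContinuousLinearMap.id ℝ Plane) x :=
      (ContinuousLinearMap.id ℝ Plane).hasFDerivAt.const_smul (r n)
    have h2 : HasFDerivAt (fun x : Plane => η (r n • x)) _ x :=
      ((hη.differentiable (by simp)) (r n • x)).hasFDerivAt.comp x h1
    rw [h2.fderiv]
    simp
  have hb : ∀ n x e, |fderiv ℝ (fun x : Plane => η (r n • x)) x e| ≤ r n * (C * ‖e‖) := by
    intro n x e
    rw [hd, abs_mul, abs_of_pos (hr n)]
    exact mul_le_mul_of_nonneg_left (((fderiv ℝ η (r n • x)).le_opNorm e).trans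
      (mul_le_mul_of_nonneg_right (hC _) (norm_nonneg _))) (hr n).le
  refine ⟨fun n x => η (r n • x), C, hC0, fun n => hη.comp (by fun_prop), fun n => ?_, fun n x => ?_,
    fun n x e => ?_, fun x => ?_, fun x e => ?_⟩
  · exact η.hasCompactSupport.comp_homeomorph (Homeomorph.smulOfNeZero (r n) (hr n).ne')
  · rw [abs_of_nonneg η.nonneg]
    exact η.le_one
  · exact (hb n x e).trans (mul_le_of_le_one_left (by positivity) (hr1 n))
  · have h1 : Filter.Tendsto (fun n => r n • x) Filter.atTop (nhds 0) := by
      simpa using hr0.smul_const x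
    filter_upwards [h1.eventually (Metric.closedBall_mem_nhds (0 : Plane) one_pos)] with n hn
    exact η.one_of_mem_closedBall hn
  · refine squeeze_zero_norm (fun n => hb n x e) ?_
    simpa using hr0.mul_const (C * ‖e‖)

/-- The weak derivative relation `∂ⱼ u = w` in the plane, tested with smooth functions of compact
support, extends to smooth square integrable functions. -/
theorem weakDeriv_extend {e : Plane} {u w : L2Top H}
    (h : ∀ θ : Plane → ℝ, ContDiff ℝ ∞ θ → HasCompactSupport θ →
      ∫ x, fderiv ℝ θ x e • u x = - ∫ x, θ x • w x) {θ : Plane → ℝ} (hθ : ContDiff ℝ ∞ θ)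
    (h0 : MemLp θ 2) (h1 : MemLp (fun x => fderiv ℝ θ x e) 2) :
    ∫ x, fderiv ℝ θ x e • u x = - ∫ x, θ x • w x := by
  obtain ⟨χ, C, hC, hs, hc, hb, hb', hl, hl'⟩ := exists_cutoff
  have hd : ∀ n x, fderiv ℝ (fun x => χ n x * θ x) x e =
      χ n x * fderiv ℝ θ x e + θ x * fderiv ℝ (χ n) x e := by
    intro n x
    rw [fderiv_fun_mul ((hs n).differentiable (by simp) x) (hθ.differentiable (by simp) x)]
    simp
  have t1 : Filter.Tendsto (fun n => ∫ x, fderiv ℝ (fun x => χ n x * θ x) x e • u x) Filter.atTop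
      (nhds (∫ x, fderiv ℝ θ x e • u x)) := by
    refine tendsto_integral_of_dominated_convergence
      (fun x => ‖fderiv ℝ θ x e • u x‖ + C * ‖e‖ * ‖θ x • u x‖) (fun n => ?_) ?_ (fun n => ?_) ?_
    · have hm : AEStronglyMeasurable (fun x => fderiv ℝ (fun x => χ n x * θ x) x e) volume :=
        ((((hs n).mul hθ).continuous_fderiv (by simp)).clm_apply
          continuous_const).aestronglyMeasurable
      exact hm.smul (Lp.aestronglyMeasurable u)
    · exact (integrable_real_smul_L2 h1 u).norm.add
        ((integrable_real_smul_L2 h0 u).norm.const_mul _)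
    · refine Filter.Eventually.of_forall fun x => ?_
      rw [hd, add_smul]
      refine (norm_add_le _ _).trans (add_le_add ?_ ?_)
      · rw [mul_smul, norm_smul]
        exact mul_le_of_le_one_left (norm_nonneg _) (hb n x)
      · rw [mul_comm, mul_smul, norm_smul]
        exact mul_le_mul_of_nonneg_right (hb' n x e) (norm_nonneg _)
    · refine Filter.Eventually.of_forall fun x => Filter.Tendsto.smul_const ?_ _
      simp only [hd]
      have a1 : Filter.Tendsto (fun n => χ n x * fderiv ℝ θ x e) Filter.atTop
          (nhds (fderiv ℝ θ x e)) := by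
        refine tendsto_const_nhds.congr' ?_
        filter_upwards [hl x] with n hn
        rw [hn, one_mul]
      simpa using a1.add ((hl' x e).const_mul (θ x))
  have t2 : Filter.Tendsto (fun n => ∫ x, (χ n x * θ x) • w x) Filter.atTop
      (nhds (∫ x, θ x • w x)) := by
    refine tendsto_integral_of_dominated_convergence (fun x => ‖θ x • w x‖) (fun n => ?_) ?_
      (fun n => ?_) ?_
    · exact ((hs n).mul hθ).continuous.aestronglyMeasurable.smul (Lp.aestronglyMeasurable w)
    · exact (integrable_real_smul_L2 h0 w).norm
    · refine Filter.Eventually.of_forall fun x => ?_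
      rw [mul_smul, norm_smul]
      exact mul_le_of_le_one_left (norm_nonneg _) (hb n x)
    · refine Filter.Eventually.of_forall fun x => ?_
      refine tendsto_const_nhds.congr' ?_
      filter_upwards [hl x] with n hn
      rw [hn, one_mul]
  refine tendsto_nhds_unique t1 (t2.neg.congr fun n => ?_)
  exact (h _ ((hs n).mul hθ) (hc n).mul_right).symm

/-- Real test functions of compact support suffice: cutoffs extend the relation to the real and
imaginary parts of Schwartz functions, and linearity does the rest. -/
theorem lineDeriv_eq_of_test {j : Fin 2} {u w : L2Top H}
    (h : ∀ θ : Plane → ℝ, ContDiff ℝ ∞ θ → HasCompactSupport θ →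
      ∫ x, ((fderiv ℝ θ x (planeDir j) : ℝ) : ℂ) • u x = - ∫ x, ((θ x : ℝ) : ℂ) • w x) :
    ∂_{planeDir j} (u : 𝓢'(Plane, H)) = (w : 𝓢'(Plane, H)) := by
  simp only [Complex.coe_smul] at h
  ext g
  rw [TemperedDistribution.lineDerivOp_apply_apply, map_neg, Lp.toTemperedDistribution_apply,
    Lp.toTemperedDistribution_apply]
  have mL : ∀ (L : ℂ →L[ℝ] ℝ) (_ : ∀ z, ‖L z‖ ≤ ‖z‖) (g : 𝓢(Plane, ℂ)),
      MemLp (fun x => L (g x)) 2 := fun L hL g =>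
    MemLp.of_le (f := fun x => L (g x)) (g.memLp 2 volume)
      (L.continuous.comp g.continuous).aestronglyMeasurable
      (Filter.Eventually.of_forall fun x => hL _)
  have key : ∀ L : ℂ →L[ℝ] ℝ, (∀ z, ‖L z‖ ≤ ‖z‖) →
      ∫ x, L ((∂_{planeDir j} g) x) • u x = - ∫ x, L (g x) • w x := by
    intro L hL
    have hd : ∀ x, fderiv ℝ (fun x => L (g x)) x (planeDir j) = L ((∂_{planeDir j} g) x) := by
      intro x
      have := (L.hasFDerivAt.comp x (g.differentiableAt (x := x)).hasFDerivAt).fderiv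
      rw [SchwartzMap.lineDerivOp_apply, (g.differentiableAt (x := x)).lineDeriv_eq_fderiv]
      exact congrArg (fun T => T (planeDir j)) this
    have h2 := weakDeriv_extend h (θ := fun x => L (g x)) (L.contDiff.comp (g.smooth ⊤))
      (mL L hL g) (by simpa only [hd] using mL L hL (∂_{planeDir j} g))
    simpa only [hd] using h2
  have split : ∀ (g : 𝓢(Plane, ℂ)) (v : L2Top H), ∫ x, g x • v x =
      (∫ x, Complex.reCLM (g x) • v x) + Complex.I • ∫ x, Complex.imCLM (g x) • v x := by
    intro g v
    have hre : ∀ z : ℂ, ‖Complex.reCLM z‖ ≤ ‖z‖ := Complex.abs_re_le_norm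
    have him : ∀ z : ℂ, ‖Complex.imCLM z‖ ≤ ‖z‖ := Complex.abs_im_le_norm
    have m1 := integrable_real_smul_L2 (mL _ hre g) v
    have m2 : Integrable fun x => Complex.I • Complex.imCLM (g x) • v x :=
      (integrable_real_smul_L2 (mL _ him g) v).smul Complex.I
    rw [← integral_smul, ← integral_add m1 m2]
    refine integral_congr_ae (Filter.Eventually.of_forall fun x => ?_)
    simp only [Complex.reCLM_apply, Complex.imCLM_apply]
    rw [← Complex.coe_smul, ← Complex.coe_smul, smul_smul, ← add_smul, mul_comm Complex.I,
      Complex.re_add_im]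
  rw [split, split, key _ Complex.abs_re_le_norm, key _ Complex.abs_im_le_norm, smul_neg,
    ← neg_add, neg_neg]

/-- A family of linear constraints that each hold almost everywhere hold simultaneously. -/
theorem ae_forall_of_forall_ae {ι E F : Type} [NormedAddCommGroup E] [NormedSpace ℂ E]
    [CompleteSpace E] [NormedAddCommGroup F] [NormedSpace ℂ F] [CompleteSpace F]
    {T : ι → E →L[ℂ] F} {U : Plane → E}
    (hU : LocallyIntegrable U) (h : ∀ i, ∀ᵐ x, T i (U x) = 0) : ∀ᵐ x, ∀ i, T i (U x) = 0 := by
  -- The constraints may be uncountably many, so null sets cannot be united. Instead the common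
  -- kernel W is closed, every integral of U against a test function lies in W, and hence the class
  -- of U in E/W vanishes almost everywhere.
  let W : Submodule ℂ E := ⨅ i, (T i).ker
  have hW : IsClosed (W : Set E) := by
    rw [Submodule.coe_iInf]
    exact isClosed_iInter fun i => (T i).isClosed_ker
  have hmem : ∀ x, x ∈ W ↔ ∀ i, T i x = 0 := fun x => by simp [W]
  let π : E →L[ℂ] E ⧸ W := W.mkQL
  have hint : ∀ g : Plane → ℝ, ContDiff ℝ ∞ g → HasCompactSupport g →
      Integrable (fun x => g x • U x) := fun g hg hc =>
    hU.integrable_smul_left_of_hasCompactSupport hg.continuous hc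
  have h0 : ∀ᵐ x, π (U x) = 0 := by
    refine ae_eq_zero_of_integral_contDiff_smul_eq_zero ?_ fun g hg hc => ?_
    · intro x
      obtain ⟨t, ht, hi⟩ := hU x
      exact ⟨t, ht, π.integrable_comp hi⟩
    · have h1 : ∫ x, g x • π (U x) = π (∫ x, g x • U x) := by
        rw [← π.integral_comp_comm (hint g hg hc)]
        refine integral_congr_ae (Filter.Eventually.of_forall fun x => ?_)
        exact (π.map_smul_of_tower (g x) (U x)).symm
      rw [h1]
      refine (Submodule.Quotient.mk_eq_zero W).2 ((hmem _).2 fun i => ?_)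
      rw [← (T i).integral_comp_comm (hint g hg hc)]
      rw [← integral_zero Plane F]
      refine integral_congr_ae ?_
      filter_upwards [h i] with x hx
      rw [(T i).map_smul_of_tower, hx, smul_zero]
  filter_upwards [h0] with x hx
  exact (hmem _).1 ((Submodule.Quotient.mk_eq_zero W).1 hx)

end Weak

end
end CurlLayer

namespace CurlLayer

noncomputable section

/-! ### Horizontal weak derivatives on the layer -/

section Slice

variable {b : ℝ} {φ : Plane × ℝ → ℝ}

/-- By uniform continuity of φ, the map x ↦ φ(x, ·)z is continuous with compact support into the
bounded continuous functions, hence into L²(0, b). -/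
theorem exists_slice {E : Type} [NormedAddCommGroup E] [NormedSpace ℝ E] (hφ : Continuous φ)
    (hc : HasCompactSupport φ) (z : E) : ∃ G : L2Layer b E,
      ∀ᵐ x : Plane, ∀ᵐ y ∂(volume.restrict (Ioo 0 b)), G x y = φ (x, y) • z := by
  obtain ⟨C, hC⟩ := hφ.bounded_above_of_compact_support hc
  let S : Plane → BoundedContinuousFunction ℝ E := fun x =>
    BoundedContinuousFunction.ofNormedAddCommGroup (fun y => φ (x, y) • z) (by fun_prop) (C * ‖z‖)
      (fun y => by
        rw [norm_smul]
        exact mul_le_mul_of_nonneg_right (hC _) (norm_nonneg _))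
  have hS : Continuous S := by
    have hu := hc.uniformContinuous_of_continuous hφ
    rw [Metric.uniformContinuous_iff] at hu
    rw [Metric.continuous_iff]
    intro x ε hε
    obtain ⟨δ, hδ, h⟩ := hu (ε / (2 * (‖z‖ + 1))) (by positivity)
    refine ⟨δ, hδ, fun x' hx' => ?_⟩
    refine lt_of_le_of_lt ((BoundedContinuousFunction.dist_le (C := ε / 2) (by positivity)).2
      fun y => ?_) (half_lt_self hε)
    have h1 := h (a := (x', y)) (b := (x, y)) (by
      rw [Prod.dist_eq, dist_self]
      exact max_lt hx' hδ)
    change dist (φ (x', y) • z) (φ (x, y) • z) ≤ ε / 2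
    rw [dist_eq_norm, ← sub_smul, norm_smul]
    rw [dist_eq_norm] at h1
    calc ‖φ (x', y) - φ (x, y)‖ * ‖z‖ ≤ ε / (2 * (‖z‖ + 1)) * (‖z‖ + 1) := by
          refine mul_le_mul h1.le (by linarith) (norm_nonneg _) (by positivity)
      _ = ε / 2 := by field_simp
  have hSc : HasCompactSupport S := by
    refine HasCompactSupport.intro (hc.image continuous_fst) fun x hx => ?_
    ext y
    change φ (x, y) • z = 0
    rw [image_eq_zero_of_notMem_tsupport fun h => hx ⟨(x, y), h, rfl⟩, zero_smul]
  let L : BoundedContinuousFunction ℝ E →L[ℝ] L2I b E :=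
    BoundedContinuousFunction.toLp 2 (volume.restrict (Ioo 0 b)) ℝ
  have hm : MemLp (fun x => L (S x)) 2 (volume : Measure Plane) :=
    (L.continuous.comp hS).memLp_of_hasCompactSupport (hSc.comp_left (map_zero L))
  refine ⟨hm.toLp, ?_⟩
  filter_upwards [hm.coeFn_toLp] with x hx
  rw [hx]
  filter_upwards [BoundedContinuousFunction.coeFn_toLp (p := 2)
    (μ := volume.restrict (Ioo (0 : ℝ) b)) ℝ (S x)] with y hy
  exact hy

variable {V : Type} [NormedAddCommGroup V] [InnerProductSpace ℂ V] [CompleteSpace V]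

theorem integrable_layer (hφ : Continuous φ) (hc : HasCompactSupport φ) (u : L2Layer b V) :
    Integrable (fun x : Plane => ∫ y in Ioo 0 b, φ (x, y) • u x y) := by
  obtain ⟨G, hG⟩ := exists_slice (b := b) hφ hc (1 : ℝ)
  let B : L2I b ℝ →L[ℝ] L2I b V →L[ℝ] V :=
    (ContinuousLinearMap.lsmul ℝ ℝ).lpPairing (volume.restrict (Ioo 0 b)) 2 2
  have h := memLp_one_iff_integrable.1 (B.memLp_of_bilin 1 (Lp.memLp G) (Lp.memLp u))
  refine h.congr ?_
  filter_upwards [hG] with x hx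
  change (ContinuousLinearMap.lsmul ℝ ℝ).lpPairing (volume.restrict (Ioo 0 b)) 2 2 (G x) (u x) = _
  rw [ContinuousLinearMap.lpPairing_eq_integral]
  refine integral_congr_ae ?_
  filter_upwards [hx] with y hy
  rw [hy]
  simp

/-- Expresses the integral against a test function as an inner product in L², so that Plancherel's
identity can be applied to it. -/
theorem inner_slice (hφ : Continuous φ) (hc : HasCompactSupport φ) {z : V} {G : L2Layer b V}
    (hG : ∀ᵐ x : Plane, ∀ᵐ y ∂(volume.restrict (Ioo 0 b)), G x y = φ (x, y) • z)
    (u : L2Layer b V) : inner ℂ G u = inner ℂ z (layerIntegral b φ u) := by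
  rw [layerIntegral, ← integral_inner (integrable_layer hφ hc u), L2.inner_def]
  refine integral_congr_ae ?_
  filter_upwards [hG] with x hx
  have hi : Integrable (fun y => φ (x, y) • u x y) (volume.restrict (Ioo 0 b)) :=
    integrable_continuousMap_smul ⟨fun y => φ (x, y), by fun_prop⟩ (u x)
  rw [← integral_inner hi, L2.inner_def]
  refine integral_congr_ae ?_
  filter_upwards [hx] with y hy
  rw [hy, ← Complex.coe_smul, ← Complex.coe_smul, inner_smul_left, inner_smul_right,
    Complex.conj_ofReal]

theorem hasFDerivAt_slice {φ : Plane × ℝ → ℝ} (hφ : ContDiff ℝ ∞ φ) (x : Plane) (y : ℝ) (e : Plane) :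
    fderiv ℝ (fun x => φ (x, y)) x e = fderiv ℝ φ (x, y) (e, 0) := by
  have h1 : HasFDerivAt (𝕜 := ℝ) (fun x : Plane => (x, y))
      ((ContinuousLinearMap.id ℝ Plane).prod (0 : Plane →L[ℝ] ℝ)) x :=
    (hasFDerivAt_id x).prodMk (hasFDerivAt_const y x)
  have h := ((hφ.differentiable (by simp)) (x, y)).hasFDerivAt.comp x h1
  have h2 : HasFDerivAt (fun x => φ (x, y)) _ x := h
  rw [h2.fderiv]
  simp

theorem dir_castSucc (j : Fin 2) : dir j.castSucc = (planeDir j, 0) := by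
  fin_cases j <;> rfl

theorem hasCompactSupport_fderiv {φ : Plane × ℝ → ℝ} (hc : HasCompactSupport φ) (e : Plane × ℝ) :
    HasCompactSupport fun z => fderiv ℝ φ z e :=
  (hc.fderiv ℝ).comp_left (g := fun T : Plane × ℝ →L[ℝ] ℝ => T e) rfl

theorem continuous_fderiv_apply {φ : Plane × ℝ → ℝ} (hφ : ContDiff ℝ ∞ φ) (e : Plane × ℝ) :
    Continuous fun z => fderiv ℝ φ z e :=
  (hφ.continuous_fderiv (by simp)).clm_apply continuous_const

theorem memLp_test {θ : Plane → ℝ} (hθ : Continuous θ) (hc : HasCompactSupport θ) :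
    MemLp (fun x => (θ x : ℂ)) 2 := (hθ.memLp_of_hasCompactSupport hc).ofReal

theorem integral_by_parts_slice (hφ : ContDiff ℝ ∞ φ) (hc : HasCompactSupport φ) {θ : Plane → ℝ}
    (hθ : ContDiff ℝ ∞ θ) (hθc : HasCompactSupport θ) (e : Plane) {ψ : ℝ → ℝ} (hψ : Continuous ψ) :
    (∫ x, fderiv ℝ θ x e * ∫ y in Ioo 0 b, ψ y * φ (x, y)) =
      - ∫ x, θ x * ∫ y in Ioo 0 b, ψ y * fderiv ℝ φ (x, y) (e, 0) := by
  have hφ' := continuous_fderiv_apply hφ (e, 0)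
  have hc' := hasCompactSupport_fderiv hc (e, 0)
  have hθ' : Continuous fun x => fderiv ℝ θ x e :=
    (hθ.continuous_fderiv (by simp)).clm_apply continuous_const
  have swap : ∀ (α : Plane → ℝ) (β : Plane × ℝ → ℝ), Continuous α → Continuous β →
      HasCompactSupport β → (∫ x, α x * ∫ y in Ioo 0 b, ψ y * β (x, y)) =
        ∫ y in Ioo 0 b, ψ y * ∫ x, α x * β (x, y) := by
    intro α β hα hβ hβc
    have h1 : Integrable (fun z : Plane × ℝ => α z.1 * (ψ z.2 * β z))
        (volume.prod (volume.restrict (Ioo 0 b))) := by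
      refine Continuous.integrable_of_hasCompactSupport (by fun_prop) ?_
      exact (hβc.mul_left (f := fun z : Plane × ℝ => ψ z.2)).mul_left
    simp only [← integral_const_mul]
    rw [integral_integral_swap (f := fun x y => α x * (ψ y * β (x, y))) h1]
    refine integral_congr_ae (Filter.Eventually.of_forall fun y => ?_)
    refine integral_congr_ae (Filter.Eventually.of_forall fun x => ?_)
    simp only
    ring
  rw [swap _ _ hθ' hφ.continuous hc, swap _ _ hθ.continuous hφ' hc', ← integral_neg]
  refine integral_congr_ae (Filter.Eventually.of_forall fun y => ?_)
  have h2 := integral_mul_fderiv_eq_neg_fderiv_mul_of_integrable (μ := (volume : Measure Plane))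
    (f := θ) (g := fun x => φ (x, y)) (v := e)
    ((hθ'.mul (hφ.continuous.comp (by fun_prop))).integrable_of_hasCompactSupport
      ((hθc.fderiv ℝ).comp_left (g := fun T : Plane →L[ℝ] ℝ => T e) rfl).mul_right)
    (by
      simp only [hasFDerivAt_slice hφ]
      exact (hθ.continuous.mul (hφ'.comp (by fun_prop))).integrable_of_hasCompactSupport
        hθc.mul_right)
    ((hθ.continuous.mul (hφ.continuous.comp (by fun_prop))).integrable_of_hasCompactSupport
        hθc.mul_right)
    (fun x _ => hθ.differentiable (by simp) x)
    (fun x _ => (hφ.comp (by fun_prop : ContDiff ℝ ∞ fun x : Plane => (x, y))).differentiable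
      (by simp) x)
  simp only [hasFDerivAt_slice hφ] at h2
  simp only
  rw [h2]
  ring

theorem fourier_slice {j : Fin 2} (hφ : ContDiff ℝ ∞ φ) (hc : HasCompactSupport φ) {z : V}
    {G G' : L2Layer b V}
    (hG : ∀ᵐ x : Plane, ∀ᵐ y ∂(volume.restrict (Ioo 0 b)), G x y = φ (x, y) • z)
    (hG' : ∀ᵐ x : Plane, ∀ᵐ y ∂(volume.restrict (Ioo 0 b)),
      G' x y = fderiv ℝ φ (x, y) (planeDir j, 0) • z) :
    ∀ᵐ ξ : Plane, dsym ξ j • (𝓕 G : L2Layer b V) ξ = (𝓕 G' : L2Layer b V) ξ := by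
  refine (lineDeriv_eq_iff j G G').1 (lineDeriv_eq_of_test fun θ hθ hθc => ?_)
  rw [← sub_eq_zero, sub_neg_eq_add]
  have hθ' : Continuous fun x => fderiv ℝ θ x (planeDir j) :=
    (hθ.continuous_fderiv (by simp)).clm_apply continuous_const
  have key : ∀ {α : Plane → ℝ} {β : Plane × ℝ → ℝ} {G : L2Layer b V},
      (∀ᵐ x : Plane, ∀ᵐ y ∂(volume.restrict (Ioo 0 b)), G x y = β (x, y) • z) →
      ∀ ψ : C(ℝ, ℝ), ∫ x, ((α x : ℝ) : ℂ) • testI b ψ (G x) =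
        (∫ x, α x * ∫ y in Ioo 0 b, ψ y * β (x, y)) • z := by
    intro α β G hG ψ
    rw [← integral_smul_const]
    refine integral_congr_ae ?_
    filter_upwards [hG] with x hx
    rw [Complex.coe_smul, mul_smul, ← integral_smul_const, testI_apply]
    congr 1
    refine integral_congr_ae ?_
    filter_upwards [hx] with y hy
    rw [hy, mul_smul]
  refine L2I.eq_zero_of_test fun ψ hψ _ _ => ?_
  change testI b ⟨ψ, hψ.continuous⟩ _ = 0
  rw [map_add, map_integral_smul_L2 _ (memLp_test hθ'
      ((hθc.fderiv ℝ).comp_left (g := fun T : Plane →L[ℝ] ℝ => T _) rfl)),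
    map_integral_smul_L2 _ (memLp_test hθ.continuous hθc)]
  refine (congrArg₂ (· + ·) (key (α := fun x => fderiv ℝ θ x (planeDir j)) hG _)
    (key (α := θ) (β := fun q => fderiv ℝ φ q (planeDir j, 0)) hG' _)).trans ?_
  rw [← add_smul]
  simp only [ContinuousMap.coe_mk]
  rw [integral_by_parts_slice hφ hc hθ hθc _ hψ.continuous, neg_add_cancel, zero_smul]

/-- A general test function is not a tensor product, so it is itself transformed as an element of
L². Plancherel's identity moves dⱼ from one factor to the other, and conj dⱼ = -dⱼ gives the sign.
-/
theorem isWeakDeriv_of_fourier {j : Fin 2} {u w : L2Layer b V}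
    (h : ∀ᵐ ξ : Plane, dsym ξ j • (𝓕 u : L2Layer b V) ξ = (𝓕 w : L2Layer b V) ξ) :
    IsWeakDeriv b j.castSucc u w := by
  intro φ hφ hc _
  rw [dir_castSucc]
  have hφ' := continuous_fderiv_apply hφ (planeDir j, 0)
  have hc' := hasCompactSupport_fderiv hc (planeDir j, 0)
  refine ext_inner_left ℂ fun z => ?_
  obtain ⟨G, hG⟩ := exists_slice (b := b) hφ.continuous hc z
  obtain ⟨G', hG'⟩ := exists_slice (b := b) hφ' hc' z
  rw [inner_neg_right, ← inner_slice hφ.continuous hc hG, ← inner_slice hφ' hc' hG',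
    ← Lp.inner_fourier_eq, ← Lp.inner_fourier_eq G w, L2.inner_def, L2.inner_def, ← integral_neg]
  refine integral_congr_ae ?_
  filter_upwards [h, fourier_slice hφ hc hG hG'] with ξ h1 h2
  rw [← h1, ← h2, inner_smul_left, inner_smul_right, dsym]
  simp only [map_mul, Complex.conj_ofReal, Complex.conj_I]
  ring

/-- The tensor product of test functions. -/
theorem layerIntegral_tensor (θ : Plane → ℝ) {ψ : ℝ → ℝ} (hψ : Continuous ψ) (u : L2Layer b V) :
    layerIntegral b (fun z => θ z.1 * ψ z.2) u =
      ∫ x, ((θ x : ℝ) : ℂ) • testI b ⟨ψ, hψ⟩ (u x) := by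
  refine integral_congr_ae (Filter.Eventually.of_forall fun x => ?_)
  simp only [mul_smul, integral_smul, Complex.coe_smul, testI_apply, ContinuousMap.coe_mk]

theorem hasCompactSupport_tensor {θ : Plane → ℝ} {ψ : ℝ → ℝ} (hθ : HasCompactSupport θ)
    (hψ : HasCompactSupport ψ) : HasCompactSupport fun z : Plane × ℝ => θ z.1 * ψ z.2 := by
  refine HasCompactSupport.intro (hθ.isCompact.prod hψ.isCompact) fun z hz => ?_
  by_contra h
  exact hz ⟨subset_tsupport _ (left_ne_zero_of_mul h), subset_tsupport _ (right_ne_zero_of_mul h)⟩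

theorem tsupport_tensor (θ : Plane → ℝ) {ψ : ℝ → ℝ} {s : Set ℝ} (h : tsupport ψ ⊆ s) :
    tsupport (fun z : Plane × ℝ => θ z.1 * ψ z.2) ⊆ univ ×ˢ s := by
  refine (closure_minimal (t := univ ×ˢ tsupport ψ) (fun z hz => ?_)
    (isClosed_univ.prod (isClosed_tsupport ψ))).trans (prod_mono_right h)
  exact ⟨mem_univ _, subset_tsupport _ (right_ne_zero_of_mul hz)⟩

theorem contDiff_tensor {θ : Plane → ℝ} {ψ : ℝ → ℝ} (hθ : ContDiff ℝ ∞ θ) (hψ : ContDiff ℝ ∞ ψ) :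
    ContDiff ℝ ∞ fun z : Plane × ℝ => θ z.1 * ψ z.2 :=
  (hθ.comp contDiff_fst).mul (hψ.comp contDiff_snd)

theorem fderiv_tensor {θ : Plane → ℝ} {ψ : ℝ → ℝ} (hθ : ContDiff ℝ ∞ θ) (hψ : ContDiff ℝ ∞ ψ)
    (z e : Plane × ℝ) : fderiv ℝ (fun z : Plane × ℝ => θ z.1 * ψ z.2) z e =
      θ z.1 * (deriv ψ z.2 * e.2) + fderiv ℝ θ z.1 e.1 * ψ z.2 := by
  have h1 : HasFDerivAt (fun z : Plane × ℝ => θ z.1)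
      ((fderiv ℝ θ z.1).comp (ContinuousLinearMap.fst ℝ Plane ℝ)) z :=
    (hθ.differentiable (by simp) z.1).hasFDerivAt.comp z hasFDerivAt_fst
  have h2 : HasFDerivAt (fun z : Plane × ℝ => ψ z.2)
      ((fderiv ℝ ψ z.2).comp (ContinuousLinearMap.snd ℝ Plane ℝ)) z :=
    (hψ.differentiable (by simp) z.2).hasFDerivAt.comp z hasFDerivAt_snd
  have h4 : HasFDerivAt (fun z : Plane × ℝ => θ z.1 * ψ z.2) _ z := h1.mul h2
  rw [h4.fderiv]
  have h3 : fderiv ℝ ψ z.2 e.2 = deriv ψ z.2 * e.2 := by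
    conv_lhs => rw [show e.2 = e.2 • (1 : ℝ) by simp, map_smul]
    rw [fderiv_apply_one_eq_deriv, smul_eq_mul, mul_comm]
  simp [h3]
  ring

/-- In this direction tensor products are enough: testing vertically first reduces the relation to
functions on the plane with values in L²(0, b). -/
theorem IsWeakDeriv.fourier {j : Fin 2} {u w : L2Layer b V} (h : IsWeakDeriv b j.castSucc u w) :
    ∀ᵐ ξ : Plane, dsym ξ j • (𝓕 u : L2Layer b V) ξ = (𝓕 w : L2Layer b V) ξ := by
  refine (lineDeriv_eq_iff j u w).1 (lineDeriv_eq_of_test fun θ hθ hθc => ?_)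
  rw [← sub_eq_zero]
  have hθ' : Continuous fun x => fderiv ℝ θ x (planeDir j) :=
    (hθ.continuous_fderiv (by simp)).clm_apply continuous_const
  have hθc' : HasCompactSupport fun x => fderiv ℝ θ x (planeDir j) :=
    (hθc.fderiv ℝ).comp_left (g := fun T : Plane →L[ℝ] ℝ => T _) rfl
  refine L2I.eq_zero_of_test fun ψ hψ hψc hψs => ?_
  change testI b ⟨ψ, hψ.continuous⟩ _ = 0
  rw [map_sub, map_neg, map_integral_smul_L2 _ (memLp_test hθ' hθc'),
    map_integral_smul_L2 _ (memLp_test hθ.continuous hθc), sub_eq_zero]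
  refine (layerIntegral_tensor (fun x => fderiv ℝ θ x (planeDir j)) hψ.continuous u).symm.trans
    (Eq.trans ?_ (congrArg Neg.neg (layerIntegral_tensor θ hψ.continuous w)))
  rw [← h _ (contDiff_tensor hθ hψ) (hasCompactSupport_tensor hθc hψc) (tsupport_tensor θ hψs)]
  simp only [fderiv_tensor hθ hψ, dir_castSucc, mul_zero, zero_add]

theorem isWeakDeriv_castSucc_iff {j : Fin 2} {u w : L2Layer b V} :
    IsWeakDeriv b j.castSucc u w ↔
      ∀ᵐ ξ : Plane, dsym ξ j • (𝓕 u : L2Layer b V) ξ = (𝓕 w : L2Layer b V) ξ :=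
  ⟨IsWeakDeriv.fourier, isWeakDeriv_of_fourier⟩

end Slice

end
end CurlLayer

namespace CurlLayer

noncomputable section

/-! ### Vertical weak derivatives and traces on the layer -/

section Vertical

variable {H H' K : Type} [NormedAddCommGroup H] [InnerProductSpace ℂ H] [CompleteSpace H]
  [NormedAddCommGroup H'] [InnerProductSpace ℂ H'] [CompleteSpace H']
  [NormedAddCommGroup K] [InnerProductSpace ℂ K] [CompleteSpace K]

theorem ae_add_eq_iff (A : H →L[ℂ] K) (B : H' →L[ℂ] K) (u : L2Top H) (w : L2Top H') (g : L2Top K) :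
    (∀ᵐ x, A (u x) + B (w x) = g x) ↔ A.compLp u + B.compLp w = g := by
  have h := Lp.coeFn_add (A.compLp u) (B.compLp w)
  constructor
  · intro h1
    refine Lp.ext ?_
    filter_upwards [h, A.coeFn_compLp u, B.coeFn_compLp w, h1] with x e1 e2 e3 e4
    rw [e1, Pi.add_apply, e2, e3, e4]
  · intro h1
    rw [h1] at h
    filter_upwards [h, A.coeFn_compLp u, B.coeFn_compLp w] with x e1 e2 e3
    rw [e1, Pi.add_apply, e2, e3]

/-- Linear relations that hold almost everywhere are transferred by the Fourier transform. -/
theorem ae_add_eq_fourier_iff (A : H →L[ℂ] K) (B : H' →L[ℂ] K) (u : L2Top H) (w : L2Top H')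
    (g : L2Top K) : (∀ᵐ x, A (u x) + B (w x) = g x) ↔
      ∀ᵐ ξ, A ((𝓕 u : L2Top H) ξ) + B ((𝓕 w : L2Top H') ξ) = (𝓕 g : L2Top K) ξ := by
  rw [ae_add_eq_iff, ae_add_eq_iff, ← fourier_compLp, ← fourier_compLp, ← FourierTransform.fourier_add]
  exact ⟨fun h => by rw [h], fun h => fourier_injective h⟩

variable {b : ℝ} {V : Type} [NormedAddCommGroup V] [InnerProductSpace ℂ V] [CompleteSpace V]

theorem locallyIntegrable_prodMk (u : L2Top H) (w : L2Top H') :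
    LocallyIntegrable fun x => (u x, w x) := by
  have hu : LocallyIntegrable (fun x => u x) := (Lp.memLp u).locallyIntegrable one_le_two
  have hw : LocallyIntegrable (fun x => w x) := (Lp.memLp w).locallyIntegrable one_le_two
  intro x
  obtain ⟨s, hs, h1⟩ := hu x
  obtain ⟨t, ht, h2⟩ := hw x
  exact ⟨s ∩ t, Filter.inter_mem hs ht,
    (h1.mono_set inter_subset_left).prodMk (h2.mono_set inter_subset_right)⟩

/-- The test functions on `(0, b)`. -/
structure TestI (b : ℝ) where
  /-- the test function -/
  toFun : ℝ → ℝ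
  smooth : ContDiff ℝ ∞ toFun
  compact : HasCompactSupport toFun
  support : tsupport toFun ⊆ Ioo 0 b

/-- The pairing with a test function. -/
def TestI.pair (ψ : TestI b) (V : Type) [NormedAddCommGroup V] [InnerProductSpace ℂ V] :
    L2I b V →L[ℂ] V := testI b ⟨ψ.toFun, ψ.smooth.continuous⟩

/-- The pairing with the derivative of a test function. -/
def TestI.pairDeriv (ψ : TestI b) (V : Type) [NormedAddCommGroup V] [InnerProductSpace ℂ V] :
    L2I b V →L[ℂ] V := testI b ⟨deriv ψ.toFun, ψ.smooth.continuous_deriv (by simp)⟩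

theorem isWeakDerivI_iff_pair {v w : L2I b V} :
    IsWeakDerivI b v w ↔ ∀ ψ : TestI b, ψ.pairDeriv V v + ψ.pair V w = 0 := by
  refine ⟨fun h ψ => ?_, fun h φ h1 h2 h3 => ?_⟩
  · exact add_eq_zero_iff_eq_neg.2 (h ψ.toFun ψ.smooth ψ.compact ψ.support)
  · exact add_eq_zero_iff_eq_neg.1 (h ⟨φ, h1, h2, h3⟩)

/-- Moves the exceptional null set in front of the uncountable family of vertical test functions. -/
theorem ae_isWeakDerivI_iff (u w : L2Layer b V) : (∀ᵐ x, IsWeakDerivI b (u x) (w x)) ↔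
    ∀ ψ : TestI b, ∀ᵐ x, ψ.pairDeriv V (u x) + ψ.pair V (w x) = 0 := by
  simp only [isWeakDerivI_iff_pair]
  refine ⟨fun h ψ => h.mono fun x hx => hx ψ, fun h => ?_⟩
  exact ae_forall_of_forall_ae (T := fun ψ : TestI b =>
    (ψ.pairDeriv V).comp (ContinuousLinearMap.fst ℂ (L2I b V) (L2I b V)) +
      (ψ.pair V).comp (ContinuousLinearMap.snd ℂ (L2I b V) (L2I b V)))
    (locallyIntegrable_prodMk u w) h

/-- Each vertical test functional acts on the values only and therefore commutes with the tangential
Fourier transform. -/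
theorem ae_isWeakDerivI_fourier_iff (u w : L2Layer b V) :
    (∀ᵐ x, IsWeakDerivI b (u x) (w x)) ↔
      ∀ᵐ ξ, IsWeakDerivI b ((𝓕 u : L2Layer b V) ξ) ((𝓕 w : L2Layer b V) ξ) := by
  rw [ae_isWeakDerivI_iff, ae_isWeakDerivI_iff]
  refine forall_congr' fun ψ => ?_
  have h := ae_add_eq_fourier_iff (ψ.pairDeriv V) (ψ.pair V) u w 0
  have h2 : (𝓕 (0 : L2Top V) : L2Top V) = 0 := FourierTransform.fourier_zero
  rw [h2] at h
  have h3 : ∀ F : Plane → V, (∀ᵐ x, F x = (0 : L2Top V) x) ↔ ∀ᵐ x, F x = 0 := fun F =>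
    Filter.eventually_congr (by
      filter_upwards [Lp.coeFn_zero V 2 (volume : Measure Plane)] with x hx
      rw [hx, Pi.zero_apply])
  rwa [h3, h3] at h

theorem dir_two : dir 2 = (0, 1) := rfl

theorem fderiv_vertical {φ : Plane × ℝ → ℝ} (hφ : ContDiff ℝ ∞ φ) (x : Plane) (y : ℝ) :
    fderiv ℝ φ (x, y) (dir 2) = deriv (fun y => φ (x, y)) y := by
  have h1 : HasFDerivAt (𝕜 := ℝ) (fun y : ℝ => (x, y))
      ((0 : ℝ →L[ℝ] Plane).prod (ContinuousLinearMap.id ℝ ℝ)) y :=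
    (hasFDerivAt_const x y).prodMk (hasFDerivAt_id y)
  have h := ((hφ.differentiable (by simp)) (x, y)).hasFDerivAt.comp y h1
  have h2 : HasFDerivAt (fun y => φ (x, y)) _ y := h
  rw [h2.hasDerivAt.deriv, dir_two]
  simp

theorem contDiff_vertical {φ : Plane × ℝ → ℝ} (hφ : ContDiff ℝ ∞ φ) (x : Plane) :
    ContDiff ℝ ∞ fun y => φ (x, y) := hφ.comp (by fun_prop)

theorem tsupport_vertical {φ : Plane × ℝ → ℝ} {s : Set ℝ} (hs : tsupport φ ⊆ univ ×ˢ s) (x : Plane) :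
    tsupport (fun y => φ (x, y)) ⊆ s := fun y hy => by
  have h := tsupport_comp_subset_preimage φ (f := fun y : ℝ => (x, y)) (by fun_prop) hy
  exact (hs h).2

theorem hasCompactSupport_vertical {φ : Plane × ℝ → ℝ} (hc : HasCompactSupport φ) (x : Plane) :
    HasCompactSupport fun y => φ (x, y) := by
  refine HasCompactSupport.intro (hc.isCompact.image continuous_snd) fun y hy => ?_
  exact image_eq_zero_of_notMem_tsupport fun h => hy ⟨(x, y), h, rfl⟩

theorem isWeakDeriv_two_iff_ae {u w : L2Layer b V} :
    IsWeakDeriv b 2 u w ↔ ∀ᵐ x, IsWeakDerivI b (u x) (w x) := by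
  constructor
  · intro h
    rw [ae_isWeakDerivI_iff]
    intro ψ
    have hu : LocallyIntegrable fun x => ψ.pairDeriv V (u x) :=
      ((Lp.memLp ((ψ.pairDeriv V).compLp u)).locallyIntegrable one_le_two).congr
        ((ψ.pairDeriv V).coeFn_compLp u)
    have hw : LocallyIntegrable fun x => ψ.pair V (w x) :=
      ((Lp.memLp ((ψ.pair V).compLp w)).locallyIntegrable one_le_two).congr
        ((ψ.pair V).coeFn_compLp w)
    refine (ae_eq_of_integral_contDiff_smul_eq hu hw.neg fun θ hθ hθc => ?_).mono
      fun x hx => add_eq_zero_iff_eq_neg.2 hx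
    have h1 := h _ (contDiff_tensor hθ ψ.smooth) (hasCompactSupport_tensor hθc ψ.compact)
      (tsupport_tensor θ ψ.support)
    simp only [fderiv_tensor hθ ψ.smooth, dir_two, mul_one, map_zero, zero_mul, add_zero] at h1
    rw [layerIntegral_tensor θ (ψ.smooth.continuous_deriv (by simp)),
      layerIntegral_tensor θ ψ.smooth.continuous] at h1
    simp only [Complex.coe_smul] at h1
    simp only [Pi.neg_apply, smul_neg, integral_neg]
    exact h1
  · intro h φ hφ hc hs
    rw [layerIntegral, layerIntegral, ← integral_neg]
    refine integral_congr_ae ?_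
    filter_upwards [h] with x hx
    simp only [fderiv_vertical hφ]
    exact hx _ (contDiff_vertical hφ x) (hasCompactSupport_vertical hc x) (tsupport_vertical hs x)

theorem isWeakDeriv_two_iff {u w : L2Layer b V} : IsWeakDeriv b 2 u w ↔
    ∀ᵐ ξ, IsWeakDerivI b ((𝓕 u : L2Layer b V) ξ) ((𝓕 w : L2Layer b V) ξ) :=
  isWeakDeriv_two_iff_ae.trans (ae_isWeakDerivI_fourier_iff u w)

/-- The trace at `0` in terms of a function and its weak derivative. -/
def botVal (b : ℝ) (V : Type) [NormedAddCommGroup V] [InnerProductSpace ℂ V] : L2I b V →L[ℂ] V :=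
  (b⁻¹ : ℝ) • testI b 1

/-- The trace at `0` in terms of a function and its weak derivative. -/
def botDer (b : ℝ) (V : Type) [NormedAddCommGroup V] [InnerProductSpace ℂ V] : L2I b V →L[ℂ] V :=
  (b⁻¹ : ℝ) • testI b ⟨fun y => y - b, by fun_prop⟩

/-- The trace at `b` in terms of a function and its weak derivative. -/
def topDer (b : ℝ) (V : Type) [NormedAddCommGroup V] [InnerProductSpace ℂ V] : L2I b V →L[ℂ] V :=
  botDer b V + testI b 1

/-- Separating the contributions of v and v' presents the trace as bounded operators on L² values,
which commute with the Fourier transform. -/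
theorem trBot_eq_val (k : ℕ) (w : HI b (k + 1) V) :
    trBot b k w = botVal b V (der b (k + 1) 0 w) + botDer b V (der b (k + 1) 1 w) := by
  rw [trBot_apply, smul_add]
  rfl

theorem trTop_eq_val (k : ℕ) (w : HI b (k + 1) V) : trTop b k w =
    botVal b V (der b (k + 1) 0 w) + topDer b V (der b (k + 1) 1 w) := by
  rw [trTop_apply, trBot_eq_val, add_assoc]
  rfl

theorem IsWeakDerivI.exists_HI {v w : L2I b V} (h : IsWeakDerivI b v w) :
    ∃ z : HI b 1 V, der b 1 0 z = v ∧ der b 1 1 z = w := by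
  have h1 : ∀ j < 1, IsWeakDerivI b ((fun j => if j = 0 then v else w) j)
      ((fun j => if j = 0 then v else w) (j + 1)) := by
    intro j hj
    obtain rfl : j = 0 := by omega
    exact h
  exact ⟨HI.mk _ h1, HI.der_mk _ _ zero_le_one, HI.der_mk _ _ le_rfl⟩

theorem green_ae (hb : 0 < b) {v w : L2I b V} (h : IsWeakDerivI b v w) {ψ : ℝ → ℝ}
    (hψ : ContDiff ℝ ∞ ψ) :
    (∫ y in Ioo 0 b, deriv ψ y • v y) + ∫ y in Ioo 0 b, ψ y • w y =
      ψ b • (botVal b V v + topDer b V w) - ψ 0 • (botVal b V v + botDer b V w) := by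
  obtain ⟨z, rfl, rfl⟩ := h.exists_HI
  rw [green_smul hb z (hψ.of_le (by simp)), trBot_eq_val, trTop_eq_val]

theorem green_layer (hb : 0 < b) {u w : L2Layer b V} (h : IsWeakDeriv b 2 u w)
    {φ : Plane × ℝ → ℝ} (hφ : ContDiff ℝ ∞ φ) (hc : HasCompactSupport φ) :
    layerIntegral b (fun z => fderiv ℝ φ z (dir 2)) u + layerIntegral b φ w =
      ∫ x : Plane, (φ (x, b) • (botVal b V (u x) + topDer b V (w x)) -
        φ (x, 0) • (botVal b V (u x) + botDer b V (w x))) := by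
  rw [layerIntegral, layerIntegral, ← integral_add
    (integrable_layer (continuous_fderiv_apply hφ _) (hasCompactSupport_fderiv hc _) u)
    (integrable_layer hφ.continuous hc w)]
  refine integral_congr_ae ?_
  filter_upwards [isWeakDeriv_two_iff_ae.1 h] with x hx
  simp only [fderiv_vertical hφ]
  exact green_ae hb hx (contDiff_vertical hφ x)

theorem locallyIntegrable_val (A B : L2I b V →L[ℂ] V) (u w : L2Layer b V) :
    LocallyIntegrable fun x => A (u x) + B (w x) := by
  have h := ((Lp.memLp (A.compLp u)).locallyIntegrable one_le_two).add
    ((Lp.memLp (B.compLp w)).locallyIntegrable one_le_two)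
  refine h.congr ?_
  filter_upwards [A.coeFn_compLp u, B.coeFn_compLp w] with x h1 h2
  rw [Pi.add_apply, h1, h2]

theorem eq_zero_of_tsupport {φ : Plane × ℝ → ℝ} {s : Set ℝ} (hs : tsupport φ ⊆ univ ×ˢ s) {y : ℝ}
    (hy : y ∉ s) (x : Plane) : φ (x, y) = 0 :=
  image_eq_zero_of_notMem_tsupport fun h => hy (hs h).2

theorem hasTraceTop_iff (hb : 0 < b) {u : L2Layer b V} {g : L2Top V} : HasTraceTop b u g ↔
    ∃ w, IsWeakDeriv b 2 u w ∧
      ∀ᵐ x, botVal b V (u x) + topDer b V (w x) = g x := by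
  refine exists_congr fun w => and_congr_right fun h => ⟨fun h1 => ?_, fun h1 φ hφ hc hs => ?_⟩
  -- A vertical cutoff equal to 1 at b and supported away from 0 isolates the top trace in Green's
  -- formula.
  · let η : ContDiffBump b := ⟨b / 4, b / 2, by positivity, by linarith⟩
    have hη : tsupport η ⊆ Ioi 0 := by
      rw [η.tsupport_eq]
      intro y hy
      rw [Metric.mem_closedBall, Real.dist_eq, abs_le] at hy
      change -(b / 2) ≤ _ ∧ _ at hy
      rw [mem_Ioi]
      linarith [hy.1]
    have hb1 : η b = 1 := η.one_of_mem_closedBall (Metric.mem_closedBall_self (by positivity))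
    have hb0 : η 0 = 0 := image_eq_zero_of_notMem_tsupport fun h =>
      absurd (hη h) (by simp)
    refine ae_eq_of_integral_contDiff_smul_eq (locallyIntegrable_val _ _ u w)
      ((Lp.memLp g).locallyIntegrable one_le_two) fun θ hθ hθc => ?_
    have h2 := h1 _ (contDiff_tensor hθ η.contDiff)
      (hasCompactSupport_tensor hθc η.hasCompactSupport) (tsupport_tensor θ hη)
    rw [green_layer hb h (contDiff_tensor hθ η.contDiff)
      (hasCompactSupport_tensor hθc η.hasCompactSupport)] at h2
    simpa only [hb1, hb0, mul_one, mul_zero, zero_smul, sub_zero] using h2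
  · rw [green_layer hb h hφ hc]
    refine integral_congr_ae ?_
    filter_upwards [h1] with x hx
    rw [hx, eq_zero_of_tsupport hs (y := 0) (by simp), zero_smul, sub_zero]

theorem hasTraceBottom_iff (hb : 0 < b) {u : L2Layer b V} {g : L2Top V} : HasTraceBottom b u g ↔
    ∃ w, IsWeakDeriv b 2 u w ∧ ∀ᵐ x, botVal b V (u x) + botDer b V (w x) = g x := by
  refine exists_congr fun w => and_congr_right fun h => ⟨fun h1 => ?_, fun h1 φ hφ hc hs => ?_⟩
  · let η : ContDiffBump (0 : ℝ) := ⟨b / 4, b / 2, by positivity, by linarith⟩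
    have hη : tsupport η ⊆ Iio b := by
      rw [η.tsupport_eq]
      intro y hy
      rw [Metric.mem_closedBall, Real.dist_eq, abs_le] at hy
      change _ ∧ _ ≤ b / 2 at hy
      rw [mem_Iio]
      linarith [hy.2]
    have hb1 : η 0 = 1 := η.one_of_mem_closedBall (Metric.mem_closedBall_self (by positivity))
    have hb0 : η b = 0 := image_eq_zero_of_notMem_tsupport fun h =>
      absurd (hη h) (by simp)
    refine ae_eq_of_integral_contDiff_smul_eq (locallyIntegrable_val _ _ u w)
      ((Lp.memLp g).locallyIntegrable one_le_two) fun θ hθ hθc => ?_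
    have h2 := h1 _ (contDiff_tensor hθ η.contDiff)
      (hasCompactSupport_tensor hθc η.hasCompactSupport) (tsupport_tensor θ hη)
    rw [green_layer hb h (contDiff_tensor hθ η.contDiff)
      (hasCompactSupport_tensor hθc η.hasCompactSupport)] at h2
    simpa only [hb1, hb0, mul_one, mul_zero, zero_smul, zero_sub, integral_neg, neg_inj] using h2
  · rw [green_layer hb h hφ hc, ← integral_neg]
    refine integral_congr_ae ?_
    filter_upwards [h1] with x hx
    rw [hx, eq_zero_of_tsupport hs (y := b) (by simp), zero_smul, zero_sub]

end Vertical

end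
end CurlLayer

namespace CurlLayer

noncomputable section

/-! ### Sobolev spaces on the layer and on its top through the Fourier transform -/

section Sobolev

variable {b : ℝ} {V : Type} [NormedAddCommGroup V] [InnerProductSpace ℂ V] [CompleteSpace V]
  {H : Type} [NormedAddCommGroup H] [InnerProductSpace ℂ H] [CompleteSpace H]

theorem continuous_bracket : Continuous bracket := by
  unfold bracket
  fun_prop

/-- Multiplication by the power `⟨ξ⟩^r`. -/
def weighted (r : ℝ) (F : Plane → H) (ξ : Plane) : H := ((bracket ξ ^ r : ℝ) : ℂ) • F ξ

theorem continuous_bracket_rpow (r : ℝ) : Continuous fun ξ : Plane => ((bracket ξ ^ r : ℝ) : ℂ) :=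
  Complex.continuous_ofReal.comp
    (continuous_bracket.rpow_const fun ξ => Or.inl (bracket_pos ξ).ne')

theorem norm_weighted (r : ℝ) (F : Plane → H) (ξ : Plane) :
    ‖weighted r F ξ‖ = bracket ξ ^ r * ‖F ξ‖ := by
  rw [weighted, norm_smul, Complex.norm_real, Real.norm_eq_abs,
    abs_of_nonneg (Real.rpow_nonneg (bracket_pos ξ).le r)]

theorem weighted_weighted (r t : ℝ) (F : Plane → H) :
    weighted r (weighted t F) = weighted (r + t) F := by
  ext ξ
  rw [weighted, weighted, weighted, smul_smul, Real.rpow_add (bracket_pos ξ), Complex.ofReal_mul]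

theorem weighted_zero (F : Plane → H) : weighted 0 F = F := by
  ext ξ
  simp [weighted]

theorem aestronglyMeasurable_weighted {F : Plane → H} (h : AEStronglyMeasurable F volume) (r : ℝ) :
    AEStronglyMeasurable (weighted r F) volume :=
  (continuous_bracket_rpow r).aestronglyMeasurable.smul h

theorem aestronglyMeasurable_of_weighted {F : Plane → H} {r : ℝ}
    (h : MemLp (weighted r F) 2) : AEStronglyMeasurable F volume := by
  have h1 := aestronglyMeasurable_weighted h.1 (-r)
  rwa [weighted_weighted, neg_add_cancel, weighted_zero] at h1

theorem MemLp.weighted_mono {F : Plane → H} {r t : ℝ} (h : MemLp (weighted r F) 2) (hrt : t ≤ r) :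
    MemLp (weighted t F) 2 := by
  refine h.of_le (aestronglyMeasurable_weighted (aestronglyMeasurable_of_weighted h) t)
    (Filter.Eventually.of_forall fun ξ => ?_)
  rw [norm_weighted, norm_weighted]
  exact mul_le_mul_of_nonneg_right (Real.rpow_le_rpow_of_exponent_le (one_le_bracket ξ) hrt)
    (norm_nonneg _)

theorem weighted_congr {F G : Plane → H} (h : F =ᵐ[volume] G) (r : ℝ) :
    weighted r F =ᵐ[volume] weighted r G := by
  filter_upwards [h] with ξ hξ
  rw [weighted, weighted, hξ]

theorem memLp_weighted_dsym {F : Plane → H} {r : ℝ} (h : MemLp (weighted (r + 1) F) 2) (j : Fin 2) :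
    MemLp (weighted r fun ξ => dsym ξ j • F ξ) 2 := by
  have hm := aestronglyMeasurable_of_weighted h
  refine h.of_le_mul (c := 7) (aestronglyMeasurable_weighted
    ((continuous_dsym j).aestronglyMeasurable.smul hm) r) (Filter.Eventually.of_forall fun ξ => ?_)
  rw [norm_weighted, norm_weighted, norm_smul, Real.rpow_add_one (bracket_pos ξ).ne']
  have h1 : ‖dsym ξ j‖ ≤ 7 * bracket ξ :=
    (norm_dsym_le' ξ j).trans (mul_le_mul_of_nonneg_left (norm_le_bracket ξ) (by norm_num))
  have h2 := Real.rpow_nonneg (bracket_pos ξ).le r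
  calc bracket ξ ^ r * (‖dsym ξ j‖ * ‖F ξ‖) ≤ bracket ξ ^ r * (7 * bracket ξ * ‖F ξ‖) := by
        gcongr
    _ = _ := by ring

theorem bracket_le_add (ξ : Plane) : bracket ξ ≤ 1 + ‖dsym ξ 0‖ + ‖dsym ξ 1‖ := by
  have h1 : ∀ j, |ξ j| ≤ ‖dsym ξ j‖ := by
    intro j
    rw [dsym, norm_mul, Complex.norm_I, mul_one, Complex.norm_real, Real.norm_eq_abs, abs_mul,
      abs_of_pos (by positivity : 0 < 2 * Real.pi)]
    have := Real.pi_gt_three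
    exact le_mul_of_one_le_left (abs_nonneg _) (by linarith)
  have h2 : bracket ξ ≤ 1 + |ξ 0| + |ξ 1| := by
    rw [bracket, EuclideanSpace.norm_sq_eq, Fin.sum_univ_two]
    refine Real.sqrt_le_iff.2 ⟨by positivity, ?_⟩
    simp only [Real.norm_eq_abs]
    nlinarith [abs_nonneg (ξ 0), abs_nonneg (ξ 1), mul_nonneg (abs_nonneg (ξ 0)) (abs_nonneg (ξ 1))]
  linarith [h1 0, h1 1]

theorem memLp_weighted_succ {F : Plane → H} {r : ℝ} (h : MemLp (weighted r F) 2)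
    (h' : ∀ j, MemLp (weighted r fun ξ => dsym ξ j • F ξ) 2) : MemLp (weighted (r + 1) F) 2 := by
  have hs := (h.norm.add (h' 0).norm).add (h' 1).norm
  refine hs.of_le (aestronglyMeasurable_weighted (aestronglyMeasurable_of_weighted h) _)
    (Filter.Eventually.of_forall fun ξ => ?_)
  simp only [Pi.add_apply, norm_weighted, norm_smul, Real.rpow_add_one (bracket_pos ξ).ne']
  have h2 := Real.rpow_nonneg (bracket_pos ξ).le r
  refine le_trans ?_ (Real.le_norm_self _)
  have h3 := mul_le_mul_of_nonneg_left (bracket_le_add ξ)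
    (mul_nonneg h2 (norm_nonneg (F ξ)))
  linarith

/-- The image of the Sobolev space `Hᵏ(Ω; V)` under the tangential Fourier transform. -/
def FiberSobolev (b : ℝ) (k : ℕ) (U : L2Layer b V) : Prop :=
  ∃ W : ℕ → Plane → L2I b V, W 0 =ᵐ[volume] U ∧
    (∀ j < k, ∀ᵐ ξ, IsWeakDerivI b (W j ξ) (W (j + 1) ξ)) ∧
    ∀ j ≤ k, MemLp (weighted ((k : ℝ) - j) (W j)) 2

theorem MemHLayer.of_succ {k : ℕ} {u : L2Layer b V} (h : MemHLayer b (k + 1) u) :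
    MemHLayer b k u := by
  induction k generalizing u with
  | zero => trivial
  | succ k ih => exact fun j => (h j).imp fun w hw => ⟨hw.1, ih hw.2⟩

theorem fourier_fourierInv_toLp {F : Plane → H} (hF : MemLp F 2) :
    (𝓕 (𝓕⁻ hF.toLp : L2Top H) : L2Top H) =ᵐ[volume] F := by
  rw [FourierTransform.fourier_fourierInv_eq]
  exact hF.coeFn_toLp

/-- Induction on the order. Horizontal derivatives multiply by dⱼ and so raise the power of the
bracket by one, since ⟨ξ⟩ ≤ 1 + |d₁| + |d₂|. The vertical derivative shifts the tuple of fiber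
derivatives. Conversely, the required derivatives are defined by inverse Fourier transform. -/
theorem memHLayer_iff (k : ℕ) (u : L2Layer b V) :
    MemHLayer b k u ↔ FiberSobolev b k (𝓕 u : L2Layer b V) := by
  induction k generalizing u with
  | zero =>
    refine ⟨fun _ => ⟨fun _ => (𝓕 u : L2Layer b V), ae_eq_rfl, fun j hj => by omega, fun j hj => ?_⟩,
      fun _ => trivial⟩
    obtain rfl : j = 0 := by omega
    rw [sub_self, weighted_zero]
    exact Lp.memLp _
  | succ k ih =>
    constructor
    · intro h
      obtain ⟨w, hw, hk⟩ := h 2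
      obtain ⟨W, hW0, hW1, hW2⟩ := (ih w).1 hk
      have hu : MemLp (weighted k (𝓕 u : L2Layer b V)) 2 := by
        obtain ⟨W', h0, -, h2⟩ := (ih u).1 h.of_succ
        have h3 := h2 0 k.zero_le
        rw [Nat.cast_zero, sub_zero] at h3
        exact h3.ae_eq (weighted_congr h0 _)
      have hu' : ∀ j, MemLp (weighted k fun ξ => dsym ξ j • (𝓕 u : L2Layer b V) ξ) 2 := by
        intro j
        obtain ⟨w', hw', hk'⟩ := h j.castSucc
        obtain ⟨W', h0, -, h2⟩ := (ih w').1 hk'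
        have h3 := h2 0 k.zero_le
        rw [Nat.cast_zero, sub_zero] at h3
        refine h3.ae_eq ((weighted_congr h0 _).trans (weighted_congr ?_ _))
        filter_upwards [hw'.fourier] with ξ hξ
        exact hξ.symm
      refine ⟨fun j => Nat.casesOn j (fun ξ => (𝓕 u : L2Layer b V) ξ) W, ae_eq_rfl, fun j hj => ?_,
        fun j hj => ?_⟩
      · cases j with
        | zero =>
          filter_upwards [isWeakDeriv_two_iff.1 hw, hW0] with ξ h1 h2
          exact h2 ▸ h1
        | succ j => exact hW1 j (by omega)
      · cases j with
        | zero =>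
          have := memLp_weighted_succ hu hu'
          simpa using this
        | succ j =>
          have := hW2 j (by omega)
          simpa using this
    · rintro ⟨W, hW0, hW1, hW2⟩ j
      have key : j = 2 ∨ ∃ i : Fin 2, j = i.castSucc := by
        fin_cases j
        · exact Or.inr ⟨0, rfl⟩
        · exact Or.inr ⟨1, rfl⟩
        · exact Or.inl rfl
      obtain rfl | ⟨i, rfl⟩ := key
      · have h1 : MemLp (W 1) 2 := by
          have h := MemLp.weighted_mono (hW2 1 (by omega)) (t := 0) (by push_cast; simp)
          rwa [weighted_zero] at h
        have h2 := fourier_fourierInv_toLp h1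
        refine ⟨𝓕⁻ h1.toLp, isWeakDeriv_two_iff.2 ?_, (ih _).2 ⟨fun j => W (j + 1), h2.symm,
          fun j hj => hW1 (j + 1) (by omega), fun j hj => ?_⟩⟩
        · filter_upwards [h2, hW0, hW1 0 k.succ_pos] with ξ e1 e2 e3
          rw [e1, ← e2]
          exact e3
        · have := hW2 (j + 1) (by omega)
          simpa using this
      · have h0 : ∀ j ≤ k, MemLp (weighted ((k : ℝ) - j) fun ξ => dsym ξ i • W j ξ) 2 := by
          intro j hj
          refine memLp_weighted_dsym ?_ i
          have := hW2 j (by omega)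
          rwa [show ((k : ℝ) - j) + 1 = ((k + 1 : ℕ) : ℝ) - j by push_cast; ring]
        have h1 : MemLp (fun ξ => dsym ξ i • W 0 ξ) 2 := by
          have h := MemLp.weighted_mono (h0 0 (by omega)) (t := 0) (by simp)
          rwa [weighted_zero] at h
        have h2 := fourier_fourierInv_toLp h1
        refine ⟨𝓕⁻ h1.toLp, isWeakDeriv_castSucc_iff.2 ?_, (ih _).2
          ⟨fun j ξ => dsym ξ i • W j ξ, h2.symm, fun j hj => ?_, h0⟩⟩
        · filter_upwards [h2, hW0] with ξ e1 e2
          rw [e1, ← e2]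
        · filter_upwards [hW1 j (by omega)] with ξ hξ
          exact hξ.smul _

theorem locallyIntegrable_weighted (g : L2Top H) (r : ℝ) : LocallyIntegrable (weighted r g) := by
  have h : LocallyIntegrable (fun ξ => g ξ) := (Lp.memLp g).locallyIntegrable one_le_two
  rw [← locallyIntegrableOn_univ] at h ⊢
  exact h.continuousOn_smul isOpen_univ.isLocallyClosed (continuous_bracket_rpow r).continuousOn

theorem memHTop_iff (σ : ℝ) (g : L2Top V) :
    MemHTop σ g ↔ MemLp (weighted σ (𝓕 g : L2Top V)) 2 := by
  have hw : (fun ξ : Plane => (((1 + ‖ξ‖ ^ 2) ^ (σ / 2) : ℝ) : ℂ)).HasTemperateGrowth := by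
    fun_prop
  have hb : ∀ ξ : Plane, ((1 + ‖ξ‖ ^ 2) ^ (σ / 2) : ℝ) = bracket ξ ^ σ := by
    intro ξ
    rw [bracket, Real.sqrt_eq_rpow, ← Real.rpow_mul (by positivity)]
    congr 1
    ring
  have key : ∀ θ : 𝓢(Plane, ℂ), (TemperedDistribution.smulLeftCLM V
      (fun ξ : Plane => (((1 + ‖ξ‖ ^ 2) ^ (σ / 2) : ℝ) : ℂ)) (𝓕 (g : 𝓢'(Plane, V)))) θ =
      ∫ ξ, θ ξ • weighted σ (𝓕 g : L2Top V) ξ := by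
    intro θ
    rw [Lp.fourier_toTemperedDistribution_eq, TemperedDistribution.smulLeftCLM_apply_apply,
      Lp.toTemperedDistribution_apply]
    refine integral_congr_ae (Filter.Eventually.of_forall fun ξ => ?_)
    simp only [SchwartzMap.smulLeftCLM_apply hw]
    simp only [hb, weighted, smul_smul, smul_eq_mul]
    rw [mul_comm]
  rw [MemHTop, TemperedDistribution.memSobolev_iff_exists_smulLeftCLM_fourier]
  constructor
  · rintro ⟨f, hf⟩
    refine (Lp.memLp f).ae_eq (ae_eq_of_schwartz ((Lp.memLp f).locallyIntegrable one_le_two)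
      (locallyIntegrable_weighted _ σ) fun θ => ?_)
    rw [← key, hf, Lp.toTemperedDistribution_apply]
  · intro h
    refine ⟨h.toLp, ?_⟩
    ext θ
    rw [key, Lp.toTemperedDistribution_apply]
    refine integral_congr_ae ?_
    filter_upwards [h.coeFn_toLp] with ξ hξ
    rw [hξ]

end Sobolev

end
end CurlLayer

namespace CurlLayer

noncomputable section

/-! ### Fourier transforms of functions defined almost everywhere -/

section Relation

variable {H K : Type} [NormedAddCommGroup H] [InnerProductSpace ℂ H] [CompleteSpace H]
  [NormedAddCommGroup K] [InnerProductSpace ℂ K] [CompleteSpace K]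

/-- `G` is the Fourier transform of the square integrable function `F`, almost everywhere. -/
def IsFT (F G : Plane → H) : Prop :=
  ∃ u : L2Top H, u =ᵐ[volume] F ∧ (𝓕 u : L2Top H) =ᵐ[volume] G

theorem isFT (u : L2Top H) : IsFT u (𝓕 u : L2Top H) := ⟨u, ae_eq_rfl, ae_eq_rfl⟩

variable {F G F' G' : Plane → H}

theorem IsFT.add (h : IsFT F G) (h' : IsFT F' G') :
    IsFT (fun x => F x + F' x) (fun x => G x + G' x) := by
  obtain ⟨u, h1, h2⟩ := h
  obtain ⟨u', h1', h2'⟩ := h'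
  refine ⟨u + u', (Lp.coeFn_add u u').trans (h1.add h1'), ?_⟩
  rw [FourierTransform.fourier_add]
  exact (Lp.coeFn_add _ _).trans (h2.add h2')

theorem IsFT.clm (h : IsFT F G) (T : H →L[ℂ] K) : IsFT (fun x => T (F x)) (fun x => T (G x)) := by
  obtain ⟨u, h1, h2⟩ := h
  refine ⟨T.compLp u, ?_, ?_⟩
  · filter_upwards [T.coeFn_compLp u, h1] with x e1 e2
    rw [e1, e2]
  · rw [fourier_compLp]
    filter_upwards [T.coeFn_compLp (𝓕 u : L2Top H), h2] with x e1 e2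
    rw [e1, e2]

theorem IsFT.smul (h : IsFT F G) (c : ℂ) : IsFT (fun x => c • F x) (fun x => c • G x) :=
  h.clm (c • ContinuousLinearMap.id ℂ H)

theorem IsFT.neg (h : IsFT F G) : IsFT (fun x => -F x) (fun x => -G x) := by
  simpa using h.smul (-1)

theorem IsFT.sub (h : IsFT F G) (h' : IsFT F' G') :
    IsFT (fun x => F x - F' x) (fun x => G x - G' x) := by
  simpa [sub_eq_add_neg] using h.add h'.neg

/-- Injectivity of the transform. An equation whose two sides are built by bounded operators on
values can thus be checked either in x or in ξ. -/
theorem IsFT.eq_zero_iff (h : IsFT F G) : (∀ᵐ x, F x = 0) ↔ ∀ᵐ ξ, G ξ = 0 := by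
  obtain ⟨u, h1, h2⟩ := h
  have e : u = 0 ↔ (𝓕 u : L2Top H) = 0 := by
    refine ⟨fun h => by rw [h]; exact FourierTransform.fourier_zero, fun h => fourier_injective ?_⟩
    rw [h]
    exact FourierTransform.fourier_zero.symm
  rw [Lp.eq_zero_iff_ae_eq_zero, Lp.eq_zero_iff_ae_eq_zero] at e
  refine Iff.trans ⟨fun h => ?_, fun h => ?_⟩ (e.trans ⟨fun h => ?_, fun h => ?_⟩)
  · exact h1.trans h
  · exact h1.symm.trans h
  · exact h2.symm.trans h
  · exact h2.trans h

end Relation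

/-! ### Derivatives on a fiber -/

section FiberDeriv

variable {b : ℝ} {V W : Type} [NormedAddCommGroup V] [InnerProductSpace ℂ V] [CompleteSpace V]
  [NormedAddCommGroup W] [InnerProductSpace ℂ W] [CompleteSpace W]

/-- The partial derivative `∂ᵢ` on a fiber, where `d` stands for the symbols of the tangential
derivatives. -/
def fd {k : ℕ} (d : Fin 2 → ℂ) (i : Fin 3) (w : HI b (k + 1) V) : HI b k V :=
  ![d 0 • HI.incl b k w, d 1 • HI.incl b k w, HI.deriv b k w] i

variable {k : ℕ} (d : Fin 2 → ℂ)

theorem fd_castSucc (j : Fin 2) (w : HI b (k + 1) V) : fd d j.castSucc w = d j • HI.incl b k w := by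
  fin_cases j <;> rfl

theorem fd_two (w : HI b (k + 1) V) : fd d 2 w = HI.deriv b k w := rfl

theorem map_fd (A : V →L[ℂ] W) (i : Fin 3) (w : HI b (k + 1) V) :
    HI.map b k A (fd d i w) = fd d i (HI.map b (k + 1) A w) := by
  fin_cases i
  · exact (map_smul _ _ _).trans (congrArg (d 0 • ·) (HI.map_incl A w))
  · exact (map_smul _ _ _).trans (congrArg (d 1 • ·) (HI.map_incl A w))
  · exact HI.map_deriv A w

theorem HI.deriv_incl (w : HI b (k + 2) V) :
    HI.deriv b k (HI.incl b (k + 1) w) = HI.incl b k (HI.deriv b (k + 1) w) := by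
  refine HI.ext_der fun j hj => ?_
  rw [HI.der_deriv hj, HI.der_incl (by omega), HI.der_incl hj, HI.der_deriv (by omega)]

theorem toL2_incl (w : HI b (k + 1) V) : toL2 b k (HI.incl b k w) = toL2 b (k + 1) w := by
  rw [toL2_eq_der, toL2_eq_der, HI.der_incl (Nat.zero_le k)]

theorem toL2_deriv (w : HI b (k + 1) V) : toL2 b k (HI.deriv b k w) = der b (k + 1) 1 w := by
  rw [toL2_eq_der, HI.der_deriv (Nat.zero_le k)]

theorem toL2_map (A : V →L[ℂ] W) (w : HI b k V) :
    toL2 b k (HI.map b k A w) = mapI b A (toL2 b k w) := by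
  rw [toL2_eq_der, toL2_eq_der, HI.der_map]

theorem toL2_const (c : V) : toL2 b k (HI.const b k V c) = constI b V c := by
  rw [toL2_eq_der, HI.der_const_zero]

variable {d} {u w : L2Layer b V} {v : Plane → HI b (k + 1) V}

/-- In horizontal directions this is the multiplier characterisation. In the vertical direction the
fiber already stores its derivative, and uniqueness identifies it with the given one. -/
theorem isWeakDeriv_iff_fd (hv : ∀ᵐ ξ, toL2 b (k + 1) (v ξ) = (𝓕 u : L2Layer b V) ξ) (i : Fin 3) :
    IsWeakDeriv b i u w ↔
      ∀ᵐ ξ, toL2 b k (fd (dsym ξ) i (v ξ)) = (𝓕 w : L2Layer b V) ξ := by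
  have key : i = 2 ∨ ∃ j : Fin 2, i = j.castSucc := by
    fin_cases i
    · exact Or.inr ⟨0, rfl⟩
    · exact Or.inr ⟨1, rfl⟩
    · exact Or.inl rfl
  obtain rfl | ⟨j, rfl⟩ := key
  · rw [isWeakDeriv_two_iff]
    refine Filter.eventually_congr ?_
    filter_upwards [hv] with ξ hξ
    rw [fd_two, toL2_deriv, ← hξ, toL2_eq_der]
    have h := isWeakDerivI_der (by omega : 0 < k + 1) (v ξ)
    exact ⟨fun h' => h.unique h', fun h' => h' ▸ h⟩
  · rw [isWeakDeriv_castSucc_iff]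
    refine Filter.eventually_congr ?_
    filter_upwards [hv] with ξ hξ
    rw [fd_castSucc, map_smul, toL2_incl, hξ]

theorem val_iff (hv : ∀ᵐ ξ, toL2 b (k + 1) (v ξ) = (𝓕 u : L2Layer b V) ξ)
    (hw : IsWeakDeriv b 2 u w) (A B : L2I b V →L[ℂ] V) (g : L2Top V) :
    (∀ᵐ x, A (u x) + B (w x) = g x) ↔
      ∀ᵐ ξ, A (der b (k + 1) 0 (v ξ)) + B (der b (k + 1) 1 (v ξ)) = (𝓕 g : L2Top V) ξ := by
  rw [ae_add_eq_fourier_iff]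
  refine Filter.eventually_congr ?_
  filter_upwards [hv, (isWeakDeriv_iff_fd hv 2).1 hw] with ξ h1 h2
  rw [← h1, ← h2, fd_two, toL2_deriv, toL2_eq_der]

theorem hasTraceTop_iff_trTop (hb : 0 < b)
    (hv : ∀ᵐ ξ, toL2 b (k + 1) (v ξ) = (𝓕 u : L2Layer b V) ξ) (hw : IsWeakDeriv b 2 u w)
    {g : L2Top V} : HasTraceTop b u g ↔ ∀ᵐ ξ, trTop b k (v ξ) = (𝓕 g : L2Top V) ξ := by
  simp only [hasTraceTop_iff hb, trTop_eq_val]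
  exact ⟨fun ⟨w', h1, h2⟩ => (val_iff hv h1 _ _ g).1 h2, fun h => ⟨w, hw, (val_iff hv hw _ _ g).2 h⟩⟩

theorem hasTraceBottom_iff_trBot (hb : 0 < b)
    (hv : ∀ᵐ ξ, toL2 b (k + 1) (v ξ) = (𝓕 u : L2Layer b V) ξ) (hw : IsWeakDeriv b 2 u w)
    {g : L2Top V} : HasTraceBottom b u g ↔ ∀ᵐ ξ, trBot b k (v ξ) = (𝓕 g : L2Top V) ξ := by
  simp only [hasTraceBottom_iff hb, trBot_eq_val]
  exact ⟨fun ⟨w', h1, h2⟩ => (val_iff hv h1 _ _ g).1 h2, fun h => ⟨w, hw, (val_iff hv hw _ _ g).2 h⟩⟩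

theorem exists_hasTraceTop (hb : 0 < b) (hw : IsWeakDeriv b 2 u w) : ∃ g, HasTraceTop b u g := by
  refine ⟨(botVal b V).compLp u + (topDer b V).compLp w, (hasTraceTop_iff hb).2 ⟨w, hw, ?_⟩⟩
  exact (ae_add_eq_iff _ _ u w _).2 rfl

end FiberDeriv

/-! ### The fiber system written with partial derivatives instead of powers of d. -/

section System

variable {b γ κ μ : ℝ} {s : ℕ} (d : Fin 2 → ℂ) (x : Unknowns b s)

/-- Regroups the polynomial in d into the divergence of the symmetric gradient, the shape in which
the equation is posed on the layer. Vertical derivative and inclusion commute. -/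
theorem fiberSys_momentum (i : Fin 3) : (fiberSys b γ κ μ s d x).1 i =
    (γ : ℂ) • HI.const b s ℂ (horizontal (WithLp.toLp 2 x.2.2) i) + fd d i x.1 -
      (μ : ℂ) • ∑ j, (fd d j (fd d j (x.2.1 i)) + fd d j (fd d i (x.2.1 j))) := by
  have key : i = 2 ∨ ∃ j : Fin 2, i = j.castSucc := by
    fin_cases i
    · exact Or.inr ⟨0, rfl⟩
    · exact Or.inr ⟨1, rfl⟩
    · exact Or.inl rfl
  obtain rfl | ⟨j, rfl⟩ := key
  · rw [fiberSys_nor]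
    simp [Fin.sum_univ_three, fd, fiberDiv, horizontal, HI.deriv_incl]
    module
  · rw [fiberSys_tan]
    fin_cases j
    · simp [Fin.sum_univ_three, fd, fiberDiv, horizontal, HI.deriv_incl]
      module
    · simp [Fin.sum_univ_three, fd, fiberDiv, horizontal, HI.deriv_incl]
      module

theorem fiberDiv_eq_sum : fiberDiv d x = ∑ i, fd d i (x.2.1 i) := by
  simp [Fin.sum_univ_three, fd, fiberDiv]

theorem fiberSys_stress (i : Fin 3) : (fiberSys b γ κ μ s d x).2.2.1 i =
    -(trTop b s x.1 * e3 i - (μ : ℂ) * (trTop b s (fd d 2 (x.2.1 i)) +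
      trTop b s (fd d i (x.2.1 2)))) - (κ : ℂ) * (d 0 * x.2.2 0 + d 1 * x.2.2 1) * e3 i := by
  have key : i = 2 ∨ ∃ j : Fin 2, i = j.castSucc := by
    fin_cases i
    · exact Or.inr ⟨0, rfl⟩
    · exact Or.inr ⟨1, rfl⟩
    · exact Or.inl rfl
  obtain rfl | ⟨j, rfl⟩ := key
  · rw [fiberSys_stress_nor]
    simp [fd_two, e3]
    ring
  · rw [fiberSys_stress_tan, fd_two, fd_castSucc, map_smul, trTop_incl]
    fin_cases j <;> simp [e3]

end System

end
end CurlLayer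

namespace CurlLayer

noncomputable section

/-! ### The system on the layer and the system on the fibers -/

/-- The unknowns in components. -/
def toUnknowns {b : ℝ} {s : ℕ} (x : FiberX b s) : Unknowns b s :=
  (x.1, fun i => HI.map b (s + 2) (coord i) x.2.1, fun i => x.2.2 i)

theorem toFiberX_toUnknowns {b : ℝ} {s : ℕ} (x : FiberX b s) : toFiberX b s (toUnknowns x) = x := by
  rw [toFiberX_apply]
  refine Prod.ext rfl (Prod.ext ?_ rfl)
  exact HI.ofComponents_map_coord x.2.1

theorem toUnknowns_toFiberX {b : ℝ} {s : ℕ} (x : Unknowns b s) : toUnknowns (toFiberX b s x) = x := by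
  rw [toFiberX_apply]
  refine Prod.ext rfl (Prod.ext ?_ rfl)
  exact funext fun i => HI.map_coord_ofComponents i x.2.1

theorem IsFT.sum_three {H : Type} [NormedAddCommGroup H] [InnerProductSpace ℂ H] [CompleteSpace H]
    {F G : Fin 3 → Plane → H} (h : ∀ j, IsFT (F j) (G j)) :
    IsFT (fun x => ∑ j, F j x) (fun ξ => ∑ j, G j ξ) := by
  simpa only [Fin.sum_univ_three] using ((h 0).add (h 1)).add (h 2)

/-- The `i`-th coordinate of `(θ, 0)`. -/
def horizontalL (i : Fin 3) : Cn 2 →L[ℂ] ℂ := ![coord 0, coord 1, 0] i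

theorem horizontalL_apply (i : Fin 3) (θ : Cn 2) : horizontalL i θ = horizontal θ i := by
  fin_cases i <;> rfl

theorem isDivTop_iff {χ : L2Top (Cn 2)} {d : L2Top ℂ} : IsDivTop χ d ↔
    ∀ᵐ ξ : Plane, dsym ξ 0 * (𝓕 χ : L2Top (Cn 2)) ξ 0 + dsym ξ 1 * (𝓕 χ : L2Top (Cn 2)) ξ 1 =
      (𝓕 d : L2Top ℂ) ξ := by
  refine (lineDeriv_add_eq_iff 0 1 (component 0 χ) (component 1 χ) d).trans
    (Filter.eventually_congr ?_)
  rw [component, component, fourier_compLp, fourier_compLp]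
  filter_upwards [(coord 0 : Cn 2 →L[ℂ] ℂ).coeFn_compLp (𝓕 χ : L2Top (Cn 2)),
    (coord 1 : Cn 2 →L[ℂ] ℂ).coeFn_compLp (𝓕 χ : L2Top (Cn 2))] with ξ h0 h1
  rw [h0, h1]
  rfl

theorem isCurlTop_zero_iff {χ : L2Top (Cn 2)} : IsCurlTop χ 0 ↔
    ∀ᵐ ξ : Plane, dsym ξ 0 * (𝓕 χ : L2Top (Cn 2)) ξ 1 - dsym ξ 1 * (𝓕 χ : L2Top (Cn 2)) ξ 0 = 0 := by
  have h1 : IsCurlTop χ 0 ↔ ∂_{planeDir 0} ((component 1 χ : L2Top ℂ) : 𝓢'(Plane, ℂ)) +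
      ∂_{planeDir 1} ((-component 0 χ : L2Top ℂ) : 𝓢'(Plane, ℂ)) =
        ((0 : L2Top ℂ) : 𝓢'(Plane, ℂ)) := by
    rw [IsCurlTop, add_comm, ← Lp.toTemperedDistributionCLM_apply (-component 0 χ), map_neg,
      LineDeriv.lineDerivOp_neg]
    rfl
  have h2 : (𝓕 (-component 0 χ : L2Top ℂ) : L2Top ℂ) = -𝓕 (component 0 χ : L2Top ℂ) :=
    map_neg (FourierTransform.fourierCLM ℂ (L2Top ℂ)) _
  rw [h1, lineDeriv_add_eq_iff, FourierTransform.fourier_zero, h2, component, component,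
    fourier_compLp, fourier_compLp]
  refine Filter.eventually_congr ?_
  filter_upwards [(coord 0 : Cn 2 →L[ℂ] ℂ).coeFn_compLp (𝓕 χ : L2Top (Cn 2)),
    (coord 1 : Cn 2 →L[ℂ] ℂ).coeFn_compLp (𝓕 χ : L2Top (Cn 2)),
    Lp.coeFn_neg ((coord 0 : Cn 2 →L[ℂ] ℂ).compLp (𝓕 χ : L2Top (Cn 2))),
    Lp.coeFn_zero ℂ 2 (volume : Measure Plane)] with ξ e0 e1 e2 e3
  rw [e1, e2, Pi.neg_apply, e0, e3, Pi.zero_apply, smul_neg, ← sub_eq_add_neg]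
  rfl

/-! ### Each equation on the layer compared with its fiber counterpart. -/

section Equations

variable {b γ κ μ : ℝ} {s : ℕ} {p : L2Layer b ℂ} {u : L2Layer b (Cn 3)} {χ : L2Top (Cn 2)}
  {f : L2Layer b (Cn 3)} {k : L2Top (Cn 3)} {H : L2Top (Cn 2)} {h d : L2Top ℂ}
  {Dp : Fin 3 → L2Layer b ℂ} {Du : Fin 3 → L2Layer b (Cn 3)} {DDu : Fin 3 → Fin 3 → L2Layer b (Cn 3)}
  {pTop : L2Top ℂ} {uTop : L2Top (Cn 3)} {DuTop : Fin 3 → L2Top (Cn 3)}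
  {X : Plane → FiberX b s} {φ : Plane → HI b s (Cn 3)}

theorem momentum_iff (hq : ∀ᵐ ξ, toL2 b (s + 1) (X ξ).1 = (𝓕 p : L2Layer b ℂ) ξ)
    (hv : ∀ᵐ ξ, toL2 b (s + 2) (X ξ).2.1 = (𝓕 u : L2Layer b (Cn 3)) ξ)
    (hχ : ∀ᵐ ξ, (X ξ).2.2 = (𝓕 χ : L2Top (Cn 2)) ξ)
    (hφ : ∀ᵐ ξ, toL2 b s (φ ξ) = (𝓕 f : L2Layer b (Cn 3)) ξ)
    (hDp : ∀ i, IsWeakDeriv b i p (Dp i)) (hDu : ∀ i, IsWeakDeriv b i u (Du i))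
    (hDDu : ∀ j i, IsWeakDeriv b j (Du i) (DDu j i)) :
    (∀ᵐ x : Plane, ∀ᵐ y ∂(volume.restrict (Ioo 0 b)), ∀ i : Fin 3,
      (γ : ℂ) * horizontal (χ x) i + Dp i x y
        - (μ : ℂ) * ∑ j : Fin 3, (DDu j j x y i + DDu j i x y j) = f x y i) ↔
    ∀ᵐ ξ, ∀ i, (fiberSys b γ κ μ s (dsym ξ) (toUnknowns (X ξ))).1 i =
      HI.map b s (coord i) (φ ξ) := by
  simp only [Filter.eventually_all]
  refine forall_congr' fun i => ?_
  -- The defect of the equation is assembled from L² functions by bounded operators on values, so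
  -- its transform is the same expression in the transforms. Here χ enters as a function constant in
  -- the vertical variable.
  have hFT := (((((isFT χ).clm (horizontalL i)).clm (constI b ℂ)).smul (γ : ℂ)).add
    (isFT (Dp i))).sub ((IsFT.sum_three fun j => ((isFT (DDu j j)).clm (mapI b (coord i))).add
      ((isFT (DDu j i)).clm (mapI b (coord j)))).smul (μ : ℂ)) |>.sub
      ((isFT f).clm (mapI b (coord i)))
  refine Iff.trans ?_ (hFT.eq_zero_iff.trans ?_)
  · refine Filter.eventually_congr (Filter.Eventually.of_forall fun x => ?_)
    rw [sub_eq_zero, Lp.ext_iff]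
    refine Filter.eventually_congr ?_
    rw [Fin.sum_univ_three]
    set c := constI b ℂ (horizontalL i (χ x)) with hc
    have e1 := fun j => coeFn_mapI (coord i) (DDu j j x)
    have e2 := fun j => coeFn_mapI (coord j) (DDu j i x)
    have e3 := fun j => Lp.coeFn_add (mapI b (coord i) (DDu j j x)) (mapI b (coord j) (DDu j i x))
    set a : Fin 3 → L2I b ℂ := fun j =>
      mapI b (coord i) (DDu j j x) + mapI b (coord j) (DDu j i x) with ha
    filter_upwards [Lp.coeFn_sub ((γ : ℂ) • c + Dp i x) ((μ : ℂ) • (a 0 + a 1 + a 2)),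
      Lp.coeFn_add ((γ : ℂ) • c) (Dp i x), Lp.coeFn_smul (γ : ℂ) c, coeFn_constI b (horizontalL i (χ x)),
      Lp.coeFn_smul (μ : ℂ) (a 0 + a 1 + a 2), Lp.coeFn_add (a 0 + a 1) (a 2),
      Lp.coeFn_add (a 0) (a 1), coeFn_mapI (coord i) (f x), e1 0, e1 1, e1 2, e2 0, e2 1, e2 2,
      e3 0, e3 1, e3 2] with y h1 h2 h3 h4 h5 h6 h7 h8 a0 a1 a2 b0 b1 b2 c0 c1 c2
    rw [h1, Pi.sub_apply, h2, Pi.add_apply, h3, Pi.smul_apply, hc, h4, h5, Pi.smul_apply, h6,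
      Pi.add_apply, h7, Pi.add_apply, h8, c0, c1, c2, Pi.add_apply, Pi.add_apply, Pi.add_apply,
      a0, a1, a2, b0, b1, b2, horizontalL_apply, Fin.sum_univ_three]
    rfl
  · have hDu' := fun i => (isWeakDeriv_iff_fd hv i).1 (hDu i)
    have hDDu' := fun j i => (isWeakDeriv_iff_fd (hDu' i) j).1 (hDDu j i)
    have hDp' := (isWeakDeriv_iff_fd hq i).1 (hDp i)
    refine Filter.eventually_congr ?_
    filter_upwards [hχ, hφ, hDp', Filter.eventually_all.2 fun j => Filter.eventually_all.2 (hDDu' j)]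
      with ξ h1 h2 h3 h4
    rw [← (HI.toL2_injective b s).eq_iff, fiberSys_momentum, map_sub, map_add, map_smul, map_smul,
      toL2_const, toL2_map, h2, sub_eq_zero, map_sum, horizontalL_apply, ← h1, ← h3]
    have h5 : ∀ j, toL2 b s (fd (dsym ξ) j (fd (dsym ξ) j ((toUnknowns (X ξ)).2.1 i)) +
        fd (dsym ξ) j (fd (dsym ξ) i ((toUnknowns (X ξ)).2.1 j))) =
        mapI b (coord i) ((𝓕 (DDu j j) : L2Layer b (Cn 3)) ξ) +
          mapI b (coord j) ((𝓕 (DDu j i) : L2Layer b (Cn 3)) ξ) := by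
      intro j
      rw [← h4 j j, ← h4 j i, ← toL2_map, ← toL2_map, map_fd, map_fd, map_fd, map_fd, map_add]
      rfl
    simp only [h5]
    rfl

theorem div_iff (hv : ∀ᵐ ξ, toL2 b (s + 2) (X ξ).2.1 = (𝓕 u : L2Layer b (Cn 3)) ξ)
    (hDu : ∀ i, IsWeakDeriv b i u (Du i)) :
    (∀ᵐ x : Plane, ∀ᵐ y ∂(volume.restrict (Ioo 0 b)),
      ∑ i : Fin 3, Du i x y i = (0 : L2Layer b ℂ) x y) ↔
    ∀ᵐ ξ, (fiberSys b γ κ μ s (dsym ξ) (toUnknowns (X ξ))).2.1 = 0 := by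
  have hFT := IsFT.sum_three fun i => (isFT (Du i)).clm (mapI b (coord i))
  refine Iff.trans ?_ (hFT.eq_zero_iff.trans ?_)
  · refine Filter.eventually_congr ?_
    filter_upwards [Lp.coeFn_zero (L2I b ℂ) 2 (volume : Measure Plane)] with x hx
    rw [hx, Pi.zero_apply, Lp.ext_iff]
    refine Filter.eventually_congr ?_
    rw [Fin.sum_univ_three]
    have e1 := fun i => coeFn_mapI (coord i) (Du i x)
    filter_upwards [Lp.coeFn_add (mapI b (coord 0) (Du 0 x) + mapI b (coord 1) (Du 1 x))
      (mapI b (coord 2) (Du 2 x)), Lp.coeFn_add (mapI b (coord 0) (Du 0 x))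
      (mapI b (coord 1) (Du 1 x)), e1 0, e1 1, e1 2] with y h1 h2 h3 h4 h5
    rw [h1, Pi.add_apply, h2, Pi.add_apply, h3, h4, h5, Fin.sum_univ_three]
    rfl
  · have hDu' := fun i => (isWeakDeriv_iff_fd hv i).1 (hDu i)
    refine Filter.eventually_congr ?_
    filter_upwards [Filter.eventually_all.2 hDu'] with ξ h1
    rw [← (HI.toL2_injective b (s + 1)).eq_iff, fiberSys_div, fiberDiv_eq_sum, map_sum, map_zero]
    have h2 : ∀ i, toL2 b (s + 1) (fd (dsym ξ) i ((toUnknowns (X ξ)).2.1 i)) =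
        mapI b (coord i) ((𝓕 (Du i) : L2Layer b (Cn 3)) ξ) := by
      intro i
      rw [← h1 i, ← toL2_map, map_fd]
      rfl
    simp only [h2]

theorem stress_iff (hb : 0 < b) (hq : ∀ᵐ ξ, toL2 b (s + 1) (X ξ).1 = (𝓕 p : L2Layer b ℂ) ξ)
    (hv : ∀ᵐ ξ, toL2 b (s + 2) (X ξ).2.1 = (𝓕 u : L2Layer b (Cn 3)) ξ)
    (hχ : ∀ᵐ ξ, (X ξ).2.2 = (𝓕 χ : L2Top (Cn 2)) ξ)
    (hDp : ∀ i, IsWeakDeriv b i p (Dp i)) (hDu : ∀ i, IsWeakDeriv b i u (Du i))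
    (hDDu : ∀ j i, IsWeakDeriv b j (Du i) (DDu j i))
    (hp : HasTraceTop b p pTop) (hD : ∀ i, HasTraceTop b (Du i) (DuTop i)) (hd : IsDivTop χ d) :
    (∀ᵐ x : Plane, ∀ i : Fin 3,
      -(pTop x * e3 i - (μ : ℂ) * (DuTop 2 x i + DuTop i x 2)) - (κ : ℂ) * d x * e3 i = k x i) ↔
    ∀ᵐ ξ, ∀ i, (fiberSys b γ κ μ s (dsym ξ) (toUnknowns (X ξ))).2.2.1 i =
      (𝓕 k : L2Top (Cn 3)) ξ i := by
  simp only [Filter.eventually_all]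
  refine forall_congr' fun i => ?_
  have hFT := ((((isFT pTop).smul (e3 i)).sub ((((isFT (DuTop 2)).clm (coord i)).add
    ((isFT (DuTop i)).clm (coord 2))).smul (μ : ℂ))).neg.sub ((isFT d).smul (e3 i * κ))).sub
      ((isFT k).clm (coord i))
  refine Iff.trans ?_ (hFT.eq_zero_iff.trans ?_)
  · refine Filter.eventually_congr (Filter.Eventually.of_forall fun x => ?_)
    rw [sub_eq_zero]
    simp only [smul_eq_mul, PiLp.proj_apply, mul_comm _ (e3 i), mul_assoc]
  · have hDu' := fun i => (isWeakDeriv_iff_fd hv i).1 (hDu i)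
    have hp' := (hasTraceTop_iff_trTop hb hq (hDp 2)).1 hp
    have hD' := fun i => (hasTraceTop_iff_trTop hb (hDu' i) (hDDu 2 i)).1 (hD i)
    refine Filter.eventually_congr ?_
    filter_upwards [hp', hD' 2, hD' i, hχ, isDivTop_iff.1 hd] with ξ h1 h2 h3 h4 h5
    rw [fiberSys_stress, ← h1, ← h2, ← h3, ← h5, ← h4, sub_eq_zero, ← trTop_map, ← trTop_map,
      map_fd, map_fd]
    simp only [smul_eq_mul, PiLp.proj_apply, toUnknowns]
    ring_nf

theorem kin_iff (hb : 0 < b) (hv : ∀ᵐ ξ, toL2 b (s + 2) (X ξ).2.1 = (𝓕 u : L2Layer b (Cn 3)) ξ)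
    (hDu : ∀ i, IsWeakDeriv b i u (Du i)) (hu : HasTraceTop b u uTop) (hh : IsDivTop H h) :
    (∀ᵐ x : Plane, uTop x 2 = h x) ↔
    ∀ᵐ ξ, (fiberSys b γ κ μ s (dsym ξ) (toUnknowns (X ξ))).2.2.2.1 =
      dsym ξ 0 * (𝓕 H : L2Top (Cn 2)) ξ 0 + dsym ξ 1 * (𝓕 H : L2Top (Cn 2)) ξ 1 := by
  have hFT := ((isFT uTop).clm (coord 2)).sub (isFT h)
  refine Iff.trans ?_ (hFT.eq_zero_iff.trans ?_)
  · refine Filter.eventually_congr (Filter.Eventually.of_forall fun x => ?_)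
    rw [sub_eq_zero]
    rfl
  · refine Filter.eventually_congr ?_
    filter_upwards [(hasTraceTop_iff_trTop hb hv (hDu 2)).1 hu, isDivTop_iff.1 hh] with ξ h1 h2
    rw [fiberSys_kin, ← h1, h2, sub_eq_zero, ← trTop_map]
    rfl

theorem bottom_iff (hb : 0 < b) (hv : ∀ᵐ ξ, toL2 b (s + 2) (X ξ).2.1 = (𝓕 u : L2Layer b (Cn 3)) ξ)
    (hDu : ∀ i, IsWeakDeriv b i u (Du i)) :
    HasTraceBottom b u 0 ↔ ∀ᵐ ξ, toUnknowns (X ξ) ∈ noSlip b s := by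
  rw [hasTraceBottom_iff_trBot hb hv (hDu 2), FourierTransform.fourier_zero]
  refine Filter.eventually_congr ?_
  filter_upwards [Lp.coeFn_zero (Cn 3) 2 (volume : Measure Plane)] with ξ h0
  rw [h0, Pi.zero_apply]
  change _ ↔ ∀ i, trBot b (s + 1) (HI.map b (s + 2) (coord i) (X ξ).2.1) = 0
  simp only [trBot_map]
  exact ⟨fun h i => by rw [h, map_zero], fun h => by ext i; exact h i⟩

end Equations

end
end CurlLayer

namespace CurlLayer

noncomputable section

/-! ### Sobolev functions on the layer as functions of the frequency -/

section Fibers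

variable {b : ℝ} {k : ℕ} {V : Type} [NormedAddCommGroup V] [InnerProductSpace ℂ V] [CompleteSpace V]

theorem aestronglyMeasurable_HI {v : Plane → HI b k V}
    (h : ∀ j ≤ k, AEStronglyMeasurable (fun ξ => der b k j (v ξ)) volume) :
    AEStronglyMeasurable v volume := by
  have hemb : Topology.IsEmbedding fun w : HI b k V =>
      ((show sobolevI V b k from w) : PiLp 2 fun _ : Fin (k + 1) => L2I b V) :=
    Topology.IsEmbedding.subtypeVal
  rw [← hemb.aestronglyMeasurable_comp_iff]
  have h1 : AEStronglyMeasurable (fun ξ => ∑ j : Fin (k + 1),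
      Pi.single (M := fun _ : Fin (k + 1) => L2I b V) j (der b k j (v ξ))) volume :=
    Finset.aestronglyMeasurable_fun_sum _ fun j _ =>
      (continuous_single j).comp_aestronglyMeasurable (h j (by omega))
  have h2 := (PiLp.continuous_toLp 2 fun _ : Fin (k + 1) => L2I b V).comp_aestronglyMeasurable h1
  refine h2.congr (Filter.Eventually.of_forall fun ξ => ?_)
  simp only [Finset.univ_sum_single]
  ext1 j
  exact der_apply j.2 (v ξ)

theorem continuous_wnorm_bracket {v : Plane → HI b k V} (hv : Continuous v) :
    Continuous fun ξ => wnorm (bracket ξ) (v ξ) := by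
  unfold wnorm
  exact continuous_finsetSum _ fun j _ =>
    (continuous_bracket.pow _).mul ((der b k j).continuous.comp hv).norm

theorem aestronglyMeasurable_wnorm {v : Plane → HI b k V} (hv : AEStronglyMeasurable v volume) :
    AEStronglyMeasurable (fun ξ => wnorm (bracket ξ) (v ξ)) volume := by
  unfold wnorm
  exact Finset.aestronglyMeasurable_fun_sum _ fun j _ =>
    (continuous_bracket.pow _).aestronglyMeasurable.mul
      ((der b k j).continuous.comp_aestronglyMeasurable hv).norm

theorem fiberSobolev_iff (U : L2Layer b V) : FiberSobolev b k U ↔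
    ∃ v : Plane → HI b k V, AEStronglyMeasurable v volume ∧ (∀ᵐ ξ, toL2 b k (v ξ) = U ξ) ∧
      MemLp (fun ξ => wnorm (bracket ξ) (v ξ)) 2 := by
  classical
  constructor
  · rintro ⟨W, h0, h1, h2⟩
    set v : Plane → HI b k V := fun ξ =>
      if h : ∀ j < k, IsWeakDerivI b (W j ξ) (W (j + 1) ξ) then HI.mk (fun j => W j ξ) h else 0
    have hv : ∀ᵐ ξ, ∀ j ≤ k, der b k j (v ξ) = W j ξ := by
      have h1' : ∀ᵐ ξ, ∀ j < k, IsWeakDerivI b (W j ξ) (W (j + 1) ξ) :=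
        ae_all_iff.2 fun j => Filter.eventually_imp_distrib_left.2 (h1 j)
      filter_upwards [h1'] with ξ hξ j hj
      simp only [v, dif_pos hξ]
      exact HI.der_mk _ _ hj
    have hm : AEStronglyMeasurable v volume := aestronglyMeasurable_HI fun j hj =>
      (aestronglyMeasurable_of_weighted (h2 j hj)).congr (by
        filter_upwards [hv] with ξ hξ
        exact (hξ j hj).symm)
    refine ⟨v, hm, ?_, ?_⟩
    · filter_upwards [hv, h0] with ξ h3 h4
      rw [toL2_eq_der, h3 0 (Nat.zero_le k), h4]
    · have hs := memLp_finsetSum (Finset.range (k + 1)) (p := 2) (μ := (volume : Measure Plane))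
        (f := fun j ξ => ‖weighted ((k : ℝ) - j) (W j) ξ‖)
        fun j hj => (h2 j (by simpa [Nat.lt_succ_iff] using hj)).norm
      refine hs.ae_eq ?_
      filter_upwards [hv] with ξ hξ
      refine Finset.sum_congr rfl fun j hj => ?_
      have hj' : j ≤ k := by simpa [Nat.lt_succ_iff] using hj
      rw [norm_weighted, hξ j hj', ← Nat.cast_sub hj', Real.rpow_natCast]
  · rintro ⟨v, hm, h0, h1⟩
    refine ⟨fun j ξ => der b k j (v ξ), ?_, fun j hj => Filter.Eventually.of_forall fun ξ =>
      isWeakDerivI_der hj (v ξ), fun j hj => ?_⟩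
    · filter_upwards [h0] with ξ hξ
      rw [← hξ, toL2_eq_der]
    · refine h1.of_le (aestronglyMeasurable_weighted
        ((der b k j).continuous.comp_aestronglyMeasurable hm) _) (Filter.Eventually.of_forall fun ξ => ?_)
      rw [norm_weighted, ← Nat.cast_sub hj, Real.rpow_natCast]
      exact (le_wnorm (bracket_pos ξ).le (v ξ) hj).trans (Real.le_norm_self _)

theorem exists_layer {v : Plane → HI b k V} (hm : AEStronglyMeasurable v volume)
    (hv : MemLp (fun ξ => wnorm (bracket ξ) (v ξ)) 2) :
    ∃ u : L2Layer b V, MemHLayer b k u ∧ ∀ᵐ ξ, toL2 b k (v ξ) = (𝓕 u : L2Layer b V) ξ := by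
  have h1 : MemLp (fun ξ => toL2 b k (v ξ)) 2 (volume : Measure Plane) := by
    refine hv.of_le ((toL2 b k).continuous.comp_aestronglyMeasurable hm)
      (Filter.Eventually.of_forall fun ξ => ?_)
    rw [toL2_eq_der]
    exact ((HI.norm_der_le 0 _).trans (norm_le_wnorm (one_le_bracket ξ) _)).trans (Real.le_norm_self _)
  have h2 := fourier_fourierInv_toLp h1
  have h3 := h2.mono fun ξ h => h.symm
  exact ⟨𝓕⁻ h1.toLp, (memHLayer_iff k _).2 ((fiberSobolev_iff _).2 ⟨v, hm, h3, hv⟩), h3⟩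

theorem exists_top {g : Plane → V} {σ : ℝ} (hσ : 0 ≤ σ) (hg : MemLp (weighted σ g) 2) :
    ∃ χ : L2Top V, MemHTop σ χ ∧ (𝓕 χ : L2Top V) =ᵐ[volume] g := by
  have h1 := MemLp.weighted_mono hg hσ
  rw [weighted_zero] at h1
  have h2 := fourier_fourierInv_toLp h1
  exact ⟨𝓕⁻ h1.toLp, (memHTop_iff σ _).2 (hg.ae_eq (weighted_congr h2.symm σ)), h2⟩

end Fibers

theorem exists_isDivTop {χ : L2Top (Cn 2)} {σ : ℝ} (hσ : 1 ≤ σ) (hχ : MemHTop σ χ) :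
    ∃ d, IsDivTop χ d := by
  have h1 : MemLp (weighted (0 + 1) (𝓕 χ : L2Top (Cn 2))) 2 :=
    MemLp.weighted_mono ((memHTop_iff σ χ).1 hχ) (by linarith)
  have h2 : ∀ j : Fin 2, MemLp (fun ξ => dsym ξ j * (𝓕 χ : L2Top (Cn 2)) ξ j) 2
      (volume : Measure Plane) := by
    intro j
    have h := memLp_weighted_dsym h1 j
    rw [weighted_zero] at h
    exact h.continuousLinearMap_comp (coord j : Cn 2 →L[ℂ] ℂ)
  have h3 := (h2 0).add (h2 1)
  exact ⟨𝓕⁻ h3.toLp, isDivTop_iff.2 ((fourier_fourierInv_toLp h3).mono fun ξ h => h.symm)⟩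

/-! ### The solution operator on the Fourier side -/

section Psi

variable {b γ κ μ : ℝ} {s : ℕ}

theorem psiSymbol_eq_iff (hb : 0 < b) (hγ : 0 < γ) (hκ : 0 < κ) (hμ : 0 < μ) {ξ : Plane}
    (hξ : ξ ≠ 0) (y : FiberY b s) (x : FiberX b s) : psiSymbol b γ κ μ s ξ y = x ↔
      fiberSys b γ κ μ s (dsym ξ) (toUnknowns x) = dataOp b s (dsym ξ) y ∧
        toUnknowns x ∈ noSlip b s := by
  have hinv := isInvertible_fiberOp (s := s) hb hγ hκ hμ hξ
  set z := (fiberOp b γ κ μ s (dsym ξ)).inverse (dataOp b s (dsym ξ) y) with hz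
  have hz' : dataOp b s (dsym ξ) y = fiberOp b γ κ μ s (dsym ξ) z := (hinv.inverse_apply_eq).1 hz.symm
  change toFiberX b s (z : Unknowns b s) = x ↔ _
  constructor
  · rintro rfl
    rw [toUnknowns_toFiberX]
    exact ⟨hz'.symm, z.2⟩
  · rintro ⟨h1, h2⟩
    have h3 : z = ⟨toUnknowns x, h2⟩ := (hinv.inverse_apply_eq).2 h1.symm
    rw [h3, toFiberX_toUnknowns]

variable {p : L2Layer b ℂ} {u : L2Layer b (Cn 3)} {χ : L2Top (Cn 2)}
  {f : L2Layer b (Cn 3)} {k : L2Top (Cn 3)} {H : L2Top (Cn 2)} {X : Plane → FiberX b s}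
  {φ : Plane → HI b s (Cn 3)}

theorem fiberSys_eq_dataOp_iff (d : Fin 2 → ℂ) (x : Unknowns b s) (y : FiberY b s) :
    fiberSys b γ κ μ s d x = dataOp b s d y ↔
      (∀ i, (fiberSys b γ κ μ s d x).1 i = HI.map b s (coord i) y.1) ∧
      (fiberSys b γ κ μ s d x).2.1 = 0 ∧ (∀ i, (fiberSys b γ κ μ s d x).2.2.1 i = y.2.1 i) ∧
      d 0 * x.2.2 1 - d 1 * x.2.2 0 = 0 ∧
      (fiberSys b γ κ μ s d x).2.2.2.1 = d 0 * y.2.2 0 + d 1 * y.2.2 1 := by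
  rw [dataOp_apply, ← fiberSys_curl (b := b) (γ := γ) (κ := κ) (μ := μ)]
  simp only [Prod.ext_iff, funext_iff]
  tauto

/-- Combines the equation-by-equation equivalences. In the direction from the fibers to the layer,
membership in 𝕏_s and 𝕐_s supplies the weak derivatives, traces and divergences that a strong
solution must exhibit. -/
theorem isPsi_iff (hb : 0 < b) (hγ : 0 < γ) (hκ : 0 < κ) (hμ : 0 < μ) (hY : MemY b s f k H)
    (hX : MemX b s p u χ) (hq : ∀ᵐ ξ, toL2 b (s + 1) (X ξ).1 = (𝓕 p : L2Layer b ℂ) ξ)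
    (hv : ∀ᵐ ξ, toL2 b (s + 2) (X ξ).2.1 = (𝓕 u : L2Layer b (Cn 3)) ξ)
    (hχ : ∀ᵐ ξ, (X ξ).2.2 = (𝓕 χ : L2Top (Cn 2)) ξ)
    (hφ : ∀ᵐ ξ, toL2 b s (φ ξ) = (𝓕 f : L2Layer b (Cn 3)) ξ) :
    IsPsi b γ κ μ s f k H p u χ ↔ ∀ᵐ ξ, psiSymbol b γ κ μ s ξ
      (φ ξ, (𝓕 k : L2Top (Cn 3)) ξ, (𝓕 H : L2Top (Cn 2)) ξ) = X ξ := by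
  have hiff : (∀ᵐ ξ, psiSymbol b γ κ μ s ξ
      (φ ξ, (𝓕 k : L2Top (Cn 3)) ξ, (𝓕 H : L2Top (Cn 2)) ξ) = X ξ) ↔ _ :=
    Filter.eventually_congr (by
      filter_upwards [ae_ne_zero] with ξ hξ
      rw [psiSymbol_eq_iff hb hγ hκ hμ hξ, fiberSys_eq_dataOp_iff])
  rw [hiff]
  simp only [Filter.eventually_and]
  have hc : (∀ᵐ ξ : Plane, dsym ξ 0 * (toUnknowns (X ξ)).2.2 1 -
      dsym ξ 1 * (toUnknowns (X ξ)).2.2 0 = 0) ↔ IsCurlTop χ 0 := by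
    rw [isCurlTop_zero_iff]
    refine Filter.eventually_congr ?_
    filter_upwards [hχ] with ξ hξ
    rw [← hξ]
    rfl
  rw [hc]
  constructor
  · rintro ⟨-, h, hh, Dp, Du, DDu, pTop, uTop, DuTop, d, h1, h2, h3, h4, h5, h6, h7, h8, h9, h10,
      h11, h12, h13⟩
    exact ⟨⟨(momentum_iff hq hv hχ hφ h1 h2 h3).1 h8, (div_iff hv h2).1 h9,
      (stress_iff hb hq hv hχ h1 h2 h3 h4 h6 h7).1 h10, h11, (kin_iff hb hv h2 h5 hh).1 h12⟩,
      (bottom_iff hb hv h2).1 h13⟩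
  · rintro ⟨⟨e1, e2, e3, e4, e5⟩, e6⟩
    -- H and χ have orders at least 5/2 and 3/2, hence at least 1, so their divergences are square
    -- integrable.
    obtain ⟨h, hh⟩ := exists_isDivTop (by have := s.cast_nonneg (α := ℝ); linarith) hY.2.2
    obtain ⟨d, hd⟩ := exists_isDivTop (by have := s.cast_nonneg (α := ℝ); linarith) hX.2.2
    choose Dp h1 _ using hX.1
    choose Du h2 h2' using hX.2.1
    choose DDu h3 _ using fun i j => h2' i j
    obtain ⟨pTop, h4⟩ := exists_hasTraceTop hb (h1 2)
    obtain ⟨uTop, h5⟩ := exists_hasTraceTop hb (h2 2)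
    choose DuTop h6 using fun i => exists_hasTraceTop hb (h3 i 2)
    refine ⟨hX, h, hh, Dp, Du, fun j i => DDu i j, pTop, uTop, DuTop, d, h1, h2, fun j i => h3 i j,
      h4, h5, h6, hd, (momentum_iff hq hv hχ hφ h1 h2 fun j i => h3 i j).2 e1, (div_iff hv h2).2 e2,
      (stress_iff hb hq hv hχ h1 h2 (fun j i => h3 i j) h4 h6 hd).2 e3, e4,
      (kin_iff hb hv h2 h5 hh).2 e5, (bottom_iff hb hv h2).2 e6⟩

theorem MemX.exists_fibers (hX : MemX b s p u χ) : ∃ X : Plane → FiberX b s,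
    (∀ᵐ ξ, toL2 b (s + 1) (X ξ).1 = (𝓕 p : L2Layer b ℂ) ξ) ∧
    (∀ᵐ ξ, toL2 b (s + 2) (X ξ).2.1 = (𝓕 u : L2Layer b (Cn 3)) ξ) ∧
    ∀ᵐ ξ, (X ξ).2.2 = (𝓕 χ : L2Top (Cn 2)) ξ := by
  obtain ⟨q, -, hq, -⟩ := (fiberSobolev_iff _).1 ((memHLayer_iff _ _).1 hX.1)
  obtain ⟨v, -, hv, -⟩ := (fiberSobolev_iff _).1 ((memHLayer_iff _ _).1 hX.2.1)
  exact ⟨fun ξ => (q ξ, v ξ, (𝓕 χ : L2Top (Cn 2)) ξ), hq, hv, Filter.Eventually.of_forall fun _ => rfl⟩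

theorem isMultiplierImage_psiSymbol (hb : 0 < b) (hγ : 0 < γ) (hκ : 0 < κ) (hμ : 0 < μ)
    (hY : MemY b s f k H) (h : IsPsi b γ κ μ s f k H p u χ) :
    IsMultiplierImage (psiSymbol b γ κ μ s) f k H p u χ := by
  obtain ⟨φ, -, hφ, -⟩ := (fiberSobolev_iff _).1 ((memHLayer_iff _ _).1 hY.1)
  obtain ⟨X, h1, h2, h3⟩ := MemX.exists_fibers h.1
  filter_upwards [hφ, h1, h2, h3, (isPsi_iff hb hγ hκ hμ hY h.1 h1 h2 h3 hφ).1 h] with ξ e0 e1 e2 e3 e4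
  exact ⟨φ ξ, (X ξ).1, (X ξ).2.1, e0, e1, e2, e4.trans (by rw [← e3])⟩

theorem IsMultiplierImage.eqOn {m : Plane → FiberOp b s}
    (h : IsMultiplierImage m f k H p u χ) (m' : Plane → FiberOp b s)
    (h' : IsMultiplierImage m' f k H p u χ) (hφ : ∀ᵐ ξ, toL2 b s (φ ξ) = (𝓕 f : L2Layer b (Cn 3)) ξ) :
    ∀ᵐ ξ, m ξ (φ ξ, (𝓕 k : L2Top (Cn 3)) ξ, (𝓕 H : L2Top (Cn 2)) ξ) =
      m' ξ (φ ξ, (𝓕 k : L2Top (Cn 3)) ξ, (𝓕 H : L2Top (Cn 2)) ξ) := by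
  filter_upwards [h, h', hφ] with ξ ⟨a, q, v, e1, e2, e3, e4⟩ ⟨a', q', v', e1', e2', e3', e4'⟩ e5
  obtain rfl := HI.toL2_injective b s (e1.trans e5.symm)
  obtain rfl := HI.toL2_injective b s (e1'.trans e1.symm)
  rw [e4, e4', HI.toL2_injective b _ (e2.trans e2'.symm), HI.toL2_injective b _ (e3.trans e3'.symm)]

theorem IsPsi.unique (hb : 0 < b) (hγ : 0 < γ) (hκ : 0 < κ) (hμ : 0 < μ) (hY : MemY b s f k H)
    {p' : L2Layer b ℂ} {u' : L2Layer b (Cn 3)} {χ' : L2Top (Cn 2)}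
    (h : IsPsi b γ κ μ s f k H p u χ) (h' : IsPsi b γ κ μ s f k H p' u' χ') :
    p = p' ∧ u = u' ∧ χ = χ' := by
  have key : ∀ᵐ ξ : Plane, (𝓕 p : L2Layer b ℂ) ξ = (𝓕 p' : L2Layer b ℂ) ξ ∧
      (𝓕 u : L2Layer b (Cn 3)) ξ = (𝓕 u' : L2Layer b (Cn 3)) ξ ∧
      (𝓕 χ : L2Top (Cn 2)) ξ = (𝓕 χ' : L2Top (Cn 2)) ξ := by
    filter_upwards [isMultiplierImage_psiSymbol hb hγ hκ hμ hY h,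
      isMultiplierImage_psiSymbol hb hγ hκ hμ hY h']
      with ξ ⟨a, q, v, e1, e2, e3, e4⟩ ⟨a', q', v', e1', e2', e3', e4'⟩
    obtain rfl := HI.toL2_injective b s (e1.trans e1'.symm)
    have e := e4.symm.trans e4'
    simp only [Prod.mk.injEq] at e
    rw [← e2, ← e2', ← e3, ← e3', e.1, e.2.1]
    exact ⟨rfl, rfl, e.2.2⟩
  exact ⟨fourier_injective (Lp.ext (key.mono fun ξ h => h.1)),
    fourier_injective (Lp.ext (key.mono fun ξ h => h.2.1)),
    fourier_injective (Lp.ext (key.mono fun ξ h => h.2.2))⟩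

end Psi

end
end CurlLayer

namespace CurlLayer

noncomputable section

/-! ### Existence of solutions and the solution operator as a multiplier. -/

section Existence

variable {b γ κ μ : ℝ} {s : ℕ}

theorem memLp_normFY {φ : Plane → HI b s (Cn 3)} {g : Plane → Cn 3} {h : Plane → Cn 2}
    (hφ : MemLp (fun ξ => wnorm (bracket ξ) (φ ξ)) 2) (hg : MemLp (weighted (1 / 2 + s) g) 2)
    (hh : MemLp (weighted (5 / 2 + s) h) 2) :
    MemLp (fun ξ => normFY (bracket ξ) ((φ ξ, g ξ, h ξ) : FiberY b s)) 2 := by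
  refine ((hφ.add hg.norm).add hh.norm).ae_eq (Filter.Eventually.of_forall fun ξ => ?_)
  simp only [Pi.add_apply, norm_weighted, normFY]
  rw [bracket_rpow ξ _ s rfl, bracket_rpow ξ _ (s + 2) (by push_cast; ring)]

theorem aestronglyMeasurable_clm_apply {E F : Type} [NormedAddCommGroup E] [NormedSpace ℂ E]
    [NormedAddCommGroup F] [NormedSpace ℂ F] {A : Plane → E →L[ℂ] F} {x : Plane → E}
    (hA : AEStronglyMeasurable A volume) (hx : AEStronglyMeasurable x volume) :
    AEStronglyMeasurable (fun ξ => A ξ (x ξ)) volume :=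
  isBoundedBilinearMap_apply.continuous.comp_aestronglyMeasurable (hA.prodMk hx)

/-- Apply the symbol frequency by frequency. The bound without derivatives makes the weighted norms
of the image square integrable in ξ, and this is membership in 𝕏_s on the Fourier side. -/
theorem exists_isPsi (hb : 0 < b) (hγ : 0 < γ) (hκ : 0 < κ) (hμ : 0 < μ)
    {f : L2Layer b (Cn 3)} {k : L2Top (Cn 3)} {H : L2Top (Cn 2)} (hY : MemY b s f k H) :
    ∃ X : L2Layer b ℂ × L2Layer b (Cn 3) × L2Top (Cn 2),
      IsPsi b γ κ μ s f k H X.1 X.2.1 X.2.2 := by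
  obtain ⟨φ, hφm, hφ, hφL⟩ := (fiberSobolev_iff _).1 ((memHLayer_iff _ _).1 hY.1)
  have hL := memLp_normFY hφL ((memHTop_iff _ _).1 hY.2.1) ((memHTop_iff _ _).1 hY.2.2)
  have hym : AEStronglyMeasurable (fun ξ => ((φ ξ, (𝓕 k : L2Top (Cn 3)) ξ, (𝓕 H : L2Top (Cn 2)) ξ) :
      FiberY b s)) volume :=
    hφm.prodMk ((Lp.aestronglyMeasurable _).prodMk (Lp.aestronglyMeasurable _))
  obtain ⟨ha, C, hC, hbd⟩ := isSymbol_psiSymbol (s := s) hb hγ hκ hμ 0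
  have hMm := aestronglyMeasurable_of_continuousOn ha.continuousOn
  obtain ⟨X, hX⟩ : ∃ X : Plane → FiberX b s, ∀ ξ, psiSymbol b γ κ μ s ξ
      (φ ξ, (𝓕 k : L2Top (Cn 3)) ξ, (𝓕 H : L2Top (Cn 2)) ξ) = X ξ := ⟨_, fun _ => rfl⟩
  have hXm : AEStronglyMeasurable X volume := by
    rw [← funext hX]
    exact aestronglyMeasurable_clm_apply hMm hym
  have hbd' : ∀ {g : Plane → ℝ}, AEStronglyMeasurable g volume →
      (∀ ξ, ‖g ξ‖ ≤ normFX (bracket ξ) (X ξ)) → MemLp g 2 := by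
    intro g hg h
    refine hL.of_le_mul (c := C) hg ?_
    filter_upwards [ae_ne_zero] with ξ hξ
    refine ((h ξ).trans ?_).trans (mul_le_mul_of_nonneg_left (Real.le_norm_self _) hC)
    rw [← hX]
    exact hbd ξ hξ _
  have hpos := fun ξ => normFX_nonneg (bracket_pos ξ).le (X ξ)
  have m2 : AEStronglyMeasurable (fun ξ => (X ξ).2) volume :=
    continuous_snd.comp_aestronglyMeasurable hXm
  have mq : AEStronglyMeasurable (fun ξ => (X ξ).1) volume :=
    continuous_fst.comp_aestronglyMeasurable hXm
  have mv : AEStronglyMeasurable (fun ξ => (X ξ).2.1) volume :=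
    continuous_fst.comp_aestronglyMeasurable m2
  have mχ : AEStronglyMeasurable (fun ξ => (X ξ).2.2) volume :=
    continuous_snd.comp_aestronglyMeasurable m2
  obtain ⟨p, hp, hq⟩ := exists_layer mq (hbd'
    (aestronglyMeasurable_wnorm mq) fun ξ => by
      rw [Real.norm_of_nonneg (hpos ξ).1, normFX]; linarith [hpos ξ])
  obtain ⟨u, hu, hv⟩ := exists_layer mv (hbd'
    (aestronglyMeasurable_wnorm mv) fun ξ => by
      rw [Real.norm_of_nonneg (hpos ξ).2.1, normFX]; linarith [hpos ξ])
  obtain ⟨χ, hχ, hχ'⟩ := exists_top (σ := 3 / 2 + s) (by positivity)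
    ((memLp_norm_iff (aestronglyMeasurable_weighted mχ _)).1 (hbd'
    (aestronglyMeasurable_weighted mχ _).norm fun ξ => by
      rw [norm_norm, norm_weighted, bracket_rpow ξ _ (s + 1) (by push_cast; ring), normFX]
      linarith [hpos ξ]))
  exact ⟨(p, u, χ), (isPsi_iff hb hγ hκ hμ hY ⟨hp, hu, hχ⟩ hq hv (hχ'.mono fun ξ h => h.symm) hφ).2
    (Filter.Eventually.of_forall hX)⟩

theorem isSymbolOfPsi_psiSymbol (hb : 0 < b) (hγ : 0 < γ) (hκ : 0 < κ) (hμ : 0 < μ) :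
    IsSymbolOfPsi b γ κ μ s (psiSymbol b γ κ μ s) := by
  refine ⟨?_, fun f k H hY p u χ h => isMultiplierImage_psiSymbol hb hγ hκ hμ hY h⟩
  -- The case α = 0 of the derivative bounds, with the factor |ξ|⁰ removed.
  have h := admissible_scaled hb (fun n => isSymbol_psiSymbol (s := s) hb hγ hκ hμ n) 0
  refine (congrArg (Admissible b s) (funext fun ξ => ?_)).mp h
  change ‖ξ‖ ^ 0 • psiSymbol b γ κ μ s ξ = _
  rw [pow_zero]
  exact one_smul ℝ (psiSymbol b γ κ μ s ξ)

end Existence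

/-! ### Uniqueness of the symbol -/

section Uniqueness

variable {b : ℝ} {s : ℕ}

instance (b : ℝ) (k n : ℕ) : SecondCountableTopology (HI b k (Cn n)) := by
  have : Fact ((2 : ℝ≥0∞) ≠ ⊤) := ⟨by norm_num⟩
  have h : SecondCountableTopology (PiLp 2 fun _ : Fin (k + 1) => L2I b (Cn n)) :=
    (PiLp.homeomorph 2 fun _ : Fin (k + 1) => L2I b (Cn n)).isInducing.secondCountableTopology
  exact Topology.IsInducing.subtypeVal.secondCountableTopology

/-- Data on the Fourier side with values in a given line. -/
theorem exists_data (y : FiberY b s) (N : ℕ) : ∃ (e : Plane → ℂ) (f : L2Layer b (Cn 3))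
    (k : L2Top (Cn 3)) (H : L2Top (Cn 2)), (∀ ξ, ‖ξ‖ ≤ N → e ξ = 1) ∧ MemY b s f k H ∧
      (∀ᵐ ξ, toL2 b s (e ξ • y.1) = (𝓕 f : L2Layer b (Cn 3)) ξ) ∧
      (𝓕 k : L2Top (Cn 3)) =ᵐ[volume] (fun ξ => e ξ • y.2.1) ∧
      (𝓕 H : L2Top (Cn 2)) =ᵐ[volume] fun ξ => e ξ • y.2.2 := by
  let g : ContDiffBump (0 : Plane) := ⟨N + 1, N + 2, by positivity, by linarith⟩
  set e : Plane → ℂ := fun ξ => ((g ξ : ℝ) : ℂ) with he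
  have hec : Continuous e := Complex.continuous_ofReal.comp g.continuous
  have hes : HasCompactSupport e := g.hasCompactSupport.comp_left (g := fun x : ℝ => (x : ℂ)) rfl
  have hφ : Continuous fun ξ => e ξ • y.1 :=
    (ContinuousLinearMap.toSpanSingleton ℂ y.1).continuous.comp hec
  have h1 : MemLp (fun ξ => wnorm (bracket ξ) (e ξ • y.1)) 2 (volume : Measure Plane) := by
    refine Continuous.memLp_of_hasCompactSupport ?_ (hes.mono fun ξ hξ => ?_)
    · exact continuous_wnorm_bracket hφ
    · contrapose! hξ
      rw [Function.notMem_support] at hξ ⊢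
      rw [hξ, zero_smul, wnorm_zero]
  have h2 : ∀ (n : ℕ) (σ : ℝ) (a : Cn n), MemLp (weighted σ fun ξ => e ξ • a) 2 := by
    intro n σ a
    refine Continuous.memLp_of_hasCompactSupport ?_ (hes.mono fun ξ hξ => ?_)
    · exact (continuous_bracket_rpow σ).smul
        (hec.smul continuous_const)
    · contrapose! hξ
      rw [Function.notMem_support] at hξ ⊢
      rw [weighted, hξ, zero_smul, smul_zero]
  obtain ⟨f, hf, hf'⟩ := exists_layer hφ.aestronglyMeasurable h1
  obtain ⟨k, hk, hk'⟩ := exists_top (σ := 1 / 2 + s) (by positivity) (h2 3 _ y.2.1)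
  obtain ⟨H, hH, hH'⟩ := exists_top (σ := 5 / 2 + s) (by positivity) (h2 2 _ y.2.2)
  refine ⟨e, f, k, H, fun ξ hξ => ?_, ⟨hf, hk, hH⟩, hf', hk', hH'⟩
  have : g ξ = 1 := g.one_of_mem_closedBall (by
    rw [mem_closedBall_zero_iff]
    exact hξ.trans (by change (N : ℝ) ≤ N + 1; linarith))
  simp only [he, this, Complex.ofReal_one]

/-- For a fixed fiber datum y and radius N there are data on the layer whose transform equals y for
|ξ| ≤ N. A solution exists for them, so both symbols send y to the same value at almost every such
ξ. Countably many pairs (y, N) with y in a dense set suffice, because each operator is continuous.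
-/
theorem IsSymbolOfPsi.ae_eq {γ κ μ : ℝ} (hb : 0 < b) (hγ : 0 < γ) (hκ : 0 < κ) (hμ : 0 < μ)
    {m m' : Plane → FiberOp b s} (h : IsSymbolOfPsi b γ κ μ s m) (h' : IsSymbolOfPsi b γ κ μ s m') :
    m =ᵐ[volume] m' := by
  have key : ∀ (i N : ℕ), ∀ᵐ ξ : Plane, ‖ξ‖ ≤ N →
      m ξ (TopologicalSpace.denseSeq (FiberY b s) i) =
        m' ξ (TopologicalSpace.denseSeq (FiberY b s) i) := by
    intro i N
    set y := TopologicalSpace.denseSeq (FiberY b s) i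
    obtain ⟨e, f, k, H, he, hY, hf, hk, hH⟩ := exists_data y N
    obtain ⟨X, hX⟩ := exists_isPsi hb hγ hκ hμ hY
    filter_upwards [(h.2 f k H hY _ _ _ hX).eqOn m' (h'.2 f k H hY _ _ _ hX) hf, hk, hH]
      with ξ e1 e2 e3 hξ
    rw [e2, e3, he ξ hξ, one_smul, one_smul, one_smul] at e1
    exact e1
  filter_upwards [ae_all_iff.2 fun i => ae_all_iff.2 (key i)] with ξ hξ
  obtain ⟨N, hN⟩ := exists_nat_ge ‖ξ‖
  exact DFunLike.coe_injective ((TopologicalSpace.denseRange_denseSeq (FiberY b s)).equalizer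
    (m ξ).continuous (m' ξ).continuous (funext fun i => hξ i N hN))

end Uniqueness

end
end CurlLayer

theorem mainTheorem6 (b γ κ μ : ℝ) (hb : 0 < b) (hγ : 0 < γ) (hκ : 0 < κ) (hμ : 0 < μ) (s : ℕ) :
    (∀ (f : L2Layer b (Cn 3)) (k : L2Top (Cn 3)) (H : L2Top (Cn 2)), MemY b s f k H →
      ∃! X : L2Layer b ℂ × L2Layer b (Cn 3) × L2Top (Cn 2),
        IsPsi b γ κ μ s f k H X.1 X.2.1 X.2.2) ∧
    (∃ m : Plane → FiberOp b s, IsSymbolOfPsi b γ κ μ s m) ∧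
    (∀ m : Plane → FiberOp b s, IsSymbolOfPsi b γ κ μ s m →
      ∃ M : Plane → FiberOp b s, M =ᵐ[volume] m ∧
        AnalyticOnNhd ℝ M {0}ᶜ ∧
        ∀ α : Fin 2 → ℕ, ∃ C : ℝ,
          Admissible b s (fun ξ => ‖ξ‖ ^ (α 0 + α 1) • iteratedPartial α M ξ) ∧
          symbolNorm b s (fun ξ => ‖ξ‖ ^ (α 0 + α 1) • iteratedPartial α M ξ) ≤ C) := by
  have hS := isSymbolOfPsi_psiSymbol (s := s) hb hγ hκ hμ
  -- The representative M is `psiSymbol`, whatever m is. Admissibility of the scaled derivative is a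
  -- separate conjunct, so C may be taken as the symbol norm itself.
  refine ⟨fun f k H hY => ?_, ⟨_, hS⟩, fun m hm => ⟨_, hS.ae_eq hb hγ hκ hμ hm, ?_, fun α => ⟨_, ?_, le_rfl⟩⟩⟩
  · obtain ⟨X, hX⟩ := exists_isPsi hb hγ hκ hμ hY
    refine ⟨X, hX, fun X' hX' => ?_⟩
    obtain ⟨h1, h2, h3⟩ := IsPsi.unique hb hγ hκ hμ hY hX' hX
    exact Prod.ext h1 (Prod.ext h2 h3)
  · exact (isSymbol_psiSymbol hb hγ hκ hμ 0).analytic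
  · exact admissible_scaled hb (fun n => isSymbol_psiSymbol hb hγ hκ hμ n) α
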